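/- All graphs are finite and simple, and "contains" refers to induced subgraphs. $C_n$ is the chordless cycle on $n$ vertices; $S_{3,3,3}$ is the tree consisting of three paths of length $3$ with one common endpoint; $C_6^{+3c}$ (respectively $C_6^{+3nc}$) is $C_6$ with one pendant vertex attached to each of three consecutive (respectively, three pairwise non-adjacent) vertices; $C_6^{+2l2}$ is $C_6$ with one path of length $2$ attached to each of two adjacent vertices. Let $$\mathcal X = \mathrm{Free}(S_{3,3,3}, C_3, C_4, C_5, C_6^{+3c}, C_6^{+3nc}, C_6^{+2l2}, C_7, C_8, \ldots)$$ be the class of graphs that contain none of the listed graphs as an induced subgraph. For $k\ge 2$ let $C_{6,k}$ be the graph with vertices $a,b,a_1,\dots,a_k,b_1,\dots,b_k$ and edges $aa_j,\ a_jb_j,\ b_jb$ $(1\le j\le k)$. For $n\ge 1$, $k_1,\dots,k_n\ge 2$ and $d_1,\dots,d_{n-1}\in\{1,-1\}$, the hexagonal strip $H(k_1,d_1,k_2,\dots,d_{n-1},k_n)$ is obtained from disjoint copies of $C_{6,k_1},\dots,C_{6,k_n}$, the vertices of the $i$-th one being written $a^i,b^i,a^i_j,b^i_j$, by identifying, for each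 $i<n$, $b^i_2$ with $a^{i+1}$ and $b^i$ with $a^{i+1}_1$ if $d_i=1$, and $b^i_2$ with $a^{i+1}_1$ and $b^i$ with $a^{i+1}$ if $d_i=-1$. A hexagonal caterpillar with gluing vertices $a$ and $b$, where $a\in\{a^1,a^1_1\}$ and $b\in\{b^n,b^n_2\}$, is a graph obtained from a hexagonal strip by attaching arbitrary (possibly no) pendant vertices to the vertices $a^i,b^i,a^i_1,b^i_2$ $(1\le i\le n)$ and by attaching at $a$ and at $b$ a rooted tree of depth at most $2$, whose root is identified with $a$, respectively $b$. A lobster with gluing vertices $a$ and $b$ is a tree in which some path has the property that every vertex is within distance $2$ of the path, $a$ and $b$ being the two endpoints of a shortest path with this property ($a=b$ if this path has one vertex). Let $m\ge 1$ and let $H_1,\dots,H_m$ be vertex-disjoint graphs, each of which is a hexagonal caterpillar or a lobster with gluing vertices $a_i,b_i$ $(1\le i\le m)$. The graph obtained from $H_1,\dots,H_m$ by identifying $b_i$ with $a_{i+1}$ for every $i=1,\dots,m-1$ is called a generalized hexagonal caterpillar. **Theorem.** Generalized hexagonal caterpillars are universal graphs for the class $\mathcal X$: every generalized hexagonal caterpillar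 belongs to $\mathcal X$, and every graph $G\in\mathcal X$ is an induced subgraph of some generalized hexagonal caterpillar. -/

import Mathlib

universe u v

open scoped SimpleGraph

/-! ### Forbidden induced subgraphs and the class `𝒳` -/

/-- The graph `S_{3,3,3}`: three paths of length 3 with a common endpoint (the vertex `0`). -/
def graphS333 : SimpleGraph (Fin 10) :=
  SimpleGraph.fromEdgeSet
    {s(0, 1), s(1, 2), s(2, 3), s(0, 4), s(4, 5), s(5, 6), s(0, 7), s(7, 8), s(8, 9)}

/-- `C₆^{+3c}`: the 6-cycle `0 1 2 3 4 5` with one pendant vertex attached to each of three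
consecutive vertices. -/
def graphC6plus3c : SimpleGraph (Fin 9) :=
  SimpleGraph.fromEdgeSet
    {s(0, 1), s(1, 2), s(2, 3), s(3, 4), s(4, 5), s(5, 0), s(0, 6), s(1, 7), s(2, 8)}

/-- `C₆^{+3nc}`: the 6-cycle `0 1 2 3 4 5` with one pendant vertex attached to each of three
pairwise non-consecutive vertices. -/
def graphC6plus3nc : SimpleGraph (Fin 9) :=
  SimpleGraph.fromEdgeSet
    {s(0, 1), s(1, 2), s(2, 3), s(3, 4), s(4, 5), s(5, 0), s(0, 6), s(2, 7), s(4, 8)}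

/-- `C₆^{+2l2}`: the 6-cycle `0 1 2 3 4 5` with one path of length 2 attached to each of two
consecutive vertices. -/
def graphC6plus2l2 : SimpleGraph (Fin 10) :=
  SimpleGraph.fromEdgeSet
    {s(0, 1), s(1, 2), s(2, 3), s(3, 4), s(4, 5), s(5, 0), s(0, 6), s(6, 7), s(1, 8), s(8, 9)}

/-- The class `𝒳` of finite graphs
`Free(S_{3,3,3}, C₃, C₄, C₅, C₆^{+3c}, C₆^{+3nc}, C₆^{+2l2}, C₇, C₈, …)`. -/
structure InClassX {V : Type u} (G : SimpleGraph V) : Prop where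
  finite : Finite V
  free_S333 : ¬ graphS333 ⊴ G
  free_C6plus3c : ¬ graphC6plus3c ⊴ G
  free_C6plus3nc : ¬ graphC6plus3nc ⊴ G
  free_C6plus2l2 : ¬ graphC6plus2l2 ⊴ G
  free_cycle : ∀ n : ℕ, 3 ≤ n → n ≠ 6 → ¬ SimpleGraph.cycleGraph n ⊴ G

/-! ### Disjoint unions and identification of vertices -/

/-- The disjoint union of a family of graphs. -/
def disjointUnion {ι : Type u} {W : ι → Type v} (G : ∀ i, SimpleGraph (W i)) :
    SimpleGraph (Σ i, W i) :=
  ⨆ i, (G i).map (Sigma.mk i)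

/-- The graph obtained from `G` by identifying `x` with `y` whenever `r x y`. Its vertices are
the classes of the equivalence relation generated by `r`, and two different classes are adjacent
if and only if some representatives of them are. -/
def identifyVertices {V : Type u} (G : SimpleGraph V) (r : V → V → Prop) :
    SimpleGraph (Quot r) :=
  G.map (Quot.mk r)

/-! ### Hexagonal strips -/

/-- The vertices `a, b, a_j, b_j` of `C_{6,k}`; the index `j` is counted from `0`, so that
`aj 0`, `bj 1` are the vertices usually called `a_1`, `b_2`. -/
inductive C6kVertex (k : ℕ) : Type
  | a : C6kVertex k
  | b : C6kVertex k
  | aj : Fin k → C6kVertex k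
  | bj : Fin k → C6kVertex k

/-- The edges `a a_j`, `a_j b_j`, `b_j b` of `C_{6,k}`. -/
inductive C6kEdge (k : ℕ) : C6kVertex k → C6kVertex k → Prop
  | a_aj (j : Fin k) : C6kEdge k .a (.aj j)
  | aj_bj (j : Fin k) : C6kEdge k (.aj j) (.bj j)
  | bj_b (j : Fin k) : C6kEdge k (.bj j) .b

/-- The graph `C_{6,k}`: `k` internally disjoint paths of length 3 between `a` and `b`. -/
def graphC6k (k : ℕ) : SimpleGraph (C6kVertex k) :=
  SimpleGraph.fromRel (C6kEdge k)

/-- The vertices of the disjoint union of `n + 1` graphs `C_{6,k_i}`, where `k_i = t i + 2 ≥ 2`. -/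
abbrev StripPart {n : ℕ} (t : Fin (n + 1) → ℕ) : Type :=
  Σ i : Fin (n + 1), C6kVertex (t i + 2)

/-- The identifications that glue the edge `b_2 b` of the `i`-th graph to the edge `a a_1` of the
next one: if `d i = 1`, then `b_2` is identified with `a`, and `b` with `a_1`; if `d i = -1`, then
`b_2` is identified with `a_1`, and `b` with `a`. -/
inductive StripGlue {n : ℕ} (t : Fin (n + 1) → ℕ) (d : Fin n → ℤˣ) :
    StripPart t → StripPart t → Prop
  | pos_b2 (i : Fin n) (h : d i = 1) : StripGlue t d ⟨i.castSucc, .bj 1⟩ ⟨i.succ, .a⟩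
  | pos_b (i : Fin n) (h : d i = 1) : StripGlue t d ⟨i.castSucc, .b⟩ ⟨i.succ, .aj 0⟩
  | neg_b2 (i : Fin n) (h : d i = -1) : StripGlue t d ⟨i.castSucc, .bj 1⟩ ⟨i.succ, .aj 0⟩
  | neg_b (i : Fin n) (h : d i = -1) : StripGlue t d ⟨i.castSucc, .b⟩ ⟨i.succ, .a⟩

/-- The vertex set of a hexagonal strip. -/
abbrev StripVertex {n : ℕ} (t : Fin (n + 1) → ℕ) (d : Fin n → ℤˣ) : Type :=
  Quot (StripGlue t d)

/-- The hexagonal strip `H(k_1, d_1, k_2, d_2, …, d_n, k_{n+1})`, where `k_{i+1} = t i + 2` and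
`d_{i+1} = d i` for the indices `i = 0, 1, …` used here. -/
def hexStrip {n : ℕ} (t : Fin (n + 1) → ℕ) (d : Fin n → ℤˣ) : SimpleGraph (StripVertex t d) :=
  identifyVertices (disjointUnion fun i => graphC6k (t i + 2)) (StripGlue t d)

/-- The vertex of a hexagonal strip that comes from the vertex `x` of the `i`-th `C_{6,k}`. -/
def stripMk {n : ℕ} (t : Fin (n + 1) → ℕ) (d : Fin n → ℤˣ) (i : Fin (n + 1))
    (x : C6kVertex (t i + 2)) : StripVertex t d :=
  Quot.mk _ ⟨i, x⟩

/-- The vertices `a^i`, `b^i`, `a^i_1`, `b^i_2` of a hexagonal strip. -/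
def IsPort {n : ℕ} (t : Fin (n + 1) → ℕ) (d : Fin n → ℤˣ) (x : StripVertex t d) : Prop :=
  ∃ i, x = stripMk t d i .a ∨ x = stripMk t d i .b ∨
    x = stripMk t d i (.aj 0) ∨ x = stripMk t d i (.bj 1)

/-! ### Hexagonal caterpillars and lobsters -/

/-- The graph obtained from `S` by attaching to each vertex `x` the graph `T x`, whose vertex
`root x` is identified with `x`. The vertex `x` of `S` becomes `⟨x, root x⟩`. -/
def attachAt {V : Type u} (S : SimpleGraph V) {W : V → Type v} (T : ∀ x, SimpleGraph (W x))
    (root : ∀ x, W x) : SimpleGraph (Σ x, W x) :=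
  S.map (fun x => (⟨x, root x⟩ : Σ x, W x)) ⊔ disjointUnion T

/-- `G` is a hexagonal caterpillar with gluing vertices `a` and `b`: up to isomorphism it is a
hexagonal strip with trees attached to its vertices (the root of the tree being the vertex itself),
where the trees at `a ∈ {a^1, a^1_1}` and `b ∈ {b^n, b^n_2}` have depth at most 2, those at the
other vertices `a^i, b^i, a^i_1, b^i_2` have depth at most 1 (so they are pendant vertices),
and nothing is attached to the remaining vertices. -/
def IsHexCaterpillar {V : Type u} (G : SimpleGraph V) (a b : V) : Prop :=
  ∃ (n : ℕ) (t : Fin (n + 1) → ℕ) (d : Fin n → ℤˣ) (α β : StripVertex t d)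
    (W : StripVertex t d → Type) (T : ∀ x, SimpleGraph (W x)) (root : ∀ x, W x),
    (α = stripMk t d 0 .a ∨ α = stripMk t d 0 (.aj 0)) ∧
    (β = stripMk t d (Fin.last n) .b ∨ β = stripMk t d (Fin.last n) (.bj 1)) ∧
    (∀ x, Finite (W x)) ∧
    (∀ x, (T x).IsTree) ∧
    (∀ x y, (T x).dist (root x) y ≤ 2) ∧
    (∀ x, x ≠ α → x ≠ β → ∀ y, (T x).dist (root x) y ≤ 1) ∧
    (∀ x, ¬ IsPort t d x → ∀ y, y = root x) ∧
    ∃ e : G ≃g attachAt (hexStrip t d) T root, e a = ⟨α, root α⟩ ∧ e b = ⟨β, root β⟩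

/-- Every vertex of the graph is within distance 2 from some vertex of the walk `p`. -/
def SecondNbhdDominates {V : Type u} {G : SimpleGraph V} {a b : V} (p : G.Walk a b) : Prop :=
  ∀ x, ∃ y ∈ p.support, G.dist y x ≤ 2

/-- `G` is a lobster with gluing vertices `a` and `b`: a finite tree, in which `a` and `b` are the
endpoints of a shortest one among the paths whose second neighbourhood is the whole graph. -/
def IsLobster {V : Type u} (G : SimpleGraph V) (a b : V) : Prop :=
  Finite V ∧ G.IsTree ∧
    ∃ p : G.Walk a b, p.IsPath ∧ SecondNbhdDominates p ∧
      ∀ (c d : V) (q : G.Walk c d), q.IsPath → SecondNbhdDominates q → p.length ≤ q.length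

/-! ### Generalized hexagonal caterpillars -/

/-- The identifications of `b_i` with `a_{i+1}` in the disjoint union of the pieces `H_i`. -/
inductive ChainGlue {m : ℕ} {W : Fin (m + 1) → Type} (a b : ∀ i, W i) :
    (Σ i, W i) → (Σ i, W i) → Prop
  | glue (i : Fin m) : ChainGlue a b ⟨i.castSucc, b i.castSucc⟩ ⟨i.succ, a i.succ⟩

/-- `G` is (isomorphic to) a generalized hexagonal caterpillar: it is obtained from vertex disjoint
hexagonal caterpillars or lobsters `H_0, …, H_m` with gluing vertices `a i`, `b i` by identifying
`b i` with `a (i + 1)` for every `i < m`. -/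
def IsGenHexCaterpillar {V : Type u} (G : SimpleGraph V) : Prop :=
  ∃ (m : ℕ) (W : Fin (m + 1) → Type) (H : ∀ i, SimpleGraph (W i)) (a b : ∀ i, W i),
    (∀ i, IsHexCaterpillar (H i) (a i) (b i) ∨ IsLobster (H i) (a i) (b i)) ∧
    Nonempty (G ≃g identifyVertices (disjointUnion H) (ChainGlue a b))

/-!
The link between the two parts of the theorem is a family of infinite graphs. A `Layout` describes a
two-way infinite sequence of cells, each of which is a graph `C_{6,k}` or a single edge, together with the way in which consecutive cells share a vertex or an edge. The graph
`Layout.graph w N` has these cells, and pendant vertices and trees of depth 2 wherever a generalized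
hexagonal caterpillar may have them. Consecutive cells meet in a *cut*, which is *fused* when they
share an edge. The names in `N` tell apart the paths of a cell and the pendant vertices at a hub; there are
as many of them as needed.

*Generalized hexagonal caterpillars belong to the class.* Hexagonal caterpillars and lobsters embed
between two unfused cuts (`IsHexCaterpillar.hasPieceLabel`, `IsLobster.hasPieceLabel`), and such
embeddings combine along the middle vertices of the unfused cuts (`exists_chain_embedding`). So it
suffices that the universal graphs contain none of the forbidden graphs (`inClassX_of_embeds`):
- of three legs of an `S_{3,3,3}` two leave the cut of the center in the same direction, and then are
  not apart (`Layout.not_three_legs`);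
- every induced cycle is a hexagon in one cell (`Layout.range_eq_hexSet`);
- each of these hexagons has two opposite vertices of degree 2, which excludes `C₆^{+3c}` and
  `C₆^{+3nc}` (`Layout.exists_antipodal`);
- edges of a hexagon with further neighbours at both ends are in cuts, where there is not enough room
  for two paths of length 2 (`Layout.left_legs_conflict`, `Layout.right_legs_conflict`).

*Graphs of the class embed into generalized hexagonal caterpillars.* Every hexagon of such a graph is
contained in a *cell*, a maximal `C_{6,k}` (`InClassX.exists_cell`), since it has two opposite vertices
of degree 2. The inner vertices of a cell separate its left side from its right side, because a path
around the cell would close to an induced cycle of the wrong length (`IsCell.not_reachable`). Hence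
the graph to the right of a cell is a part that hangs at an edge, and the graph on one side of a
bridge is a part that hangs at a vertex. Parts of both kinds are labelled by vertices of a universal
graph in a simultaneous induction (`InClassX.labels`). Here freeness from `S_{3,3,3}` shows that at a
vertex there is a star of depth 2 apart from one continuation of the strip, and freeness from
`C₆^{+2l2}` that one of the two ends of an edge has only pendant vertices. Labels on both sides of a
cell, or of a bridge, are joined by `IsCell.assemble` and `Labels.merge`, and components are put side
by side (`InClassX.exists_labels`). Finally a bounded part of a universal graph, split at its unfused
cuts, is a generalized hexagonal caterpillar, whose pieces are the hexagonal caterpillars of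
`Layout.isHexCaterpillar_region` and the lobsters of `Layout.isLobster_region`.
-/

/-! ### The universal strip of a layout -/

/-- The position of a hub in a cut: every cut consists of a middle hub `mid` and the hubs `lo` and
`hi`, which are its neighbours in the cut. -/
inductive Spot : Type
  | mid | lo | hi
  deriving DecidableEq

/-- The vertices of the universal graph of a layout, with names in `N`. The hubs lie in the cuts,
which are indexed by `ℤ`; the cell `i` lies between the cuts `i` and `i + 1`. The vertices `A i`
and `B i` are the vertices `a_j` and `b_j` of the cell `i` which are not in cuts: `A i none` is
`a_2`, `B i none` is `b_1`, and `A i (some n)`, `B i (some n)` are the two inner vertices of the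
path with name `n`. The vertices `pend i s n` are pendant at `hub i s`, and `deep i n m` is
pendant at `pend i .mid n`. -/
inductive Lab (N : Type u) : Type u
  | hub (i : ℤ) (s : Spot)
  | A (i : ℤ) (n : Option N)
  | B (i : ℤ) (n : Option N)
  | pend (i : ℤ) (s : Spot) (n : N)
  | deep (i : ℤ) (n m : N)

/-- A layout says how the cells of a two-way infinite strip are glued. The cell `i` is a
`C_{6,k}`, in which there is a path for each name besides the first two ones, if `hex i` holds,
and otherwise a single edge between the middle hubs of the cuts `i` and `i + 1`. In a hexagonal
cell `i` the edge `a a₁` lies in cut `i` and the edge `b b₂` in cut `i + 1`; one end of each is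
the middle hub, namely `a` if `aMid i` and `b` if `bMid i`. If `fused i` holds, then the right
edge of the cell `i - 1` and the left edge of the cell `i` are both the edge between `mid` and
`lo`. Otherwise the former is the edge between `mid` and `lo`, the latter is the edge between
`mid` and `hi`, and the two cells share only the middle hub. -/
structure Layout : Type where
  /-- The cell `i` is hexagonal. -/
  hex : ℤ → Bool
  /-- The vertex `a` of the cell `i`, rather than `a₁`, is the middle hub of the cut `i`. -/
  aMid : ℤ → Bool
  /-- The vertex `b` of the cell `i`, rather than `b₂`, is the middle hub of the cut `i + 1`. -/
  bMid : ℤ → Bool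
  /-- The cells `i - 1` and `i` have an edge in common. -/
  fused : ℤ → Bool

namespace Layout
variable {N : Type u}

/-- The spot of the vertex `a` of the cell `i` in the cut `i`. -/
def aS (w : Layout) (i : ℤ) : Spot := if w.aMid i then .mid else if w.fused i then .lo else .hi

/-- The spot of the vertex `a₁` of the cell `i` in the cut `i`. -/
def a1S (w : Layout) (i : ℤ) : Spot := if w.aMid i then (if w.fused i then .lo else .hi) else .mid

/-- The spot of the vertex `b` of the cell `i` in the cut `i + 1`. -/
def bS (w : Layout) (i : ℤ) : Spot := if w.bMid i then .mid else .lo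

/-- The spot of the vertex `b₂` of the cell `i` in the cut `i + 1`. -/
def b2S (w : Layout) (i : ℤ) : Spot := if w.bMid i then .lo else .mid

/-- The edges of the universal graph, each in one direction. Labels without a place in the layout,
such as the hub `hi` of a fused cut or the inner vertices of a cell that is not hexagonal, are
isolated. Vertices `deep` have edges only at unfused cuts. -/
def Edge (w : Layout) : Lab N → Lab N → Prop
  | .hub i s, .hub j s' =>
      (i = j ∧ s = .mid ∧ s' ≠ .mid ∧ (s' = .hi → w.fused i = false)) ∨
      (j = i + 1 ∧ s = .mid ∧ s' = .mid ∧ w.hex i = false)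
  | .hub i s, .A j n =>
      w.hex j = true ∧ ((i = j ∧ s = w.aS j) ∨ (i = j + 1 ∧ n = none ∧ s = w.b2S j))
  | .hub i s, .B j n =>
      w.hex j = true ∧ ((i = j ∧ n = none ∧ s = w.a1S j) ∨ (i = j + 1 ∧ s = w.bS j))
  | .A i n, .B j m => w.hex i = true ∧ i = j ∧ n = m ∧ n ≠ none
  | .hub i s, .pend j s' _ => i = j ∧ s = s' ∧ (s = .hi → w.fused i = false)
  | .pend i s n, .deep j m _ => i = j ∧ s = .mid ∧ n = m ∧ w.fused i = false
  | _, _ => False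

theorem not_edge_self (w : Layout) (x : Lab N) : ¬ w.Edge x x := by
  cases x <;> simp [Edge]
  grind

/-- The universal graph of a layout with names in `N`. -/
def graph (w : Layout) (N : Type u) : SimpleGraph (Lab N) where
  Adj x y := w.Edge x y ∨ w.Edge y x
  symm := ⟨fun _ _ h => h.symm⟩
  loopless := ⟨fun x h => w.not_edge_self x (by simpa using h)⟩

theorem adj_iff {w : Layout} {x y : Lab N} : (w.graph N).Adj x y ↔ w.Edge x y ∨ w.Edge y x := Iff.rfl

theorem aS_a1S (w : Layout) (i : ℤ) : (w.aS i = .mid ∧ w.a1S i ≠ .mid ∧ (w.a1S i = .hi ↔ w.fused i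
    = false) ∧ (w.a1S i = .lo ↔ w.fused i = true)) ∨
  (w.a1S i = .mid ∧ w.aS i ≠ .mid ∧ (w.aS i = .hi ↔ w.fused i = false)∧ (w.aS i = .lo ↔ w.fused i =
    true)) := by
  unfold aS a1S; grind
theorem bS_b2S (w : Layout) (i : ℤ) : (w.bS i = .mid ∧ w.b2S i = .lo) ∨
  (w.b2S i = .mid ∧ w.bS i = .lo) := by
  unfold bS b2S; grind

section Neighbours
variable {w : Layout} {i : ℤ} {s : Spot} {n m : N} {y : Lab N}

theorem adj_A_some : (w.graph N).Adj (.A i (some n)) y ↔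
    w.hex i = true ∧ (y = .hub i (w.aS i) ∨ y = .B i (some n)) := by
  cases y <;> simp [adj_iff, Edge] <;> grind

theorem adj_A_none : (w.graph N).Adj (.A i none) y ↔
    w.hex i = true ∧ (y = .hub i (w.aS i) ∨ y = .hub (i + 1) (w.b2S i)) := by
  cases y <;> simp [adj_iff, Edge] <;> grind

theorem adj_B_some : (w.graph N).Adj (.B i (some n)) y ↔
    w.hex i = true ∧ (y = .hub (i + 1) (w.bS i) ∨ y = .A i (some n)) := by
  cases y <;> simp [adj_iff, Edge] <;> grind

theorem adj_B_none : (w.graph N).Adj (.B i none) y ↔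
    w.hex i = true ∧ (y = .hub (i + 1) (w.bS i) ∨ y = .hub i (w.a1S i)) := by
  cases y <;> simp [adj_iff, Edge] <;> grind

theorem adj_pend : (w.graph N).Adj (.pend i s n) y ↔
    (y = .hub i s ∧ (s = .hi → w.fused i = false)) ∨
      (s = .mid ∧ w.fused i = false ∧ ∃ m, y = .deep i n m) := by
  cases y <;> simp [adj_iff, Edge] <;> grind

theorem adj_deep : (w.graph N).Adj (.deep i n m) y ↔
    w.fused i = false ∧ y = .pend i .mid n := by
  cases y <;> simp [adj_iff, Edge] <;> grind

theorem adj_hub : (w.graph N).Adj (.hub i s) y ↔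
    (∃ s', y = .hub i s' ∧ ((s = .mid ∧ s' ≠ .mid) ∨ (s ≠ .mid ∧ s' = .mid)) ∧
      (s = .hi ∨ s' = .hi → w.fused i = false)) ∨
    (w.hex i = false ∧ s = .mid ∧ y = .hub (i + 1) .mid) ∨
    (w.hex (i - 1) = false ∧ s = .mid ∧ y = .hub (i - 1) .mid) ∨
    (w.hex i = true ∧ s = w.aS i ∧ ∃ n, y = .A i n) ∨
    (w.hex i = true ∧ s = w.a1S i ∧ y = .B i none) ∨
    (w.hex (i - 1) = true ∧ s = w.b2S (i - 1) ∧ y = .A (i - 1) none) ∨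
    (w.hex (i - 1) = true ∧ s = w.bS (i - 1) ∧ ∃ n, y = .B (i - 1) n) ∨
    ((s = .hi → w.fused i = false) ∧ ∃ n, y = .pend i s n) := by
  cases y with
  | hub j s' =>
    simp only [adj_iff, Edge, Lab.hub.injEq, reduceCtorEq, and_false, exists_false, or_false]
    constructor
    · grind
    · rintro (h | h | h)
      · grind
      · grind
      · have : i = (i - 1) + 1 := by ring
        grind
  | A j n =>
    simp only [adj_iff, Edge, Lab.A.injEq, reduceCtorEq, and_false, false_and, exists_false, or_false, false_or]
    constructor
    · rintro ⟨h, h' | ⟨rfl, h'⟩⟩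
      · grind
      · right; simp; grind
    · have : i = (i - 1) + 1 := by ring
      grind
  | B j n =>
    simp only [adj_iff, Edge, Lab.B.injEq, reduceCtorEq, and_false, false_and, exists_false, or_false, false_or]
    constructor
    · rintro ⟨h, h' | ⟨rfl, h'⟩⟩
      · grind
      · right; simp; grind
    · have : i = (i - 1) + 1 := by ring
      grind
  | pend j s' n => simp [adj_iff, Edge]; grind
  | deep j n m => simp [adj_iff, Edge]

end Neighbours

/-! ### Reversal of a layout -/

/-- The effect of reversal on the spots of a cut: `lo` and `hi` are exchanged unless the cut is
fused. -/
def flip (f : Bool) : Spot → Spot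
  | .mid => .mid
  | .lo => if f then .lo else .hi
  | .hi => if f then .hi else .lo

@[simp] theorem flip_flip (f : Bool) (s : Spot) : flip f (flip f s) = s := by
  cases s <;> cases f <;> rfl

/-- The layout seen from the other side: the cut `i` becomes the cut `-i` and the cell `i` becomes
the cell `-1 - i`, with the roles of `a` and `b` exchanged. -/
def rev (w : Layout) : Layout where
  hex i := w.hex (-1 - i)
  aMid i := w.bMid (-1 - i)
  bMid i := w.aMid (-1 - i)
  fused i := w.fused (-i)

/-- The label of the same vertex in the reversed layout; `a₁` becomes `b₂` and `a₂` becomes `b₁`.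
-/
def revLab (w : Layout) : Lab N → Lab N
  | .hub i s => .hub (-i) (flip (w.fused i) s)
  | .A i n => .B (-1 - i) n
  | .B i n => .A (-1 - i) n
  | .pend i s n => .pend (-i) (flip (w.fused i) s) n
  | .deep i n m => .deep (-i) n m

@[simp] theorem rev_rev (w : Layout) : w.rev.rev = w := by
  simp [rev]

@[simp] theorem revLab_revLab (w : Layout) (x : Lab N) : w.rev.revLab (w.revLab x) = x := by
  cases x <;> simp [revLab, rev]

theorem revLab_injective (w : Layout) : Function.Injective (w.revLab (N := N)) :=
  Function.LeftInverse.injective w.revLab_revLab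

theorem rev_aS (w : Layout) (i : ℤ) : w.rev.aS (-1 - i) = flip (w.fused (i + 1)) (w.bS i) := by
  have e1 : -1 - (-1 - i) = i := by ring
  have e2 : -(-1 - i) = i + 1 := by ring
  unfold aS bS rev flip
  simp only [e1, e2]
  grind

theorem rev_a1S (w : Layout) (i : ℤ) : w.rev.a1S (-1 - i) = flip (w.fused (i + 1)) (w.b2S i) := by
  have e1 : -1 - (-1 - i) = i := by ring
  have e2 : -(-1 - i) = i + 1 := by ring
  unfold a1S b2S rev flip
  simp only [e1, e2]
  grind

theorem rev_bS (w : Layout) (i : ℤ) : w.rev.bS (-1 - i) = flip (w.fused i) (w.aS i) := by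
  have e1 : -1 - (-1 - i) = i := by ring
  unfold aS bS rev flip
  simp only [e1]
  grind

theorem rev_b2S (w : Layout) (i : ℤ) : w.rev.b2S (-1 - i) = flip (w.fused i) (w.a1S i) := by
  have e1 : -1 - (-1 - i) = i := by ring
  unfold a1S b2S rev flip
  simp only [e1]
  grind

@[simp] theorem rev_hex (w : Layout) (i : ℤ) : w.rev.hex (-1 - i) = w.hex i := by
  simp [rev]

theorem Edge.rev {w : Layout} {x y : Lab N} (h : w.Edge x y) :
    (w.rev.graph N).Adj (w.revLab x) (w.revLab y) := by
  have f1 : ∀ i, w.rev.fused (-i) = w.fused i := fun i => by simp [Layout.rev]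
  have f2 : ∀ i, w.rev.hex (-1 + -i) = w.hex i := fun i => by
    rw [← sub_eq_add_neg]; exact w.rev_hex i
  rw [adj_iff]
  cases x with
  | hub i s =>
    cases y with
    | hub j s' =>
      simp only [revLab, Edge, f1] at h ⊢
      rcases h with ⟨rfl, rfl, h, h'⟩ | ⟨rfl, rfl, rfl, h⟩
      · cases s' <;> simp_all [flip] <;> grind
      · right; right; simp [flip, f2, h]
    | A j n =>
      simp only [revLab, Edge, rev_bS, rev_b2S, rev_aS, rev_a1S, rev_hex] at h ⊢
      rcases h with ⟨h, ⟨rfl, rfl⟩ | ⟨rfl, rfl, rfl⟩⟩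
      · simp [h]; right; ring
      · simp [h]; left; ring
    | B j n =>
      simp only [revLab, Edge, rev_bS, rev_b2S, rev_aS, rev_a1S, rev_hex] at h ⊢
      rcases h with ⟨h, ⟨rfl, rfl, rfl⟩ | ⟨rfl, rfl⟩⟩
      · simp [h]; right; ring
      · simp [h]; left; ring
    | pend j s' n =>
      simp only [revLab, Edge, f1] at h ⊢
      obtain ⟨rfl, rfl, h⟩ := h
      cases s <;> simp_all [flip]
    | deep j n m => simp [Edge] at h
  | A i n => cases y <;> simp [Edge] at h ⊢; simp [revLab, h]; grind
  | B i n => cases y <;> simp [Edge] at h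
  | pend i s n =>
    cases y <;> simp [Edge] at h ⊢
    obtain ⟨rfl, rfl, rfl, h⟩ := h
    simp [revLab, h, flip, f1]
  | deep i n m => cases y <;> simp [Edge] at h

theorem rev_adj_iff {w : Layout} {x y : Lab N} :
    (w.rev.graph N).Adj (w.revLab x) (w.revLab y) ↔ (w.graph N).Adj x y := by
  refine ⟨fun h => ?_, fun h => h.elim Edge.rev fun h => h.rev.symm⟩
  have : (w.rev.rev.graph N).Adj (w.rev.revLab (w.revLab x)) (w.rev.revLab (w.revLab y)) :=
    h.elim Edge.rev fun h => h.rev.symm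
  simpa using this

end Layout

/-! ### `S_{3,3,3}` is not in a universal strip -/

instance : DecidableRel graphS333.Adj := by unfold graphS333; infer_instance
instance : DecidableRel graphC6plus3c.Adj := by unfold graphC6plus3c; infer_instance
instance : DecidableRel graphC6plus3nc.Adj := by unfold graphC6plus3nc; infer_instance
instance : DecidableRel graphC6plus2l2.Adj := by unfold graphC6plus2l2; infer_instance

/-- A walk `c x y z` without backtracking, as in the three paths of `S_{3,3,3}`. -/
def IsLeg {V : Type u} (G : SimpleGraph V) (c x y z : V) : Prop :=
  G.Adj c x ∧ G.Adj x y ∧ G.Adj y z ∧ c ≠ y ∧ x ≠ z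

/-- The vertices of the two lists are distinct and not adjacent. -/
def Apart {V : Type u} (G : SimpleGraph V) (l l' : List V) : Prop :=
  ∀ p ∈ l, ∀ q ∈ l', p ≠ q ∧ ¬ G.Adj p q

theorem exists_legs_of_S333 {V : Type u} {G : SimpleGraph V} (h : graphS333 ⊴ G) :
    ∃ c x₁ y₁ z₁ x₂ y₂ z₂ x₃ y₃ z₃, IsLeg G c x₁ y₁ z₁ ∧ IsLeg G c x₂ y₂ z₂ ∧ IsLeg G c x₃ y₃ z₃ ∧
      Apart G [x₁, y₁, z₁] [x₂, y₂, z₂] ∧ Apart G [x₁, y₁, z₁] [x₃, y₃, z₃] ∧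
      Apart G [x₂, y₂, z₂] [x₃, y₃, z₃] := by
  obtain ⟨φ⟩ := h
  refine ⟨φ 0, φ 1, φ 2, φ 3, φ 4, φ 5, φ 6, φ 7, φ 8, φ 9, ?_⟩
  have ha : ∀ i j, G.Adj (φ i) (φ j) ↔ graphS333.Adj i j := fun i j => φ.map_adj_iff
  have he : ∀ i j, φ i = φ j ↔ i = j := fun i j => φ.injective.eq_iff
  simp only [IsLeg, Apart, ha, he, List.mem_cons, List.not_mem_nil, or_false, forall_eq_or_imp,
    forall_eq, ne_eq]
  simp [graphS333]

namespace Layout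
variable {N : Type u}

/-- A vertex with three neighbours, each of which has a further neighbour, is a hub. -/
theorem isHub_of_adj3 {w : Layout} {c x₁ y₁ x₂ y₂ x₃ y₃ : Lab N}
   (h1 : (w.graph N).Adj c x₁) (h2 : (w.graph N).Adj c x₂) (h3 : (w.graph N).Adj c x₃)
   (h12 : x₁ ≠ x₂) (h23 : x₂ ≠ x₃) (h13 : x₁ ≠ x₃)
   (k1 : (w.graph N).Adj x₁ y₁)  (k2 : (w.graph N).Adj x₂ y₂) (k3 : (w.graph N).Adj x₃ y₃)
   (l1 : c ≠ y₁) (l2 : c ≠ y₂) (l3 : c ≠ y₃) :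
   ∃ i s, c = .hub i s := by
  cases c with
  | hub i s => exact ⟨i, s, rfl⟩
  | A i n => cases n <;> simp only [adj_A_none, adj_A_some] at h1 h2 h3 <;> grind
  | B i n => cases n <;> simp only [adj_B_none, adj_B_some] at h1 h2 h3 <;> grind
  | pend i s n =>
    have : ∀ {x y : Lab N}, (w.graph N).Adj (.pend i s n) x → (w.graph N).Adj x y →
        .pend i s n ≠ y → x = .hub i s := by
      intro x y h k l
      rw [adj_pend] at h
      rcases h with ⟨h, -⟩ | ⟨rfl, -, m, rfl⟩
      · exact h
      · rw [adj_deep] at k; exact absurd k.2.symm l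
    exact absurd ((this h1 k1 l1).trans (this h2 k2 l2).symm) h12
  | deep i n m => simp only [adj_deep] at h1 h2; grind

/-- The labels that are reached by a step to the right from cut `i`: inner vertices of the cell
`i` and hubs of the next cut. -/
def IsR (i : ℤ) : Lab N → Prop
  | .hub j _ => j = i + 1
  | .A j _ => j = i
  | .B j _ => j = i
  | _ => False

/-- The labels that are reached by a step to the left from cut `i`. -/
def IsL (i : ℤ) : Lab N → Prop
  | .hub j _ => j = i - 1
  | .A j _ => j = i - 1
  | .B j _ => j = i - 1
  | _ => False

theorem adj_a_a1 (w : Layout) (i : ℤ) : (w.graph N).Adj (.hub i (w.aS i)) (.hub i (w.a1S i)) := by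
  simp only [adj_hub]; left
  refine ⟨_, rfl, ?_⟩
  have := w.aS_a1S i
  grind

theorem adj_b_b2 (w : Layout) (i : ℤ) :
    (w.graph N).Adj (.hub (i + 1) (w.bS i)) (.hub (i + 1) (w.b2S i)) := by
  simp only [adj_hub]; left
  refine ⟨_, rfl, ?_⟩
  have := w.bS_b2S i
  grind

theorem adj_B_b {w : Layout} {i : ℤ} (h : w.hex i = true) (n : Option N) :
    (w.graph N).Adj (.B i n) (.hub (i + 1) (w.bS i)) := by
  cases n <;> simp [adj_B_none, adj_B_some, h]

theorem adj_A_a {w : Layout} {i : ℤ} (h : w.hex i = true) (n : Option N) :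
    (w.graph N).Adj (.A i n) (.hub i (w.aS i)) := by
  cases n <;> simp [adj_A_none, adj_A_some, h]

theorem isR_of_adj_hub {w : Layout} {i : ℤ} {s : Spot} {x : Lab N}
   (h : (w.graph N).Adj (.hub i s) x) (hx : IsR i x) :
   (w.hex i = false ∧ s = .mid ∧ x = .hub (i+1) .mid) ∨
    (w.hex i = true ∧ s = w.aS i ∧ ∃ n, x = .A i n)
     ∨ (w.hex i = true ∧ s = w.a1S i ∧ x = .B i none) := by
  rw [adj_hub] at h
  rcases h with ⟨s', rfl, hs⟩ | ⟨h, h', rfl⟩ | ⟨-, -, rfl⟩ | ⟨h, h', n, rfl⟩ | ⟨h, h', rfl⟩ |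
    ⟨-, -, rfl⟩ | ⟨-, -, n, rfl⟩ | ⟨-, n, rfl⟩ <;> simp [IsR] at hx <;> simp_all
  omega

/-- A walk from a hub of cut `i` to `x` and `y` leaves this cut to the right. -/
def Right (i : ℤ) (x y : Lab N) : Prop := IsR i x ∨ (∃ t, x = .hub i t) ∧ IsR i y

/-- A walk from a hub of cut `i` to `x` and `y` leaves this cut to the left. -/
def Left (i : ℤ) (x y : Lab N) : Prop := IsL i x ∨ (∃ t, x = .hub i t) ∧ IsL i y

/-- The possible legs to the right. In an edge cell they pass the middle hub or start there; in a
hexagonal cell they go along a path from `a` to `b`, possibly after a step in the cut. -/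
theorem right_form {w : Layout} {i : ℤ} {s : Spot} {x y z : Lab N}
   (h : (w.graph N).Adj (.hub i s) x) (k : (w.graph N).Adj x y) (l : (w.graph N).Adj y z)
   (hy : .hub i s ≠ y) (hz : x ≠ z) (hr : Right i x y) :
   (w.hex i = false ∧ s = .mid ∧ x = .hub (i+1) .mid) ∨
   (w.hex i = false ∧ s ≠ .mid ∧ x = .hub i .mid) ∨
   (w.hex i = true ∧ s = w.aS i ∧ ∃ n, x = .A i (some n) ∧ y = .B i (some n) ∧ z = .hub (i+1) (w.bS
    i)) ∨
   (w.hex i = true ∧ s = w.aS i ∧ x = .A i none ∧ y = .hub (i+1) (w.b2S i)) ∨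
   (w.hex i = true ∧ s = w.a1S i ∧ x = .B i none ∧ y = .hub (i+1) (w.bS i)) ∨
   (w.hex i = true ∧ s ≠ w.aS i ∧ x = .hub i (w.aS i) ∧ ∃ n, y = .A i n ∧ ((∃ m, n = some m ∧ z =
    .B i n) ∨ z = .hub (i+1) (w.b2S i))) ∨
   (w.hex i = true ∧ s ≠ w.a1S i ∧ x = .hub i (w.a1S i) ∧ y = .B i none ∧ z = .hub (i+1) (w.bS i))
    := by
  have aux : s = w.a1S i → s ≠ w.aS i := by have := w.aS_a1S i; grind
  rcases hr with hr | ⟨⟨t, rfl⟩, hr⟩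
  · rcases isR_of_adj_hub h hr with h' | ⟨h1, h2, n, rfl⟩ | ⟨h1, h2, rfl⟩
    · exact .inl h'
    · cases n with
      | none => rw [adj_A_none] at k; grind
      | some n =>
        rw [adj_A_some] at k
        obtain rfl : y = .B i (some n) := by grind
        rw [adj_B_some] at l; grind
    · rw [adj_B_none] at k; grind
  · have hst : s ≠ t := by rintro rfl; exact (w.graph N).irrefl h
    rcases isR_of_adj_hub k hr with ⟨h1, rfl, -⟩ | ⟨h1, rfl, n, rfl⟩ | ⟨h1, rfl, rfl⟩
    · exact .inr (.inl ⟨h1, hst, rfl⟩)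
    · cases n with
      | none => rw [adj_A_none] at l; grind
      | some n => rw [adj_A_some] at l; grind
    · rw [adj_B_none] at l; grind

/-- Any two legs from the same hub to the right meet or are joined by an edge; this is checked for
all pairs of forms in `right_form`. -/
theorem right_conflict {w : Layout} {i : ℤ} {s : Spot} {x y z x' y' z' : Lab N}
   (h : (w.graph N).Adj (.hub i s) x) (k : (w.graph N).Adj x y) (l : (w.graph N).Adj y z)
   (hy : .hub i s ≠ y) (hz : x ≠ z) (hr : Right i x y)
   (h' : (w.graph N).Adj (.hub i s) x') (k' : (w.graph N).Adj x' y') (l' : (w.graph N).Adj y' z')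
   (hy' : .hub i s ≠ y') (hz' : x' ≠ z') (hr' : Right i x' y')
   (hne : ∀ p ∈ [x, y, z], ∀ q ∈ [x', y', z'], p ≠ q ∧ ¬ (w.graph N).Adj p q) : False := by
  have e1 := adj_a_a1 (N := N) w i
  have e2 := adj_b_b2 (N := N) w i
  have e3 := fun h n => adj_B_b (N := N) (w := w) (i := i) h n
  have e1' := e1.symm
  have e2' := e2.symm
  have e3' := fun h n => (e3 h n).symm
  simp only [List.mem_cons, List.not_mem_nil, or_false, forall_eq_or_imp, forall_eq] at hne
  obtain ⟨⟨n1, n2, n3⟩, ⟨n4, n5, n6⟩, ⟨n7, n8, n9⟩⟩ := hne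
  rcases right_form h k l hy hz hr with ⟨c, d, rfl⟩ | ⟨c, d, rfl⟩ | ⟨c, rfl, n, rfl, rfl, rfl⟩ | ⟨c, rfl, rfl, rfl⟩ | ⟨c, rfl, rfl, rfl⟩ | ⟨c, d, rfl, n, rfl, hf⟩ | ⟨c, d, rfl, rfl, rfl⟩ <;>
  rcases right_form h' k' l' hy' hz' hr' with ⟨c', d', rfl⟩ | ⟨c', d', rfl⟩ | ⟨c', d', n, rfl, rfl, rfl⟩ | ⟨c', d', rfl, rfl⟩ | ⟨c', d', rfl, rfl⟩ | ⟨c', d', rfl, n, rfl, hf'⟩ | ⟨c', d', rfl, rfl, rfl⟩ <;> grind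

theorem isR_revLab {w : Layout} {i : ℤ} {x : Lab N} (h : IsL i x) : IsR (-i) (w.revLab x) := by
  cases x <;> simp [IsL, IsR, revLab] at h ⊢ <;> omega

/-- Any two legs from the same hub to the left meet or are joined by an edge; this is
`right_conflict` in the reversed layout. -/
theorem left_conflict {w : Layout} {i : ℤ} {s : Spot} {x y z x' y' z' : Lab N}
   (h : (w.graph N).Adj (.hub i s) x) (k : (w.graph N).Adj x y) (l : (w.graph N).Adj y z)
   (hy : .hub i s ≠ y) (hz : x ≠ z) (hr : Left i x y)
   (h' : (w.graph N).Adj (.hub i s) x') (k' : (w.graph N).Adj x' y') (l' : (w.graph N).Adj y' z')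
   (hy' : .hub i s ≠ y') (hz' : x' ≠ z') (hr' : Left i x' y')
   (hne : ∀ p ∈ [x, y, z], ∀ q ∈ [x', y', z'], p ≠ q ∧ ¬ (w.graph N).Adj p q) : False := by
  have key : ∀ {x y : Lab N}, Left i x y → Right (-i) (w.revLab x) (w.revLab y) := by
    rintro x y (h | ⟨⟨t, rfl⟩, h⟩)
    · exact .inl (isR_revLab h)
    · exact .inr ⟨⟨_, rfl⟩, isR_revLab h⟩
  have inj := w.revLab_injective (N := N)
  refine right_conflict (w := w.rev) (rev_adj_iff.2 h) (rev_adj_iff.2 k) (rev_adj_iff.2 l)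
    (inj.ne hy) (inj.ne hz) (key hr) (rev_adj_iff.2 h') (rev_adj_iff.2 k') (rev_adj_iff.2 l')
    (inj.ne hy') (inj.ne hz') (key hr') ?_
  simp only [List.mem_cons, List.not_mem_nil, or_false, forall_eq_or_imp, forall_eq, rev_adj_iff, inj.ne_iff] at hne ⊢
  exact hne

/-- Every leg from a hub leaves its cut to the right or to the left, or passes the middle hub. The
last case is of interest only for the hubs `lo` and `hi` of an unfused cut, which belong to a cell
on one side only. -/
theorem leg_type {w : Layout} {i : ℤ} {s : Spot} {x y z : Lab N}
   (h : (w.graph N).Adj (.hub i s) x) (k : (w.graph N).Adj x y) (l : (w.graph N).Adj y z)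
   (hy : .hub i s ≠ y) (hz : x ≠ z) :
   ((s = .mid ∨ w.fused i = true) ∧ (Right i x y ∨ Left i x y)) ∨
   (s = .lo ∧ w.fused i = false ∧ (Left i x y ∨ x = .hub i .mid)) ∨
   (s = .hi ∧ w.fused i = false ∧ (Right i x y ∨ x = .hub i .mid)) := by
  have h0 := h
  rw [adj_hub] at h0
  have e := w.aS_a1S i
  have e2 := w.bS_b2S (i-1)
  have e3 : ∀ {t}, x = .hub i t → (s = .mid ∨ w.fused i = true) →
      (t = .mid ∧ s ≠ .mid ∨ t ≠ .mid ∧ s = .mid) → (t = .hi ∨ s = .hi → w.fused i = false) → IsR i y ∨ IsL i y := by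
    rintro t rfl hs ht hf
    clear h0 e e2
    rw [adj_hub] at k
    rcases k with ⟨s', rfl, hs⟩ | ⟨-, -, rfl⟩ | ⟨-, -, rfl⟩ | ⟨-, -, n, rfl⟩ | ⟨-, -, rfl⟩ |
      ⟨-, -, rfl⟩ | ⟨-, -, n, rfl⟩ | ⟨-, n, rfl⟩ <;> simp [IsR, IsL]
    · cases s <;> cases s' <;> grind
    · rw [adj_pend] at l; grind
  rcases h0 with ⟨s', rfl, hs⟩ | ⟨h1, h2, rfl⟩ | ⟨h1, h2, rfl⟩ | ⟨h1, h2, n, rfl⟩ | ⟨h1, h2, rfl⟩ |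
    ⟨h1, h2, rfl⟩ | ⟨h1, h2, n, rfl⟩ | ⟨h1, n, rfl⟩
  · by_cases hm : s = .mid ∨ w.fused i = true
    · left
      refine ⟨hm, ?_⟩
      have := e3 rfl hm (by grind) (by grind)
      exact this.imp (fun h => .inr ⟨⟨_, rfl⟩, h⟩) (fun h => .inr ⟨⟨_, rfl⟩, h⟩)
    · cases s <;> simp_all
  · left; exact ⟨.inl h2, .inl (.inl rfl)⟩
  · left; exact ⟨.inl h2, .inr (.inl rfl)⟩
  · have : Right i (Lab.A i n) y := .inl rfl
    cases s <;> simp_all <;> grind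
  · have : Right i (Lab.B i none : Lab N) y := .inl rfl
    cases s <;> simp_all <;> grind
  · have : Left i (Lab.A (i-1) none : Lab N) y := .inl rfl
    cases s <;> simp_all <;> grind
  · have : Left i (Lab.B (i-1) n : Lab N) y := .inl rfl
    cases s <;> simp_all <;> grind
  · rw [adj_pend] at k; rcases k with ⟨h, -⟩ | ⟨rfl, -, m, rfl⟩
    · grind
    · rw [adj_deep] at l; grind

/-- By `leg_type` there are two kinds of legs at each hub, so two of three legs are of the same
kind, and these are not apart by `right_conflict` and `left_conflict`, or because they start with
the same vertex. -/
theorem not_three_legs (w : Layout) {c x₁ y₁ z₁ x₂ y₂ z₂ x₃ y₃ z₃ : Lab N}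
    (h1 : IsLeg (w.graph N) c x₁ y₁ z₁) (h2 : IsLeg (w.graph N) c x₂ y₂ z₂)
    (h3 : IsLeg (w.graph N) c x₃ y₃ z₃) (h12 : Apart (w.graph N) [x₁, y₁, z₁] [x₂, y₂, z₂])
    (h13 : Apart (w.graph N) [x₁, y₁, z₁] [x₃, y₃, z₃])
    (h23 : Apart (w.graph N) [x₂, y₂, z₂] [x₃, y₃, z₃]) : False := by
  obtain ⟨a1, b1, c1, d1, e1⟩ := h1
  obtain ⟨a2, b2, c2, d2, e2⟩ := h2
  obtain ⟨a3, b3, c3, d3, e3⟩ := h3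
  have n12 := (h12 x₁ (by simp) x₂ (by simp)).1
  have n13 := (h13 x₁ (by simp) x₃ (by simp)).1
  have n23 := (h23 x₂ (by simp) x₃ (by simp)).1
  obtain ⟨i, s, rfl⟩ := isHub_of_adj3 a1 a2 a3 n12 n23 n13 b1 b2 b3 d1 d2 d3
  have t1 := leg_type a1 b1 c1 d1 e1
  have t2 := leg_type a2 b2 c2 d2 e2
  have t3 := leg_type a3 b3 c3 d3 e3
  have r12 := fun p q => right_conflict a1 b1 c1 d1 e1 p a2 b2 c2 d2 e2 q h12
  have r13 := fun p q => right_conflict a1 b1 c1 d1 e1 p a3 b3 c3 d3 e3 q h13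
  have r23 := fun p q => right_conflict a2 b2 c2 d2 e2 p a3 b3 c3 d3 e3 q h23
  have l12 := fun p q => left_conflict a1 b1 c1 d1 e1 p a2 b2 c2 d2 e2 q h12
  have l13 := fun p q => left_conflict a1 b1 c1 d1 e1 p a3 b3 c3 d3 e3 q h13
  have l23 := fun p q => left_conflict a2 b2 c2 d2 e2 p a3 b3 c3 d3 e3 q h23
  clear a1 b1 c1 d1 e1 a2 b2 c2 d2 e2 a3 b3 c3 d3 e3 h12 h13 h23
  grind

theorem not_isIndContained_S333 (w : Layout) : ¬ graphS333 ⊴ w.graph N := by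
  intro h
  obtain ⟨c, x₁, y₁, z₁, x₂, y₂, z₂, x₃, y₃, z₃, h1, h2, h3, h12, h13, h23⟩ := exists_legs_of_S333 h
  exact w.not_three_legs h1 h2 h3 h12 h13 h23

end Layout

/-! ### Cycles in a universal strip -/

theorem SimpleGraph.Preconnected.mem_of_closed {V : Type u} {G : SimpleGraph V}
    (hG : G.Preconnected)
    {T : Set V} (hT : ∀ x y, x ∈ T → G.Adj x y → y ∈ T) {x : V} (hx : x ∈ T) (y : V) : y ∈ T := by
  have h := (SimpleGraph.reachable_iff_reflTransGen x y).1 (hG x y)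
  induction h with
  | refl => exact hx
  | tail _ h ih => exact hT _ _ ih h

theorem cycleGraph_nbrs {n : ℕ} (hn : 3 ≤ n) (k : Fin n) : ∃ p q : Fin n, p ≠ q ∧
    (SimpleGraph.cycleGraph n).Adj k p ∧ (SimpleGraph.cycleGraph n).Adj k q ∧
      ∀ r, (SimpleGraph.cycleGraph n).Adj k r → r = p ∨ r = q := by
  obtain ⟨m, rfl⟩ : ∃ m, n = m + 3 := ⟨n - 3, by omega⟩
  have h := SimpleGraph.cycleGraph_degree_three_le (n := m) (v := k)
  rw [← SimpleGraph.card_neighborFinset_eq_degree, Finset.card_eq_two] at h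
  obtain ⟨p, q, hpq, h⟩ := h
  have h' : ∀ r, (SimpleGraph.cycleGraph (m + 3)).Adj k r ↔ r = p ∨ r = q := by
    intro r
    rw [← SimpleGraph.mem_neighborFinset, h]; simp
  exact ⟨p, q, hpq, (h' p).2 (.inl rfl), (h' q).2 (.inr rfl), fun r => (h' r).1⟩

namespace Layout
variable {N : Type u}

/-- A hexagonal cell is a family of paths `a, pA j, pB j, b`, which is indexed by `Option (Option
N)`: the index `none` stands for the path through `a₁` and `b₁`, the index `some none` for the
path through `a₂` and `b₂`. -/
def pA (w : Layout) (i : ℤ) : Option (Option N) → Lab N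
  | none => .hub i (w.a1S i)
  | some n => .A i n

/-- The second inner vertex of a path in a hexagonal cell; see `pA`. -/
def pB (w : Layout) (i : ℤ) : Option (Option N) → Lab N
  | none => .B i none
  | some none => .hub (i + 1) (w.b2S i)
  | some (some n) => .B i (some n)

section cell
variable {w : Layout} {i : ℤ}

theorem adj_a_pA (h : w.hex i = true) (j : Option (Option N)) :
    (w.graph N).Adj (.hub i (w.aS i)) (w.pA i j) := by
  rcases j with _ | n
  · exact adj_a_a1 w i
  · exact (adj_A_a h n).symm

theorem adj_pA_pB (h : w.hex i = true) (j : Option (Option N)) :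
    (w.graph N).Adj (w.pA i j) (w.pB i j) := by
  rcases j with _ | _ | n
  · exact (adj_B_none.2 ⟨h, .inr rfl⟩).symm
  · exact adj_A_none.2 ⟨h, .inr rfl⟩
  · exact adj_A_some.2 ⟨h, .inr rfl⟩

theorem adj_pB_b (h : w.hex i = true) (j : Option (Option N)) :
    (w.graph N).Adj (w.pB i j) (.hub (i + 1) (w.bS i)) := by
  rcases j with _ | _ | n
  · exact adj_B_b h _
  · exact (adj_b_b2 w i).symm
  · exact adj_B_b h _
end cell

/-- Twice the position of a vertex along the strip. -/
def level : Lab N → ℤ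
  | .hub i _ => 2 * i
  | .A i _ => 2 * i + 1
  | .B i _ => 2 * i + 1
  | .pend i _ _ => 2 * i
  | .deep i _ _ => 2 * i

/-- A finite set in which every vertex has exactly two neighbours contains a hexagon of a cell:
from a vertex of least level, which is in the left edge of a cell, both ways around lead through
the cell to its vertex `b`. -/
theorem exists_hexagon {w : Layout} {C : Set (Lab N)} (hf : C.Finite) (hne : C.Nonempty)
    (hC : ∀ x ∈ C, ∃ p ∈ C, ∃ q ∈ C, p ≠ q ∧ (w.graph N).Adj x p ∧ (w.graph N).Adj x q ∧
      ∀ r ∈ C, (w.graph N).Adj x r → r = p ∨ r = q) :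
    ∃ i, w.hex i = true ∧ ∃ j l : Option (Option N), j ≠ l ∧
      .hub i (w.aS i) ∈ C ∧ w.pA i j ∈ C ∧ w.pB i j ∈ C ∧ .hub (i + 1) (w.bS i) ∈ C ∧
      w.pA i l ∈ C ∧ w.pB i l ∈ C := by
  -- no vertex of `C` has only one neighbour in `C`
  have h1 : ∀ x ∈ C, ∀ z, (∀ r ∈ C, (w.graph N).Adj x r → r = z) → False := by
    intro x hx z h
    obtain ⟨p, hp, q, hq, hpq, ap, aq, -⟩ := hC x hx
    exact hpq ((h p hp ap).trans (h q hq aq).symm)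
  -- if only two vertices can be neighbours in `C`, then both of them are in `C`
  have h2 : ∀ x ∈ C, ∀ y z, (∀ r ∈ C, (w.graph N).Adj x r → r = y ∨ r = z) → y ∈ C ∧ z ∈ C := by
    intro x hx y z h
    obtain ⟨p, hp, q, hq, hpq, ap, aq, -⟩ := hC x hx
    rcases h p hp ap with rfl | rfl <;> rcases h q hq aq with rfl | rfl <;> simp_all
  have hdeep : ∀ i n m, .deep i n m ∉ C := fun i n m h =>
    h1 _ h _ fun r _ ha => (adj_deep.1 ha).2
  have hpend : ∀ i s n, .pend i s n ∉ C := fun i s n h =>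
    h1 _ h (.hub i s) fun r hr ha => by
      rcases adj_pend.1 ha with h | ⟨-, -, m, rfl⟩
      · exact h.1
      · exact absurd hr (hdeep _ _ _)
  obtain ⟨x, hx, hmin⟩ := hf.exists_minimalFor level C hne
  replace hmin : ∀ y ∈ C, level x ≤ level y := fun y hy => (le_total _ _).elim id (hmin hy)
  have hA : ∀ i n, .A i n ∈ C → w.hex i = true ∧ .hub i (w.aS i) ∈ C ∧ w.pB i (some n) ∈ C := by
    intro i n h
    cases n with
    | none =>
      refine ⟨?_, h2 _ h _ _ fun r hr ha => (adj_A_none.1 ha).2⟩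
      obtain ⟨p, hp, -, -, -, ap, -, -⟩ := hC _ h
      exact (adj_A_none.1 ap).1
    | some n =>
      refine ⟨?_, h2 _ h _ _ fun r hr ha => (adj_A_some.1 ha).2⟩
      obtain ⟨p, hp, -, -, -, ap, -, -⟩ := hC _ h
      exact (adj_A_some.1 ap).1
  have hB0 : ∀ i, .B i none ∈ C → w.hex i = true ∧ .hub i (w.a1S i) ∈ C ∧ .hub (i + 1) (w.bS i) ∈ C := by
    intro i h
    refine ⟨?_, h2 _ h _ _ fun r hr ha => (adj_B_none.1 ha).2.symm⟩
    obtain ⟨p, hp, -, -, -, ap, -, -⟩ := hC _ h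
    exact (adj_B_none.1 ap).1
  have hB1 : ∀ i n, .B i (some n) ∈ C → .A i (some n) ∈ C ∧ .hub (i + 1) (w.bS i) ∈ C := by
    intro i n h
    exact h2 _ h _ _ fun r hr ha => (adj_B_some.1 ha).2.symm
  have hxhub : ∃ i s, x = .hub i s := by
    cases x with
    | hub i s => exact ⟨i, s, rfl⟩
    | A i n => have := hmin _ (hA _ _ hx).2.1; simp [level] at this
    | B i n =>
      cases n with
      | none => have := hmin _ (hB0 _ hx).2.1; simp [level] at this
      | some n => have := hmin _ (hA _ _ (hB1 _ _ hx).1).2.1; simp [level] at this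
    | pend i s n => exact absurd hx (hpend _ _ _)
    | deep i n m => exact absurd hx (hdeep _ _ _)
  obtain ⟨i, s, rfl⟩ := hxhub
  -- in the cut of least level, neighbours in `C` are in the cut or to the right of it
  have hnb : ∀ s', ∀ r ∈ C, (w.graph N).Adj (.hub i s') r →
      (∃ t, r = .hub i t ∧ ((s' = .mid ∧ t ≠ .mid) ∨ (s' ≠ .mid ∧ t = .mid)) ∧
      (s' = .hi ∨ t = .hi → w.fused i = false)) ∨
    (w.hex i = false ∧ s' = .mid ∧ r = .hub (i + 1) .mid) ∨
    (w.hex i = true ∧ s' = w.aS i ∧ ∃ n, r = .A i n) ∨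
    (w.hex i = true ∧ s' = w.a1S i ∧ r = .B i none) := by
    intro s' r hr ha
    have hl := hmin r hr
    rw [adj_hub] at ha
    rcases ha with h | h | ⟨-, -, rfl⟩ | h | h | ⟨-, -, rfl⟩ | ⟨-, -, n, rfl⟩ | ⟨-, n, rfl⟩
    · exact .inl h
    · exact .inr (.inl h)
    · simp [level] at hl
    · exact .inr (.inr (.inl h))
    · exact .inr (.inr (.inr h))
    · simp [level] at hl; omega
    · simp [level] at hl; omega
    · exact absurd hr (hpend _ _ _)
  have e := w.aS_a1S i
  -- a hub outside the left edge of the cell has at most one neighbour in `C`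
  have hS : ∀ s', .hub i s' ∈ C → s' = w.aS i ∨ s' = w.a1S i := by
    intro s' hs'
    by_contra hcon
    push Not at hcon
    refine h1 _ hs' (.hub i .mid) fun r hr ha => ?_
    have := hnb s' r hr ha
    grind
  have hhex : w.hex i = true := by
    by_contra hh
    have hm : ∀ s', s' ≠ .mid → .hub i s' ∉ C := by
      intro s' hs' hc
      refine h1 _ hc (.hub i .mid) fun r hr ha => ?_
      have := hnb s' r hr ha
      grind
    have hs : s = .mid := by by_contra h; exact hm s h hx
    subst hs
    refine h1 _ hx (.hub (i + 1) .mid) fun r hr ha => ?_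
    have := hnb _ r hr ha
    grind
  have ha1 : .hub i (w.a1S i) ∈ C → .hub i (w.aS i) ∈ C ∧ .B i none ∈ C := by
    intro hc
    refine h2 _ hc _ _ fun r hr ha => ?_
    have := hnb _ r hr ha
    grind
  have ha : .hub i (w.aS i) ∈ C := by
    rcases hS s hx with rfl | rfl
    · exact hx
    · exact (ha1 hx).1
  have hB : ∀ n, w.pB i (some n) ∈ C → .hub (i + 1) (w.bS i) ∈ C ∨ n = none := by
    intro n hc
    rcases n with _ | n
    · exact .inr rfl
    · exact .inl (hB1 _ _ hc).2
  obtain ⟨p, hp, q, hq, hpq, ap, aq, -⟩ := hC _ ha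
  have key : ∀ r ∈ C, (w.graph N).Adj (.hub i (w.aS i)) r → ∃ j, r = w.pA i j := by
    intro r hr ha
    have := hnb _ r hr ha
    rcases this with ⟨t, rfl, h⟩ | h | ⟨-, -, n, rfl⟩ | ⟨-, h, -⟩
    · refine ⟨none, ?_⟩
      have := hS t hr
      grind [pA]
    · grind
    · exact ⟨some n, rfl⟩
    · grind
  obtain ⟨j, rfl⟩ := key p hp ap
  obtain ⟨l, rfl⟩ := key q hq aq
  have hj : ∀ j, w.pA i j ∈ C → w.pB i j ∈ C := by
    intro j hc
    rcases j with _ | n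
    · exact (ha1 hc).2
    · exact (hA i n hc).2.2
  have hb : .hub (i + 1) (w.bS i) ∈ C := by
    rcases j with _ | _ | n
    · exact (hB0 _ (ha1 hp).2).2.2
    · rcases l with _ | _ | n
      · exact (hB0 _ (ha1 hq).2).2.2
      · exact absurd rfl hpq
      · exact (hB1 _ _ (hj _ hq)).2
    · exact (hB1 _ _ (hj _ hp)).2
  exact ⟨i, hhex, j, l, fun h => hpq (h ▸ rfl), ha, hp, hj _ hp, hb, hq, hj _ hq⟩

theorem aS_ne_a1S (w : Layout) (i : ℤ) : w.aS i ≠ w.a1S i := by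
  have := w.aS_a1S i
  grind

theorem bS_ne_b2S (w : Layout) (i : ℤ) : w.bS i ≠ w.b2S i := by
  have := w.bS_b2S i
  grind

/-- The vertices of the hexagon which is formed by the paths `j` and `l` of the cell `i`. -/
def hexSet (w : Layout) (i : ℤ) (j l : Option (Option N)) : Set (Lab N) :=
  {.hub i (w.aS i), w.pA i j, w.pB i j, .hub (i + 1) (w.bS i), w.pB i l, w.pA i l}

theorem pA_injective {w : Layout} {i : ℤ} : Function.Injective (w.pA i (N := N)) := by
  rintro (_ | j) (_ | l) <;> simp [pA]

/-- Every induced cycle is a hexagon of a cell: it contains one by `exists_hexagon`, and is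
connected. -/
theorem range_eq_hexSet {w : Layout} {n : ℕ} (hn : 3 ≤ n)
    (φ : SimpleGraph.cycleGraph n ↪g w.graph N) :
    ∃ i, w.hex i = true ∧ ∃ j l : Option (Option N), j ≠ l ∧ Set.range φ = w.hexSet i j l := by
  have hC : ∀ x ∈ Set.range φ, ∃ p ∈ Set.range φ, ∃ q ∈ Set.range φ, p ≠ q ∧ (w.graph N).Adj x p ∧
      (w.graph N).Adj x q ∧ ∀ r ∈ Set.range φ, (w.graph N).Adj x r → r = p ∨ r = q := by
    rintro _ ⟨k, rfl⟩
    obtain ⟨p, q, hpq, hp, hq, h⟩ := cycleGraph_nbrs hn k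
    refine ⟨_, ⟨p, rfl⟩, _, ⟨q, rfl⟩, φ.injective.ne hpq, φ.map_adj_iff.2 hp, φ.map_adj_iff.2 hq, ?_⟩
    rintro _ ⟨r, rfl⟩ hr
    exact (h r (φ.map_adj_iff.1 hr)).imp (congrArg φ) (congrArg φ)
  obtain ⟨i, hi, j, l, hjl, h1, h2, h3, h4, h5, h6⟩ :=
    exists_hexagon (Set.finite_range φ) ⟨_, ⟨⟨0, by omega⟩, rfl⟩⟩ hC
  refine ⟨i, hi, j, l, hjl, ?_⟩
  have hsub : w.hexSet i j l ⊆ Set.range φ := by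
    rintro x (rfl | rfl | rfl | rfl | rfl | rfl) <;> assumption
  refine subset_antisymm ?_ hsub
  have two : ∀ x p q, x ∈ Set.range φ → p ∈ Set.range φ → q ∈ Set.range φ → p ≠ q →
      (w.graph N).Adj x p → (w.graph N).Adj x q → ∀ r ∈ Set.range φ, (w.graph N).Adj x r → r = p ∨ r = q := by
    intro x p q hx hp hq hpq ap aq r hr ar
    obtain ⟨p', -, q', -, -, -, -, h⟩ := hC x hx
    rcases h p hp ap with rfl | rfl <;> rcases h q hq aq with rfl | rfl <;> rcases h r hr ar with rfl | rfl <;>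
      simp_all
  have ne1 : w.pA i j ≠ w.pA i l := pA_injective.ne hjl
  have ne2 : w.pB i j ≠ w.pB i l := by
    rcases j with _ | _ | j <;> rcases l with _ | _ | l <;> simp_all [pB]
  have ne3 : ∀ j : Option (Option N), .hub i (w.aS i) ≠ w.pB i j := by
    rintro (_ | _ | j) <;> simp [pB]
  have ne4 : ∀ j : Option (Option N), w.pA i j ≠ .hub (i + 1) (w.bS i) := by
    rintro (_ | _ | j) <;> simp [pA]
  have hclosed : ∀ x ∈ w.hexSet i j l, ∀ r ∈ Set.range φ, (w.graph N).Adj x r → r ∈ w.hexSet i j l := by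
    have e1 := fun j : Option (Option N) => adj_a_pA hi j
    have e2 := fun j : Option (Option N) => adj_pA_pB hi j
    have e3 := fun j : Option (Option N) => adj_pB_b hi j
    rintro x (rfl | rfl | rfl | rfl | rfl | rfl) r hr ha
    · rcases two _ _ _ h1 h2 h5 ne1 (e1 j) (e1 l) r hr ha with rfl | rfl <;> simp [hexSet]
    · rcases two _ _ _ h2 h1 h3 (ne3 _) (e1 j).symm (e2 j) r hr ha with rfl | rfl <;> simp [hexSet]
    · rcases two _ _ _ h3 h2 h4 (ne4 _) (e2 j).symm (e3 j) r hr ha with rfl | rfl <;> simp [hexSet]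
    · rcases two _ _ _ h4 h3 h6 ne2 (e3 j).symm (e3 l).symm r hr ha with rfl | rfl <;> simp [hexSet]
    · rcases two _ _ _ h6 h5 h4 (ne4 _) (e2 l).symm (e3 l) r hr ha with rfl | rfl <;> simp [hexSet]
    · rcases two _ _ _ h5 h1 h6 (ne3 _) (e1 l).symm (e2 l) r hr ha with rfl | rfl <;> simp [hexSet]
  obtain ⟨k0, hk0⟩ := h1
  rintro _ ⟨k, rfl⟩
  refine SimpleGraph.cycleGraph_preconnected.mem_of_closed (T := {k | φ k ∈ w.hexSet i j l}) ?_ (x := k0) ?_ k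
  · exact fun x y hx hxy => hclosed _ hx _ ⟨y, rfl⟩ (φ.map_adj_iff.2 hxy)
  · simp [hk0, hexSet]

theorem eq_six_of_cycleGraph {w : Layout} {n : ℕ} (hn : 3 ≤ n)
    (h : SimpleGraph.cycleGraph n ⊴ w.graph N) :
    n = 6 := by
  obtain ⟨φ⟩ := h
  obtain ⟨i, hi, j, l, hjl, h⟩ := range_eq_hexSet hn φ
  have h1 : (Set.range φ).ncard = n := by
    rw [← Set.image_univ, Set.ncard_image_of_injective _ φ.injective]
    simp
  have h2 : (w.hexSet i j l).ncard = 6 := by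
    have n1 := w.aS_ne_a1S i
    have n2 := w.bS_ne_b2S i
    rcases j with _ | _ | j <;> rcases l with _ | _ | l <;> simp only [ne_eq, not_true] at hjl <;>
      simp only [hexSet, pA, pB] <;> repeat rw [Set.ncard_insert_of_notMem]
    all_goals simp [n1, n2, n1.symm, n2.symm]
    all_goals grind
  rw [← h1, h, h2]

/-- Among the vertices `pA j`, only `a₁` has neighbours outside the path. -/
theorem nbr_pA {w : Layout} {i : ℤ} {j : Option (Option N)} (hj : j ≠ none) {r : Lab N}
    (h : (w.graph N).Adj (w.pA i j) r) : r = .hub i (w.aS i) ∨ r = w.pB i j := by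
  rcases j with _ | _ | j
  · exact absurd rfl hj
  · exact (adj_A_none.1 h).2
  · exact (adj_A_some.1 h).2

/-- Among the vertices `pB j`, only `b₂` has neighbours outside the path. -/
theorem nbr_pB {w : Layout} {i : ℤ} {j : Option (Option N)} (hj : j ≠ some none) {r : Lab N}
    (h : (w.graph N).Adj (w.pB i j) r) : r = .hub (i + 1) (w.bS i) ∨ r = w.pA i j := by
  rcases j with _ | _ | j
  · exact (adj_B_none.1 h).2
  · exact absurd rfl hj
  · exact (adj_B_some.1 h).2

theorem hexSet_comm (w : Layout) (i : ℤ) (j l : Option (Option N)) :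
    w.hexSet i j l = w.hexSet i l j := by
  ext x; simp only [hexSet, Set.mem_insert_iff, Set.mem_singleton_iff]; tauto

/-- Every induced hexagon has two opposite vertices without neighbours outside the hexagon: of its
paths `j ≠ l` one can be chosen as `j` with `pB j ≠ b₂` and the other one as `l` with `pA l ≠ a₁`,
and `pB j` and `pA l` are opposite. -/
theorem exists_antipodal {w : Layout} (φ : SimpleGraph.cycleGraph 6 ↪g w.graph N) :
    ∃ k, (∀ r, (w.graph N).Adj (φ k) r → r ∈ Set.range φ) ∧
      (∀ r, (w.graph N).Adj (φ (k + 3)) r → r ∈ Set.range φ) := by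
  obtain ⟨i, hi, j, l, hjl, h⟩ := range_eq_hexSet (by norm_num) φ
  wlog hw : j ≠ some none ∧ l ≠ none generalizing j l with H
  · refine H l j hjl.symm (by rw [h, hexSet_comm]) ?_
    grind
  obtain ⟨k, hk⟩ : w.pB i j ∈ Set.range φ := by rw [h]; simp [hexSet]
  obtain ⟨k', hk'⟩ : w.pA i l ∈ Set.range φ := by rw [h]; simp [hexSet]
  have d1 : ∀ r, (w.graph N).Adj (w.pB i j) r → r ∈ Set.range φ := by
    intro r hr
    rw [h]
    rcases nbr_pB hw.1 hr with rfl | rfl <;> simp [hexSet]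
  have d2 : ∀ r, (w.graph N).Adj (w.pA i l) r → r ∈ Set.range φ := by
    intro r hr
    rw [h]
    rcases nbr_pA hw.2 hr with rfl | rfl <;> simp [hexSet]
  have ne1 : w.pB i j ≠ w.pA i l := by
    rcases j with _ | _ | j <;> rcases l with _ | _ | l <;> simp_all [pA, pB]
  have hna : ¬ (w.graph N).Adj (w.pB i j) (w.pA i l) := by
    intro ha
    rcases nbr_pB hw.1 ha with h | h
    · rcases l with _ | _ | l <;> simp_all [pA]
    · exact hjl (pA_injective h).symm
  have hnc : ∀ r, (w.graph N).Adj (w.pB i j) r → ¬ (w.graph N).Adj (w.pA i l) r := by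
    intro r hr hr'
    rcases nbr_pB hw.1 hr with rfl | rfl <;> rcases nbr_pA hw.2 hr' with h | h <;> revert h
    · simp
    · rcases l with _ | _ | l <;> simp_all [pB, w.bS_ne_b2S]
    · have := w.aS_ne_a1S i
      rcases j with _ | _ | j <;> simp_all [pA, this.symm]
    · rcases j with _ | _ | j <;> rcases l with _ | _ | l <;> simp_all [pA, pB]
  have dec : ∀ k k' : Fin 6, k ≠ k' → ¬ (SimpleGraph.cycleGraph 6).Adj k k' →
      (∀ m, (SimpleGraph.cycleGraph 6).Adj k m → ¬ (SimpleGraph.cycleGraph 6).Adj k' m) →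
      k' = k + 3 := by decide
  have hkk : k' = k + 3 := by
    rw [← hk, ← hk'] at *
    exact dec k k' (fun h => ne1 (h ▸ rfl)) (fun h => hna (φ.map_adj_iff.2 h))
      (fun m hm hm' => hnc (φ m) (φ.map_adj_iff.2 hm) (φ.map_adj_iff.2 hm'))
  exact ⟨k, hk ▸ d1, hkk ▸ hk' ▸ d2⟩

end Layout

/-- The hexagon of the graphs on `Fin n` in which the vertices `0, …, 5` induce it. -/
theorem hexagonEmb {n : ℕ} {F : SimpleGraph (Fin n)} (hn : 6 ≤ n)
   (hF : ∀ i j : Fin 6, F.Adj (i.castLE hn) (j.castLE hn) ↔ (SimpleGraph.cycleGraph 6).Adj i j)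
   {V : Type u} {G : SimpleGraph V} (φ : F ↪g G) :
   ∃ ψ : SimpleGraph.cycleGraph 6 ↪g G, ∀ i, ψ i = φ (i.castLE hn) :=
  ⟨⟨⟨fun i => φ (i.castLE hn), fun i j h => by simpa [Fin.ext_iff] using φ.injective h⟩,
    by intro i j; exact φ.map_adj_iff.trans (hF i j)⟩, fun i => rfl⟩

namespace Layout
theorem not_isIndContained_C6plus3c (w : Layout) : ¬ graphC6plus3c ⊴ w.graph N := by
  rintro ⟨φ⟩
  obtain ⟨ψ, hψ⟩ := hexagonEmb (F := graphC6plus3c) (by norm_num)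
    (by decide) φ
  obtain ⟨k, h1, h2⟩ := exists_antipodal ψ
  have key : ∀ p q : Fin 9, graphC6plus3c.Adj p q → 6 ≤ q.val → φ q ∉ Set.range ψ := by
    rintro p q - hq ⟨m, hm⟩
    rw [hψ] at hm
    have := φ.injective hm
    simp [Fin.ext_iff] at this
    omega
  simp only [hψ] at h1 h2
  have e := fun p q (h : graphC6plus3c.Adj p q) => (φ.map_adj_iff (v := p) (w := q)).2 h
  fin_cases k
  · exact key 0 6 (by decide) (by decide) (h1 _ (e 0 6 (by decide)))
  · exact key 1 7 (by decide) (by decide) (h1 _ (e 1 7 (by decide)))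
  · exact key 2 8 (by decide) (by decide) (h1 _ (e 2 8 (by decide)))
  · exact key 0 6 (by decide) (by decide) (h2 _ (e 0 6 (by decide)))
  · exact key 1 7 (by decide) (by decide) (h2 _ (e 1 7 (by decide)))
  · exact key 2 8 (by decide) (by decide) (h2 _ (e 2 8 (by decide)))

theorem not_isIndContained_C6plus3nc (w : Layout) : ¬ graphC6plus3nc ⊴ w.graph N := by
  rintro ⟨φ⟩
  obtain ⟨ψ, hψ⟩ := hexagonEmb (F := graphC6plus3nc) (by norm_num)
    (by decide) φ
  obtain ⟨k, h1, h2⟩ := exists_antipodal ψ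
  have key : ∀ p q : Fin 9, graphC6plus3nc.Adj p q → 6 ≤ q.val → φ q ∉ Set.range ψ := by
    rintro p q - hq ⟨m, hm⟩
    rw [hψ] at hm
    have := φ.injective hm
    simp [Fin.ext_iff] at this
    omega
  simp only [hψ] at h1 h2
  have e := fun p q (h : graphC6plus3nc.Adj p q) => (φ.map_adj_iff (v := p) (w := q)).2 h
  fin_cases k
  · exact key 0 6 (by decide) (by decide) (h1 _ (e 0 6 (by decide)))
  · exact key 4 8 (by decide) (by decide) (h2 _ (e 4 8 (by decide)))
  · exact key 2 7 (by decide) (by decide) (h1 _ (e 2 7 (by decide)))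
  · exact key 0 6 (by decide) (by decide) (h2 _ (e 0 6 (by decide)))
  · exact key 4 8 (by decide) (by decide) (h1 _ (e 4 8 (by decide)))
  · exact key 2 7 (by decide) (by decide) (h2 _ (e 2 7 (by decide)))

end Layout

/-! ### `C₆^{+2l2}` is not in a universal strip -/

namespace Layout
variable {N : Type u}

/-- The possibilities for a path `x y` of length 2 that is attached to a left corner of a hexagon
in the cell `i`. It is attached to the middle hub of an unfused cut or of a cut after an edge
cell, or it leads to the far side of the hexagonal cell `i - 1`. -/
theorem left_legs {w : Layout} {i : ℤ} (hi : w.hex i = true) {C : Set (Lab N)}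
   (ha : .hub i (w.aS i) ∈ C) (ha1 : .hub i (w.a1S i) ∈ C) (hb : .hub (i + 1) (w.bS i) ∈ C)
    {s : Spot} {x y : Lab N}
   (hs : .hub i s ∈ C) (hss : s = w.aS i ∨ s = w.a1S i)
   (h : (w.graph N).Adj (.hub i s) x) (k : (w.graph N).Adj x y) (hx : x ∉ C) (hy : y ∉ C)
   (hyC : ∀ c ∈ C, ¬ (w.graph N).Adj y c) :
   (w.fused i = false ∧ s = .mid) ∨
   (w.hex (i - 1) = false ∧ s = .mid) ∨
   (w.hex (i - 1) = true ∧ s = w.b2S (i - 1) ∧ y = .hub (i - 1) (w.aS (i - 1))) ∨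
   (w.hex (i - 1) = true ∧ s = w.bS (i - 1) ∧ ∃ n, y = w.pA (i - 1) n ∧ n ≠ some none) := by
  have e := w.aS_a1S i
  have hyb : ¬ (w.graph N).Adj y (.hub (i + 1) (w.bS i)) := hyC _ hb
  by_cases hf : w.fused i = false ∧ s = .mid
  · exact .inl hf
  right
  have e1 : i - 1 + 1 = i := by ring
  rw [adj_hub] at h
  rcases h with ⟨s', rfl, hs⟩ | ⟨h1, h2, rfl⟩ | ⟨h1, h2, rfl⟩ | ⟨h1, h2, n, rfl⟩ | ⟨h1, h2, rfl⟩ |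
    ⟨h1, h2, rfl⟩ | ⟨h1, h2, n, rfl⟩ | ⟨h1, n, rfl⟩
  · exfalso
    cases s <;> cases s' <;> simp_all <;> grind
  · simp_all
  · exact .inl ⟨h1, h2⟩
  · exfalso
    rcases n with _ | n
    · rcases (adj_A_none.1 k).2 with rfl | rfl
      · exact hy ha
      · exact hyb (adj_b_b2 w i).symm
    · rcases (adj_A_some.1 k).2 with rfl | rfl
      · exact hy ha
      · exact hyb (adj_B_b hi _)
  · exfalso
    rcases (adj_B_none.1 k).2 with rfl | rfl
    · exact hy hb
    · exact hy ha1
  · right; left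
    refine ⟨h1, h2, ?_⟩
    rcases (adj_A_none.1 k).2 with h | rfl
    · exact h
    · rw [e1, ← h2] at hy; exact absurd hs hy
  · right; right
    refine ⟨h1, h2, ?_⟩
    rcases n with _ | n
    · rcases (adj_B_none.1 k).2 with rfl | h
      · rw [e1, ← h2] at hy; exact absurd hs hy
      · exact ⟨none, h, by simp⟩
    · rcases (adj_B_some.1 k).2 with rfl | h
      · rw [e1, ← h2] at hy; exact absurd hs hy
      · exact ⟨some (some n), h, by simp⟩
  · exfalso
    rcases adj_pend.1 k with ⟨rfl, -⟩ | ⟨rfl, hf', -⟩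
    · exact hy hs
    · exact hf ⟨hf', rfl⟩

/-- Paths of length 2 are not attached to both left corners of a hexagon without an edge between
them: when both of them go through the cell `i - 1`, one ends in `a` and the other one in a
neighbour of `a`. -/
theorem left_legs_conflict {w : Layout} {i : ℤ} (hi : w.hex i = true) {C : Set (Lab N)}
   (ha : .hub i (w.aS i) ∈ C) (ha1 : .hub i (w.a1S i) ∈ C) (hb : .hub (i + 1) (w.bS i) ∈ C)
    {s s' : Spot} {x y x' y' : Lab N}
   (hss : s = w.aS i ∨ s = w.a1S i) (hss' : s' = w.aS i ∨ s' = w.a1S i) (hne : s ≠ s')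
   (h : (w.graph N).Adj (.hub i s) x) (k : (w.graph N).Adj x y) (hx : x ∉ C) (hy : y ∉ C)
   (hyC : ∀ c ∈ C, ¬ (w.graph N).Adj y c)
   (h' : (w.graph N).Adj (.hub i s') x') (k' : (w.graph N).Adj x' y') (hx' : x' ∉ C) (hy' : y' ∉ C)
   (hyC' : ∀ c ∈ C, ¬ (w.graph N).Adj y' c) (hyy : ¬ (w.graph N).Adj y y') : False := by
  have hs : .hub i s ∈ C := by rcases hss with rfl | rfl <;> assumption
  have hs' : .hub i s' ∈ C := by rcases hss' with rfl | rfl <;> assumption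
  have t1 := left_legs hi ha ha1 hb hs hss h k hx hy hyC
  have t2 := left_legs hi ha ha1 hb hs' hss' h' k' hx' hy' hyC'
  have e := w.aS_a1S i
  have e2 := w.bS_b2S (i - 1)
  rcases t1 with ⟨h1, rfl⟩ | ⟨h1, rfl⟩ | ⟨h1, rfl, rfl⟩ | ⟨h1, rfl, n, rfl, hn⟩ <;>
  rcases t2 with ⟨h2, h2'⟩ | ⟨h2, h2'⟩ | ⟨h2, h2', h3⟩ | ⟨h2, h2', n, h3, hn⟩
  case inr.inr.inl.inr.inr.inr => exact hyy (h3 ▸ adj_a_pA h1 _)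
  case inr.inr.inr.inr.inr.inl => exact hyy (h3 ▸ (adj_a_pA h1 _).symm)
  all_goals clear hyy hyC hyC' h k h' k'
  all_goals grind

/-- The mirror image of `left_legs_conflict`. -/
theorem right_legs_conflict {w : Layout} {i : ℤ} (hi : w.hex i = true) {C : Set (Lab N)}
   (ha : .hub (i + 1) (w.bS i) ∈ C) (ha1 : .hub (i + 1) (w.b2S i) ∈ C) (hb : .hub i (w.aS i) ∈ C)
    {s s' : Spot} {x y x' y' : Lab N}
   (hss : s = w.bS i ∨ s = w.b2S i) (hss' : s' = w.bS i ∨ s' = w.b2S i) (hne : s ≠ s')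
   (h : (w.graph N).Adj (.hub (i + 1) s) x) (k : (w.graph N).Adj x y) (hx : x ∉ C) (hy : y ∉ C)
   (hyC : ∀ c ∈ C, ¬ (w.graph N).Adj y c)
   (h' : (w.graph N).Adj (.hub (i + 1) s') x') (k' : (w.graph N).Adj x' y') (hx' : x' ∉ C)
    (hy' : y' ∉ C)
   (hyC' : ∀ c ∈ C, ¬ (w.graph N).Adj y' c) (hyy : ¬ (w.graph N).Adj y y') : False := by
  have inj := w.revLab_injective (N := N)
  have e1 : ∀ s, w.revLab (.hub (i + 1) s : Lab N) = .hub (-1 - i) (flip (w.fused (i + 1)) s) := by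
    intro s; simp only [revLab]; congr 1; ring
  have e2 : w.revLab (.hub i (w.aS i) : Lab N) = .hub (-1 - i + 1) (w.rev.bS (-1 - i)) := by
    simp only [revLab, rev_bS]; congr 1; ring
  have hm : ∀ x ∉ C, w.revLab x ∉ w.revLab '' C := fun x hx => by rwa [inj.mem_set_image]
  have hm' : ∀ x ∈ C, w.revLab x ∈ w.revLab '' C := fun x hx => Set.mem_image_of_mem _ hx
  refine left_legs_conflict (w := w.rev) (i := -1 - i) (C := w.revLab '' C) (by simpa using hi)
    (s := flip (w.fused (i + 1)) s) (s' := flip (w.fused (i + 1)) s')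
    (x := w.revLab x) (y := w.revLab y) (x' := w.revLab x') (y' := w.revLab y')
    ?_ ?_ ?_ ?_ ?_ ?_ ?_ (rev_adj_iff.2 k) (hm _ hx) (hm _ hy) ?_ ?_ (rev_adj_iff.2 k') (hm _ hx') (hm _ hy') ?_
    (by rwa [rev_adj_iff])
  · rw [rev_aS, ← e1]; exact hm' _ ha
  · rw [rev_a1S, ← e1]; exact hm' _ ha1
  · rw [← e2]; exact hm' _ hb
  · rw [rev_aS, rev_a1S]; exact hss.imp (congrArg _) (congrArg _)
  · rw [rev_aS, rev_a1S]; exact hss'.imp (congrArg _) (congrArg _)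
  · intro h; exact hne (by simpa using congrArg (flip (w.fused (i + 1))) h)
  · rw [← e1]; exact rev_adj_iff.2 h
  · rintro _ ⟨c, hc, rfl⟩; rw [rev_adj_iff]; exact hyC c hc
  · rw [← e1]; exact rev_adj_iff.2 h'
  · rintro _ ⟨c, hc, rfl⟩; rw [rev_adj_iff]; exact hyC' c hc

/-- An edge of a hexagon whose ends both have neighbours outside the hexagon is the left or the
right edge of the cell. -/
theorem hexagon_edge {w : Layout} {i : ℤ} (hi : w.hex i = true) {j l : Option (Option N)}
    (hjl : j ≠ l) {u v : Lab N}
    (hu : u ∈ w.hexSet i j l) (hv : v ∈ w.hexSet i j l) (huv : (w.graph N).Adj u v)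
    (hu' : ∃ r, (w.graph N).Adj u r ∧ r ∉ w.hexSet i j l)
    (hv' : ∃ r, (w.graph N).Adj v r ∧ r ∉ w.hexSet i j l) :
    (∃ s s', s ≠ s' ∧ u = .hub i s ∧ v = .hub i s' ∧ (s = w.aS i ∨ s = w.a1S i) ∧ (s' = w.aS i ∨ s'
    = w.a1S i)) ∨
    (∃ s s', s ≠ s' ∧ u = .hub (i + 1) s ∧ v = .hub (i + 1) s' ∧ (s = w.bS i ∨ s = w.b2S i) ∧
      (s' = w.bS i ∨ s' = w.b2S i)) := by
  have key : ∀ u ∈ w.hexSet i j l, (∃ r, (w.graph N).Adj u r ∧ r ∉ w.hexSet i j l) →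
      (∃ s, u = .hub i s ∧ (s = w.aS i ∨ s = w.a1S i)) ∨
      (∃ s, u = .hub (i + 1) s ∧ (s = w.bS i ∨ s = w.b2S i)) := by
    have kA : ∀ j', (j' = j ∨ j' = l) → ∀ r, (w.graph N).Adj (w.pA i j') r → r ∉ w.hexSet i j l → j' = none := by
      intro j' h r hr hn
      by_contra hj
      apply hn
      rcases nbr_pA hj hr with rfl | rfl <;> rcases h with rfl | rfl <;> simp [hexSet]
    have kB : ∀ j', (j' = j ∨ j' = l) → ∀ r, (w.graph N).Adj (w.pB i j') r → r ∉ w.hexSet i j l → j' = some none := by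
      intro j' h r hr hn
      by_contra hj
      apply hn
      rcases nbr_pB hj hr with rfl | rfl <;> rcases h with rfl | rfl <;> simp [hexSet]
    rintro u (rfl | rfl | rfl | rfl | rfl | rfl) ⟨r, hr, hn⟩
    · exact .inl ⟨_, rfl, .inl rfl⟩
    · obtain rfl := kA _ (.inl rfl) r hr hn; exact .inl ⟨_, rfl, .inr rfl⟩
    · obtain rfl := kB _ (.inl rfl) r hr hn; exact .inr ⟨_, rfl, .inr rfl⟩
    · exact .inr ⟨_, rfl, .inl rfl⟩
    · obtain rfl := kB _ (.inr rfl) r hr hn; exact .inr ⟨_, rfl, .inr rfl⟩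
    · obtain rfl := kA _ (.inr rfl) r hr hn; exact .inl ⟨_, rfl, .inr rfl⟩
  rcases key u hu hu' with ⟨s, rfl, hs⟩ | ⟨s, rfl, hs⟩ <;> rcases key v hv hv' with ⟨s', rfl, hs'⟩ | ⟨s', rfl, hs'⟩
  · exact .inl ⟨s, s', fun h => huv.ne (h ▸ rfl), rfl, rfl, hs, hs'⟩
  · simp [adj_iff, Edge, hi] at huv
    omega
  · simp [adj_iff, Edge, hi] at huv
    omega
  · exact .inr ⟨s, s', fun h => huv.ne (h ▸ rfl), rfl, rfl, hs, hs'⟩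

theorem not_isIndContained_C6plus2l2 (w : Layout) : ¬ graphC6plus2l2 ⊴ w.graph N := by
  rintro ⟨φ⟩
  obtain ⟨ψ, hψ⟩ := hexagonEmb (F := graphC6plus2l2) (by norm_num)
    (by decide) φ
  obtain ⟨i, hi, j, l, hjl, hC⟩ := range_eq_hexSet (by norm_num) ψ
  have e := fun p q (h : graphC6plus2l2.Adj p q) => (φ.map_adj_iff (v := p) (w := q)).2 h
  have n := fun p q (h : ¬ graphC6plus2l2.Adj p q) => (not_congr (φ.map_adj_iff (v := p) (w := q))).2 h
  have hin : ∀ p : Fin 10, p.val < 6 → φ p ∈ w.hexSet i j l := by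
    intro p hp
    rw [← hC]
    exact ⟨⟨p, hp⟩, hψ _⟩
  have hout : ∀ q : Fin 10, 6 ≤ q.val → φ q ∉ w.hexSet i j l := by
    intro q hq h
    rw [← hC] at h
    obtain ⟨m, hm⟩ := h
    rw [hψ] at hm
    have := φ.injective hm
    simp [Fin.ext_iff] at this
    omega
  have hno : ∀ q : Fin 10, q = 7 ∨ q = 9 → ∀ c ∈ w.hexSet i j l, ¬ (w.graph N).Adj (φ q) c := by
    intro q hq c hc
    rw [← hC] at hc
    obtain ⟨m, rfl⟩ := hc
    rw [hψ]
    apply n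
    revert m q
    decide
  have a01 := e 0 1 (by decide)
  have a06 := e 0 6 (by decide)
  have a67 := e 6 7 (by decide)
  have a18 := e 1 8 (by decide)
  have a89 := e 8 9 (by decide)
  have n79 := n 7 9 (by decide)
  have i0 := hin 0 (by decide)
  have i1 := hin 1 (by decide)
  rcases hexagon_edge hi hjl i0 i1 a01 ⟨_, a06, hout 6 (by decide)⟩ ⟨_, a18, hout 8 (by decide)⟩ with
    ⟨s, s', hss, h0, h1, hs, hs'⟩ | ⟨s, s', hss, h0, h1, hs, hs'⟩
  · rw [h0] at i0 a06
    rw [h1] at i1 a18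
    refine left_legs_conflict hi (C := w.hexSet i j l) ?_ ?_ ?_ hs hs' hss a06 a67 (hout _ (by decide)) (hout _ (by decide))
      (hno _ (.inl rfl)) a18 a89 (hout _ (by decide)) (hout _ (by decide)) (hno _ (.inr rfl)) n79
    · grind
    · grind
    · simp [hexSet]
  · rw [h0] at i0 a06
    rw [h1] at i1 a18
    refine right_legs_conflict hi (C := w.hexSet i j l) ?_ ?_ ?_ hs hs' hss a06 a67 (hout _ (by decide)) (hout _ (by decide))
      (hno _ (.inl rfl)) a18 a89 (hout _ (by decide)) (hout _ (by decide)) (hno _ (.inr rfl)) n79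
    · grind
    · grind
    · simp [hexSet]

end Layout

/-- Finite induced subgraphs of universal strips belong to the class. -/
theorem inClassX_of_embeds {V : Type u} {N : Type v} [Finite V] {G : SimpleGraph V} {w : Layout}
    (φ : G ↪g w.graph N) : InClassX G where
  finite := inferInstance
  free_S333 h := w.not_isIndContained_S333 (h.trans φ.isIndContained)
  free_C6plus3c h := w.not_isIndContained_C6plus3c (h.trans φ.isIndContained)
  free_C6plus3nc h := w.not_isIndContained_C6plus3nc (h.trans φ.isIndContained)
  free_C6plus2l2 h := w.not_isIndContained_C6plus2l2 (h.trans φ.isIndContained)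
  free_cycle n hn hn6 h := hn6 (Layout.eq_six_of_cycleGraph hn (h.trans φ.isIndContained))

/-! ### Gluing along unfused cuts -/

theorem disjointUnion_adj {ι : Type u} {W : ι → Type v} {G : ∀ i, SimpleGraph (W i)}
    {p q : Σ i, W i} :
    (disjointUnion G).Adj p q ↔ ∃ i x y, (G i).Adj x y ∧ p = ⟨i, x⟩ ∧ q = ⟨i, y⟩ := by
  simp only [disjointUnion, SimpleGraph.iSup_adj, SimpleGraph.map_adj']
  constructor
  · rintro ⟨i, -, x, y, h, rfl, rfl⟩; exact ⟨i, x, y, h, rfl, rfl⟩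
  · rintro ⟨i, x, y, h, rfl, rfl⟩
    refine ⟨i, ?_, x, y, h, rfl, rfl⟩
    intro h'
    exact h.ne (by simpa using h')

theorem disjointUnion_adj_mk {ι : Type u} {W : ι → Type v} {G : ∀ i, SimpleGraph (W i)} {i : ι}
    {x y : W i} :
    (disjointUnion G).Adj ⟨i, x⟩ ⟨i, y⟩ ↔ (G i).Adj x y := by
  rw [disjointUnion_adj]
  constructor
  · rintro ⟨j, x', y', h, h1, h2⟩
    obtain ⟨rfl, h1⟩ := Sigma.mk.inj h1
    obtain ⟨-, h2⟩ := Sigma.mk.inj h2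
    obtain rfl := eq_of_heq h1
    obtain rfl := eq_of_heq h2
    exact h
  · intro h; exact ⟨i, x, y, h, rfl, rfl⟩

theorem identifyVertices_adj {V : Type u} {G : SimpleGraph V} {r : V → V → Prop} {x y : V}
    (h : G.Adj x y)
   (hne : Quot.mk r x ≠ Quot.mk r y) : (identifyVertices G r).Adj (Quot.mk r x) (Quot.mk r y) :=
  SimpleGraph.map_adj_apply' h hne

/-- A map compatible with the identifications, which separates different classes and under which adjacent images come from
adjacent classes, embeds the graph obtained by identification. -/
theorem identifyVertices_embedding {V : Type u} {G : SimpleGraph V} {r : V → V → Prop} {X : Type v}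
    {U : SimpleGraph X}
    (f : V → X) (h1 : ∀ x y, r x y → f x = f y) (h2 : ∀ x y, f x = f y → Quot.mk r x = Quot.mk r y)
    (h3 : ∀ x y, G.Adj x y → U.Adj (f x) (f y))
    (h4 : ∀ x y, U.Adj (f x) (f y) → (identifyVertices G r).Adj (Quot.mk r x) (Quot.mk r y)) :
    ∃ φ : identifyVertices G r ↪g U, ∀ x, φ (Quot.mk r x) = f x := by
  refine ⟨⟨⟨Quot.lift f h1, ?_⟩, ?_⟩, fun x => rfl⟩
  · rintro ⟨x⟩ ⟨y⟩ h
    exact h2 x y h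
  · rintro ⟨x⟩ ⟨y⟩
    refine ⟨h4 x y, ?_⟩
    rintro ⟨hne, x', y', h, hx, hy⟩
    have e1 : f x' = f x := congrArg (Quot.lift f h1) hx
    have e2 : f y' = f y := congrArg (Quot.lift f h1) hy
    have := h3 x' y' h
    rw [e1, e2] at this
    exact this

namespace Lab
variable {N : Type u} {N' : Type v}

/-- The label moved by `k` cuts. -/
def shift (k : ℤ) : Lab N → Lab N
  | .hub i s => .hub (i + k) s
  | .A i n => .A (i + k) n
  | .B i n => .B (i + k) n
  | .pend i s n => .pend (i + k) s n
  | .deep i n m => .deep (i + k) n m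

/-- The label with its names replaced. -/
def map (f : N → N') : Lab N → Lab N'
  | .hub i s => .hub i s
  | .A i n => .A i (n.map f)
  | .B i n => .B i (n.map f)
  | .pend i s n => .pend i s (f n)
  | .deep i n m => .deep i (f n) (f m)

theorem shift_injective (k : ℤ) : Function.Injective (shift k (N := N)) := by
  rintro (_ | _ | _ | _ | _) (_ | _ | _ | _ | _) <;> simp [shift]

theorem map_injective {f : N → N'} (hf : Function.Injective f) : Function.Injective (map f) := by
  rintro (_ | _ | _ | _ | _) (_ | _ | _ | _ | _) <;> simp [map, hf.eq_iff, (Option.map_injective hf).eq_iff]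

/-- Labels whose cuts are in `K`; the inner vertices of the cell `i` belong to the cuts `i` and `i
+ 1`. -/
def Within (K : Set ℤ) : Lab N → Prop
  | .hub i _ => i ∈ K
  | .A i _ => i ∈ K ∧ i + 1 ∈ K
  | .B i _ => i ∈ K ∧ i + 1 ∈ K
  | .pend i _ _ => i ∈ K
  | .deep i _ _ => i ∈ K

/-- Labels of the piece between the unfused cuts `p` and `q`. The middle hubs of both cuts are
included, as well as what is attached to them. The hub `lo` of cut `p` and the hub `hi` of cut `q`
belong to the neighbouring pieces. -/
def InPiece (p q : ℤ) : Lab N → Prop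
  | .hub i s => p ≤ i ∧ i ≤ q ∧ (i = p → s ≠ .lo) ∧ (i = q → s ≠ .hi)
  | .A i _ => p ≤ i ∧ i < q
  | .B i _ => p ≤ i ∧ i < q
  | .pend i s _ => p ≤ i ∧ i ≤ q ∧ (i = p → s ≠ .lo) ∧ (i = q → s ≠ .hi)
  | .deep i _ _ => p ≤ i ∧ i ≤ q

/-- The cut, the spot and the name of the pendant vertex to which a label `pend` or `deep`
belongs. Pieces that meet in a middle hub are kept disjoint by their tags. -/
def tag : Lab N → Option (ℤ × Spot × N)
  | .pend i s n => some (i, s, n)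
  | .deep i n _ => some (i, .mid, n)
  | _ => none

theorem InPiece.within {p q : ℤ} {x : Lab N} (h : InPiece p q x) : Within (Set.Icc p q) x := by
  cases x <;> simp [InPiece, Within] at h ⊢ <;> omega

theorem InPiece.shift {p q : ℤ} {x : Lab N} (h : InPiece p q x) (k : ℤ) : InPiece (p + k) (q + k)
    (x.shift k) := by
  cases x <;> simp_all [InPiece, Lab.shift]

theorem InPiece.map {p q : ℤ} {x : Lab N} (h : InPiece p q x) (f : N → N') : InPiece p q (x.map f)
    := by
  cases x <;> simp_all [InPiece, Lab.map]

end Lab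

namespace Layout
variable {N : Type u} {N' : Type v}

theorem adj_map {w : Layout} {f : N → N'} (hf : Function.Injective f) {x y : Lab N} :
    (w.graph N').Adj (x.map f) (y.map f) ↔ (w.graph N).Adj x y := by
  cases x <;> cases y <;> simp [adj_iff, Edge, Lab.map, hf.eq_iff, (Option.map_injective hf).eq_iff]

/-- Adjacency of labels within `K` depends only on the part of the layout in `K`. -/
theorem adj_shift {w w' : Layout} {K : Set ℤ} {k : ℤ} (hf : ∀ i ∈ K, w'.fused (i + k) = w.fused i)
    (hc : ∀ i ∈ K, i + 1 ∈ K → w'.hex (i + k) = w.hex i ∧ w'.aMid (i + k) = w.aMid i ∧ w'.bMid (i +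
    k) = w.bMid i)
    {x y : Lab N} (hx : x.Within K) (hy : y.Within K) :
    (w'.graph N).Adj (x.shift k) (y.shift k) ↔ (w.graph N).Adj x y := by
  have key : ∀ {x y : Lab N}, x.Within K → y.Within K → (w'.Edge (x.shift k) (y.shift k) ↔ w.Edge x y) := by
    intro x y hx hy
    have eA : ∀ i ∈ K, i + 1 ∈ K → w'.aS (i + k) = w.aS i := by
      intro i hi hi'; simp only [aS, hf i hi, hc i hi hi']
    have eA1 : ∀ i ∈ K, i + 1 ∈ K → w'.a1S (i + k) = w.a1S i := by
      intro i hi hi'; simp only [a1S, hf i hi, hc i hi hi']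
    have eB : ∀ i ∈ K, i + 1 ∈ K → w'.bS (i + k) = w.bS i := by
      intro i hi hi'; simp only [bS, hc i hi hi']
    have eB2 : ∀ i ∈ K, i + 1 ∈ K → w'.b2S (i + k) = w.b2S i := by
      intro i hi hi'; simp only [b2S, hc i hi hi']
    have c1 : ∀ i j : ℤ, i + k = j + k + 1 ↔ i = j + 1 := by intro i j; omega
    cases x with
    | hub i s =>
      cases y with
      | hub j t =>
        simp only [Edge, Lab.shift, Lab.Within, add_left_inj, c1] at *
        rw [hf i hx]
        constructor
        · rintro (h | ⟨h1, h2, h3, h⟩)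
          · exact .inl h
          · subst h1; rw [(hc i hx hy).1] at h; exact .inr ⟨rfl, h2, h3, h⟩
        · rintro (h | ⟨h1, h2, h3, h⟩)
          · exact .inl h
          · subst h1; rw [← (hc i hx hy).1] at h; exact .inr ⟨rfl, h2, h3, h⟩
      | A j n =>
        simp only [Edge, Lab.shift, Lab.Within, add_left_inj, c1] at *
        rw [eA _ hy.1 hy.2, eB2 _ hy.1 hy.2, (hc j hy.1 hy.2).1]
      | B j n =>
        simp only [Edge, Lab.shift, Lab.Within, add_left_inj, c1] at *
        rw [eA1 _ hy.1 hy.2, eB _ hy.1 hy.2, (hc j hy.1 hy.2).1]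
      | pend j t n => simp [Edge, Lab.shift, Lab.Within] at *; rw [hf i hx]; tauto
      | deep j n m => simp [Edge, Lab.shift]
    | A i n => cases y <;> simp [Edge, Lab.shift, Lab.Within] at *; rw [(hc i hx.1 hx.2).1]; tauto
    | B i n => cases y <;> simp [Edge, Lab.shift] at *
    | pend i s n => cases y <;> simp [Edge, Lab.shift, Lab.Within] at *; rw [hf i hx]; tauto
    | deep i n m => cases y <;> simp [Edge, Lab.shift] at *
  rw [adj_iff, adj_iff, key hx hy, key hy hx]

/-- Consecutive pieces have only the middle hub of their common cut in common, apart from pendant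
vertices. -/
theorem eq_hub_of_inPiece {p q p' q' : ℤ} {X : Lab N} (hq : q ≤ p')
    (hX : X.InPiece p q) (hY : X.InPiece p' q') (ht : X.tag = none) : X = .hub q .mid := by
  cases X with
  | hub i s =>
    simp only [Lab.InPiece] at hX hY
    obtain rfl : i = q := by omega
    cases s <;> grind
  | A => simp only [Lab.InPiece] at hX hY; omega
  | B => simp only [Lab.InPiece] at hX hY; omega
  | pend => simp [Lab.tag] at ht
  | deep => simp [Lab.tag] at ht

/-- Edges between consecutive pieces start in the middle hub of their common cut. -/
theorem eq_hub_of_adj_inPiece {w : Layout} {p q p' q' : ℤ} {X Y : Lab N} (hq : q ≤ p')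
    (hfq : w.fused q = false) (hX : X.InPiece p q) (hY : Y.InPiece p' q')
    (ht : ∀ t, X.tag = some t → Y.tag ≠ some t) (h : (w.graph N).Adj X Y) :
    X = .hub q .mid ∨ Y = .hub p' .mid := by
  have e1 := w.aS_a1S q
  have e2 := fun i => w.bS_b2S i
  cases X <;> cases Y <;> simp only [adj_iff, Edge, Lab.InPiece, Lab.tag, Lab.hub.injEq, reduceCtorEq] at *
  case hub.hub i s j t =>
    clear ht
    obtain ⟨a1, a2, a3, a4⟩ := hX
    obtain ⟨b1, b2, b3, b4⟩ := hY
    by_cases hs : s = .mid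
    · by_cases htt : t = .mid
      · grind
      · have : i = j := by grind
        grind
    · have : i = j := by grind
      have : i = q := by omega
      cases s <;> grind
  case hub.A => grind
  case hub.B => grind
  case A.hub => grind
  case B.hub => grind
  case hub.pend i s j t n =>
    clear ht
    have : i = j := by grind
    have : i = q := by omega
    cases s <;> grind
  case pend.hub i s n j t =>
    clear ht
    have : i = j := by grind
    have : i = q := by omega
    cases s <;> grind
  all_goals grind
end Layout

/-- Embeddings of the pieces of a chain into consecutive parts of a layout, which meet in the
middle hubs of unfused cuts, combine to an embedding of the chain. -/
theorem exists_chain_embedding {m : ℕ} {W : Fin (m + 1) → Type} {H : ∀ i, SimpleGraph (W i)}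
    {a b : ∀ i, W i} {N : Type u} {w : Layout} (u : ℕ → ℤ) (hu : Monotone u)
    (hfu : ∀ l, w.fused (u l) = false) (φ : ∀ i, H i ↪g w.graph N)
    (hp : ∀ i x, (φ i x).InPiece (u i) (u (i + 1)))
    (ha : ∀ i, φ i (a i) = .hub (u i) .mid) (hb : ∀ i, φ i (b i) = .hub (u (i + 1)) .mid)
    (ht : ∀ i j x y t, i ≠ j → (φ i x).tag = some t → (φ j y).tag ≠ some t) :
    ∃ Φ : identifyVertices (disjointUnion H) (ChainGlue a b) ↪g w.graph N,
      ∀ i x, Φ (Quot.mk _ ⟨i, x⟩) = φ i x := by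
  let f : (Σ i, W i) → Lab N := fun p => φ p.1 p.2
  have hglue : ∀ x y, ChainGlue a b x y → f x = f y := by
    rintro _ _ ⟨i⟩
    simp only [f, ha, hb]
    simp
  -- the vertex `b i` may be replaced by `a (i + 1)`
  have step : ∀ i j : Fin (m + 1), (j : ℕ) = i + 1 →
      (Quot.mk (ChainGlue a b) ⟨i, b i⟩ = Quot.mk (ChainGlue a b) ⟨j, a j⟩) := by
    intro i j hij
    have hi : (i : ℕ) < m := by omega
    obtain ⟨i', rfl⟩ : ∃ i' : Fin m, i = i'.castSucc := ⟨⟨i, hi⟩, rfl⟩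
    obtain rfl : j = i'.succ := by ext; simpa using hij
    exact Quot.sound (.glue i')
  have inj : ∀ k : ℕ, ∀ (i j : Fin (m + 1)) (x : W i) (y : W j), (j : ℕ) = i + k → φ i x = φ j y →
      Quot.mk (ChainGlue a b) ⟨i, x⟩ = Quot.mk (ChainGlue a b) ⟨j, y⟩ := by
    intro k
    induction k with
    | zero =>
      intro i j x y hij h
      obtain rfl : i = j := by ext; omega
      rw [(φ i).injective h]
    | succ k ih =>
      intro i j x y hij h
      have hne : i ≠ j := by rintro rfl; omega
      have htag : (φ i x).tag = none := by
        rw [Option.eq_none_iff_forall_ne_some]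
        intro t h'
        exact ht i j x y t hne h' (h ▸ h')
      have hX := Layout.eq_hub_of_inPiece (hu (by omega : (i : ℕ) + 1 ≤ j)) (hp i x) (h ▸ hp j y) htag
      have hx : x = b i := (φ i).injective (hX.trans (hb i).symm)
      have hj := j.isLt
      let i' : Fin (m + 1) := ⟨i + 1, by omega⟩
      rw [hx, step i i' rfl]
      exact ih i' j _ y (by simp only [i']; omega) ((ha i').trans (hX.symm.trans h))
  have inj' : ∀ x y, f x = f y → Quot.mk (ChainGlue a b) x = Quot.mk (ChainGlue a b) y := by
    rintro ⟨i, x⟩ ⟨j, y⟩ h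
    rcases le_total (i : ℕ) j with hij | hij
    · exact inj (j - i) i j x y (by omega) h
    · exact (inj (i - j) j i y x (by omega) h.symm).symm
  have hadj : ∀ k : ℕ, ∀ (i j : Fin (m + 1)) (x : W i) (y : W j), (j : ℕ) = i + k →
      (w.graph N).Adj (φ i x) (φ j y) →
      (identifyVertices (disjointUnion H) (ChainGlue a b)).Adj (Quot.mk _ ⟨i, x⟩) (Quot.mk _ ⟨j, y⟩) := by
    intro k
    induction k with
    | zero =>
      intro i j x y hij h
      obtain rfl : i = j := by ext; omega
      refine identifyVertices_adj (disjointUnion_adj_mk.2 ((φ i).map_adj_iff.1 h)) fun h' => h.ne ?_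
      exact congrArg (Quot.lift f hglue) h'
    | succ k ih =>
      intro i j x y hij h
      have hne : i ≠ j := by rintro rfl; omega
      have hj := j.isLt
      rcases Layout.eq_hub_of_adj_inPiece (hu (by omega : (i : ℕ) + 1 ≤ j)) (hfu _) (hp i x) (hp j y) (fun t => ht i j x y t hne) h with hX | hY
      · have hx : x = b i := (φ i).injective (hX.trans (hb i).symm)
        let i' : Fin (m + 1) := ⟨i + 1, by omega⟩
        rw [hx, step i i' rfl]
        exact ih i' j _ y (by simp only [i']; omega) ((ha i').trans hX.symm ▸ h)
      · have hy : y = a j := (φ j).injective (hY.trans (ha j).symm)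
        let j' : Fin (m + 1) := ⟨i + k, by omega⟩
        have hj' : (j : ℕ) = j' + 1 := by simp only [j']; omega
        rw [hy, ← step j' j hj']
        refine ih i j' x _ (by simp only [j']) ?_
        have : φ j' (b j') = φ j y := by rw [hb, hY, hj']
        rwa [this]
  refine identifyVertices_embedding f hglue inj' ?_ ?_ |>.imp fun Φ h i x => h ⟨i, x⟩
  · rintro ⟨i, x⟩ ⟨j, y⟩ h
    obtain ⟨i, x, y, h, h1, h2⟩ := disjointUnion_adj.1 h
    rw [h1, h2]
    exact (φ i).map_adj_iff.2 h
  · rintro ⟨i, x⟩ ⟨j, y⟩ h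
    rcases le_total (i : ℕ) j with hij | hij
    · exact hadj (j - i) i j x y (by omega) h
    · exact (hadj (i - j) j i y x (by omega) h.symm).symm

/-- `G` is laid out between two unfused cuts, `a` and `b` being the middle hubs of these cuts. -/
def HasPieceLabel {V : Type u} (G : SimpleGraph V) (a b : V) : Prop :=
  ∃ (n : ℕ) (w : Layout) (N : Type) (φ : G ↪g w.graph N), (∀ x, (φ x).InPiece 0 n) ∧
    φ a = .hub 0 .mid ∧ φ b = .hub n .mid ∧ w.fused 0 = false ∧ w.fused n = false

/-- A chain of pieces is embedded after their layouts are put side by side. The names are tagged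
with the index of the piece, so that vertices which are pendant at a common middle hub do not
collide. -/
theorem exists_embedding_of_pieces {m : ℕ} {W : Fin (m + 1) → Type} {H : ∀ i, SimpleGraph (W i)}
    {a b : ∀ i, W i} (h : ∀ i, HasPieceLabel (H i) (a i) (b i)) :
    ∃ (w : Layout) (N : Type), Nonempty (identifyVertices (disjointUnion H) (ChainGlue a b) ↪g
    w.graph N) := by
  classical
  choose n w N φ hp ha hb hf0 hfn using h
  let u : ℕ → ℤ := fun l => ∑ j ∈ Finset.range l, if h : j < m + 1 then (n ⟨j, h⟩ : ℤ) else 0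
  have hu : Monotone u := by
    refine monotone_nat_of_le_succ fun l => ?_
    simp only [u, Finset.sum_range_succ]
    split_ifs <;> omega
  have hu1 : ∀ i : Fin (m + 1), u (i + 1) = u i + n i := by
    intro i
    simp only [u, Finset.sum_range_succ]
    simp only [i.isLt, dite_true]
  have uniq : ∀ (i j : Fin (m + 1)) (c : ℤ), u i ≤ c → c < u (i + 1) → u j ≤ c → c < u (j + 1) → i = j := by
    intro i j c h1 h2 h3 h4
    rcases lt_trichotomy i j with h | h | h
    · have : u (i + 1) ≤ u j := hu h
      omega
    · exact h
    · have : u (j + 1) ≤ u i := hu h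
      omega
  let comb : ((i : Fin (m + 1)) → ℤ → Bool) → ℤ → Bool := fun g c =>
    decide (∃ i : Fin (m + 1), u i ≤ c ∧ c < u (i + 1) ∧ g i (c - u i) = true)
  have hcomb : ∀ g (i : Fin (m + 1)) (c : ℤ), 0 ≤ c → c < n i → comb g (c + u i) = g i c := by
    intro g i c h1 h2
    have := hu1 i
    rw [Bool.eq_iff_iff, decide_eq_true_iff]
    constructor
    · rintro ⟨j, h3, h4, h⟩
      obtain rfl := uniq i j _ (by omega) (by omega) h3 h4
      simpa using h
    · intro h
      exact ⟨i, by omega, by omega, by simpa using h⟩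
  let w' : Layout := ⟨comb fun i => (w i).hex, comb fun i => (w i).aMid, comb fun i => (w i).bMid,
    comb fun i => (w i).fused⟩
  have hfu : ∀ l, w'.fused (u l) = false := by
    intro l
    rw [← Bool.not_eq_true]
    intro h
    obtain ⟨j, h1, h2, h⟩ := decide_eq_true_iff.1 h
    have e : u l = u j := by
      by_contra hne
      have h3 : ¬ l ≤ j := fun h => by have := hu h; omega
      have h4 : u (j + 1) ≤ u l := hu (by omega)
      omega
    rw [e, sub_self] at h
    exact absurd ((hf0 j).symm.trans h) (by simp)
  have hfu' : ∀ i (c : ℤ), 0 ≤ c → c ≤ n i → w'.fused (c + u i) = (w i).fused c := by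
    intro i c h1 h2
    rcases h2.lt_or_eq with h2 | h2
    · exact hcomb (fun i => (w i).fused) i c h1 h2
    · rw [h2, hfn, add_comm, ← hu1, hfu]
  let ψ : ∀ i, H i ↪g w'.graph (Σ i, N i) := fun i =>
    ⟨⟨fun x => ((φ i x).shift (u i)).map (Sigma.mk i), fun x y h =>
      (φ i).injective (Lab.shift_injective _ (Lab.map_injective sigma_mk_injective h))⟩, by
      intro x y
      change (w'.graph _).Adj (Lab.map _ _) (Lab.map _ _) ↔ _
      rw [Layout.adj_map sigma_mk_injective, Layout.adj_shift (w := w i) (K := Set.Icc 0 (n i)) ?_ ?_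
        (hp i x).within (hp i y).within]
      · exact (φ i).map_adj_iff
      · intro c hc
        exact hfu' i c hc.1 hc.2
      · intro c hc hc'
        have := hc.1
        have := hc'.2
        exact ⟨hcomb (fun i => (w i).hex) i c hc.1 (by omega),
          hcomb (fun i => (w i).aMid) i c hc.1 (by omega),
          hcomb (fun i => (w i).bMid) i c hc.1 (by omega)⟩⟩
  have hψ : ∀ i x, ψ i x = ((φ i x).shift (u i)).map (Sigma.mk i) := fun i x => rfl
  suffices ∃ Φ : identifyVertices (disjointUnion H) (ChainGlue a b) ↪g w'.graph (Σ i, N i),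
      ∀ i x, Φ (Quot.mk _ ⟨i, x⟩) = ψ i x from ⟨w', _, ⟨this.choose⟩⟩
  refine exists_chain_embedding u hu hfu ψ ?_ ?_ ?_ ?_
  · intro i x
    have := ((hp i x).shift (u i)).map (Sigma.mk (β := N) i)
    rw [hψ, hu1, add_comm (u i)]
    simpa using this
  · intro i
    simp [hψ, ha, Lab.shift, Lab.map]
  · intro i
    simp [hψ, hb, Lab.shift, Lab.map, hu1, add_comm]
  · intro i j x y t hij h1 h2
    rw [hψ] at h1 h2
    have key : ∀ i (X : Lab (N i)), (X.map (Sigma.mk i)).tag = some t → t.2.2.1 = i := by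
      intro i X h
      cases X <;> simp [Lab.map, Lab.tag] at h <;> simp [← h]
    exact hij ((key i _ h1).symm.trans (key j _ h2))

/-! ### Rooted trees and lobsters -/

/-- A rooted tree is given by a parent function. -/
theorem SimpleGraph.IsTree.exists_parent {V : Type u} {G : SimpleGraph V} (hG : G.IsTree) (r : V) :
    ∃ par : V → V, (∀ x, x ≠ r → G.dist r x = G.dist r (par x) + 1) ∧
      ∀ x y, G.Adj x y ↔ (x ≠ r ∧ y = par x) ∨ (y ≠ r ∧ x = par y) := by
  choose p hp using fun x => (hG.connected.exists_path_of_dist r x)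
  have key : ∀ x y, G.Adj x y → G.dist r y = G.dist r x + 1 → x = (p y).penultimate := by
    intro x y h hd
    have h1 : ((p x).concat h).IsPath := Walk.isPath_of_length_eq_dist _ (by simp [(hp x).2, hd])
    have h2 := congrArg Subtype.val (hG.isAcyclic.path_unique ⟨_, h1⟩ ⟨p y, (hp y).1⟩)
    simp only at h2
    rw [← h2]
    simp
  have hnil : ∀ x, x ≠ r → ¬ (p x).Nil := fun x hx h => hx h.eq.symm
  have hadj : ∀ x, x ≠ r → G.Adj (p x).penultimate x := fun x hx => (p x).adj_penultimate (hnil x hx)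
  have hdist : ∀ x, x ≠ r → G.dist r x = G.dist r (p x).penultimate + 1 := by
    intro x hx
    have h1 := G.dist_le (p x).dropLast
    have h2 := (p x).length_dropLast_add_one (hnil x hx)
    have h3 := hG.dist_eq_dist_add_one_of_adj r (hadj x hx)
    have := (hp x).2
    omega
  refine ⟨fun x => (p x).penultimate, hdist, fun x y => ⟨fun h => ?_, ?_⟩⟩
  · rcases hG.dist_eq_dist_add_one_of_adj r h with h' | h'
    · exact .inl ⟨by rintro rfl; simp at h', key y x h.symm h'⟩
    · exact .inr ⟨by rintro rfl; simp at h', key x y h h'⟩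
  · rintro (⟨h, rfl⟩ | ⟨h, rfl⟩)
    · exact (hadj x h).symm
    · exact hadj y h

/-- The layout which consists of edge cells only. Its middle hubs form a path. -/
def Layout.straight : Layout := ⟨fun _ => false, fun _ => false, fun _ => false, fun _ => false⟩

/-- A tree in which every vertex is within distance 2 of a path embeds into the straight strip.
The vertices of the path become middle hubs, those at distance 1 from it become `pend`, and those
at distance 2 become `deep`. -/
theorem SimpleGraph.IsTree.exists_spine_embedding {V : Type u} {G : SimpleGraph V} (hG : G.IsTree)
    {a b : V}
    (p : G.Walk a b) (hp : p.IsPath) (hd : SecondNbhdDominates p) :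
    ∃ φ : G ↪g Layout.straight.graph V, (∀ i : ℕ, i ≤ p.length → φ (p.getVert i) = .hub i .mid) ∧
      (∀ x, (φ x).InPiece 0 p.length) ∧ (∀ x i s, φ x = .hub i s → s = .mid) ∧ ∀ x i s n, φ x =
    .pend i s n → s = .mid := by
  classical
  obtain ⟨par, hpd, hadj⟩ := hG.exists_parent a
  have hidx : ∀ x ∈ p.support, ∃ i : ℕ, i ≤ p.length ∧ p.getVert i = x := by
    intro x hx
    obtain ⟨i, h1, h2⟩ := Walk.mem_support_iff_exists_getVert.1 hx
    exact ⟨i, h2, h1⟩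
  have hinj : ∀ i j, i ≤ p.length → j ≤ p.length → p.getVert i = p.getVert j → i = j :=
    fun i j hi hj h => hp.getVert_injOn hi hj h
  have h0 : p.getVert 0 = a := p.getVert_zero
  have hspine : ∀ i, i + 1 ≤ p.length → par (p.getVert (i + 1)) = p.getVert i := by
    intro i
    induction i with
    | zero =>
      intro hi
      have := p.adj_getVert_succ (i := 0) (by omega)
      rcases (hadj _ _).1 this with ⟨h, -⟩ | ⟨-, h⟩
      · exact absurd h0 h
      · exact h.symm
    | succ i ih =>
      intro hi
      have := p.adj_getVert_succ (i := i + 1) (by omega)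
      rcases (hadj _ _).1 this with ⟨-, h⟩ | ⟨-, h⟩
      · rw [ih (by omega)] at h
        have := hinj _ _ hi (by omega) h
        omega
      · exact h.symm
  have hdep : ∀ y z, y ∉ p.support → z ∈ p.support → G.Adj y z → z = par y := by
    intro y z hy hz h
    rcases (hadj _ _).1 h with ⟨-, h⟩ | ⟨h1, h⟩
    · exact h
    · obtain ⟨i, hi, rfl⟩ := hidx z hz
      rcases i with _ | i
      · exact absurd h0 h1
      · rw [hspine i hi] at h
        exact absurd (h ▸ p.getVert_mem_support i) hy
  have hcov : ∀ y, y ∉ p.support → par y ∉ p.support → par (par y) ∈ p.support := by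
    intro y hy hy'
    obtain ⟨z, hz, hzy⟩ := hd y
    obtain ⟨q, hq⟩ := hG.connected.exists_walk_length_eq_dist z y
    match q, hq with
    | .nil, _ => exact absurd hz hy
    | .cons h .nil, _ => exact absurd (hdep y z hy hz h.symm ▸ hz) hy'
    | .cons (v := t) h (.cons h' .nil), _ =>
      by_cases ht : t ∈ p.support
      · exact absurd (hdep y t hy ht h'.symm ▸ ht) hy'
      · have h1 := hdep t z ht hz h.symm
        rcases (hadj _ _).1 h' with ⟨-, h2⟩ | ⟨-, h2⟩
        · rw [h2, ← h1] at hy; exact absurd hz hy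
        · rwa [← h2, ← h1]
    | .cons h (.cons h' (.cons h'' q)), hq => simp at hq; omega
  choose! idx hidx1 hidx2 using hidx
  let f : V → Lab V := fun y => if y ∈ p.support then .hub (idx y) .mid else
    if par y ∈ p.support then .pend (idx (par y)) .mid y else .deep (idx (par (par y))) (par y) y
  have hinj' : ∀ x y, x ∈ p.support → y ∈ p.support → idx x = idx y → x = y := by
    intro x y hx hy h
    rw [← hidx2 x hx, ← hidx2 y hy, h]
  have hne : ∀ y, y ∉ p.support → y ≠ a := by rintro y hy rfl; exact hy p.start_mem_support
  have hpar : ∀ x y, x ∈ p.support → y ∈ p.support → (G.Adj x y ↔ idx y = idx x + 1 ∨ idx x = idx y + 1) := by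
    have aux : ∀ x y, x ∈ p.support → y ∈ p.support → (x ≠ a ∧ y = par x ↔ idx x = idx y + 1) := by
      intro x y hx hy
      constructor
      · rintro ⟨h, h'⟩
        have := hidx1 x hx
        rcases hi : idx x with _ | i
        · have := hidx2 x hx
          rw [hi, h0] at this
          exact absurd this.symm h
        · have e := hspine i (by omega)
          rw [← hi, hidx2 x hx, ← h', ← hidx2 y hy] at e
          rw [hinj _ _ (hidx1 y hy) (by omega) e]
      · intro h
        have h1 := hidx2 x hx
        have h2 := hidx1 x hx
        refine ⟨?_, ?_⟩
        · rintro rfl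
          have := hinj _ _ h2 (by omega) (h1.trans h0.symm)
          omega
        · rw [← h1, h, hspine _ (by omega), hidx2 y hy]
    intro x y hx hy
    rw [hadj, aux x y hx hy, aux y x hy hx, or_comm]
  have hoff : ∀ x y, x ∈ p.support → y ∉ p.support → (G.Adj x y ↔ x = par y) := fun x y hx hy =>
    ⟨fun h => hdep y x hy hx h.symm, fun h => (hadj x y).2 (.inr ⟨hne y hy, h⟩)⟩
  have hoff2 : ∀ x y, x ∉ p.support → y ∉ p.support → (G.Adj x y ↔ y = par x ∨ x = par y) := by
    intro x y hx hy
    simp [hadj, hne x hx, hne y hy]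
  have f1 : ∀ y, y ∈ p.support → f y = .hub (idx y) .mid := fun y hy => if_pos hy
  have f2 : ∀ y, y ∉ p.support → par y ∈ p.support → f y = .pend (idx (par y)) .mid y := by
    intro y h1 h2; simp only [f, h1, h2, if_true, if_false]
  have f3 : ∀ y, y ∉ p.support → par y ∉ p.support → f y = .deep (idx (par (par y))) (par y) y := by
    intro y h1 h2; simp only [f, h1, h2, if_false]
  have hcases : ∀ y, (y ∈ p.support ∧ f y = .hub (idx y) .mid) ∨
      (y ∉ p.support ∧ par y ∈ p.support ∧ f y = .pend (idx (par y)) .mid y) ∨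
      (y ∉ p.support ∧ par y ∉ p.support ∧ f y = .deep (idx (par (par y))) (par y) y) := by
    intro y
    by_cases h1 : y ∈ p.support
    · exact .inl ⟨h1, f1 y h1⟩
    · by_cases h2 : par y ∈ p.support
      · exact .inr (.inl ⟨h1, h2, f2 y h1 h2⟩)
      · exact .inr (.inr ⟨h1, h2, f3 y h1 h2⟩)
  have hf : Function.Injective f := by
    intro x y h
    rcases hcases x with ⟨x1, x2⟩ | ⟨x1, x2, x3⟩ | ⟨x1, x2, x3⟩ <;>
    rcases hcases y with ⟨y1, y2⟩ | ⟨y1, y2, y3⟩ | ⟨y1, y2, y3⟩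
    · rw [x2, y2] at h; exact hinj' x y x1 y1 (by exact_mod_cast (Lab.hub.inj h).1)
    · rw [x2, y3] at h; cases h
    · rw [x2, y3] at h; cases h
    · rw [x3, y2] at h; cases h
    · rw [x3, y3] at h; exact (Lab.pend.inj h).2.2
    · rw [x3, y3] at h; cases h
    · rw [x3, y2] at h; cases h
    · rw [x3, y3] at h; cases h
    · rw [x3, y3] at h; exact (Lab.deep.inj h).2.2
  refine ⟨⟨⟨f, hf⟩, ?_⟩, ?_, ?_, ?_, ?_⟩
  · intro x y
    change (Layout.straight.graph V).Adj (f x) (f y) ↔ _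
    rcases hcases x with ⟨x1, x2⟩ | ⟨x1, x2, x3⟩ | ⟨x1, x2, x3⟩ <;>
    rcases hcases y with ⟨y1, y2⟩ | ⟨y1, y2, y3⟩ | ⟨y1, y2, y3⟩
    · rw [hpar x y x1 y1, x2, y2]
      simp [Layout.adj_iff, Layout.Edge, Layout.straight]
      omega
    · rw [hoff x y x1 y1, x2, y3]
      simp [Layout.adj_iff, Layout.Edge, Layout.straight]
      exact ⟨hinj' _ _ x1 y2, fun h => h ▸ rfl⟩
    · rw [hoff x y x1 y1, x2, y3]
      simp [Layout.adj_iff, Layout.Edge, Layout.straight]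
      rintro rfl; exact y2 x1
    · rw [G.adj_comm, hoff y x y1 x1, x3, y2]
      simp [Layout.adj_iff, Layout.Edge, Layout.straight]
      exact ⟨hinj' _ _ y1 x2, fun h => h ▸ rfl⟩
    · rw [hoff2 x y x1 y1, x3, y3]
      simp [Layout.adj_iff, Layout.Edge, Layout.straight]
      grind
    · rw [hoff2 x y x1 y1, x3, y3]
      simp [Layout.adj_iff, Layout.Edge, Layout.straight]
      grind
    · rw [G.adj_comm, hoff y x y1 x1, x3, y2]
      simp [Layout.adj_iff, Layout.Edge, Layout.straight]
      rintro rfl; exact x2 y1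
    · rw [hoff2 x y x1 y1, x3, y3]
      simp [Layout.adj_iff, Layout.Edge, Layout.straight]
      grind
    · rw [hoff2 x y x1 y1, x3, y3]
      simp [Layout.adj_iff, Layout.Edge, Layout.straight]
      have := hcov x x1 x2
      have := hcov y y1 y2
      grind
  · intro i hi
    have h1 := p.getVert_mem_support i
    change f _ = _
    rw [f1 _ h1, hinj _ _ (hidx1 _ h1) hi (hidx2 _ h1)]
  · intro x
    change Lab.InPiece _ _ (f x)
    rcases hcases x with ⟨x1, x2⟩ | ⟨x1, x2, x3⟩ | ⟨x1, x2, x3⟩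
    · rw [x2]; simpa [Lab.InPiece] using hidx1 x x1
    · rw [x3]; simpa [Lab.InPiece] using hidx1 _ x2
    · rw [x3]; simpa [Lab.InPiece] using hidx1 _ (hcov x x1 x2)
  · intro x i s h
    change f x = _ at h
    rcases hcases x with ⟨x1, x2⟩ | ⟨x1, x2, x3⟩ | ⟨x1, x2, x3⟩
    · rw [x2] at h; cases h; try rfl
    · rw [x3] at h; cases h; try rfl
    · rw [x3] at h; cases h
  · intro x i s n h
    change f x = _ at h
    rcases hcases x with ⟨x1, x2⟩ | ⟨x1, x2, x3⟩ | ⟨x1, x2, x3⟩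
    · rw [x2] at h; cases h; try rfl
    · rw [x3] at h; cases h; try rfl
    · rw [x3] at h; cases h

theorem IsLobster.hasPieceLabel {V : Type} {G : SimpleGraph V} {a b : V} (h : IsLobster G a b) :
    HasPieceLabel G a b := by
  obtain ⟨-, hG, p, hp, hd, -⟩ := h
  obtain ⟨φ, h1, h2, -⟩ := hG.exists_spine_embedding p hp hd
  refine ⟨p.length, _, V, φ, h2, ?_, ?_, rfl, rfl⟩
  · simpa using h1 0 (by omega)
  · simpa using h1 p.length le_rfl

/-! ### Hexagonal strips with attached trees -/

namespace Layout

/-- The labels of a `C_{6,k+2}` in the cell `i`. The indices `0` and `1` stand for the vertices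
`a₁, b₁` and `a₂, b₂`, other indices are their own names. -/
def cellLab (w : Layout) (i : ℤ) {k : ℕ} : C6kVertex (k + 2) → Lab ℕ
  | .a => .hub i (w.aS i)
  | .b => .hub (i + 1) (w.bS i)
  | .aj j => if j = 0 then .hub i (w.a1S i) else if j = 1 then .A i none else .A i (some j)
  | .bj j => if j = 0 then .B i none else if j = 1 then .hub (i + 1) (w.b2S i) else .B i (some j)

theorem cellLab_injective (w : Layout) (i : ℤ) {k : ℕ} : Function.Injective (w.cellLab i (k := k)) := by
  have h1 := w.aS_a1S i
  have h2 := w.bS_b2S i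
  rintro (_ | _ | j | j) (_ | _ | l | l) <;> simp only [cellLab] <;> (try split_ifs) <;>
    simp_all [Fin.val_inj] <;> grind

theorem cellLab_adj {w : Layout} {i : ℤ} (hi : w.hex i = true) {k : ℕ} {x y : C6kVertex (k + 2)} :
    (w.graph ℕ).Adj (w.cellLab i x) (w.cellLab i y) ↔ (graphC6k (k + 2)).Adj x y := by
  have h1 := w.aS_a1S i
  have h2 := w.bS_b2S i
  have h3 : (0 : Fin (k + 2)) ≠ 1 := by simp
  have h4 : ∀ p q, C6kEdge (k + 2) p q ↔ (p = .a ∧ ∃ j, q = .aj j) ∨ (∃ j, p = .aj j ∧ q = .bj j) ∨ (q = .b ∧ ∃ j, p = .bj j) := by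
    intro p q
    constructor
    · rintro (_ | _ | _) <;> simp
    · rintro (⟨rfl, j, rfl⟩ | ⟨j, rfl, rfl⟩ | ⟨rfl, j, rfl⟩) <;> constructor
  simp only [graphC6k, SimpleGraph.fromRel_adj, h4]
  clear h4
  rcases x with (_ | _ | j | j) <;> rcases y with (_ | _ | l | l) <;> simp only [cellLab] <;> (try split_ifs) <;>
    (try subst_vars) <;> simp [adj_iff, Edge, hi, Fin.val_inj] <;> grind

theorem eq_of_cellLab_eq {w : Layout} {i j : ℤ} (hij : i < j) {k l : ℕ} {x : C6kVertex (k + 2)}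
    {y : C6kVertex (l + 2)} (h : w.cellLab i x = w.cellLab j y) : j = i + 1 ∧ (x = .b ∨ x = .bj 1)
    := by
  rcases x with (_ | _ | x | x) <;> rcases y with (_ | _ | y | y) <;> simp only [cellLab] at h <;>
    (try split_ifs at h) <;> simp at h <;> grind

/-- Edges between vertices of different cells have an end in the common edge of the cells. -/
theorem eq_of_cellLab_adj {w : Layout} {i j : ℤ} (hij : i < j) {k l : ℕ} {x : C6kVertex (k + 2)}
    {y : C6kVertex (l + 2)} (hi : w.hex (i + 1) = true) (hf : j = i + 1 → w.fused j = true)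
    (h : (w.graph ℕ).Adj (w.cellLab i x) (w.cellLab j y)) :
    j = i + 1 ∧ ((x = .b ∨ x = .bj 1) ∨ (y = .a ∨ y = .aj 0)) := by
  have h1 := w.aS_a1S i
  have h2 := w.bS_b2S i
  have h3 := w.aS_a1S j
  have h4 := w.bS_b2S j
  rcases x with (_ | _ | x | x) <;> rcases y with (_ | _ | y | y) <;> simp only [cellLab] at h <;>
    (try split_ifs at h) <;> simp [adj_iff, Edge] at h <;> grind

/-- A hexagonal strip embeds into a layout with fused cuts. The vertices `b` and `a` of
consecutive cells are at different ends of the common edge if `d i = 1`, and at the same end if `d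
i = -1`. -/
theorem exists_strip_embedding (w : Layout) {n : ℕ} (t : Fin (n + 1) → ℕ) (d : Fin n → ℤˣ) (p : ℤ)
    (hhex : ∀ i : Fin (n + 1), w.hex (p + i) = true)
    (hfus : ∀ i : Fin n, w.fused (p + i + 1) = true)
    (hd : ∀ i : Fin n, d i = 1 ↔ w.bMid (p + i) ≠ w.aMid (p + i + 1)) :
    ∃ Φ : hexStrip t d ↪g w.graph ℕ, ∀ i x, Φ (stripMk t d i x) = w.cellLab (p + i) x := by
  let f : StripPart t → Lab ℕ := fun q => w.cellLab (p + (q.1 : ℕ)) q.2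
  have hglue : ∀ x y, StripGlue t d x y → f x = f y := by
    have hm : (-1 : ℤˣ) ≠ 1 := by decide
    rintro _ _ (⟨i, h⟩ | ⟨i, h⟩ | ⟨i, h⟩ | ⟨i, h⟩) <;> have h1 := hd i <;> have h2 := hfus i <;>
      simp [f, cellLab, ← add_assoc, aS, a1S, bS, b2S] <;> rw [h] at h1 <;> grind
  have right : ∀ (i j : Fin (n + 1)) (x : C6kVertex (t i + 2)), (j : ℕ) = i + 1 → x = .b ∨ x = .bj 1 →
      ∃ y, Quot.mk (StripGlue t d) ⟨i, x⟩ = Quot.mk (StripGlue t d) ⟨j, y⟩ := by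
    intro i j x hij hx
    have hi : (i : ℕ) < n := by omega
    obtain ⟨i', rfl⟩ : ∃ i' : Fin n, i = i'.castSucc := ⟨⟨i, hi⟩, rfl⟩
    obtain rfl : j = i'.succ := by ext; simpa using hij
    rcases hx with rfl | rfl <;> rcases Int.units_eq_one_or (d i') with h | h
    · exact ⟨_, Quot.sound (.pos_b i' h)⟩
    · exact ⟨_, Quot.sound (.neg_b i' h)⟩
    · exact ⟨_, Quot.sound (.pos_b2 i' h)⟩
    · exact ⟨_, Quot.sound (.neg_b2 i' h)⟩
  have left : ∀ (i j : Fin (n + 1)) (y : C6kVertex (t j + 2)), (j : ℕ) = i + 1 → y = .a ∨ y = .aj 0 →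
      ∃ x, Quot.mk (StripGlue t d) ⟨i, x⟩ = Quot.mk (StripGlue t d) ⟨j, y⟩ := by
    intro i j x hij hx
    have hi : (i : ℕ) < n := by omega
    obtain ⟨i', rfl⟩ : ∃ i' : Fin n, i = i'.castSucc := ⟨⟨i, hi⟩, rfl⟩
    obtain rfl : j = i'.succ := by ext; simpa using hij
    rcases hx with rfl | rfl <;> rcases Int.units_eq_one_or (d i') with h | h
    · exact ⟨_, Quot.sound (.pos_b2 i' h)⟩
    · exact ⟨_, Quot.sound (.neg_b i' h)⟩
    · exact ⟨_, Quot.sound (.pos_b i' h)⟩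
    · exact ⟨_, Quot.sound (.neg_b2 i' h)⟩
  have hlift : ∀ {x y : StripPart t}, Quot.mk (StripGlue t d) x = Quot.mk (StripGlue t d) y → f x = f y :=
    fun h => congrArg (Quot.lift f hglue) h
  have inj : ∀ (i j : Fin (n + 1)) (x : C6kVertex (t i + 2)) (y : C6kVertex (t j + 2)), i ≤ j →
      f ⟨i, x⟩ = f ⟨j, y⟩ → Quot.mk (StripGlue t d) ⟨i, x⟩ = Quot.mk (StripGlue t d) ⟨j, y⟩ := by
    intro i j x y hij h
    rcases hij.eq_or_lt with rfl | hij
    · obtain rfl : x = y := w.cellLab_injective _ h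
      rfl
    · obtain ⟨h1, h2⟩ := eq_of_cellLab_eq (i := p + (i : ℕ)) (j := p + (j : ℕ)) (by have : (i : ℕ) < j := hij; omega) h
      obtain ⟨y', hy'⟩ := right i j x (by omega) h2
      rw [hy']
      rw [hlift hy'] at h
      obtain rfl : y' = y := w.cellLab_injective _ h
      rfl
  have hsame : ∀ (i : Fin (n + 1)) (x y : C6kVertex (t i + 2)), (w.graph ℕ).Adj (f ⟨i, x⟩) (f ⟨i, y⟩) →
      (hexStrip t d).Adj (Quot.mk _ ⟨i, x⟩) (Quot.mk _ ⟨i, y⟩) := by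
    intro i x y h
    exact identifyVertices_adj (disjointUnion_adj_mk.2 ((cellLab_adj (hhex i)).1 h)) fun h' => h.ne (hlift h')
  have adj : ∀ (i j : Fin (n + 1)) (x : C6kVertex (t i + 2)) (y : C6kVertex (t j + 2)), i ≤ j →
      (w.graph ℕ).Adj (f ⟨i, x⟩) (f ⟨j, y⟩) → (hexStrip t d).Adj (Quot.mk _ ⟨i, x⟩) (Quot.mk _ ⟨j, y⟩) := by
    intro i j x y hij h
    rcases hij.eq_or_lt with rfl | hij
    · exact hsame i x y h
    · obtain ⟨h1, h2⟩ := eq_of_cellLab_adj (i := p + (i : ℕ)) (j := p + (j : ℕ)) (by have : (i : ℕ) < j := hij; omega) (by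
          have hj := j.isLt
          have : (i : ℕ) < j := hij
          have := hhex ⟨i + 1, by omega⟩
          rwa [show (p + (i : ℕ) + 1 : ℤ) = p + ((i + 1 : ℕ) : ℤ) by push_cast; ring])
        (fun h => by
          have hj := j.isLt
          have := hfus ⟨i, by omega⟩
          rwa [show (p + (j : ℕ) : ℤ) = p + (i : ℕ) + 1 by omega]) h
      rcases h2 with h2 | h2
      · obtain ⟨y', hy'⟩ := right i j x (by omega) h2
        rw [hy']
        rw [hlift hy'] at h
        exact hsame j _ _ h
      · obtain ⟨x', hx'⟩ := left i j y (by omega) h2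
        rw [← hx']
        rw [← hlift hx'] at h
        exact hsame i _ _ h
  refine identifyVertices_embedding f hglue ?_ ?_ ?_ |>.imp fun Φ h i x => h ⟨i, x⟩
  · rintro ⟨i, x⟩ ⟨j, y⟩ h
    rcases le_total i j with hij | hij
    · exact inj i j x y hij h
    · exact (inj j i y x hij h.symm).symm
  · intro x y h
    obtain ⟨i, x, y, h', rfl, rfl⟩ := disjointUnion_adj.1 h
    exact (cellLab_adj (hhex i)).2 h'
  · rintro ⟨i, x⟩ ⟨j, y⟩ h
    rcases le_total i j with hij | hij
    · exact adj i j x y hij h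
    · exact (adj j i y x hij h.symm).symm

end Layout

theorem attachAt_adj {V : Type u} {S : SimpleGraph V} {W : V → Type v} {T : ∀ x, SimpleGraph (W x)}
    {root : ∀ x, W x} {p q : Σ x, W x} : (attachAt S T root).Adj p q ↔
      (S.Adj p.1 q.1 ∧ p.2 = root p.1 ∧ q.2 = root q.1) ∨ ∃ x y z, (T x).Adj y z ∧ p = ⟨x, y⟩ ∧ q =
    ⟨x, z⟩ := by
  rw [attachAt, SimpleGraph.sup_adj, disjointUnion_adj, SimpleGraph.map_adj']
  refine or_congr_left ⟨?_, ?_⟩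
  · rintro ⟨-, x, y, h, rfl, rfl⟩
    exact ⟨h, rfl, rfl⟩
  · obtain ⟨x, x'⟩ := p
    obtain ⟨y, y'⟩ := q
    rintro ⟨h, h1, h2⟩
    simp only at h h1 h2
    subst h1 h2
    exact ⟨fun h' => h.ne (congrArg Sigma.fst h'), x, y, h, rfl, rfl⟩

namespace Layout
/-- Trees of depth at most 2, or at most 1 where there is no room for more, may be attached to hubs. -/
theorem exists_attach_embedding {V : Type u} {S : SimpleGraph V} {W : V → Type v}
    {T : ∀ x, SimpleGraph (W x)}
    {root : ∀ x, W x} {w : Layout} {N : Type u} (Φ : S ↪g w.graph N) (hΦ : ∀ x, (Φ x).tag = none)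
    (hT : ∀ x, (T x).IsTree)
    (hd : ∀ x y, (T x).dist (root x) y ≤ 2)
    (h1 : ∀ x y, y ≠ root x → ∃ i s, Φ x = .hub i s ∧ (s = .hi → w.fused i = false))
    (h2 : ∀ x y, 1 < (T x).dist (root x) y → ∃ i, Φ x = .hub i .mid ∧ w.fused i = false) :
    ∃ Ψ : attachAt S T root ↪g w.graph (N ⊕ Σ x, W x), (∀ x, Ψ ⟨x, root x⟩ = (Φ x).map .inl) ∧
      ∀ x y p q, (Φ x).InPiece p q → (Ψ ⟨x, y⟩).InPiece p q := by
  classical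
  choose par hp1 hp2 using fun x => (hT x).exists_parent (root x)
  let f : (Σ x, W x) → Lab (N ⊕ Σ x, W x) := fun p =>
    if p.2 = root p.1 then (Φ p.1).map .inl else match Φ p.1 with
      | .hub i s => if par p.1 p.2 = root p.1 then .pend i s (.inr p) else .deep i (.inr ⟨p.1, par p.1 p.2⟩) (.inr p)
      | X => X.map .inl
  have hcases : ∀ x y, (y = root x ∧ f ⟨x, y⟩ = (Φ x).map .inl) ∨
      (y ≠ root x ∧ par x y = root x ∧ ∃ i s, Φ x = .hub i s ∧ (s = .hi → w.fused i = false) ∧ f ⟨x, y⟩ = .pend i s (.inr ⟨x, y⟩)) ∨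
      (y ≠ root x ∧ par x y ≠ root x ∧ par x (par x y) = root x ∧ ∃ i, Φ x = .hub i .mid ∧ w.fused i = false ∧
         f ⟨x, y⟩ = .deep i (.inr ⟨x, par x y⟩) (.inr ⟨x, y⟩)) := by
    intro x y
    by_cases hy : y = root x
    · exact .inl ⟨hy, if_pos hy⟩
    obtain ⟨i, s, e, hs⟩ := h1 x y hy
    by_cases hy' : par x y = root x
    · refine .inr (.inl ⟨hy, hy', i, s, e, hs, ?_⟩)
      simp only [f, hy, e, hy', if_true, if_false]
    · have d1 := hp1 x y hy
      have d2 := hp1 x _ hy'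
      have d3 := hd x y
      obtain ⟨i, e, hs⟩ := h2 x y (by omega)
      refine .inr (.inr ⟨hy, hy', ?_, i, e, hs, ?_⟩)
      · by_contra h
        have := hp1 x _ h
        omega
      · simp only [f, hy, e, hy', if_false]
  have hinlr : ∀ (X : Lab N) i s (n : Σ x, W x), X.map (Sum.inl : N → N ⊕ Σ x, W x) ≠ .pend i s (.inr n) ∧
      ∀ n', X.map (Sum.inl : N → N ⊕ Σ x, W x) ≠ .deep i n' (.inr n) := by
    rintro (_ | _ | _ | _ | _) i s n <;> simp [Lab.map]
  have hf : Function.Injective f := by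
    rintro ⟨x, y⟩ ⟨x', y'⟩ h
    rcases hcases x y with ⟨rfl, e⟩ | ⟨-, -, i, s, -, -, e⟩ | ⟨-, -, -, i, -, -, e⟩ <;>
    rcases hcases x' y' with ⟨rfl, e'⟩ | ⟨-, -, i', s', -, -, e'⟩ | ⟨-, -, -, i', -, -, e'⟩ <;> rw [e, e'] at h
    · obtain rfl := Φ.injective (Lab.map_injective Sum.inl_injective h)
      rfl
    · exact absurd h (hinlr _ _ _ _).1
    · exact absurd h ((hinlr _ _ .mid _).2 _)
    · exact absurd h.symm (hinlr _ _ _ _).1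
    · exact Sum.inr_injective (Lab.pend.inj h).2.2
    · cases h
    · exact absurd h.symm ((hinlr _ _ .mid _).2 _)
    · cases h
    · exact Sum.inr_injective (Lab.deep.inj h).2.2
  have hrp : ∀ (X : Lab N) i s (n : Σ x, W x), X.tag = none → ((w.graph (N ⊕ Σ x, W x)).Adj (X.map .inl) (.pend i s (.inr n)) ↔
      X = .hub i s ∧ (s = .hi → w.fused i = false)) := by
    rintro (_ | _ | _ | _ | _) i s n h <;> simp [Lab.tag] at h <;> simp [Lab.map, adj_iff, Edge]
    grind
  have hrd : ∀ (X : Lab N) i n (m : Σ x, W x), X.tag = none → ¬ (w.graph (N ⊕ Σ x, W x)).Adj (X.map .inl) (.deep i n (.inr m)) := by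
    rintro (_ | _ | _ | _ | _) i n m h <;> simp [Lab.tag] at h <;> simp [Lab.map, adj_iff, Edge]
  have hpp : ∀ i j s s' n m, ¬ (w.graph (N ⊕ Σ x, W x)).Adj (.pend i s n) (.pend j s' m) := by simp [adj_iff, Edge]
  have hdd : ∀ i j n n' m m', ¬ (w.graph (N ⊕ Σ x, W x)).Adj (.deep i n m) (.deep j n' m') := by simp [adj_iff, Edge]
  have hsame : ∀ x y y', (w.graph (N ⊕ Σ x, W x)).Adj (f ⟨x, y⟩) (f ⟨x, y'⟩) ↔ (T x).Adj y y' := by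
    intro x y y'
    rw [hp2]
    rcases hcases x y with ⟨rfl, e⟩ | ⟨h3, h4, i, s, h5, h6, e⟩ | ⟨h3, h4, h5, i, h6, h7, e⟩ <;>
    rcases hcases x y' with ⟨rfl, e'⟩ | ⟨h3', h4', i', s', h5', h6', e'⟩ | ⟨h3', h4', h5', i', h6', h7', e'⟩ <;> simp only [e, e']
    · simp
    · rw [hrp _ _ _ _ (hΦ x)]; simp_all
    · simp [hrd _ _ _ _ (hΦ x)]; grind
    · rw [SimpleGraph.adj_comm, hrp _ _ _ _ (hΦ x)]; simp_all
    · simp [hpp]; grind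
    · simp [adj_iff, Edge]; grind
    · rw [SimpleGraph.adj_comm]; simp [hrd _ _ _ _ (hΦ x)]; grind
    · simp [adj_iff, Edge]; grind
    · simp [hdd]; grind
  refine ⟨⟨⟨f, hf⟩, ?_⟩, fun x => if_pos rfl, ?_⟩
  · rintro ⟨x, y⟩ ⟨x', y'⟩
    change (w.graph _).Adj (f _) (f _) ↔ _
    by_cases hx : x = x'
    · subst hx
      rw [hsame, attachAt_adj]
      constructor
      · intro h
        exact .inr ⟨x, y, y', h, rfl, rfl⟩
      · rintro (⟨h, -⟩ | ⟨z, z1, z2, h, h3, h4⟩)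
        · exact absurd h (by simp)
        · cases h3
          cases h4
          exact h
    · rw [attachAt_adj]
      have hno : ¬ ∃ z z1 z2, (T z).Adj z1 z2 ∧ (⟨x, y⟩ : Σ x, W x) = ⟨z, z1⟩ ∧ (⟨x', y'⟩ : Σ x, W x) = ⟨z, z2⟩ := by
        rintro ⟨z, z1, z2, -, h3, h4⟩
        exact hx ((congrArg Sigma.fst h3).trans (congrArg Sigma.fst h4).symm)
      rw [or_iff_left hno]
      have hΦx := hΦ x
      have hΦx' := hΦ x'
      have hne : Φ x ≠ Φ x' := fun h => hx (Φ.injective h)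
      rcases hcases x y with ⟨rfl, e⟩ | ⟨h3, h4, i, s, h5, h6, e⟩ | ⟨h3, h4, h5, i, h6, h7, e⟩ <;>
      rcases hcases x' y' with ⟨rfl, e'⟩ | ⟨h3', h4', i', s', h5', h6', e'⟩ | ⟨h3', h4', h5', i', h6', h7', e'⟩ <;> simp only [e, e']
      · rw [adj_map Sum.inl_injective]
        simp
      · rw [hrp _ _ _ _ hΦx]; simp [h3']; rintro h; exact absurd (h.trans h5'.symm) hne
      · simp [hrd _ _ _ _ hΦx, h3']
      · rw [SimpleGraph.adj_comm, hrp _ _ _ _ hΦx']; simp [h3]; rintro h; exact absurd (h5.trans h.symm) hne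
      · simp [hpp, h3]
      · simp [adj_iff, Edge, h3]; rintro - - h; exact absurd h hx
      · rw [SimpleGraph.adj_comm]; simp [hrd _ _ _ _ hΦx', h3]
      · simp [adj_iff, Edge, h3]; rintro - - h; exact absurd h.symm hx
      · simp [hdd, h3]
  · intro x y p q h
    change (f _).InPiece _ _
    rcases hcases x y with ⟨rfl, e⟩ | ⟨h3, h4, i, s, h5, h6, e⟩ | ⟨h3, h4, h5, i, h6, h7, e⟩ <;> rw [e]
    · exact h.map _
    · rw [h5] at h; exact h
    · rw [h6] at h; exact ⟨h.1, h.2.1⟩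
end Layout

/-! ### Generalized hexagonal caterpillars are in the class -/

namespace Layout
theorem cellLab_tag (w : Layout) (i : ℤ) {k : ℕ} (x : C6kVertex (k + 2)) : (w.cellLab i x).tag =
    none := by
  rcases x with (_ | _ | j | j) <;> simp only [cellLab] <;> (try split_ifs) <;> rfl

theorem cellLab_inPiece {w : Layout} {p q i : ℤ} (hp : p ≤ i) (hq : i < q) (hf : w.fused p = false)
    {k : ℕ}
    (x : C6kVertex (k + 2)) : (w.cellLab i x).InPiece p q := by
  have h1 := w.aS_a1S i
  have h2 := w.bS_b2S i
  rcases x with (_ | _ | j | j) <;> simp only [cellLab] <;> (try split_ifs) <;> simp only [Lab.InPiece] <;> grind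

/-- A vertex of a hexagonal strip that is one of `a^i, b^i, a^i_1, b^i_2` is labelled by a hub. -/
theorem cellLab_eq_hub {w : Layout} {i : ℤ} {k : ℕ} {x : C6kVertex (k + 2)}
    (hx : x = .a ∨ x = .b ∨ x = .aj 0 ∨ x = .bj 1) : ∃ j s, w.cellLab i x = .hub j s ∧
    (s = .hi → w.fused j = false) := by
  have h1 := w.aS_a1S i
  have h2 := w.bS_b2S i
  rcases hx with rfl | rfl | rfl | rfl
  · exact ⟨_, _, rfl, by grind⟩
  · exact ⟨_, _, rfl, by grind⟩
  · exact ⟨i, w.a1S i, by simp [cellLab], by grind⟩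
  · exact ⟨i + 1, w.b2S i, by simp [cellLab], by grind⟩
end Layout

/-- A hexagonal caterpillar is a piece: its strip fills the cells between the cuts `0` and `n +
1`, and only these two cuts are unfused, so that there is room for trees of depth 2 exactly at the
gluing vertices. -/
theorem IsHexCaterpillar.hasPieceLabel {V : Type} {G : SimpleGraph V} {a b : V}
    (h : IsHexCaterpillar G a b) : HasPieceLabel G a b := by
  classical
  obtain ⟨n, t, d, α, β, W, T, root, hα, hβ, -, hT, hd2, hd1, hd0, e, ea, eb⟩ := h
  let w : Layout :=
    { hex := fun _ => true
      -- at the two ends of the strip the gluing vertex is a middle hub; inside the strip `a`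
      -- always is one, and `b` is one if the sign there is `-1`
      aMid := fun c => if c = 0 then decide (α = stripMk t d 0 .a) else true
      bMid := fun c => if c = n then decide (β = stripMk t d (Fin.last n) .b) else decide (∃ i : Fin n, (i : ℤ) = c ∧ d i = -1)
      fused := fun c => decide (1 ≤ c ∧ c ≤ n) }
  have hf0 : w.fused 0 = false := by simp [w]
  have hfn : w.fused (n + 1) = false := by simp [w]
  obtain ⟨Φ, hΦ⟩ := w.exists_strip_embedding t d 0 (fun i => rfl) (fun i => by simp [w]) (by
    intro i
    have e1 : ¬ (i : ℤ) + 1 = 0 := by omega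
    have e2 : ¬ (i : ℤ) = n := by omega
    have e3 : (∃ j : Fin n, (j : ℤ) = (i : ℤ) ∧ d j = -1) ↔ d i = -1 := by
      constructor
      · rintro ⟨j, h, h'⟩
        obtain rfl : j = i := by ext; omega
        exact h'
      · intro h; exact ⟨i, rfl, h⟩
    simp only [w, zero_add, e1, e2, if_false, e3]
    rcases Int.units_eq_one_or (d i) with h | h <;> simp [h])
  simp only [zero_add] at hΦ
  have hΦα : Φ α = .hub 0 .mid := by
    by_cases h : α = stripMk t d 0 .a
    · have : w.aS 0 = .mid := by simp [Layout.aS, w, h]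
      rw [h, hΦ]
      simp [Layout.cellLab, this]
    · have : w.a1S 0 = .mid := by simp [Layout.a1S, w, h]
      rw [hα.resolve_left h, hΦ]
      simp [Layout.cellLab, this]
  have hΦβ : Φ β = .hub (n + 1) .mid := by
    by_cases h : β = stripMk t d (Fin.last n) .b
    · have : w.bS n = .mid := by simp [Layout.bS, w, h]
      rw [h, hΦ]
      simp [Layout.cellLab, this]
    · have : w.b2S n = .mid := by simp [Layout.b2S, w, h]
      rw [hβ.resolve_left h, hΦ]
      simp [Layout.cellLab, this]
  have hmk : ∀ x, ∃ i y, x = stripMk t d i y := by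
    rintro ⟨i, y⟩
    exact ⟨i, y, rfl⟩
  obtain ⟨Ψ, h3, h4⟩ := Layout.exists_attach_embedding Φ (T := T) (root := root) (by
      intro x
      obtain ⟨i, y, rfl⟩ := hmk x
      rw [hΦ, w.cellLab_tag]) hT hd2 (by
      intro x y hy
      have : IsPort t d x := by
        by_contra h
        exact hy (hd0 x h y)
      obtain ⟨i, h⟩ := this
      rcases h with rfl | rfl | rfl | rfl <;> rw [hΦ] <;> exact Layout.cellLab_eq_hub (by simp)) (by
      intro x y hy
      by_cases h1 : x = α
      · exact ⟨0, h1 ▸ hΦα, hf0⟩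
      by_cases h2 : x = β
      · exact ⟨n + 1, h2 ▸ hΦβ, hfn⟩
      exact absurd (hd1 x h1 h2 y) (by omega))
  refine ⟨n + 1, w, _, e.toEmbedding.trans Ψ, ?_, ?_, ?_, hf0, by push_cast; exact hfn⟩
  · intro x
    refine h4 (e x).1 (e x).2 _ _ ?_
    obtain ⟨i, y, h⟩ := hmk (e x).1
    rw [h, hΦ]
    refine Layout.cellLab_inPiece ?_ ?_ hf0 y
    · omega
    · have := i.isLt; omega
  · change Ψ (e a) = _
    rw [ea, h3, hΦα]
    rfl
  · change Ψ (e b) = _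
    rw [eb, h3, hΦβ]
    simp [Lab.map]

theorem finite_of_isHexCaterpillar {V : Type} {G : SimpleGraph V} {a b : V}
    (h : IsHexCaterpillar G a b) : Finite V := by
  obtain ⟨n, t, d, α, β, W, T, root, -, -, hW, -, -, -, -, e, -⟩ := h
  have hC : ∀ k, Finite (C6kVertex k) := fun k => by
    refine Finite.of_surjective (α := Unit ⊕ Unit ⊕ Fin k ⊕ Fin k)
      (fun | .inl _ => .a | .inr (.inl _) => .b | .inr (.inr (.inl j)) => .aj j | .inr (.inr (.inr j)) => .bj j) ?_
    rintro (_ | _ | j | j)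
    · exact ⟨.inl (), rfl⟩
    · exact ⟨.inr (.inl ()), rfl⟩
    · exact ⟨.inr (.inr (.inl j)), rfl⟩
    · exact ⟨.inr (.inr (.inr j)), rfl⟩
  exact Finite.of_equiv _ e.symm.toEquiv

/-- Generalized hexagonal caterpillars belong to the class. -/
theorem IsGenHexCaterpillar.inClassX {V : Type u} {G : SimpleGraph V} (h : IsGenHexCaterpillar G) :
    InClassX G := by
  obtain ⟨m, W, H, a, b, h, ⟨e⟩⟩ := h
  have hW : ∀ i, Finite (W i) := fun i => (h i).elim finite_of_isHexCaterpillar (fun h => h.1)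
  obtain ⟨w, N, ⟨φ⟩⟩ := exists_embedding_of_pieces fun i => (h i).elim IsHexCaterpillar.hasPieceLabel IsLobster.hasPieceLabel
  have : Finite V := Finite.of_equiv _ e.symm.toEquiv
  exact inClassX_of_embeds (e.toEmbedding.trans φ)

/-! ### Forbidden subgraphs -/

theorem isIndContained_of_fin {V : Type u} {G : SimpleGraph V} {n : ℕ} {F : SimpleGraph (Fin n)}
    (f : Fin n → V)
    (h : ∀ i j, i < j → f i ≠ f j ∧ (G.Adj (f i) (f j) ↔ F.Adj i j)) : F ⊴ G := by
  refine ⟨⟨⟨f, fun i j hij => ?_⟩, fun {i j} => ?_⟩⟩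
  · rcases lt_trichotomy i j with h' | h' | h'
    · exact absurd hij (h i j h').1
    · exact h'
    · exact absurd hij.symm (h j i h').1
  · change G.Adj (f i) (f j) ↔ _
    rcases lt_trichotomy i j with h' | rfl | h'
    · exact (h i j h').2
    · simp
    · rw [G.adj_comm, F.adj_comm]; exact (h j i h').2

theorem cycleGraph_adj_val {n : ℕ} {i j : Fin n} (h : i < j) :
    (SimpleGraph.cycleGraph n).Adj i j ↔ (j : ℕ) = i + 1 ∨ ((i : ℕ) = 0 ∧ (j : ℕ) + 1 = n) := by
  rw [SimpleGraph.cycleGraph_adj']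
  have hi := i.isLt
  have hj := j.isLt
  have h' : (i : ℕ) < j := h
  rw [Fin.sub_def, Fin.sub_def]
  simp only
  have e1 : (n - (j : ℕ) + i) % n = n - j + i := Nat.mod_eq_of_lt (by omega)
  have e2 : (n - (i : ℕ) + j) % n = j - i := by
    rw [show n - (i : ℕ) + j = n + (j - i) by omega, Nat.add_mod_left, Nat.mod_eq_of_lt (by omega)]
  rw [e1, e2]
  omega

namespace InClassX
variable {V : Type u} {G : SimpleGraph V}

/-- Induced cycles, given as sequences of vertices, have length 6. -/
theorem eq_six (hX : InClassX G) {n : ℕ} (hn : 3 ≤ n) (c : ℕ → V)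
    (hc : ∀ i j, i < j → j < n → c i ≠ c j ∧
    (G.Adj (c i) (c j) ↔ j = i + 1 ∨ (i = 0 ∧ j + 1 = n))) : n = 6 := by
  by_contra h
  refine hX.free_cycle n hn h (isIndContained_of_fin (fun i => c i) fun i j hij => ?_)
  rw [cycleGraph_adj_val hij]
  exact hc i j hij j.isLt

theorem no3 (hX : InClassX G) {x y z : V} (h1 : G.Adj x y) (h2 : G.Adj y z) : ¬ G.Adj x z := by
  intro h3
  refine hX.free_cycle 3 le_rfl (by norm_num) (isIndContained_of_fin ![x, y, z] fun i j hij => ?_)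
  rw [cycleGraph_adj_val hij]
  fin_cases i <;> fin_cases j <;> simp at hij ⊢ <;> first | exact ⟨h1.ne, h1⟩ | exact ⟨h2.ne, h2⟩ | exact ⟨h3.ne, h3⟩

theorem no4 (hX : InClassX G) {x y z t : V} (h1 : G.Adj x y) (h2 : G.Adj y z) (h3 : G.Adj z t)
    (h4 : G.Adj x t) :
    x = z ∨ y = t := by
  by_contra! h
  refine hX.free_cycle 4 (by norm_num) (by norm_num) (isIndContained_of_fin ![x, y, z, t] fun i j hij => ?_)
  rw [cycleGraph_adj_val hij]
  have h5 := hX.no3 h1 h2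
  have h6 := hX.no3 h2 h3
  fin_cases i <;> fin_cases j <;> simp at hij ⊢ <;> grind [SimpleGraph.Adj.ne]

theorem no5 (hX : InClassX G) {x y z t u : V} (h1 : G.Adj x y) (h2 : G.Adj y z) (h3 : G.Adj z t)
    (h4 : G.Adj t u) :
    ¬ G.Adj x u := by
  intro h5
  refine hX.free_cycle 5 (by norm_num) (by norm_num) (isIndContained_of_fin ![x, y, z, t, u] fun i j hij => ?_)
  rw [cycleGraph_adj_val hij]
  have a1 := hX.no3 h1 h2
  have a2 := hX.no3 h2 h3
  have a3 := hX.no3 h3 h4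
  have a4 := hX.no3 h4 h5.symm
  have a5 := hX.no3 h5.symm h1
  fin_cases i <;> fin_cases j <;> simp at hij ⊢ <;> grind [SimpleGraph.Adj.ne, SimpleGraph.Adj.symm]

/-- Freeness from `S_{3,3,3}`; the legs need not be known to be paths, since there are no
triangles. -/
theorem not_three_legs (hX : InClassX G) {c x₁ y₁ z₁ x₂ y₂ z₂ x₃ y₃ z₃ : V}
    (h1 : IsLeg G c x₁ y₁ z₁) (h2 : IsLeg G c x₂ y₂ z₂) (h3 : IsLeg G c x₃ y₃ z₃)
    (h12 : Apart G [x₁, y₁, z₁] [x₂, y₂, z₂]) (h13 : Apart G [x₁, y₁, z₁] [x₃, y₃, z₃])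
    (h23 : Apart G [x₂, y₂, z₂] [x₃, y₃, z₃]) : False := by
  have key : ∀ {x y z}, IsLeg G c x y z → c ≠ x ∧ c ≠ y ∧ c ≠ z ∧ x ≠ y ∧ x ≠ z ∧ y ≠ z ∧ ¬ G.Adj c y ∧ ¬ G.Adj c z ∧ ¬ G.Adj x z := by
    rintro x y z ⟨a, b, d, e, f⟩
    have := hX.no3 a b
    have := hX.no3 b d
    have h4 := fun h => hX.no4 a b d h
    refine ⟨a.ne, e, ?_, b.ne, f, d.ne, ‹_›, ?_, ‹_›⟩
    · rintro rfl; exact absurd a.symm (hX.no3 b d)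
    · intro h; rcases h4 h with h | h <;> contradiction
  have k1 := key h1
  have k2 := key h2
  have k3 := key h3
  simp only [Apart, List.mem_cons, List.not_mem_nil, or_false, forall_eq_or_imp, forall_eq] at h12 h13 h23
  obtain ⟨l1, m1, n1, -, -⟩ := h1
  obtain ⟨l2, m2, n2, -, -⟩ := h2
  obtain ⟨l3, m3, n3, -, -⟩ := h3
  obtain ⟨k11, k12, k13, k14, k15, k16, k17, k18, k19⟩ := k1
  obtain ⟨k21, k22, k23, k24, k25, k26, k27, k28, k29⟩ := k2
  obtain ⟨k31, k32, k33, k34, k35, k36, k37, k38, k39⟩ := k3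
  obtain ⟨⟨⟨a1, a2⟩, ⟨a3, a4⟩, a5, a6⟩, ⟨⟨a7, a8⟩, ⟨a9, a10⟩, a11, a12⟩, ⟨a13, a14⟩, ⟨a15, a16⟩, a17, a18⟩ := h12
  obtain ⟨⟨⟨b1, b2⟩, ⟨b3, b4⟩, b5, b6⟩, ⟨⟨b7, b8⟩, ⟨b9, b10⟩, b11, b12⟩, ⟨b13, b14⟩, ⟨b15, b16⟩, b17, b18⟩ := h13
  obtain ⟨⟨⟨c1, c2⟩, ⟨c3, c4⟩, c5, c6⟩, ⟨⟨c7, c8⟩, ⟨c9, c10⟩, c11, c12⟩, ⟨c13, c14⟩, ⟨c15, c16⟩, c17, c18⟩ := h23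
  clear key
  refine hX.free_S333 (isIndContained_of_fin ![c, x₁, y₁, z₁, x₂, y₂, z₂, x₃, y₃, z₃] fun i j hij => ?_)
  fin_cases i <;> fin_cases j <;> first
    | exact absurd hij (by decide)
    | exact ⟨by assumption, iff_of_true (by assumption) (by decide)⟩
    | exact ⟨by assumption, iff_of_false (by assumption) (by decide)⟩
end InClassX

/-! ### Hexagons in graphs of the class -/

/-- A closed walk of length 6 without backtracking; in the graphs of the class it is an induced 6-cycle. -/
structure IsHex {V : Type u} (G : SimpleGraph V) (a b c d e f : V) : Prop where
  ab : G.Adj a b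
  bc : G.Adj b c
  cd : G.Adj c d
  de : G.Adj d e
  ef : G.Adj e f
  fa : G.Adj f a
  ac : a ≠ c
  bd : b ≠ d
  ce : c ≠ e
  df : d ≠ f
  ea : e ≠ a
  fb : f ≠ b

/-- All neighbours of `x` are among `p` and `q`. -/
def OnlyNbrs {V : Type u} (G : SimpleGraph V) (x p q : V) : Prop := ∀ z, G.Adj x z → z = p ∨ z = q

section
variable {V : Type u} {G : SimpleGraph V} {a b c d e f x y z x' y' : V}

/-- Distinct and not adjacent. -/
def Far (G : SimpleGraph V) (x y : V) : Prop := x ≠ y ∧ ¬ G.Adj x y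

theorem Far.symm (h : Far G x y) : Far G y x := ⟨h.1.symm, fun h' => h.2 h'.symm⟩

theorem isIndContained_of_far {n : ℕ} {F : SimpleGraph (Fin n)} (f : Fin n → V)
    (h : ∀ i j, i < j → (G.Adj (f i) (f j) ∧ F.Adj i j) ∨ (Far G (f i) (f j) ∧ ¬ F.Adj i j)) : F ⊴
    G := by
  refine isIndContained_of_fin f fun i j hij => ?_
  rcases h i j hij with ⟨h1, h2⟩ | ⟨h1, h2⟩
  · exact ⟨h1.ne, iff_of_true h1 h2⟩
  · exact ⟨h1.1, iff_of_false h1.2 h2⟩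

theorem IsHex.rot (h : IsHex G a b c d e f) : IsHex G b c d e f a :=
  ⟨h.bc, h.cd, h.de, h.ef, h.fa, h.ab, h.bd, h.ce, h.df, h.ea, h.fb, h.ac⟩

theorem IsHex.reflect (h : IsHex G a b c d e f) : IsHex G b a f e d c :=
  ⟨h.ab.symm, h.fa.symm, h.ef.symm, h.de.symm, h.cd.symm, h.bc.symm, h.fb.symm, h.ea.symm, h.df.symm, h.ce.symm, h.bd.symm, h.ac.symm⟩

theorem IsHex.far (hX : InClassX G) (h : IsHex G a b c d e f) : Far G a c ∧ Far G a d ∧ Far G a e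
    := by
  refine ⟨⟨h.ac, hX.no3 h.ab h.bc⟩, ⟨?_, ?_⟩, h.ea.symm, fun h' => hX.no3 h.ef h.fa h'.symm⟩
  · rintro rfl; exact hX.no3 h.ab h.bc h.cd.symm
  · intro h'; rcases hX.no4 h.ab h.bc h.cd h' with h' | h'
    · exact h.ac h'
    · exact h.bd h'

/-- In the absence of shorter cycles, a vertex attached to a hexagon is adjacent to one vertex of
it only. -/
theorem IsHex.outer (hX : InClassX G) (h : IsHex G a b c d e f) (hx : G.Adj a x) (hb : x ≠ b)
    (hf : x ≠ f) :
    Apart G [x] [b, c, d, e, f] := by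
  have n1 := h.far hX
  simp only [Apart, List.mem_cons, List.not_mem_nil, or_false, forall_eq_or_imp, forall_eq]
  refine ⟨⟨hb, hX.no3 hx.symm h.ab⟩, ⟨?_, ?_⟩, ⟨?_, ?_⟩, ⟨?_, ?_⟩, ⟨hf, hX.no3 hx.symm h.fa.symm⟩⟩
  · rintro rfl; exact n1.1.2 hx
  · intro h'; rcases hX.no4 h.ab h.bc h'.symm hx with h' | h'
    · exact h.ac h'
    · exact hb h'.symm
  · rintro rfl; exact n1.2.1.2 hx
  · intro h'; exact hX.no5 h.ab h.bc h.cd h'.symm hx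
  · rintro rfl; exact n1.2.2.2 hx
  · intro h'; rcases hX.no4 h.fa.symm h.ef.symm h'.symm hx with h' | h'
    · exact h.ea h'.symm
    · exact hf h'.symm

namespace InClassX
theorem not_3c (hX : InClassX G) (h : IsHex G a b c d e f) (hx : G.Adj a x) (hxb : x ≠ b)
    (hxf : x ≠ f)
    (hy : G.Adj b y) (hya : y ≠ a) (hyc : y ≠ c) (hz : G.Adj c z) (hzb : z ≠ b) (hzd : z ≠ d) :
    False := by
  have h1 := h.outer hX hx hxb hxf
  have h2 := h.rot.outer hX hy hyc hya
  have h3 := h.rot.rot.outer hX hz hzd hzb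
  obtain ⟨n11, n12, n13⟩ := h.far hX
  obtain ⟨n21, n22, n23⟩ := h.rot.far hX
  obtain ⟨n31, n32, n33⟩ := h.rot.rot.far hX
  obtain ⟨n41, n42, n43⟩ := h.rot.rot.rot.far hX
  obtain ⟨n51, n52, n53⟩ := h.rot.rot.rot.rot.far hX
  obtain ⟨e1, e2, e3, e4, e5, e6, e7, e8, e9, e10, e11, e12⟩ := h
  have k1 : Far G x y := ⟨by rintro rfl; exact hX.no3 e1 hy hx, fun h => by
    rcases hX.no4 e1 hy h.symm hx with h | h
    · exact hya h.symm
    · exact hxb h.symm⟩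
  have k2 : Far G y z := ⟨by rintro rfl; exact hX.no3 e2 hz hy, fun h => by
    rcases hX.no4 e2 hz h.symm hy with h | h
    · exact hzb h.symm
    · exact hyc h.symm⟩
  have k3 : Far G x z := ⟨by
    rintro rfl; rcases hX.no4 e1 e2 hz hx with h | h
    · exact e7 h
    · exact hxb h.symm, fun h => hX.no5 e1 e2 hz h.symm hx⟩
  have h1 := fun q hq => (h1 x (by simp) q hq : Far G x q)
  have h2 := fun q hq => (h2 y (by simp) q hq : Far G y q)
  have h3 := fun q hq => (h3 z (by simp) q hq : Far G z q)
  simp only [List.mem_cons, List.not_mem_nil, or_false, forall_eq_or_imp, forall_eq] at h1 h2 h3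
  obtain ⟨p1, p2, p3, p4, p5⟩ := h1
  obtain ⟨q1, q2, q3, q4, q5⟩ := h2
  obtain ⟨r1, r2, r3, r4, r5⟩ := h3
  refine hX.free_C6plus3c (isIndContained_of_far ![a, b, c, d, e, f, x, y, z] fun i j hij => ?_)
  fin_cases i <;> fin_cases j <;> first
    | exact absurd hij (by decide)
    | refine .inl ⟨?_, by decide⟩; first | assumption | exact SimpleGraph.Adj.symm (by assumption)
    | refine .inr ⟨?_, by decide⟩; first | assumption | exact Far.symm (by assumption)

theorem not_3nc (hX : InClassX G) (h : IsHex G a b c d e f) (hx : G.Adj a x) (hxb : x ≠ b)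
    (hxf : x ≠ f)
    (hy : G.Adj c y) (hyb : y ≠ b) (hyd : y ≠ d) (hz : G.Adj e z) (hzd : z ≠ d) (hzf : z ≠ f) :
    False := by
  have h1 := h.outer hX hx hxb hxf
  have h2 := h.rot.rot.outer hX hy hyd hyb
  have h3 := h.rot.rot.rot.rot.outer hX hz hzf hzd
  obtain ⟨n11, n12, n13⟩ := h.far hX
  obtain ⟨n21, n22, n23⟩ := h.rot.far hX
  obtain ⟨n31, n32, n33⟩ := h.rot.rot.far hX
  obtain ⟨n41, n42, n43⟩ := h.rot.rot.rot.far hX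
  obtain ⟨n51, n52, n53⟩ := h.rot.rot.rot.rot.far hX
  obtain ⟨e1, e2, e3, e4, e5, e6, e7, e8, e9, e10, e11, e12⟩ := h
  have k1 : Far G x y := ⟨by
    rintro rfl; rcases hX.no4 e1 e2 hy hx with h | h
    · exact e7 h
    · exact hxb h.symm, fun h => hX.no5 e1 e2 hy h.symm hx⟩
  have k2 : Far G y z := ⟨by
    rintro rfl; rcases hX.no4 e3 e4 hz hy with h | h
    · exact e9 h
    · exact hyd h.symm, fun h => hX.no5 e3 e4 hz h.symm hy⟩
  have k3 : Far G z x := ⟨by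
    rintro rfl; rcases hX.no4 e5 e6 hx hz with h | h
    · exact e11 h
    · exact hzf h.symm, fun h => hX.no5 e5 e6 hx h.symm hz⟩
  have h1 := fun q hq => (h1 x (by simp) q hq : Far G x q)
  have h2 := fun q hq => (h2 y (by simp) q hq : Far G y q)
  have h3 := fun q hq => (h3 z (by simp) q hq : Far G z q)
  simp only [List.mem_cons, List.not_mem_nil, or_false, forall_eq_or_imp, forall_eq] at h1 h2 h3
  obtain ⟨p1, p2, p3, p4, p5⟩ := h1
  obtain ⟨q1, q2, q3, q4, q5⟩ := h2
  obtain ⟨r1, r2, r3, r4, r5⟩ := h3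
  refine hX.free_C6plus3nc (isIndContained_of_far ![a, b, c, d, e, f, x, y, z] fun i j hij => ?_)
  fin_cases i <;> fin_cases j <;> first
    | exact absurd hij (by decide)
    | refine .inl ⟨?_, by decide⟩; first | assumption | exact SimpleGraph.Adj.symm (by assumption)
    | refine .inr ⟨?_, by decide⟩; first | assumption | exact Far.symm (by assumption)

theorem not_2l2 (hX : InClassX G) (h : IsHex G a b c d e f) (hx : G.Adj a x) (hxx : G.Adj x x')
    (hxa : x' ≠ a)
    (hy : G.Adj b y) (hyy : G.Adj y y') (hyb : y' ≠ b)
    (h1 : Apart G [x, x'] [b, c, d, e, f]) (h2 : Apart G [y, y'] [a, c, d, e, f])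
    (h3 : Apart G [x, x'] [y, y']) : False := by
  obtain ⟨n11, n12, n13⟩ := h.far hX
  obtain ⟨n21, n22, n23⟩ := h.rot.far hX
  obtain ⟨n31, n32, n33⟩ := h.rot.rot.far hX
  obtain ⟨n41, n42, n43⟩ := h.rot.rot.rot.far hX
  obtain ⟨n51, n52, n53⟩ := h.rot.rot.rot.rot.far hX
  obtain ⟨e1, e2, e3, e4, e5, e6, e7, e8, e9, e10, e11, e12⟩ := h
  have k1 : Far G x' a := ⟨hxa, fun h => hX.no3 hx hxx h.symm⟩
  have k2 : Far G y' b := ⟨hyb, fun h => hX.no3 hy hyy h.symm⟩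
  have h1 := fun p hp q hq => (h1 p hp q hq : Far G p q)
  have h2 := fun p hp q hq => (h2 p hp q hq : Far G p q)
  have h3 := fun p hp q hq => (h3 p hp q hq : Far G p q)
  simp only [List.mem_cons, List.not_mem_nil, or_false, forall_eq_or_imp, forall_eq] at h1 h2 h3
  obtain ⟨⟨p1, p2, p3, p4, p5⟩, p6, p7, p8, p9, p10⟩ := h1
  obtain ⟨⟨q1, q2, q3, q4, q5⟩, q6, q7, q8, q9, q10⟩ := h2
  obtain ⟨⟨r1, r2⟩, r3, r4⟩ := h3
  refine hX.free_C6plus2l2 (isIndContained_of_far ![a, b, c, d, e, f, x, x', y, y'] fun i j hij => ?_)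
  fin_cases i <;> fin_cases j <;> first
    | exact absurd hij (by decide)
    | refine .inl ⟨?_, by decide⟩; first | assumption | exact SimpleGraph.Adj.symm (by assumption)
    | refine .inr ⟨?_, by decide⟩; first | assumption | exact Far.symm (by assumption)

/-- Every hexagon has two opposite vertices of degree 2: otherwise each of the three opposite
pairs contains a vertex of larger degree, and these three vertices are consecutive or pairwise not
adjacent. -/
theorem antipodal (hX : InClassX G) (h : IsHex G a b c d e f) :
    (OnlyNbrs G a f b ∧ OnlyNbrs G d c e) ∨
    (OnlyNbrs G b a c ∧ OnlyNbrs G e d f) ∨ (OnlyNbrs G c b d ∧ OnlyNbrs G f e a) := by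
  have key : ∀ {x p q}, ¬ OnlyNbrs G x p q → ∃ z, G.Adj x z ∧ z ≠ p ∧ z ≠ q := by
    intro x p q h
    simpa [OnlyNbrs] using h
  have c3 : ∀ {a b c d e f}, IsHex G a b c d e f → OnlyNbrs G a f b ∨ OnlyNbrs G b a c ∨ OnlyNbrs G c b d := by
    intro a b c d e f h
    by_contra! h'
    obtain ⟨x, hx, hx1, hx2⟩ := key h'.1
    obtain ⟨y, hy, hy1, hy2⟩ := key h'.2.1
    obtain ⟨z, hz, hz1, hz2⟩ := key h'.2.2
    exact hX.not_3c h hx hx2 hx1 hy hy1 hy2 hz hz1 hz2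
  have nc3 : ∀ {a b c d e f}, IsHex G a b c d e f → OnlyNbrs G a f b ∨ OnlyNbrs G c b d ∨ OnlyNbrs G e d f := by
    intro a b c d e f h
    by_contra! h'
    obtain ⟨x, hx, hx1, hx2⟩ := key h'.1
    obtain ⟨y, hy, hy1, hy2⟩ := key h'.2.1
    obtain ⟨z, hz, hz1, hz2⟩ := key h'.2.2
    exact hX.not_3nc h hx hx2 hx1 hy hy1 hy2 hz hz1 hz2
  have a1 := c3 h
  have a2 := c3 h.rot
  have a3 := c3 h.rot.rot
  have a4 := c3 h.rot.rot.rot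
  have a5 := c3 h.rot.rot.rot.rot
  have a6 := c3 h.rot.rot.rot.rot.rot
  have b1 := nc3 h
  have b2 := nc3 h.rot
  clear key c3 nc3 hX h
  grind
end InClassX
end

/-! ### Geodesics and induced cycles -/

section
variable {V : Type u} {G : SimpleGraph V}

/-- A geodesic, as a sequence of vertices. -/
theorem SimpleGraph.Reachable.exists_geodesic {H : SimpleGraph V} {u v : V} (h : H.Reachable u v) :
    ∃ c : ℕ → V, c 0 = u ∧ c (H.dist u v) = v ∧ (∀ i < H.dist u v, H.Adj (c i) (c (i + 1))) ∧
      (∀ i j, i < j → j ≤ H.dist u v → c i ≠ c j ∧ (H.Adj (c i) (c j) → j = i + 1)) ∧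
      (∀ i ≤ H.dist u v, H.Reachable (c i) v ∧ H.dist (c i) v + i ≤ H.dist u v) := by
  obtain ⟨p, hp, hl⟩ := h.exists_path_of_dist
  have key : ∀ i ≤ H.dist u v, H.Reachable (p.getVert i) v ∧ H.dist (p.getVert i) v + i ≤ H.dist u v := by
    intro i hi
    refine ⟨⟨p.drop i⟩, ?_⟩
    have := H.dist_le (p.drop i)
    rw [SimpleGraph.Walk.drop_length] at this
    omega
  refine ⟨p.getVert, p.getVert_zero, by rw [← hl, p.getVert_length], ?_, ?_, key⟩
  · intro i hi
    exact p.adj_getVert_succ (by omega)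
  · intro i j hij hj
    refine ⟨fun h => ?_, fun h => ?_⟩
    · have := hp.getVert_injOn (by simp; omega) (by simp; omega) h
      omega
    · have h1 := H.dist_le ((p.take i).append (.cons h (p.drop j)))
      rw [SimpleGraph.Walk.length_append, SimpleGraph.Walk.length_cons, SimpleGraph.Walk.drop_length, SimpleGraph.Walk.take_length] at h1
      omega

namespace InClassX

/-- An edge `p q` whose ends are joined by another path within `S` lies in a hexagon within `S`. -/
theorem exists_hex_of_edge (hX : InClassX G) {S : Set V} {p q : V} (hpq : G.Adj p q)
    {H : SimpleGraph V}
    (hH : ∀ x y, H.Adj x y ↔ G.Adj x y ∧ x ∈ S ∧ y ∈ S ∧ ¬ (x = p ∧ y = q) ∧ ¬ (x = q ∧ y = p))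
    (h : H.Reachable p q) : ∃ c d e f, c ∈ S ∧ d ∈ S ∧ e ∈ S ∧ f ∈ S ∧ IsHex G p q c d e f := by
  obtain ⟨c, h0, hk, hs, hi, -⟩ := h.exists_geodesic
  set k := H.dist p q
  have hk0 : k ≠ 0 := by rintro h; rw [h] at hk; exact hpq.ne (h0.symm.trans hk)
  have hk1 : k ≠ 1 := by
    intro h
    have := hs 0 (by omega)
    rw [zero_add, ← h, h0, hk, hH] at this
    simp at this
  have h6 : k + 1 = 6 := by
    refine hX.eq_six (by omega) c fun i j hij hj => ⟨(hi i j hij (by omega)).1, ?_, ?_⟩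
    · intro hG
      by_cases h' : H.Adj (c i) (c j)
      · exact .inl ((hi i j hij (by omega)).2 h')
      · right
        have hmem : ∀ i ≤ k, c i ∈ S := by
          intro i hik
          rcases hik.lt_or_eq with h | h
          · exact ((hH _ _).1 (hs i h)).2.1
          · have := ((hH _ _).1 (hs (i - 1) (by omega))).2.2.1
            rwa [show i - 1 + 1 = i by omega] at this
        rw [hH] at h'
        have h2 : (c i = p ∧ c j = q) ∨ (c i = q ∧ c j = p) := by
          by_contra! h3
          exact h' ⟨hG, hmem i (by omega), hmem j (by omega), fun h => h3.1 h.1 h.2, fun h => h3.2 h.1 h.2⟩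
        have i0 : c i = p → i = 0 := fun h => by
          by_contra hne
          exact (hi 0 i (by omega) (by omega)).1 (h0.trans h.symm)
        have jk : c j = q → j = k := fun h => by
          by_contra hne
          exact (hi j k (by omega) le_rfl).1 (h.trans hk.symm)
        rcases h2 with h2 | h2
        · have := i0 h2.1; have := jk h2.2; omega
        · exact absurd (h2.1.trans hk.symm) (hi i k (by omega) le_rfl).1
    · rintro (rfl | ⟨rfl, h⟩)
      · exact ((hH _ _).1 (hs i (by omega))).1
      · obtain rfl : j = k := by omega
        rw [h0, hk]; exact hpq
  have h5 : k = 5 := by omega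
  rw [h5] at hs hi hk
  have e := fun i hi => (hH _ _).1 (hs i hi)
  have n := fun i j hij hj => (hi i j hij hj).1
  refine ⟨c 4, c 3, c 2, c 1, (e 4 (by norm_num)).2.1, (e 3 (by norm_num)).2.1, (e 2 (by norm_num)).2.1, (e 1 (by norm_num)).2.1, ?_⟩
  rw [← h0, ← hk]
  refine ⟨?_, (e 4 (by norm_num)).1.symm, (e 3 (by norm_num)).1.symm, (e 2 (by norm_num)).1.symm, (e 1 (by norm_num)).1.symm, (e 0 (by norm_num)).1.symm,
    n 0 4 (by norm_num) (by norm_num), (n 3 5 (by norm_num) (by norm_num)).symm, (n 2 4 (by norm_num) (by norm_num)).symm,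
    (n 1 3 (by norm_num) (by norm_num)).symm, (n 0 2 (by norm_num) (by norm_num)).symm, n 1 5 (by norm_num) (by norm_num)⟩
  rw [h0, hk]; exact hpq

/-- Two induced paths that close up to an induced cycle. -/
theorem length_add_of_two_paths (hX : InClassX G) {k m : ℕ} (hk : 0 < k) (hm : 0 < m) (c r : ℕ → V)
    (hc : ∀ i j, i < j → j ≤ k → c i ≠ c j ∧ (G.Adj (c i) (c j) ↔ j = i + 1))
    (hr : ∀ i j, i < j → j < m → r i ≠ r j ∧ (G.Adj (r i) (r j) ↔ j = i + 1))
    (hcr : ∀ i j, i ≤ k → j < m → c i ≠ r j ∧ (G.Adj (c i) (r j) ↔ (i = k ∧ j = 0) ∨ (i = 0 ∧ j + 1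
    = m))) :
    k + 1 + m = 6 := by
  refine hX.eq_six (by omega) (fun n => if n ≤ k then c n else r (n - k - 1)) fun i j hij hj => ?_
  by_cases h1 : j ≤ k
  · have h2 : i ≤ k := by omega
    simp only [h1, h2, if_true]
    rw [(hc i j hij h1).2]
    exact ⟨(hc i j hij h1).1, by omega⟩
  · by_cases h2 : i ≤ k
    · simp only [h1, h2, if_true, if_false]
      obtain ⟨h3, h4⟩ := hcr i (j - k - 1) h2 (by omega)
      exact ⟨h3, by rw [h4]; omega⟩
    · simp only [h1, h2, if_false]
      obtain ⟨h3, h4⟩ := hr (i - k - 1) (j - k - 1) (by omega) (by omega)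
      exact ⟨h3, by rw [h4]; omega⟩

end InClassX
end

/-! ### Cells separate the graph -/

/-- A cell with left edge `a a₁` and right edge `b b₂`: a hexagon `a a₁ b₁ b b₂ a₂` in which `b₁`
and `a₂` have degree 2, such that all further paths of length 3 from `a` to `b` have inner
vertices of degree 2, and there is no further path of length 3 from `a₁` to `b₂`. So this is a
maximal `C_{6,k}`, and the rest of the graph is attached to the edges `a a₁` and `b b₂` only. -/
structure IsCell {V : Type u} (G : SimpleGraph V) (a a₁ b₁ b b₂ a₂ : V) : Prop where
  hex : IsHex G a a₁ b₁ b b₂ a₂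
  only_b₁ : OnlyNbrs G b₁ a₁ b
  only_a₂ : OnlyNbrs G a₂ a b₂
  other : ∀ x y, G.Adj a x → G.Adj x y → G.Adj y b → x ≠ a₁ → x ≠ a₂ → OnlyNbrs G x a y ∧ OnlyNbrs G y x b
  no_other : ∀ x y, G.Adj a₁ x → G.Adj x y → G.Adj y b₂ → x = a ∨ x = b₁

section
variable {V : Type u} {G : SimpleGraph V} {a a₁ b₁ b b₂ a₂ : V}

theorem OnlyNbrs.swap {x p q : V} (h : OnlyNbrs G x p q) : OnlyNbrs G x q p := fun z hz => (h z hz).symm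

/-- A cell seen from the other side. -/
theorem IsCell.flip (hX : InClassX G) (h : IsCell G a a₁ b₁ b b₂ a₂) : IsCell G b b₂ a₂ a a₁ b₁ :=
    by
  have hx := h.hex
  obtain ⟨f1, f2, f3⟩ := hx.far hX
  obtain ⟨g1, g2, g3⟩ := hx.rot.far hX
  refine ⟨hx.rot.rot.rot, h.only_a₂.swap, h.only_b₁.swap, ?_, ?_⟩
  · intro x y h1 h2 h3 h4 h5
    have := h.other y x h3.symm h2.symm h1.symm ?_ ?_
    · exact ⟨this.2.swap, this.1.swap⟩
    · rintro rfl
      rcases hX.no4 h2.symm h1.symm hx.cd.symm hx.bc with e | e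
      · exact g1.1 e
      · exact h5 e
    · rintro rfl
      rcases h.only_a₂ x h2.symm with e | e
      · rw [e] at h1; exact f2.2 h1.symm
      · exact h4 e
  · intro x y h1 h2 h3
    rcases h.no_other y x h3.symm h2.symm h1.symm with rfl | rfl
    · rcases hX.no4 h2.symm h1.symm hx.ef hx.fa.symm with e | e
      · exact absurd e.symm hx.ea
      · exact .inr e
    · exact .inl ((h.only_b₁ x h2.symm).resolve_left (by rintro rfl; exact g2.2 h1.symm))

/-- The inner vertices of a cell, that is, the vertices of its paths from `a` to `b` with the
exception of the corners `a, a₁, b, b₂`. -/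
def CellInner (G : SimpleGraph V) (a a₁ b₁ b b₂ a₂ : V) : Set V :=
  {z | z = b₁ ∨ z = a₂ ∨ ∃ x y, G.Adj a x ∧ G.Adj x y ∧ G.Adj y b ∧ x ≠ a₁ ∧ x ≠ a₂ ∧ (z = x ∨ z = y)}

/-- Outside the inner vertices, the two sides of a cell are not connected. A shortest path between
the two sides forms induced cycles with the arcs of the hexagon. As these have length 6, the path
joins `a` and `b`, or `a₁` and `b₂`, and has length 3, which is excluded by the definition of a
cell. -/
theorem IsCell.not_reachable (hX : InClassX G) (h : IsCell G a a₁ b₁ b b₂ a₂) {H : SimpleGraph V}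
    (hH : ∀ x y, H.Adj x y ↔ G.Adj x y ∧ x ∉ CellInner G a a₁ b₁ b b₂ a₂ ∧ y ∉ CellInner G a a₁ b₁
    b b₂ a₂) :
    ¬ H.Reachable a b := by
  classical
  intro hab
  set I := CellInner G a a₁ b₁ b b₂ a₂ with hI
  have hx := h.hex
  have hf1 := hx.far hX
  have hf2 := hx.rot.far hX
  have hf3 := hx.rot.rot.far hX
  have hf4 := hx.rot.rot.rot.far hX
  have ib₁ : b₁ ∈ I := .inl rfl
  have ia₂ : a₂ ∈ I := .inr (.inl rfl)
  -- corners are not inner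
  have ia : a ∉ I := by
    rintro (e | e | ⟨x, y, h1, h2, h3, -, -, e | e⟩)
    · exact hf1.1.1 e
    · exact hx.fa.ne e.symm
    · exact h1.ne e
    · rw [← e] at h3; exact hf1.2.1.2 h3
  have ib : b ∉ I := by
    rintro (e | e | ⟨x, y, h1, h2, h3, -, -, e | e⟩)
    · exact hx.cd.ne e.symm
    · exact hx.df e
    · rw [← e] at h1; exact hf1.2.1.2 h1
    · exact h3.ne e.symm
  have ia₁ : a₁ ∉ I := by
    rintro (e | e | ⟨x, y, h1, h2, h3, h4, -, e | e⟩)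
    · exact hx.bc.ne e
    · exact hf2.2.2.1 e
    · exact h4 e.symm
    · rw [← e] at h3; exact hf2.1.2 h3
  have ib₂ : b₂ ∉ I := by
    rintro (e | e | ⟨x, y, h1, h2, h3, h4, h5, e | e⟩)
    · exact hf3.1.1 e.symm
    · exact hx.ef.ne e
    · rw [← e] at h1; exact hf1.2.2.2 h1
    · rcases hX.no4 h2 (e ▸ hx.ef) hx.fa h1.symm with e' | e'
      · exact h5 e'
      · rw [← e] at e'; exact hx.ea e'
  -- a shortest path between the two sides
  obtain ⟨p, ⟨hpL, hpR, hp⟩, hmin⟩ : ∃ p : V × V, ((p.1 = a ∨ p.1 = a₁) ∧ (p.2 = b ∨ p.2 = b₂) ∧ H.Reachable p.1 p.2) ∧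
      ∀ q : V × V, ((q.1 = a ∨ q.1 = a₁) ∧ (q.2 = b ∨ q.2 = b₂) ∧ H.Reachable q.1 q.2) → H.dist p.1 p.2 ≤ H.dist q.1 q.2 := by
    let P : ℕ → Prop := fun n => ∃ q : V × V, ((q.1 = a ∨ q.1 = a₁) ∧ (q.2 = b ∨ q.2 = b₂) ∧ H.Reachable q.1 q.2) ∧ H.dist q.1 q.2 = n
    have hP : ∃ n, P n := ⟨_, (a, b), ⟨.inl rfl, .inl rfl, hab⟩, rfl⟩
    obtain ⟨p, hp, e⟩ := Nat.find_spec hP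
    exact ⟨p, hp, fun q hq => e ▸ Nat.find_min' hP ⟨q, hq, rfl⟩⟩
  obtain ⟨u, t⟩ := p
  simp only at hpL hpR hp hmin
  have hmin' : ∀ x y, (x = a ∨ x = a₁) → (y = b ∨ y = b₂) → H.Reachable x y → H.dist u t ≤ H.dist x y := fun x y h1 h2 h3 => hmin (x, y) ⟨h1, h2, h3⟩
  obtain ⟨c, h0, hk, hs, hi, hd⟩ := hp.exists_geodesic
  set k := H.dist u t
  have hut : ¬ G.Adj u t ∧ u ≠ t := by
    rcases hpL with rfl | rfl <;> rcases hpR with rfl | rfl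
    · exact ⟨hf1.2.1.2, hf1.2.1.1⟩
    · exact ⟨hf1.2.2.2, hf1.2.2.1⟩
    · exact ⟨hf2.1.2, hf2.1.1⟩
    · exact ⟨hf2.2.1.2, hf2.2.1.1⟩
  have uI : u ∉ I := by rcases hpL with rfl | rfl <;> assumption
  have tI : t ∉ I := by rcases hpR with rfl | rfl <;> assumption
  have hk0 : k ≠ 0 := by intro h; rw [h] at hk; exact hut.2 (h0.symm.trans hk)
  have hk1 : k ≠ 1 := by
    intro h
    have := (hH _ _).1 (hs 0 (by omega))
    rw [zero_add, ← h, h0, hk] at this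
    exact hut.1 this.1
  have hcI : ∀ i ≤ k, c i ∉ I := by
    intro i hik
    rcases hik.lt_or_eq with h | h
    · exact ((hH _ _).1 (hs i h)).2.1
    · rw [h, hk]; exact tI
  have hc : ∀ i j, i < j → j ≤ k → c i ≠ c j ∧ (G.Adj (c i) (c j) ↔ j = i + 1) := by
    intro i j hij hj
    refine ⟨(hi i j hij hj).1, fun h => (hi i j hij hj).2 ((hH _ _).2 ⟨h, hcI i (by omega), hcI j hj⟩), ?_⟩
    rintro rfl
    exact ((hH _ _).1 (hs i (by omega))).1
  -- inner vertices of the path are far from the corners, with the exception of its ends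
  have hdl : ∀ i, i ≤ k → H.Reachable u (c i) ∧ H.dist u (c i) ≤ i := by
    intro i
    induction i with
    | zero => intro _; rw [h0]; simp
    | succ i ih =>
      intro hik
      obtain ⟨h1, h2⟩ := ih (by omega)
      have h3 := hs i (by omega)
      refine ⟨h1.trans h3.reachable, ?_⟩
      have := h1.dist_triangle_left (c (i + 1))
      rw [SimpleGraph.dist_eq_one_iff_adj.2 h3] at this
      omega
  have intL : ∀ i, 0 < i → i < k → c i ≠ a ∧ c i ≠ a₁ := by
    intro i h1 h2
    obtain ⟨h3, h4⟩ := hd i h2.le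
    constructor <;> intro e <;> rw [e] at h3 h4
    · have := hmin' a t (.inl rfl) hpR h3; omega
    · have := hmin' a₁ t (.inr rfl) hpR h3; omega
  have intR : ∀ i, 0 < i → i < k → c i ≠ b ∧ c i ≠ b₂ := by
    intro i h1 h2
    obtain ⟨h3, h4⟩ := hdl i h2.le
    constructor <;> intro e <;> rw [e] at h3 h4
    · have := hmin' u b hpL (.inl rfl) h3; omega
    · have := hmin' u b₂ hpL (.inr rfl) h3; omega
  have adjL : ∀ x, (x = a ∨ x = a₁) → x ≠ u → ∀ i, 0 < i → i < k → ¬ G.Adj (c i) x := by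
    intro x hx' hxu i h1 h2 hadj
    have xI : x ∉ I := by rcases hx' with rfl | rfl <;> assumption
    have hux : G.Adj u x := by
      rcases hx' with rfl | rfl <;> rcases hpL with rfl | rfl
      · exact absurd rfl hxu
      · exact hx.ab.symm
      · exact hx.ab
      · exact absurd rfl hxu
    have h3 : i ≠ 1 := by
      rintro rfl
      have := (hc 0 1 (by omega) (by omega)).2.2 rfl
      rw [h0] at this
      exact hX.no3 this hadj hux
    have h4 : H.Adj x (c i) := (hH _ _).2 ⟨hadj.symm, xI, hcI i h2.le⟩
    obtain ⟨h5, h6⟩ := hd i h2.le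
    have h7 := h4.reachable.dist_triangle_left t
    rw [SimpleGraph.dist_eq_one_iff_adj.2 h4] at h7
    have := hmin' x t hx' hpR (h4.reachable.trans h5)
    omega
  have adjR : ∀ x, (x = b ∨ x = b₂) → x ≠ t → ∀ i, 0 < i → i < k → ¬ G.Adj (c i) x := by
    intro x hx' hxt i h1 h2 hadj
    have xI : x ∉ I := by rcases hx' with rfl | rfl <;> assumption
    have htx : G.Adj t x := by
      rcases hx' with rfl | rfl <;> rcases hpR with rfl | rfl
      · exact absurd rfl hxt
      · exact hx.de.symm
      · exact hx.de
      · exact absurd rfl hxt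
    have h3 : i + 1 ≠ k := by
      intro h3
      have := (hc i (i + 1) (by omega) (by omega)).2.2 rfl
      rw [h3, hk] at this
      exact hX.no3 this htx hadj
    have h4 : H.Adj (c i) x := (hH _ _).2 ⟨hadj, hcI i h2.le, xI⟩
    obtain ⟨h5, h6⟩ := hdl i h2.le
    have h7 := h5.dist_triangle_left x
    rw [SimpleGraph.dist_eq_one_iff_adj.2 h4] at h7
    have := hmin' u x hpL hx' (h5.trans h4.reachable)
    omega
  have adjI : ∀ x, (x = b₁ ∨ x = a₂) → ∀ i, 0 < i → i < k → c i ≠ x ∧ ¬ G.Adj (c i) x := by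
    intro x hx' i h1 h2
    obtain ⟨l1, l2⟩ := intL i h1 h2
    obtain ⟨r1, r2⟩ := intR i h1 h2
    refine ⟨fun e => hcI i h2.le (e ▸ by rcases hx' with rfl | rfl <;> assumption), fun hadj => ?_⟩
    rcases hx' with rfl | rfl
    · rcases h.only_b₁ _ hadj.symm with e | e <;> contradiction
    · rcases h.only_a₂ _ hadj.symm with e | e <;> contradiction
  have tri : ∀ i, i ≤ k → i = 0 ∨ i = k ∨ (0 < i ∧ i < k) := by intro i _; omega
  have hk' : 0 < k := Nat.pos_of_ne_zero hk0
  -- the path closes to an induced cycle with an arc of length 2, 3 or 4 of the hexagon, and this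
  -- determines its length
  have cyc1 : ∀ x, (∀ i, 0 < i → i < k → c i ≠ x ∧ ¬ G.Adj (c i) x) → G.Adj t x → G.Adj x u → k = 4 := by
    intro x h1 h2 h3
    have := hX.length_add_of_two_paths hk' (m := 1) (by norm_num) c (fun _ => x) hc (by intro i j hij hj; omega) (by
      intro i j hi' hj
      obtain rfl : j = 0 := by omega
      rcases tri i hi' with rfl | rfl | ⟨h4, h5⟩
      · rw [h0]; exact ⟨h3.ne.symm, by simp [h3.symm]⟩
      · rw [hk]; exact ⟨h2.ne, by simp [h2]⟩
      · refine ⟨(h1 i h4 h5).1, iff_of_false (h1 i h4 h5).2 (by omega)⟩)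
    omega
  have cyc2 : ∀ x y, (∀ i, 0 < i → i < k → c i ≠ x ∧ ¬ G.Adj (c i) x) → (∀ i, 0 < i → i < k → c i ≠ y ∧ ¬ G.Adj (c i) y) →
      G.Adj t x → G.Adj x y → G.Adj y u → Far G u x → Far G t y → k = 3 := by
    intro x y h1 h1' h2 h3 h4 h5 h6
    have := hX.length_add_of_two_paths hk' (m := 2) (by norm_num) c (fun j => if j = 0 then x else y) hc (by
      intro i j hij hj
      obtain rfl : i = 0 := by omega
      obtain rfl : j = 1 := by omega
      simpa using ⟨h3.ne, h3⟩) (by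
      intro i j hi' hj
      rcases tri i hi' with rfl | rfl | ⟨h7, h8⟩ <;> interval_cases j
      · rw [h0]; exact ⟨h5.1, iff_of_false h5.2 (by omega)⟩
      · rw [h0]; exact ⟨h4.ne.symm, by simp [h4.symm]⟩
      · rw [hk]; exact ⟨h2.ne, by simp [h2]⟩
      · rw [hk]; exact ⟨h6.1, iff_of_false h6.2 (by omega)⟩
      · exact ⟨(h1 i h7 h8).1, iff_of_false (h1 i h7 h8).2 (by omega)⟩
      · exact ⟨(h1' i h7 h8).1, iff_of_false (h1' i h7 h8).2 (by omega)⟩)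
    omega
  have cyc3 : ∀ x y z, (∀ i, 0 < i → i < k → c i ≠ x ∧ ¬ G.Adj (c i) x) → (∀ i, 0 < i → i < k → c i ≠ y ∧ ¬ G.Adj (c i) y) →
      (∀ i, 0 < i → i < k → c i ≠ z ∧ ¬ G.Adj (c i) z) →
      G.Adj t x → G.Adj x y → G.Adj y z → G.Adj z u → Far G u x → Far G u y → Far G t y → Far G t z → Far G x z → k = 2 := by
    intro x y z g1 g2 g3 h1 h2 h3 h4 f1 f2 f3 f4 f5
    have := hX.length_add_of_two_paths hk' (m := 3) (by norm_num) c (fun j => if j = 0 then x else if j = 1 then y else z) hc (by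
      intro i j hij hj
      interval_cases j <;> interval_cases i
      · exact ⟨h2.ne, by simp [h2]⟩
      · exact ⟨f5.1, by simp [f5.2]⟩
      · exact ⟨h3.ne, by simp [h3]⟩) (by
      intro i j hi' hj
      rcases tri i hi' with rfl | rfl | ⟨h7, h8⟩ <;> interval_cases j
      · rw [h0]; exact ⟨f1.1, iff_of_false f1.2 (by omega)⟩
      · rw [h0]; exact ⟨f2.1, iff_of_false f2.2 (by omega)⟩
      · rw [h0]; exact ⟨h4.ne.symm, by simp [h4.symm]⟩
      · rw [hk]; exact ⟨h1.ne, by simp [h1]⟩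
      · rw [hk]; exact ⟨f3.1, iff_of_false f3.2 (by omega)⟩
      · rw [hk]; exact ⟨f4.1, iff_of_false f4.2 (by omega)⟩
      · exact ⟨(g1 i h7 h8).1, iff_of_false (g1 i h7 h8).2 (by omega)⟩
      · exact ⟨(g2 i h7 h8).1, iff_of_false (g2 i h7 h8).2 (by omega)⟩
      · exact ⟨(g3 i h7 h8).1, iff_of_false (g3 i h7 h8).2 (by omega)⟩)
    omega
  have fL : ∀ x, (x = a ∨ x = a₁) → x ≠ u → ∀ i, 0 < i → i < k → c i ≠ x ∧ ¬ G.Adj (c i) x := by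
    intro x h1 h2 i h3 h4
    refine ⟨?_, adjL x h1 h2 i h3 h4⟩
    obtain ⟨l1, l2⟩ := intL i h3 h4
    rcases h1 with rfl | rfl <;> assumption
  have fR : ∀ x, (x = b ∨ x = b₂) → x ≠ t → ∀ i, 0 < i → i < k → c i ≠ x ∧ ¬ G.Adj (c i) x := by
    intro x h1 h2 i h3 h4
    refine ⟨?_, adjR x h1 h2 i h3 h4⟩
    obtain ⟨l1, l2⟩ := intR i h3 h4
    rcases h1 with rfl | rfl <;> assumption
  have gb₁ := adjI b₁ (.inl rfl)
  have ga₂ := adjI a₂ (.inr rfl)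
  have path3 : k = 3 → G.Adj u (c 1) ∧ G.Adj (c 1) (c 2) ∧ G.Adj (c 2) t := by
    intro h3
    have e0 := (hc 0 1 (by omega) (by omega)).2.2 rfl
    have e1 := (hc 1 2 (by omega) (by omega)).2.2 rfl
    have e2 := (hc 2 3 (by omega) (by omega)).2.2 rfl
    rw [h0] at e0
    rw [← h3, hk] at e2
    exact ⟨e0, e1, e2⟩
  -- the ends of the path are opposite in the hexagon, or the two arcs between them require different lengths
  rcases hpL with rfl | rfl <;> rcases hpR with rfl | rfl
  · have h3 := cyc2 b₁ a₁ gb₁ (fL a₁ (.inr rfl) hx.ab.ne.symm) hx.cd.symm hx.bc.symm hx.ab.symm hf1.1 hf2.1.symm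
    obtain ⟨e1, e2, e3⟩ := path3 h3
    refine hcI 1 (by omega) (.inr (.inr ⟨_, _, e1, e2, e3, (intL 1 (by omega) (by omega)).2, ?_, .inl rfl⟩))
    rintro e
    exact hcI 1 (by omega) (e ▸ ia₂)
  · have h1 := cyc1 a₂ ga₂ hx.ef hx.fa
    have h2 := cyc3 b b₁ a₁ (fR b (.inl rfl) hx.de.ne) gb₁ (fL a₁ (.inr rfl) hx.ab.ne.symm) hx.de.symm hx.cd.symm hx.bc.symm hx.ab.symm
      hf1.2.1 hf1.1 hf3.1.symm hf2.2.1.symm hf2.1.symm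
    omega
  · have h1 := cyc1 b₁ gb₁ hx.cd.symm hx.bc.symm
    have h2 := cyc3 b₂ a₂ a (fR b₂ (.inr rfl) hx.de.ne.symm) ga₂ (fL a (.inl rfl) hx.ab.ne) hx.de hx.ef hx.fa hx.ab
      hf2.2.1 hf2.2.2 hf4.1 hf4.2.1 hf1.2.2.symm
    omega
  · have h3 := cyc2 b b₁ (fR b (.inl rfl) hx.de.ne) gb₁ hx.de.symm hx.cd.symm hx.bc.symm hf2.1 hf3.1.symm
    obtain ⟨e1, e2, e3⟩ := path3 h3
    rcases h.no_other _ _ e1 e2 e3 with e | e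
    · exact (intL 1 (by omega) (by omega)).1 e
    · exact (gb₁ 1 (by omega) (by omega)).1 e

end

/-! ### Existence of cells -/

section
variable {V : Type u} {G : SimpleGraph V} {a a₁ b₁ b b₂ a₂ : V}

/-- `v` has degree at most 2. -/
def SmallDeg {V : Type u} (G : SimpleGraph V) (v : V) : Prop := ∃ p q, OnlyNbrs G v p q

/-- A third path of length 3 between the opposite vertices `a` and `b` of a hexagon, in which `a₁`
and `a₂` are the neighbours of `a`. -/
def ThirdPath (G : SimpleGraph V) (a a₁ b a₂ : V) : Prop := ∃ x y, G.Adj a x ∧ G.Adj x y ∧ G.Adj y b ∧ x ≠ a₁ ∧ x ≠ a₂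

instance : DecidableRel (SimpleGraph.cycleGraph 8).Adj := fun i j => decidable_of_iff _ SimpleGraph.cycleGraph_adj'.symm

/-- Two further paths across a hexagon in different directions would form an induced 8-cycle. -/
theorem InClassX.no_cross (hX : InClassX G) (h : IsHex G a a₁ b₁ b b₂ a₂) {x y x' y' : V}
    (h1 : G.Adj a x) (h2 : G.Adj x y)
    (h3 : G.Adj y b) (hx : OnlyNbrs G x a y) (hy : OnlyNbrs G y x b) (hx1 : x ≠ a₁) (hx2 : x ≠ a₂)
    (k1 : G.Adj a₁ x') (k2 : G.Adj x' y') (k3 : G.Adj y' b₂) : x' = a ∨ x' = b₁ := by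
  by_contra! hne
  obtain ⟨f1, f2, f3⟩ := h.far hX
  obtain ⟨g1, g2, g3⟩ := h.rot.far hX
  obtain ⟨i1, i2, i3⟩ := h.rot.rot.rot.far hX
  have ex : ∀ z, z ≠ a → z ≠ y → x ≠ z → Far G x z := fun z h1 h2 h3 => ⟨h3, fun h => (hx z h).elim h1 h2⟩
  have ey : ∀ z, z ≠ x → z ≠ b → y ≠ z → Far G y z := fun z h1 h2 h3 => ⟨h3, fun h => (hy z h).elim h1 h2⟩
  have yb₂ : y ≠ b₂ := by rintro rfl; rcases hX.no4 h1 h2 h.ef h.fa.symm with e | e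
                          · exact h.ea e.symm
                          · exact hx2 e
  have xb₂ : x ≠ b₂ := by rintro rfl; exact f3.2 h1
  have ya₁ : y ≠ a₁ := by rintro rfl; exact g1.2 h3
  have xb : x ≠ b := by rintro rfl; exact f2.2 h1
  have ya : y ≠ a := by rintro rfl; exact f2.2 h3
  have xx' : x ≠ x' := by
    rintro rfl
    exact hX.no3 h.ab k1 h1
  have y'x : y' ≠ x := by
    rintro rfl
    rcases hx _ k3 with e | e
    · exact h.ea e
    · exact yb₂ e.symm
  have y'y : y' ≠ y := by
    rintro rfl
    rcases hy _ k3 with e | e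
    · exact xb₂ e.symm
    · exact h.de.ne e.symm
  have x'y : x' ≠ y := by
    rintro rfl
    rcases hy _ k1.symm with e | e
    · exact hx1 e.symm
    · exact g1.1 e
  have y'a : y' ≠ a := by rintro rfl; exact f3.2 k3
  have a₁y' : a₁ ≠ y' := by rintro rfl; exact g2.2 k3
  have ay' : Far G a y' := ⟨y'a.symm, fun e => by
    rcases hX.no4 h.ab k1 k2 e with e | e
    · exact hne.1 e.symm
    · exact a₁y' e⟩
  have ax' : Far G a x' := ⟨hne.1.symm, hX.no3 h.ab k1⟩
  have x'b : Far G x' b := by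
    refine ⟨by rintro rfl; exact g1.2 k1, fun e => ?_⟩
    rcases hX.no4 k1 e h.cd.symm h.bc with e | e
    · exact g1.1 e
    · exact hne.2 e
  have y'b : Far G y' b := by
    refine ⟨by rintro rfl; exact x'b.2 k2, hX.no3 k3 h.de.symm⟩
  have x'b₂ : Far G x' b₂ := ⟨by rintro rfl; exact g2.2 k1, hX.no3 k2 k3⟩
  have a₁y'' : Far G a₁ y' := ⟨a₁y', hX.no3 k1 k2⟩
  have l1 := ex b₂ h.ea yb₂.symm xb₂
  have l2 := ex y' y'a y'y y'x.symm
  have l3 := ex x' hne.1 x'y xx'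
  have l4 := ex a₁ h.ab.ne.symm ya₁.symm hx1
  have l5 : Far G x b := ex b f2.1.symm h3.ne.symm xb
  have m1 := ey b₂ xb₂.symm h.de.ne.symm yb₂
  have m2 := ey y' y'x y'b.1 y'y.symm
  have m3 := ey x' xx'.symm x'b.1 x'y.symm
  have m4 := ey a₁ hx1.symm g1.1 ya₁
  have m5 : Far G a y := ⟨ya.symm, hX.no3 h1 h2⟩
  have n1 := h.de
  have n2 := h.ab
  refine hX.free_cycle 8 (by norm_num) (by norm_num) (isIndContained_of_far ![a, x, y, b, b₂, y', x', a₁] fun i j hij => ?_)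
  fin_cases i <;> fin_cases j <;> first
    | exact absurd hij (by decide)
    | refine .inl ⟨?_, by decide⟩; first | assumption | exact SimpleGraph.Adj.symm (by assumption)
    | refine .inr ⟨?_, by decide⟩; first | assumption | exact Far.symm (by assumption)

/-- If there are at least three paths of length 3 from `a` to `b`, then all of them form a cell.
By `antipodal`, applied to pairs of paths, at most one path has a first inner vertex of degree
larger than 2, and at most one has such a second inner vertex; these two paths can be taken to be
different, and provide the corners `a₁` and `b₂`. -/
theorem InClassX.exists_cell_of_third (hX : InClassX G) (h : IsHex G a a₁ b₁ b b₂ a₂)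
    (hb₁ : OnlyNbrs G b₁ a₁ b) (ha₂ : OnlyNbrs G a₂ a b₂)
    (ht : ThirdPath G a a₁ b a₂) : ∃ p₁ q₁ q₂ p₂, IsCell G a p₁ q₁ b q₂ p₂ ∧
    (a₁ = p₁ ∨ SmallDeg G a₁) ∧ (b₂ = q₂ ∨ SmallDeg G b₂) := by
  classical
  let P : V → V → Prop := fun x y => G.Adj a x ∧ G.Adj x y ∧ G.Adj y b
  have P1 : P a₁ b₁ := ⟨h.ab, h.bc, h.cd⟩
  have P2 : P a₂ b₂ := ⟨h.fa.symm, h.ef.symm, h.de.symm⟩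
  have hab := (h.far hX).2.1
  have hxy : ∀ {x y x' y'}, P x y → P x' y' → (x = x' ↔ y = y') := by
    rintro x y x' y' ⟨h1, h2, h3⟩ ⟨k1, k2, k3⟩
    constructor
    · rintro rfl
      rcases hX.no4 h2 h3 k3.symm k2 with e | e
      · rw [e] at h1; exact absurd h1 hab.2
      · exact e
    · rintro rfl
      rcases hX.no4 h1 h2 k2.symm k1 with e | e
      · rw [← e] at h3; exact absurd h3 hab.2
      · exact e
  obtain ⟨x₀, y₀, t1, t2, t3, hx₀1, hx₀2⟩ := ht
  have P3 : P x₀ y₀ := ⟨t1, t2, t3⟩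
  have h12 : a₁ ≠ a₂ := h.fb.symm
  -- some path is different from two given ones
  have hthird : ∀ x x', ∃ x'' y'', P x'' y'' ∧ x'' ≠ x ∧ x'' ≠ x' := by
    intro x x'
    by_cases c1 : a₁ ≠ x ∧ a₁ ≠ x'
    · exact ⟨_, _, P1, c1⟩
    by_cases c2 : a₂ ≠ x ∧ a₂ ≠ x'
    · exact ⟨_, _, P2, c2⟩
    refine ⟨_, _, P3, ?_⟩
    grind
  have hexP : ∀ {x y x' y'}, P x y → P x' y' → x ≠ x' → IsHex G a x y b y' x' := by
    rintro x y x' y' p p' hne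
    have hne' : y ≠ y' := fun e => hne ((hxy p p').2 e)
    obtain ⟨h1, h2, h3⟩ := p
    obtain ⟨k1, k2, k3⟩ := p'
    refine ⟨h1, h2, h3, k3.symm, k2.symm, k1.symm, ?_, ?_, hne', ?_, ?_, hne.symm⟩
    · rintro rfl; exact hab.2 h3
    · rintro rfl; exact hab.2 h1
    · rintro rfl; exact hab.2 k1
    · rintro rfl; exact hab.2 k3
  have hanti : ∀ {x y x' y'}, P x y → P x' y' → x ≠ x' →
      (OnlyNbrs G x a y ∧ OnlyNbrs G y' b x') ∨ (OnlyNbrs G y x b ∧ OnlyNbrs G x' y' a) := by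
    intro x y x' y' p p' hne
    rcases hX.antipodal (hexP p p' hne) with e | e | e
    · obtain ⟨x'', y'', p'', n1, n2⟩ := hthird x x'
      rcases e.1 _ p''.1 with e | e <;> contradiction
    · exact .inl e
    · exact .inr e
  obtain ⟨p₁, q₁, p₂, q₂, hp1, hp2, hne, hx, hy⟩ : ∃ p₁ q₁ p₂ q₂, P p₁ q₁ ∧ P p₂ q₂ ∧ p₁ ≠ p₂ ∧
      (∀ x y, P x y → x ≠ p₁ → OnlyNbrs G x a y) ∧ (∀ x y, P x y → x ≠ p₂ → OnlyNbrs G y x b) := by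
    have hother : ∀ x, ∃ x' y', P x' y' ∧ x' ≠ x := fun x => by
      obtain ⟨x', y', h1, h2, -⟩ := hthird x x; exact ⟨x', y', h1, h2⟩
    by_cases c1 : ∃ x y, P x y ∧ ¬ OnlyNbrs G x a y
    · obtain ⟨p₁, q₁, p, hp⟩ := c1
      have hx : ∀ x y, P x y → x ≠ p₁ → OnlyNbrs G x a y := by
        intro x y p' hne
        rcases hanti p p' hne.symm with e | e
        · exact absurd e.1 hp
        · exact e.2.swap
      by_cases c2 : ∃ x y, P x y ∧ ¬ OnlyNbrs G y x b
      · obtain ⟨p₂, q₂, p', hp'⟩ := c2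
        refine ⟨p₁, q₁, p₂, q₂, p, p', ?_, hx, ?_⟩
        · rintro rfl
          obtain rfl := (hxy p p').1 rfl
          obtain ⟨x', y', p'', hne⟩ := hother p₁
          rcases hanti p p'' hne.symm with e | e
          · exact hp e.1
          · exact hp' e.1
        · intro x y p'' hne
          rcases hanti p' p'' hne.symm with e | e
          · exact e.2.swap
          · exact absurd e.1 hp'
      · obtain ⟨x', y', p'', hne⟩ := hother p₁
        push Not at c2
        exact ⟨p₁, q₁, x', y', p, p'', hne.symm, hx, fun x y p _ => c2 x y p⟩
    · push Not at c1
      by_cases c2 : ∃ x y, P x y ∧ ¬ OnlyNbrs G y x b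
      · obtain ⟨p₂, q₂, p', hp'⟩ := c2
        obtain ⟨x', y', p'', hne⟩ := hother p₂
        refine ⟨x', y', p₂, q₂, p'', p', hne, fun x y p _ => c1 x y p, ?_⟩
        intro x y p'' hne
        rcases hanti p' p'' hne.symm with e | e
        · exact e.2.swap
        · exact absurd e.1 hp'
      · push Not at c2
        exact ⟨a₁, b₁, a₂, b₂, P1, P2, h12, fun x y p _ => c1 x y p, fun x y p _ => c2 x y p⟩
  have hX' := hexP hp1 hp2 hne
  obtain ⟨x, y, p, n1, n2⟩ := hthird p₁ p₂
  refine ⟨p₁, q₁, q₂, p₂, ⟨hX', hy _ _ hp1 hne, hx _ _ hp2 hne.symm, ?_, ?_⟩, ?_, ?_⟩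
  · intro x y h1 h2 h3 n1 n2
    exact ⟨hx x y ⟨h1, h2, h3⟩ n1, hy x y ⟨h1, h2, h3⟩ n2⟩
  · intro x' y' k1 k2 k3
    exact hX.no_cross hX' p.1 p.2.1 p.2.2 (hx _ _ p n1) (hy _ _ p n2) n1 n2 k1 k2 k3
  · by_cases e : a₁ = p₁
    · exact .inl e
    · exact .inr ⟨_, _, hx _ _ P1 e⟩
  · by_cases e : a₂ = p₂
    · exact .inl ((hxy P2 hp2).1 e)
    · exact .inr ⟨_, _, hy _ _ P2 e⟩

/-- Every hexagon gives a cell, whose corners contain all vertices of the hexagon of degree at least 3. -/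
theorem InClassX.exists_cell (hX : InClassX G) {h₀ h₁ h₂ h₃ h₄ h₅ : V}
    (h : IsHex G h₀ h₁ h₂ h₃ h₄ h₅) :
    ∃ a a₁ b₁ b b₂ a₂, IsCell G a a₁ b₁ b b₂ a₂ ∧ a ∈ [h₀, h₁, h₂, h₃, h₄, h₅] ∧ b ∈
    [h₀, h₁, h₂, h₃, h₄, h₅] ∧
      ∀ v ∈ [h₀, h₁, h₂, h₃, h₄, h₅], v = a ∨ v = a₁ ∨ v = b ∨ v = b₂ ∨ SmallDeg G v := by
  have key : ∀ {a a₁ b₁ b b₂ a₂ : V}, IsHex G a a₁ b₁ b b₂ a₂ → OnlyNbrs G b₁ a₁ b → OnlyNbrs G a₂ a b₂ →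
     ∃ p p₁ q₁ q q₂ p₂, IsCell G p p₁ q₁ q q₂ p₂ ∧ p ∈ [a, a₁, b₁, b, b₂, a₂] ∧ q ∈ [a, a₁, b₁, b, b₂, a₂] ∧ ∀ v ∈ [a, a₁, b₁, b, b₂, a₂], v = p ∨ v = p₁ ∨ v = q ∨ v = q₂ ∨ SmallDeg G v := by
    intro a a₁ b₁ b b₂ a₂ h hb₁ ha₂
    have s1 : SmallDeg G b₁ := ⟨_, _, hb₁⟩
    have s2 : SmallDeg G a₂ := ⟨_, _, ha₂⟩
    by_cases t1 : ThirdPath G a a₁ b a₂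
    · obtain ⟨p₁, q₁, q₂, p₂, hc, k1, k2⟩ := hX.exists_cell_of_third h hb₁ ha₂ t1
      refine ⟨_, _, _, _, _, _, hc, by simp, by simp, ?_⟩
      simp only [List.mem_cons, List.not_mem_nil, or_false, forall_eq_or_imp, forall_eq]
      grind
    · by_cases t2 : ThirdPath G a₁ a b₂ b₁
      · obtain ⟨p₁, q₁, q₂, p₂, hc, k1, k2⟩ := hX.exists_cell_of_third h.reflect ha₂ hb₁ t2
        refine ⟨_, _, _, _, _, _, hc, by simp, by simp, ?_⟩
        simp only [List.mem_cons, List.not_mem_nil, or_false, forall_eq_or_imp, forall_eq]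
        grind
      · refine ⟨_, _, _, _, _, _, ⟨h, hb₁, ha₂, ?_, ?_⟩, by simp, by simp, ?_⟩
        · intro x y h1 h2 h3 h4 h5
          exact absurd ⟨x, y, h1, h2, h3, h4, h5⟩ t1
        · intro x y h1 h2 h3
          by_contra! hne
          exact t2 ⟨x, y, h1, h2, h3, hne⟩
        · simp only [List.mem_cons, List.not_mem_nil, or_false, forall_eq_or_imp, forall_eq]
          grind
  rcases hX.antipodal h with e | e | e
  · have := key h.rot e.2.swap.swap e.1.swap
    simpa only [List.mem_cons, List.not_mem_nil, or_false, or_assoc, or_comm, or_left_comm] using this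
  · have := key h.rot.rot e.2 e.1.swap
    simpa only [List.mem_cons, List.not_mem_nil, or_false, or_assoc, or_comm, or_left_comm] using this
  · exact key h e.1 e.2.swap
end

/-! ### Labelings and their combination -/

/-- `f` embeds the subgraph of `G` induced by `S` into the universal graph of `w`. -/
structure Labels {V : Type u} {N : Type v} (G : SimpleGraph V) (w : Layout) (S : Set V)
    (f : V → Lab N) : Prop where
  inj : ∀ x ∈ S, ∀ y ∈ S, f x = f y → x = y
  adj : ∀ x ∈ S, ∀ y ∈ S, (w.graph N).Adj (f x) (f y) ↔ G.Adj x y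

namespace Layout
variable {N : Type u}

/-- A cut may be fused only if it lies between two hexagonal cells. -/
def Normal (w : Layout) : Prop := ∀ i, w.fused i = true → w.hex i = true ∧ w.hex (i - 1) = true

/-- The cells and cuts of `wl` up to cut 0, a new cell 0, and then those of `wr` from its cut 0 on. -/
def merge (wl wr : Layout) (c am bm : Bool) : Layout where
  hex i := if i < 0 then wl.hex i else if i = 0 then c else wr.hex (i - 1)
  aMid i := if i < 0 then wl.aMid i else if i = 0 then am else wr.aMid (i - 1)
  bMid i := if i < 0 then wl.bMid i else if i = 0 then bm else wr.bMid (i - 1)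
  fused i := if i ≤ 0 then wl.fused i else wr.fused (i - 1)

variable {wl wr : Layout} {c am bm : Bool} {x y : Lab N}

theorem merge_normal (hl : wl.Normal) (hr : wr.Normal)
    (hc : c = true ∨ (wl.fused 0 = false ∧ wr.fused 0 = false)) :
    (merge wl wr c am bm).Normal := by
  intro i hi
  have h1 := hl i
  have h2 := hr (i - 1)
  rcases lt_trichotomy i 0 with h | rfl | h
  · simp only [merge, h, h.le, if_true, show i - 1 < 0 by omega] at hi ⊢
    exact h1 hi
  · simp [merge] at hi ⊢
    rcases hc with h | h
    · exact ⟨h, (h1 hi).2⟩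
    · rw [h.1] at hi; cases hi
  · simp only [merge, not_lt.2 h.le, not_le.2 h, h.ne', if_false, show ¬ i - 1 < 0 by omega] at hi ⊢
    refine ⟨(h2 hi).1, ?_⟩
    split_ifs with h3
    · rcases hc with h | h
      · exact h
      · rw [h3, h.2] at hi; cases hi
    · exact (h2 hi).2

theorem _root_.Lab.shift_zero (x : Lab N) : x.shift 0 = x := by
  cases x <;> simp [Lab.shift]

theorem merge_adj_left (hx : x.Within (Set.Iic 0)) (hy : y.Within (Set.Iic 0)) :
    ((merge wl wr c am bm).graph N).Adj x y ↔ (wl.graph N).Adj x y := by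
  have := adj_shift (w := wl) (w' := merge wl wr c am bm) (K := Set.Iic 0) (k := 0) ?_ ?_ hx hy
  · rwa [x.shift_zero, y.shift_zero] at this
  · intro i hi
    have : i ≤ 0 := hi
    simp [merge, this]
  · intro i hi hi'
    have : i + 1 ≤ 0 := hi'
    simp [merge, show i < 0 by omega]

theorem merge_adj_right (hx : x.Within (Set.Ici 0)) (hy : y.Within (Set.Ici 0)) :
    ((merge wl wr c am bm).graph N).Adj (x.shift 1) (y.shift 1) ↔ (wr.graph N).Adj x y := by
  refine adj_shift (K := Set.Ici 0) ?_ ?_ hx hy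
  · intro i hi
    have : 0 ≤ i := hi
    simp [merge, show ¬ i + 1 ≤ 0 by omega]
  · intro i hi hi'
    have : 0 ≤ i := hi
    simp [merge, show ¬ i + 1 < 0 by omega, show ¬ i + 1 = 0 by omega]

theorem merge_adj_cross (hx : x.Within (Set.Iic 0)) (hy : y.Within (Set.Ici 0)) :
    ((merge wl wr c am bm).graph N).Adj x (y.shift 1) ↔ c = false ∧ x = .hub 0 .mid ∧ y = .hub 0
    .mid := by
  cases x <;> cases y <;> simp [Lab.Within] at hx hy <;> simp [adj_iff, Edge, Lab.shift]
  case hub.hub i s j t =>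
    constructor
    · rintro ((h | ⟨h1, h2, h3, h4⟩) | h | h)
      · omega
      · obtain rfl : i = 0 := by omega
        obtain rfl : j = 0 := by omega
        simp [merge] at h4
        simp_all
      · omega
      · omega
    · rintro ⟨rfl, ⟨rfl, rfl⟩, rfl, rfl⟩
      left; right
      simp [merge]
  all_goals omega

theorem shift_ne (hx : x.Within (Set.Iic 0)) (hy : y.Within (Set.Ici 0)) : x ≠ y.shift 1 := by
  cases x <;> cases y <;> simp [Lab.Within, Lab.shift] at * <;> omega

end Layout

section
variable {V : Type u} {G : SimpleGraph V} {N : Type v}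

open Classical in
/-- Labels on the two sides of a new cell 0. There is no edge between the two sides if the cell is
hexagonal, and one edge if it is an edge cell. -/
theorem Labels.merge {wl wr : Layout} {c am bm : Bool} {L R : Set V} {f g : V → Lab N}
    (hl : Labels G wl L f) (hr : Labels G wr R g)
    (hf : ∀ x ∈ L, (f x).Within (Set.Iic 0)) (hg : ∀ x ∈ R, (g x).Within (Set.Ici 0))
    (hLR : ∀ x ∈ L, x ∉ R)
    (hadj : ∀ x ∈ L, ∀ y ∈ R, G.Adj x y ↔ c = false ∧ f x = .hub 0 .mid ∧ g y = .hub 0 .mid) :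
    Labels G (wl.merge wr c am bm) (L ∪ R) (fun x => if x ∈ L then f x else (g x).shift 1) := by
  have hR : ∀ x ∈ R, x ∉ L := fun x h h' => hLR x h' h
  constructor
  · rintro x (hx | hx) y (hy | hy) h
    · simp only [hx, hy, if_true] at h; exact hl.inj x hx y hy h
    · simp only [hx, hR y hy, if_true, if_false] at h; exact absurd h (Layout.shift_ne (hf x hx) (hg y hy))
    · simp only [hy, hR x hx, if_true, if_false] at h; exact absurd h.symm (Layout.shift_ne (hf y hy) (hg x hx))
    · simp only [hR x hx, hR y hy, if_false] at h; exact hr.inj x hx y hy (Lab.shift_injective 1 h)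
  · rintro x (hx | hx) y (hy | hy)
    · simp only [hx, hy, if_true]; rw [Layout.merge_adj_left (hf x hx) (hf y hy), hl.adj x hx y hy]
    · simp only [hx, hR y hy, if_true, if_false]; rw [Layout.merge_adj_cross (hf x hx) (hg y hy), hadj x hx y hy]
    · simp only [hy, hR x hx, if_true, if_false]
      rw [SimpleGraph.adj_comm, Layout.merge_adj_cross (hf y hy) (hg x hx), G.adj_comm, hadj y hy x hx]
    · simp only [hR x hx, hR y hy, if_false]; rw [Layout.merge_adj_right (hg x hx) (hg y hy), hr.adj x hx y hy]

/-- The labels at a spot of cut 0: the hub and the vertices pendant at it. -/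
def IsAtSpot (s : Spot) (x : Lab N) : Prop := x = .hub 0 s ∨ ∃ n, x = .pend 0 s n

open Classical in
/-- A neighbour `q` of the middle hub of cut 0, together with pendant vertices at `q`, is put at another spot of that cut. -/
theorem Labels.add_partner {w : Layout} {T Q : Set V} {f : V → Lab V} {v q : V} {s : Spot}
    (h : Labels G w T f) (hTQ : ∀ x ∈ T, x ∉ Q)
    (hv : v ∈ T) (hfv : f v = .hub 0 .mid) (hq : q ∈ Q) (hs : s ≠ .mid)
    (hsf : s = .hi → w.fused 0 = false)
    (hT : ∀ x ∈ T, ¬ IsAtSpot s (f x)) (hT' : ∀ x ∈ T, (w.graph V).Adj (f x) (.hub 0 s) → f x =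
    .hub 0 .mid)
    (hQ : ∀ x ∈ Q, ∀ y ∈ Q, G.Adj x y ↔ (x = q ∧ y ≠ q) ∨ (y = q ∧ x ≠ q))
    (hcross : ∀ x ∈ T, ∀ y ∈ Q, G.Adj x y ↔ x = v ∧ y = q) :
    Labels G w (T ∪ Q) (fun x => if x ∈ T then f x else if x = q then .hub 0 s else .pend 0 s x) :=
    by
  have hR : ∀ x ∈ Q, x ∉ T := fun x h h' => hTQ x h' h
  have hfv' : ∀ x ∈ T, f x = .hub 0 .mid → x = v := fun x hx e => h.inj x hx v hv (e.trans hfv.symm)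
  have key : ∀ x ∈ T, ∀ y ∈ Q, f x ≠ (if y = q then .hub 0 s else .pend 0 s y) ∧
     ((w.graph V).Adj (f x) (if y = q then .hub 0 s else .pend 0 s y) ↔ G.Adj x y) := by
    intro x hx y hy
    rw [hcross x hx y hy]
    split_ifs with hyq
    · refine ⟨fun e => hT x hx (.inl e), fun e => ⟨hfv' x hx (hT' x hx e), hyq⟩, ?_⟩
      rintro ⟨rfl, -⟩
      rw [hfv]
      left
      exact .inl ⟨rfl, rfl, hs, hsf⟩
    · refine ⟨fun e => hT x hx (.inr ⟨y, e⟩), iff_of_false (fun e => ?_) (fun e => hyq e.2)⟩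
      rw [SimpleGraph.adj_comm, Layout.adj_pend] at e
      rcases e with e | e
      · exact hT x hx (.inl e.1)
      · exact hs e.1
  have key2 : ∀ x ∈ Q, ∀ y ∈ Q, (w.graph V).Adj (if x = q then .hub 0 s else .pend 0 s x) (if y = q then .hub 0 s else .pend 0 s y) ↔ G.Adj x y := by
    intro x hx y hy
    rw [hQ x hx y hy]
    split_ifs with h1 h2 h2 <;> simp [h1, h2, Layout.adj_iff, Layout.Edge, hs] <;> exact hsf
  constructor
  · rintro x (hx | hx) y (hy | hy) h'
    · simp only [hx, hy, if_true] at h'; exact h.inj x hx y hy h'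
    · simp only [hx, hR y hy, if_true, if_false] at h'; exact absurd h' (key x hx y hy).1
    · simp only [hy, hR x hx, if_true, if_false] at h'; exact absurd h'.symm (key y hy x hx).1
    · simp only [hR x hx, hR y hy, if_false] at h'
      split_ifs at h' with h1 h2 h2
      · rw [h1, h2]
      · exact (Lab.pend.inj h').2.2
  · rintro x (hx | hx) y (hy | hy)
    · simp only [hx, hy, if_true]; exact h.adj x hx y hy
    · simp only [hx, hR y hy, if_true, if_false]; exact (key x hx y hy).2
    · simp only [hy, hR x hx, if_true, if_false]; rw [SimpleGraph.adj_comm, G.adj_comm]; exact (key y hy x hx).2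
    · simp only [hR x hx, hR y hy, if_false]; exact key2 x hx y hy

/-- A layout of hexagonal cells in which only cut 0 may be fused. It serves to label the
surroundings of this cut. -/
def Layout.cut (φ : Bool) : Layout := ⟨fun _ => true, fun _ => true, fun _ => true, fun i => decide (i = 0) && φ⟩

theorem Layout.cut_normal (φ : Bool) : (Layout.cut φ).Normal := fun _ _ => ⟨rfl, rfl⟩

/-- The labels of a star of depth 2 at cut 0. -/
def IsStarLab (x : Lab N) : Prop := x = .hub 0 .mid ∨ (∃ n, x = .pend 0 .mid n) ∨ ∃ n m, x = .deep 0 n m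

theorem IsStarLab.not_isAtSpot {x : Lab N} (h : IsStarLab x) {s : Spot} (hs : s ≠ .mid) : ¬
    IsAtSpot s x := by
  rcases h with rfl | ⟨n, rfl⟩ | ⟨n, m, rfl⟩ <;> rintro (h | ⟨n, h⟩) <;> cases h <;> exact hs rfl

theorem IsStarLab.eq_mid_of_adj {x : Lab N} (h : IsStarLab x) {w : Layout} {s : Spot}
    (hs : s ≠ .mid)
    (h' : (w.graph N).Adj x (.hub 0 s)) : x = .hub 0 .mid := by
  rcases h with rfl | ⟨n, rfl⟩ | ⟨n, m, rfl⟩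
  · rfl
  · rw [Layout.adj_pend] at h'
    rcases h' with h' | ⟨-, -, m, h'⟩
    · exact absurd (Lab.hub.inj h'.1).2 hs
    · cases h'
  · rw [Layout.adj_deep] at h'
    cases h'.2

theorem IsStarLab.within {x : Lab N} (h : IsStarLab x) {K : Set ℤ} (hK : 0 ∈ K) : x.Within K := by
  rcases h with rfl | ⟨n, rfl⟩ | ⟨n, m, rfl⟩ <;> exact hK

/-- In the absence of short cycles the ball of radius 2 is a tree, and can be put at the middle
hub of a cut. At a fused cut only radius 1 is possible. -/
theorem InClassX.exists_star (hX : InClassX G) {v : V} {T : Set V} (φ : Bool) (hv : v ∈ T)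
    (hT : ∀ x ∈ T, x = v ∨ G.Adj v x ∨ (φ = false ∧ ∃ y ∈ T, G.Adj v y ∧ G.Adj y x)) :
    ∃ f : V → Lab V, Labels G (Layout.cut φ) T f ∧ f v = .hub 0 .mid ∧ ∀ x ∈ T, IsStarLab (f x) :=
    by
  classical
  let f : V → Lab V := fun x => if x = v then .hub 0 .mid else if G.Adj v x then .pend 0 .mid x else
    if h : ∃ y ∈ T, G.Adj v y ∧ G.Adj y x then .deep 0 h.choose x else .deep 0 v x
  have hcases : ∀ x ∈ T, (x = v ∧ f x = .hub 0 .mid) ∨ (x ≠ v ∧ G.Adj v x ∧ f x = .pend 0 .mid x) ∨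
      (x ≠ v ∧ ¬ G.Adj v x ∧ φ = false ∧ ∃ y ∈ T, G.Adj v y ∧ G.Adj y x ∧ f x = .deep 0 y x) := by
    intro x hx
    by_cases h1 : x = v
    · exact .inl ⟨h1, if_pos h1⟩
    · by_cases h2 : G.Adj v x
      · exact .inr (.inl ⟨h1, h2, by simp only [f, h1, h2, if_true, if_false]⟩)
      · obtain ⟨h3, h4⟩ := ((hT x hx).resolve_left h1).resolve_left h2
        refine .inr (.inr ⟨h1, h2, h3, h4.choose, h4.choose_spec.1, h4.choose_spec.2.1, h4.choose_spec.2.2, ?_⟩)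
        simp only [f, h1, h2, if_false]
        exact dif_pos h4
  refine ⟨f, ⟨?_, ?_⟩, if_pos rfl, ?_⟩
  · intro x hx y hy h
    rcases hcases x hx with ⟨x1, e⟩ | ⟨x1, x2, e⟩ | ⟨x1, x2, x3, z, x4, x5, x6, e⟩ <;>
    rcases hcases y hy with ⟨y1, e'⟩ | ⟨y1, y2, e'⟩ | ⟨y1, y2, y3, t, y4, y5, y6, e'⟩ <;> rw [e, e'] at h
    · rw [x1, y1]
    · cases h
    · cases h
    · cases h
    · exact (Lab.pend.inj h).2.2
    · cases h
    · cases h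
    · cases h
    · exact (Lab.deep.inj h).2.2
  · intro x hx y hy
    have hf : φ = false → (Layout.cut φ).fused 0 = false := by rintro rfl; rfl
    rcases hcases x hx with ⟨x1, e⟩ | ⟨x1, x2, e⟩ | ⟨x1, x2, x3, z, x4, x5, x6, e⟩ <;>
    rcases hcases y hy with ⟨y1, e'⟩ | ⟨y1, y2, e'⟩ | ⟨y1, y2, y3, t, y4, y5, y6, e'⟩ <;> rw [e, e']
    · simp [x1, y1]
    · simp [Layout.adj_iff, Layout.Edge, x1, y2]
    · simp [Layout.adj_iff, Layout.Edge, x1, y2]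
    · simp [Layout.adj_iff, Layout.Edge, y1, x2.symm]
    · simp [Layout.adj_iff, Layout.Edge, hX.no3 x2.symm y2]
    · simp only [Layout.adj_iff, Layout.Edge, or_false, true_and, hf y3, and_true]
      constructor
      · rintro rfl; exact y6
      · intro h
        rcases hX.no4 x2 h y6.symm y5 with e | e
        · exact absurd e.symm y1
        · exact e
    · simp [Layout.adj_iff, Layout.Edge, y1]; exact fun h => x2 h.symm
    · simp only [Layout.adj_iff, Layout.Edge, false_or, true_and, hf x3, and_true]
      constructor
      · rintro rfl; exact x6.symm
      · intro h
        rcases hX.no4 y2 h.symm x6.symm x5 with e | e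
        · exact absurd e.symm x1
        · exact e
    · simp only [Layout.adj_iff, Layout.Edge, or_false, false_iff]
      exact fun h => hX.no5 x5 x6 h y6.symm y5
  · intro x hx
    rcases hcases x hx with ⟨x1, e⟩ | ⟨x1, x2, e⟩ | ⟨x1, x2, x3, z, x4, x5, x6, e⟩
    · exact .inl e
    · exact .inr (.inl ⟨_, e⟩)
    · exact .inr (.inr ⟨_, _, e⟩)

/-- The inner vertices of a cell are put into the hexagonal cell 0 between labelled corners. -/
theorem Labels.add_inner (hX : InClassX G) {a a₁ b₁ b b₂ a₂ : V} (hc : IsCell G a a₁ b₁ b b₂ a₂)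
    {w : Layout} {T : Set V} {f : V → Lab V}
    (h : Labels G w T f) (hhex : w.hex 0 = true) (hT : ∀ x ∈ T, x ∉ CellInner G a a₁ b₁ b b₂ a₂)
    (ha : a ∈ T) (ha₁ : a₁ ∈ T) (hb : b ∈ T) (hb₂ : b₂ ∈ T) (fa : f a = .hub 0 (w.aS 0))
    (fa₁ : f a₁ = .hub 0 (w.a1S 0))
    (fb : f b = .hub 1 (w.bS 0)) (fb₂ : f b₂ = .hub 1 (w.b2S 0))
    (hAB : ∀ x ∈ T, ∀ n, f x ≠ .A 0 n ∧ f x ≠ .B 0 n) :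
    ∃ g, Labels G w (T ∪ CellInner G a a₁ b₁ b b₂ a₂) g ∧ (∀ x ∈ T, g x = f x) ∧
      ∀ x ∈ CellInner G a a₁ b₁ b b₂ a₂, ∃ n, g x = .A 0 n ∨ g x = .B 0 n := by
  classical
  set I := CellInner G a a₁ b₁ b b₂ a₂
  have hx := hc.hex
  have hf1 := hx.far hX
  have hf2 := hx.rot.far hX
  have hf4 := hx.rot.rot.rot.far hX
  let P : V → V → Prop := fun x y => G.Adj a x ∧ G.Adj x y ∧ G.Adj y b ∧ x ≠ a₁ ∧ x ≠ a₂
  have hP : ∀ {x y}, P x y → OnlyNbrs G x a y ∧ OnlyNbrs G y x b := fun h => hc.other _ _ h.1 h.2.1 h.2.2.1 h.2.2.2.1 h.2.2.2.2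
  have hf3 := hx.rot.rot.far hX
  have hab : ∀ z, G.Adj a z → ¬ G.Adj z b := fun z h1 h2 => hX.no5 h1 h2 hx.cd.symm hx.bc.symm hx.ab
  have huniq : ∀ {x x' y}, P x y → P x' y → x = x' := by
    rintro x x' y ⟨h1, h2, h3, -, -⟩ ⟨k1, k2, -, -, -⟩
    rcases hX.no4 h1 h2 k2.symm k1 with e | e
    · rw [← e] at h3; exact absurd h3 hf1.2.1.2
    · exact e
  let k : V → Lab V := fun z => if z = a₂ then .A 0 none else if z = b₁ then .B 0 none else if G.Adj a z then .A 0 (some z)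
    else if h : ∃ x, P x z then .B 0 (some h.choose) else .A 0 none
  have kX : ∀ {x y}, P x y → k x = .A 0 (some x) := by
    intro x y p
    have h1 : x ≠ a₂ := p.2.2.2.2
    have h2 : x ≠ b₁ := by rintro rfl; exact hf1.1.2 p.1
    simp only [k, h1, h2, p.1, if_true, if_false]
  have hYb : ∀ {x y}, P x y → y ≠ a₂ ∧ y ≠ b₁ := by
    intro x y p
    constructor
    · rintro rfl; exact hf4.1.2 p.2.2.1.symm
    · rintro rfl
      rcases hc.only_b₁ _ p.2.1.symm with e | e
      · exact p.2.2.2.1 e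
      · exact hf1.2.1.2 (e ▸ p.1)
  have kY : ∀ {x y}, P x y → k y = .B 0 (some x) := by
    intro x y p
    obtain ⟨h1, h2⟩ := hYb p
    have h3 : ¬ G.Adj a y := fun h => hab y h p.2.2.1
    have h4 : ∃ x, P x y := ⟨x, p⟩
    simp only [k, h1, h2, h3, if_false]
    rw [dif_pos h4, huniq h4.choose_spec p]
  have ka₂ : k a₂ = .A 0 none := if_pos rfl
  have kb₁ : k b₁ = .B 0 none := by
    have : b₁ ≠ a₂ := hf3.2.1.1
    simp only [k, this, if_true, if_false]
  have hI : ∀ z ∈ I, z = a₂ ∨ z = b₁ ∨ (∃ y, P z y) ∨ ∃ x, P x z := by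
    rintro z (h | h | ⟨x, y, h1, h2, h3, h4, h5, rfl | rfl⟩)
    · exact .inr (.inl h)
    · exact .inl h
    · exact .inr (.inr (.inl ⟨y, h1, h2, h3, h4, h5⟩))
    · exact .inr (.inr (.inr ⟨x, h1, h2, h3, h4, h5⟩))
  have hIP : ∀ {x y}, P x y → x ∈ I ∧ y ∈ I := fun p =>
    ⟨.inr (.inr ⟨_, _, p.1, p.2.1, p.2.2.1, p.2.2.2.1, p.2.2.2.2, .inl rfl⟩), .inr (.inr ⟨_, _, p.1, p.2.1, p.2.2.1, p.2.2.2.1, p.2.2.2.2, .inr rfl⟩)⟩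
  have ea : ∀ x ∈ T, f x = .hub 0 (w.aS 0) ↔ x = a := fun x hx => ⟨fun e => h.inj x hx a ha (e.trans fa.symm), fun e => e ▸ fa⟩
  have ea₁ : ∀ x ∈ T, f x = .hub 0 (w.a1S 0) ↔ x = a₁ := fun x hx => ⟨fun e => h.inj x hx a₁ ha₁ (e.trans fa₁.symm), fun e => e ▸ fa₁⟩
  have eb : ∀ x ∈ T, f x = .hub (0 + 1) (w.bS 0) ↔ x = b := fun x hx => ⟨fun e => h.inj x hx b hb (e.trans fb.symm), fun e => e ▸ fb⟩
  have eb₂ : ∀ x ∈ T, f x = .hub (0 + 1) (w.b2S 0) ↔ x = b₂ := fun x hx => ⟨fun e => h.inj x hx b₂ hb₂ (e.trans fb₂.symm), fun e => e ▸ fb₂⟩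
  have hTI : ∀ x ∈ T, ∀ z ∈ I, f x ≠ k z ∧ ((w.graph V).Adj (k z) (f x) ↔ G.Adj z x) := by
    intro x hxT z hz
    rcases hI z hz with rfl | rfl | ⟨y, p⟩ | ⟨x', p⟩
    · rw [ka₂, Layout.adj_A_none, ea x hxT, eb₂ x hxT]
      refine ⟨(hAB x hxT _).1, fun e => ?_, hc.only_a₂ x |>.comp id |> fun h e => ⟨hhex, h e⟩⟩
      rcases e.2 with rfl | rfl
      · exact hx.fa
      · exact hx.ef.symm
    · rw [kb₁, Layout.adj_B_none, ea₁ x hxT, eb x hxT]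
      refine ⟨(hAB x hxT _).2, fun e => ?_, fun e => ⟨hhex, (hc.only_b₁ x e).symm⟩⟩
      rcases e.2 with rfl | rfl
      · exact hx.cd
      · exact hx.bc.symm
    · rw [kX p, Layout.adj_A_some, ea x hxT]
      refine ⟨(hAB x hxT _).1, fun e => ?_, fun e => ⟨hhex, ?_⟩⟩
      · rcases e.2 with rfl | e
        · exact p.1.symm
        · exact absurd e (hAB x hxT _).2
      · rcases (hP p).1 x e with e | e
        · exact .inl e
        · exact absurd (hIP p).2 (e ▸ hT x hxT)
    · rw [kY p, Layout.adj_B_some, eb x hxT]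
      refine ⟨(hAB x hxT _).2, fun e => ?_, fun e => ⟨hhex, ?_⟩⟩
      · rcases e.2 with rfl | e
        · exact p.2.2.1
        · exact absurd e (hAB x hxT _).1
      · rcases (hP p).2 x e with e | e
        · exact absurd (hIP p).1 (e ▸ hT x hxT)
        · exact .inl e
  have hk2 : ∀ x ∈ I, ∃ n, k x = .A 0 n ∨ k x = .B 0 n := by
    intro z hz
    rcases hI z hz with rfl | rfl | ⟨y, p⟩ | ⟨x', p⟩
    · exact ⟨_, .inl ka₂⟩
    · exact ⟨_, .inr kb₁⟩
    · exact ⟨_, .inl (kX p)⟩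
    · exact ⟨_, .inr (kY p)⟩
  have hno : ∀ z, z ∈ I → z ≠ a ∧ z ≠ a₁ ∧ z ≠ b ∧ z ≠ b₂ := fun z hz =>
    ⟨fun e => hT a ha (e ▸ hz), fun e => hT a₁ ha₁ (e ▸ hz), fun e => hT b hb (e ▸ hz), fun e => hT b₂ hb₂ (e ▸ hz)⟩
  have na₂ : ∀ z ∈ I, ¬ G.Adj a₂ z := fun z hz e => by
    rcases hc.only_a₂ z e with e | e
    · exact (hno z hz).1 e
    · exact (hno z hz).2.2.2 e
  have nb₁ : ∀ z ∈ I, ¬ G.Adj b₁ z := fun z hz e => by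
    rcases hc.only_b₁ z e with e | e
    · exact (hno z hz).2.1 e
    · exact (hno z hz).2.2.1 e
  have nX : ∀ {x y}, P x y → ∀ z ∈ I, G.Adj x z ↔ z = y := fun p z hz =>
    ⟨fun e => ((hP p).1 z e).resolve_left (hno z hz).1, fun e => e ▸ p.2.1⟩
  have nY : ∀ {x y}, P x y → ∀ z ∈ I, G.Adj y z ↔ z = x := fun p z hz =>
    ⟨fun e => ((hP p).2 z e).resolve_right (hno z hz).2.2.1, fun e => e ▸ p.2.1.symm⟩
  have hXY : ∀ {x y x' y'}, P x y → P x' y' → x ≠ y' := by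
    rintro x y x' y' p p' rfl
    exact hab _ p.1 p'.2.2.1
  have huniq' : ∀ {x y y'}, P x y → P x y' → y = y' := by
    rintro x y y' p p'
    exact ((nX p y' (hIP p').2).1 p'.2.1).symm
  have hII : ∀ x ∈ I, ∀ z ∈ I, (k x = k z → x = z) ∧ ((w.graph V).Adj (k x) (k z) ↔ G.Adj x z) := by
    intro x hxI z hz
    rcases hI x hxI with rfl | rfl | ⟨y, p⟩ | ⟨x', p⟩ <;> rcases hI z hz with rfl | rfl | ⟨y', p'⟩ | ⟨t, p'⟩
    · simp
    · rw [ka₂, kb₁]; simp [Layout.adj_iff, Layout.Edge, na₂ _ hz]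
    · rw [ka₂, kX p']; simp [Layout.adj_iff, Layout.Edge, na₂ _ hz]
    · rw [ka₂, kY p']; simp [Layout.adj_iff, Layout.Edge, na₂ _ hz]
    · rw [ka₂, kb₁]; simp [Layout.adj_iff, Layout.Edge, nb₁ _ hz]
    · simp
    · rw [kb₁, kX p']; simp [Layout.adj_iff, Layout.Edge, nb₁ _ hz]
    · rw [kb₁, kY p']; simp [Layout.adj_iff, Layout.Edge, nb₁ _ hz]
    · rw [ka₂, kX p, G.adj_comm]; simp [Layout.adj_iff, Layout.Edge, na₂ _ hxI]
    · rw [kb₁, kX p, G.adj_comm]; simp [Layout.adj_iff, Layout.Edge, nb₁ _ hxI]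
    · rw [kX p, kX p', nX p z hz]; simp [Layout.adj_iff, Layout.Edge, hXY p' p]
    · rw [kX p, kY p', nX p z hz]; simp [Layout.adj_iff, Layout.Edge, hhex]
      exact ⟨fun e => huniq' p' (e ▸ p), fun e => huniq p (e ▸ p')⟩
    · rw [ka₂, kY p, G.adj_comm]; simp [Layout.adj_iff, Layout.Edge, na₂ _ hxI]
    · rw [kb₁, kY p, G.adj_comm]; simp [Layout.adj_iff, Layout.Edge, nb₁ _ hxI]
    · rw [kY p, kX p', nY p z hz]; simp [Layout.adj_iff, Layout.Edge, hhex]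
    · rw [kY p, kY p', nY p z hz]; simp [Layout.adj_iff, Layout.Edge, (hXY p p').symm]
      rintro rfl; exact huniq' p p'
  let g : V → Lab V := fun x => if x ∈ T then f x else k x
  have hIT : ∀ x ∈ I, x ∉ T := fun x h h' => hT x h' h
  refine ⟨g, ⟨?_, ?_⟩, fun x hx => if_pos hx, ?_⟩
  · rintro x (hx | hx) y (hy | hy) e
    · simp only [g, hx, hy, if_true] at e; exact h.inj x hx y hy e
    · simp only [g, hx, hIT y hy, if_true, if_false] at e; exact absurd e (hTI x hx y hy).1
    · simp only [g, hy, hIT x hx, if_true, if_false] at e; exact absurd e.symm (hTI y hy x hx).1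
    · simp only [g, hIT x hx, hIT y hy, if_false] at e; exact (hII x hx y hy).1 e
  · rintro x (hx | hx) y (hy | hy)
    · simp only [g, hx, hy, if_true]; exact h.adj x hx y hy
    · simp only [g, hx, hIT y hy, if_true, if_false]; rw [SimpleGraph.adj_comm, G.adj_comm]; exact (hTI x hx y hy).2
    · simp only [g, hy, hIT x hx, if_true, if_false]; exact (hTI y hy x hx).2
    · simp only [g, hIT x hx, hIT y hy, if_false]; exact (hII x hx y hy).2
  · intro x hx
    simp only [g, hIT x hx, if_false]
    exact hk2 x hx

end

/-! ### Parts of a graph hanging at a vertex or an edge -/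

section
variable {V : Type u} {G : SimpleGraph V}

/-- The vertices that can be reached from `v` by walks that do not enter `F`. -/
def SimpleGraph.reach (G : SimpleGraph V) (F : Set V) (v : V) : Set V :=
  {x | Relation.ReflTransGen (fun x y => G.Adj x y ∧ y ∉ F) v x}

theorem SimpleGraph.mem_reach_self {F : Set V} {v : V} : v ∈ G.reach F v := Relation.ReflTransGen.refl

theorem SimpleGraph.mem_reach_of_adj {F : Set V} {v x y : V} (hx : x ∈ G.reach F v) (h : G.Adj x y)
    (hy : y ∉ F) :
    y ∈ G.reach F v := Relation.ReflTransGen.tail hx ⟨h, hy⟩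

theorem SimpleGraph.reach_subset {F T : Set V} {v : V} (hv : v ∈ T)
    (h : ∀ x ∈ T, ∀ y ∈ G.reach F v, G.Adj x y → y ∈ T) :
    G.reach F v ⊆ T := by
  intro x hx
  have hx' : Relation.ReflTransGen (fun x y => G.Adj x y ∧ y ∉ F) v x := hx
  induction hx' with
  | refl => exact hv
  | tail h1 h2 ih => exact h _ (ih h1) _ (mem_reach_of_adj h1 h2.1 h2.2) h2.1

theorem SimpleGraph.notMem_of_mem_reach {F : Set V} {v x : V} (hv : v ∉ F) (hx : x ∈ G.reach F v) :
    x ∉ F := by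
  have hx' : Relation.ReflTransGen (fun x y => G.Adj x y ∧ y ∉ F) v x := hx
  cases hx' with
  | refl => exact hv
  | tail h1 h2 => exact h2.2

/-- `S` is a part of `G` that is attached to the rest at vertices in `D` only. -/
def ClosedOff (G : SimpleGraph V) (S D : Set V) : Prop := ∀ x ∈ S, x ∉ D → ∀ y, G.Adj x y → y ∈ S

/-- All of `S` is reached from `v` within `S`: every set that contains `v` and is closed under
edges in `S` contains `S`. -/
def ConnFrom (G : SimpleGraph V) (S : Set V) (v : V) : Prop :=
  ∀ T : Set V, v ∈ T → (∀ x ∈ T, ∀ y ∈ S, G.Adj x y → y ∈ T) → S ⊆ T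

/-- `S` hangs at `v`, and `v` is the start of a path of length 3 outside `S`. This path is one leg
of an `S_{3,3,3}` at `v`. -/
structure HangsAtVertex (G : SimpleGraph V) (S : Set V) (v : V) : Prop where
  mem : v ∈ S
  closed : ClosedOff G S {v}
  conn : ConnFrom G S v
  leg : ∃ l₁ l₂ l₃, IsLeg G v l₁ l₂ l₃ ∧ l₁ ∉ S ∧ l₂ ∉ S ∧ l₃ ∉ S

/-- `S` hangs at the edge `p q`, which is in a hexagon otherwise outside `S`. The hexagon provides
a path of length 2 outside `S` at each end of the edge. -/
structure HangsAtEdge (G : SimpleGraph V) (S : Set V) (p q : V) : Prop where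
  mem : p ∈ S
  mem' : q ∈ S
  closed : ClosedOff G S {p, q}
  conn : ConnFrom G S p
  hex : ∃ c d e f, IsHex G p q c d e f ∧ c ∉ S ∧ d ∉ S ∧ e ∉ S ∧ f ∉ S

theorem ClosedOff.far {S D : Set V} (h : ClosedOff G S D) {x y : V} (hx : x ∈ S) (hxD : x ∉ D)
    (hy : y ∉ S) : Far G x y :=
  ⟨fun e => hy (e ▸ hx), fun e => hy (h x hx hxD y e)⟩

variable {a a₁ b₁ b b₂ a₂ : V}

theorem IsCell.corner_notMem (hX : InClassX G) (h : IsCell G a a₁ b₁ b b₂ a₂) : a ∉ CellInner G a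
    a₁ b₁ b b₂ a₂ ∧
    a₁ ∉ CellInner G a a₁ b₁ b b₂ a₂ ∧ b ∉ CellInner G a a₁ b₁ b b₂ a₂ ∧ b₂ ∉ CellInner G a a₁ b₁ b
    b₂ a₂ := by
  have hx := h.hex
  have hf1 := hx.far hX
  have hf2 := hx.rot.far hX
  have hf3 := hx.rot.rot.far hX
  refine ⟨?_, ?_, ?_, ?_⟩
  · rintro (e | e | ⟨x, y, h1, h2, h3, -, -, e | e⟩)
    · exact hf1.1.1 e
    · exact hx.fa.ne e.symm
    · exact h1.ne e
    · rw [← e] at h3; exact hf1.2.1.2 h3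
  · rintro (e | e | ⟨x, y, h1, h2, h3, h4, -, e | e⟩)
    · exact hx.bc.ne e
    · exact hf2.2.2.1 e
    · exact h4 e.symm
    · rw [← e] at h3; exact hf2.1.2 h3
  · rintro (e | e | ⟨x, y, h1, h2, h3, -, -, e | e⟩)
    · exact hx.cd.ne e.symm
    · exact hx.df e
    · rw [← e] at h1; exact hf1.2.1.2 h1
    · exact h3.ne e.symm
  · rintro (e | e | ⟨x, y, h1, h2, h3, h4, h5, e | e⟩)
    · exact hf3.1.1 e.symm
    · exact hx.ef.ne e
    · rw [← e] at h1; exact hf1.2.2.2 h1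
    · rcases hX.no4 h2 (e ▸ hx.ef) hx.fa h1.symm with e' | e'
      · exact h5 e'
      · rw [← e] at e'; exact hx.ea e'

theorem IsCell.nbr_inner (h : IsCell G a a₁ b₁ b b₂ a₂) {x y : V}
    (hx : x ∈ CellInner G a a₁ b₁ b b₂ a₂) (hxy : G.Adj x y) :
    y ∈ CellInner G a a₁ b₁ b b₂ a₂ ∨ y = a ∨ y = a₁ ∨ y = b ∨ y = b₂ := by
  rcases hx with rfl | rfl | ⟨x', y', h1, h2, h3, h4, h5, rfl | rfl⟩
  · rcases h.only_b₁ y hxy with e | e <;> simp [e]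
  · rcases h.only_a₂ y hxy with e | e <;> simp [e]
  · rcases (h.other _ _ h1 h2 h3 h4 h5).1 y hxy with rfl | rfl
    · simp
    · exact .inl (.inr (.inr ⟨_, _, h1, h2, h3, h4, h5, .inr rfl⟩))
  · rcases (h.other _ _ h1 h2 h3 h4 h5).2 y hxy with rfl | rfl
    · exact .inl (.inr (.inr ⟨_, _, h1, h2, h3, h4, h5, .inl rfl⟩))
    · simp

/-- The part of `G` to the right of a cell: the vertices that are reached from `b` outside the
left edge and the inner vertices. -/
def CellRight (G : SimpleGraph V) (a a₁ b₁ b b₂ a₂ : V) : Set V := G.reach (CellInner G a a₁ b₁ b b₂ a₂ ∪ {a, a₁}) b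

theorem IsCell.right_notMem (hX : InClassX G) (h : IsCell G a a₁ b₁ b b₂ a₂) {x : V}
    (hx : x ∈ CellRight G a a₁ b₁ b b₂ a₂) :
    x ∉ CellInner G a a₁ b₁ b b₂ a₂ ∧ x ≠ a ∧ x ≠ a₁ := by
  have hf1 := h.hex.far hX
  have hf2 := h.hex.rot.far hX
  have := SimpleGraph.notMem_of_mem_reach (by
    simp [hf1.2.1.1.symm, hf2.1.1.symm, (h.corner_notMem hX).2.2.1]) hx
  simpa [not_or, and_assoc, and_comm] using this

/-- The part to the right of a cell is not adjacent to the left edge; this is where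
`IsCell.not_reachable` is used. -/
theorem IsCell.right_nbr (hX : InClassX G) (h : IsCell G a a₁ b₁ b b₂ a₂) {x y : V}
    (hx : x ∈ CellRight G a a₁ b₁ b b₂ a₂) (hxy : G.Adj x y) :
    y ≠ a ∧ y ≠ a₁ := by
  set I := CellInner G a a₁ b₁ b b₂ a₂
  let H : SimpleGraph V :=
    { Adj := fun x y => G.Adj x y ∧ x ∉ I ∧ y ∉ I
      symm := ⟨fun x y h => ⟨h.1.symm, h.2.2, h.2.1⟩⟩
      loopless := ⟨fun x h => h.1.ne rfl⟩ }
  have hno := h.not_reachable hX (H := H) (fun x y => Iff.rfl)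
  obtain ⟨ca, ca₁, cb, cb₂⟩ := h.corner_notMem hX
  have hbx : H.Reachable b x := by
    have : G.reach (I ∪ {a, a₁}) b ⊆ {x | H.Reachable b x ∧ x ∉ I} := by
      refine SimpleGraph.reach_subset ⟨.refl _, cb⟩ ?_
      rintro z ⟨h1, h2⟩ t ht hzt
      have h3 := (h.right_notMem hX ht).1
      exact ⟨h1.trans (SimpleGraph.Adj.reachable ⟨hzt, h2, h3⟩), h3⟩
    exact (this hx).1
  have hxI := (h.right_notMem hX hx).1
  constructor
  · rintro rfl
    exact hno (hbx.trans (SimpleGraph.Adj.reachable ⟨hxy, hxI, ca⟩)).symm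
  · rintro rfl
    have h1 : H.Reachable a x := by
      have e1 : H.Adj a y := ⟨h.hex.ab, ca, ca₁⟩
      have e2 : H.Adj y x := ⟨hxy.symm, ca₁, hxI⟩
      exact e1.reachable.trans e2.reachable
    exact hno (h1.trans hbx.symm)

theorem IsCell.hangs_right (hX : InClassX G) (h : IsCell G a a₁ b₁ b b₂ a₂) : HangsAtEdge G
    (CellRight G a a₁ b₁ b b₂ a₂) b b₂ := by
  obtain ⟨ca, ca₁, cb, cb₂⟩ := h.corner_notMem hX
  have hf1 := h.hex.far hX
  have hf2 := h.hex.rot.far hX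
  refine ⟨SimpleGraph.mem_reach_self, ?_, ?_, ?_, a₂, a, a₁, b₁, h.hex.rot.rot.rot, ?_, ?_, ?_, ?_⟩
  · refine SimpleGraph.mem_reach_of_adj SimpleGraph.mem_reach_self h.hex.de ?_
    simp [cb₂, hf1.2.2.1.symm, hf2.2.1.1.symm]
  · intro x hx hxD y hxy
    refine SimpleGraph.mem_reach_of_adj hx hxy ?_
    obtain ⟨h1, h2⟩ := h.right_nbr hX hx hxy
    obtain ⟨h3, h4, h5⟩ := h.right_notMem hX hx
    simp only [Set.mem_union, Set.mem_insert_iff, Set.mem_singleton_iff, h1, h2, or_false]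
    intro hyI
    rcases h.nbr_inner hyI hxy.symm with e | e | e | e | e
    · exact h3 e
    · exact h4 e
    · exact h5 e
    · exact hxD (by simp [e])
    · exact hxD (by simp [e])
  · intro T hT h'
    exact SimpleGraph.reach_subset hT h'
  · exact fun e => (h.right_notMem hX e).1 (.inr (.inl rfl))
  · exact fun e => (h.right_notMem hX e).2.1 rfl
  · exact fun e => (h.right_notMem hX e).2.2 rfl
  · exact fun e => (h.right_notMem hX e).1 (.inl rfl)

/-- A part of `G` hanging at left corners of a cell contains the cell and everything to the right of it. -/
theorem IsCell.subset_of_closedOff (hX : InClassX G) (h : IsCell G a a₁ b₁ b b₂ a₂) {S D : Set V}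
    (hS : ClosedOff G S D)
    (hD : D ⊆ {a, a₁}) (ha : a ∈ S) (hb : b ∈ S) :
    a₁ ∈ S ∧ b₂ ∈ S ∧ CellInner G a a₁ b₁ b b₂ a₂ ⊆ S ∧ CellRight G a a₁ b₁ b b₂ a₂ ⊆ S := by
  have hf1 := h.hex.far hX
  have hf2 := h.hex.rot.far hX
  have hD' : ∀ x, x ≠ a → x ≠ a₁ → x ∉ D := fun x h1 h2 h3 => by
    rcases hD h3 with e | e
    · exact h1 e
    · exact h2 e
  have key : ∀ x y, G.Adj a x → G.Adj x y → G.Adj y b → x ∈ S ∧ y ∈ S := by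
    intro x y h1 h2 h3
    have hy : y ∈ S := hS b hb (hD' b hf1.2.1.1.symm hf2.1.1.symm) y h3.symm
    refine ⟨hS y hy (hD' y ?_ ?_) x h2.symm, hy⟩
    · rintro rfl; exact hf1.2.1.2 h3
    · rintro rfl; exact hf2.1.2 h3
  have k1 := key _ _ h.hex.ab h.hex.bc h.hex.cd
  have k2 := key _ _ h.hex.fa.symm h.hex.ef.symm h.hex.de.symm
  refine ⟨k1.1, k2.2, ?_, ?_⟩
  · rintro x (rfl | rfl | ⟨x', y', h1, h2, h3, h4, h5, rfl | rfl⟩)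
    · exact k1.2
    · exact k2.1
    · exact (key _ _ h1 h2 h3).1
    · exact (key _ _ h1 h2 h3).2
  · have : CellRight G a a₁ b₁ b b₂ a₂ ⊆ {x | x ∈ S ∧ x ∈ CellRight G a a₁ b₁ b b₂ a₂} := by
      refine SimpleGraph.reach_subset ⟨hb, SimpleGraph.mem_reach_self⟩ ?_
      rintro x ⟨h1, h2⟩ y hy hxy
      exact ⟨hS x h1 (hD' x (h.right_notMem hX h2).2.1 (h.right_notMem hX h2).2.2) y hxy, hy⟩
    exact fun x hx => (this hx).1

/-- A vertex to the left of a cell is far from the cell and what is to the right of it, with the exception of the left corners. -/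
theorem IsCell.far_of_left (hX : InClassX G) (h : IsCell G a a₁ b₁ b b₂ a₂) {x y : V} (hxa : x ≠ a)
    (hxa₁ : x ≠ a₁)
    (hxI : x ∉ CellInner G a a₁ b₁ b b₂ a₂) (hxR : x ∉ CellRight G a a₁ b₁ b b₂ a₂)
    (hy : y ∈ CellInner G a a₁ b₁ b b₂ a₂ ∨ y ∈ CellRight G a a₁ b₁ b b₂ a₂) : Far G x y := by
  have hh := h.hangs_right hX
  refine ⟨fun e => hy.elim (fun h => hxI (e ▸ h)) (fun h => hxR (e ▸ h)), fun hxy => ?_⟩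
  rcases hy with hy | hy
  · rcases h.nbr_inner hy hxy.symm with e | e | e | e | e
    · exact hxI e
    · exact hxa e
    · exact hxa₁ e
    · exact hxR (e ▸ hh.mem)
    · exact hxR (e ▸ hh.mem')
  · exact hxR (SimpleGraph.mem_reach_of_adj hy hxy.symm (by simp [hxI, hxa, hxa₁]))

end

/-! ### Assembling labels at a cell -/

section
variable {V : Type u} {G : SimpleGraph V} {a a₁ b₁ b b₂ a₂ : V}

/-- If one left corner has a path of length 2 outside `S` attached to it, then only pendant
vertices of `S` can be attached to the other one. Otherwise there is a `C₆^{+2l2}`. -/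
theorem IsCell.pendant (hX : InClassX G) (h : IsCell G a a₁ b₁ b b₂ a₂) {S D : Set V}
    (hS : ClosedOff G S D) (hD : D ⊆ {a, a₁})
    (ha : a ∈ S) (hb : b ∈ S) {v v' l₁ l₂ x y : V} (hv : (v = a ∧ v' = a₁) ∨ (v = a₁ ∧ v' = a))
    (hl : G.Adj v l₁) (hl' : G.Adj l₁ l₂) (hlv : l₂ ≠ v) (hl₁ : l₁ ∉ S) (hl₂ : l₂ ∉ S)
    (hxS : x ∈ S) (hx : G.Adj v' x) (hxv : x ≠ v) (hxI : x ∉ CellInner G a a₁ b₁ b b₂ a₂)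
    (hxy : G.Adj x y) : y = v' := by
  by_contra hy
  obtain ⟨ha₁, hb₂, hI, hR⟩ := h.subset_of_closedOff hX hS hD ha hb
  have hvS : v ∈ S := by rcases hv with ⟨rfl, -⟩ | ⟨rfl, -⟩ <;> assumption
  have hvS' : v' ∈ S := by rcases hv with ⟨-, rfl⟩ | ⟨-, rfl⟩ <;> assumption
  have hD' : ∀ x, x ≠ v → x ≠ v' → x ∉ D := fun x h1 h2 h3 => by
    rcases hv with ⟨rfl, rfl⟩ | ⟨rfl, rfl⟩ <;> rcases hD h3 with e | e <;> first | exact h1 e | exact h2 e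
  have hfar : ∀ z, z ∈ S → z ≠ v → z ≠ v' → Far G l₁ z ∧ Far G l₂ z := fun z h1 h2 h3 =>
    ⟨(hS.far h1 (hD' z h2 h3) hl₁).symm, (hS.far h1 (hD' z h2 h3) hl₂).symm⟩
  have hxR : x ∉ CellRight G a a₁ b₁ b b₂ a₂ := fun e => by
    have := h.right_nbr hX e hx.symm
    rcases hv with ⟨-, rfl⟩ | ⟨-, rfl⟩
    exacts [this.2 rfl, this.1 rfl]
  have hne : ∀ z, z ≠ v → z ≠ v' → z ≠ a ∧ z ≠ a₁ := fun z h1 h2 => by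
    rcases hv with ⟨rfl, rfl⟩ | ⟨rfl, rfl⟩
    exacts [⟨h1, h2⟩, ⟨h2, h1⟩]
  obtain ⟨c, d, e, f, hh, hc⟩ : ∃ c d e f, IsHex G v v' c d e f ∧ ∀ z ∈ [c, d, e, f],
      z ∈ CellInner G a a₁ b₁ b b₂ a₂ ∨ z ∈ CellRight G a a₁ b₁ b b₂ a₂ := by
    have i1 : b₁ ∈ CellInner G a a₁ b₁ b b₂ a₂ := .inl rfl
    have i2 : a₂ ∈ CellInner G a a₁ b₁ b b₂ a₂ := .inr (.inl rfl)
    have i3 := (h.hangs_right hX).mem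
    have i4 := (h.hangs_right hX).mem'
    rcases hv with ⟨rfl, rfl⟩ | ⟨rfl, rfl⟩
    · exact ⟨_, _, _, _, h.hex, by simp [i1, i2, i3, i4]⟩
    · exact ⟨_, _, _, _, h.hex.reflect, by simp [i1, i2, i3, i4]⟩
  have hxv' : x ≠ v' := hx.ne'
  have hxfar : ∀ z ∈ [c, d, e, f], Far G x z := fun z hz => h.far_of_left hX (hne x hxv hxv').1 (hne x hxv hxv').2 hxI hxR (hc z hz)
  have hyS : y ∈ S := hS x hxS (hD' x hxv hxv') y hxy
  have hyv : y ≠ v := by rintro rfl; exact hX.no3 hh.ab hx hxy.symm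
  have hyIR : ¬ (y ∈ CellInner G a a₁ b₁ b b₂ a₂ ∨ y ∈ CellRight G a a₁ b₁ b b₂ a₂) := fun e =>
    (h.far_of_left hX (hne x hxv hxv').1 (hne x hxv hxv').2 hxI hxR e).2 hxy
  have hyfar : ∀ z ∈ [c, d, e, f], Far G y z := fun z hz => h.far_of_left hX (hne y hyv hy).1 (hne y hyv hy).2
    (fun e => hyIR (.inl e)) (fun e => hyIR (.inr e)) (hc z hz)
  have hlfar : ∀ z ∈ [c, d, e, f], Far G l₁ z ∧ Far G l₂ z := by
    intro z hz
    have hzS : z ∈ S := (hc z hz).elim (fun e => hI e) (fun e => hR e)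
    obtain ⟨n1, n2, n3⟩ := hh.far hX
    obtain ⟨m1, m2, m3⟩ := hh.rot.far hX
    refine hfar z hzS ?_ ?_
    · rintro rfl
      simp only [List.mem_cons, List.not_mem_nil, or_false] at hz
      rcases hz with e | e | e | e
      exacts [n1.1 e, n2.1 e, n3.1 e, hh.fa.ne e.symm]
    · rintro rfl
      simp only [List.mem_cons, List.not_mem_nil, or_false] at hz
      rcases hz with e | e | e | e
      exacts [hh.bc.ne e, m1.1 e, m2.1 e, m3.1 e]
  refine hX.not_2l2 hh hl hl' hlv hx hxy hy ?_ ?_ ?_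
  · intro z hz t ht
    rcases List.mem_cons.1 ht with rfl | ht
    · simp only [List.mem_cons, List.not_mem_nil, or_false] at hz
      rcases hz with rfl | rfl
      · exact ⟨fun e => hl₁ (e ▸ hvS'), fun e => hX.no3 hl e hh.ab⟩
      · refine ⟨fun e => hl₂ (e ▸ hvS'), fun e => ?_⟩
        rcases hX.no4 hl hl' e hh.ab with e' | e'
        · exact hlv e'.symm
        · exact hl₁ (e' ▸ hvS')
    · simp only [List.mem_cons, List.not_mem_nil, or_false] at hz
      rcases hz with rfl | rfl
      exacts [(hlfar t ht).1, (hlfar t ht).2]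
  · intro z hz t ht
    rcases List.mem_cons.1 ht with rfl | ht
    · simp only [List.mem_cons, List.not_mem_nil, or_false] at hz
      rcases hz with rfl | rfl
      · exact ⟨hxv, fun e => hX.no3 hh.ab hx e.symm⟩
      · refine ⟨hyv, fun e => ?_⟩
        rcases hX.no4 hh.ab hx hxy e.symm with e' | e'
        · exact hxv e'.symm
        · exact hy e'.symm
    · simp only [List.mem_cons, List.not_mem_nil, or_false] at hz
      rcases hz with rfl | rfl
      exacts [hxfar t ht, hyfar t ht]
  · intro z hz t ht
    simp only [List.mem_cons, List.not_mem_nil, or_false] at hz ht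
    have k1 := hfar x hxS hxv hxv'
    have k2 := hfar y hyS hyv hy
    rcases hz with rfl | rfl <;> rcases ht with rfl | rfl
    exacts [k1.1, k2.1, k1.2, k2.2]

open Classical in
/-- A star of depth 2 at `v` (of depth 1 if the cut is fused) and a star of depth 1 at a neighbour
`q` of `v` are put at the two ends of the left edge of a hexagonal cell. -/
theorem InClassX.exists_star_with_partner (hX : InClassX G) {v q : V} {T Q : Set V} (φ : Bool)
    (hv : v ∈ T)
    (hT : ∀ x ∈ T, x = v ∨ G.Adj v x ∨ (φ = false ∧ ∃ y ∈ T, G.Adj v y ∧ G.Adj y x))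
    (hTQ : ∀ x ∈ T, x ∉ Q) (hq : q ∈ Q)
    (hQ : ∀ x ∈ Q, ∀ y ∈ Q, G.Adj x y ↔ (x = q ∧ y ≠ q) ∨ (y = q ∧ x ≠ q))
    (hcross : ∀ x ∈ T, ∀ y ∈ Q, G.Adj x y ↔ x = v ∧ y = q) :
    ∃ f : V → Lab V, Labels G (Layout.cut φ) (T ∪ Q) f ∧ f v = .hub 0 .mid ∧ f q = .hub 0
    (if φ then .lo else .hi) ∧
      ∀ x ∈ T ∪ Q, IsStarLab (f x) ∨ IsAtSpot (if φ then .lo else .hi) (f x) := by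
  obtain ⟨f, h1, h2, h3⟩ := hX.exists_star φ hv hT
  have hs : (if φ then Spot.lo else .hi) ≠ .mid := by cases φ <;> simp
  have := h1.add_partner (s := if φ then .lo else .hi) hTQ hv h2 hq hs (by cases φ <;> simp [Layout.cut])
    (fun x hx => (h3 x hx).not_isAtSpot hs) (fun x hx h => (h3 x hx).eq_mid_of_adj hs h) hQ hcross
  refine ⟨_, this, by simp [hv, h2], by simp [show q ∉ T from fun h => hTQ q h hq], ?_⟩
  rintro x (hx | hx)
  · simp only [hx, if_true]; exact .inl (h3 x hx)
  · simp only [show x ∉ T from fun h => hTQ x h hx, if_false]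
    by_cases hxq : x = q
    · simp only [hxq, if_true]; exact .inr (.inl rfl)
    · simp only [hxq, if_false]; exact .inr (.inr ⟨x, rfl⟩)

/-- Labels on both sides of a cell extend to the cell, when its corners are labelled by the ends
of suitable edges of the cuts. -/
theorem IsCell.assemble (hX : InClassX G) (h : IsCell G a a₁ b₁ b b₂ a₂) {wl wr : Layout}
    {L R : Set V} {f g : V → Lab V}
    (hwl : wl.Normal) (hwr : wr.Normal) (hl : Labels G wl L f) (hr : Labels G wr R g)
    (hf : ∀ x ∈ L, (f x).Within (Set.Iic 0)) (hg : ∀ x ∈ R, (g x).Within (Set.Ici 0))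
    (hLR : ∀ x ∈ L, x ∉ R)
    (hadj : ∀ x ∈ L, ∀ y ∈ R, ¬ G.Adj x y) (hLI : ∀ x ∈ L, x ∉ CellInner G a a₁ b₁ b b₂ a₂)
    (hRI : ∀ x ∈ R, x ∉ CellInner G a a₁ b₁ b b₂ a₂) (ha : a ∈ L) (ha₁ : a₁ ∈ L) (hb : b ∈ R)
    (hb₂ : b₂ ∈ R)
    (hfa : (f a = .hub 0 .mid ∧ f a₁ = .hub 0 (if wl.fused 0 then .lo else .hi)) ∨
      (f a₁ = .hub 0 .mid ∧ f a = .hub 0 (if wl.fused 0 then .lo else .hi)))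
    (hgb : (g b = .hub 0 .mid ∧ g b₂ = .hub 0 .lo) ∨ (g b₂ = .hub 0 .mid ∧ g b = .hub 0 .lo)) :
    ∃ (w : Layout) (k : V → Lab V), w.Normal ∧ w.fused 0 = wl.fused 0 ∧ Labels G w
    (L ∪ R ∪ CellInner G a a₁ b₁ b b₂ a₂) k ∧
      (∀ x ∈ L, k x = f x) ∧ (∀ x ∈ R, k x = (g x).shift 1) ∧ ∀ x ∈ CellInner G a a₁ b₁ b b₂ a₂, ∃
    n, k x = .A 0 n ∨ k x = .B 0 n := by
  classical
  have h1 := hl.merge (c := true) (am := decide (f a = .hub 0 .mid)) (bm := decide (g b = .hub 0 .mid)) hr hf hg hLR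
    (fun x hx y hy => by simp [hadj x hx y hy])
  set w := wl.merge wr true (decide (f a = .hub 0 .mid)) (decide (g b = .hub 0 .mid)) with hw
  have hR : ∀ x ∈ R, x ∉ L := fun x h h' => hLR x h' h
  have fus : w.fused 0 = wl.fused 0 := by simp [hw, Layout.merge]
  have eam : w.aMid 0 = decide (f a = .hub 0 .mid) := by simp [hw, Layout.merge]
  have ebm : w.bMid 0 = decide (g b = .hub 0 .mid) := by simp [hw, Layout.merge]
  have hs : (if wl.fused 0 then Spot.lo else .hi) ≠ .mid := by cases wl.fused 0 <;> simp
  have fa : (if a ∈ L then f a else (g a).shift 1) = .hub 0 (w.aS 0) := by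
    simp only [ha, if_true]
    rcases hfa with ⟨e1, e2⟩ | ⟨e1, e2⟩ <;> simp [Layout.aS, eam, fus, e1, e2, hs]
  have fa₁ : (if a₁ ∈ L then f a₁ else (g a₁).shift 1) = .hub 0 (w.a1S 0) := by
    simp only [ha₁, if_true]
    rcases hfa with ⟨e1, e2⟩ | ⟨e1, e2⟩ <;> simp [Layout.a1S, eam, fus, e1, e2, hs]
  have fb : (if b ∈ L then f b else (g b).shift 1) = .hub 1 (w.bS 0) := by
    simp only [hR b hb, if_false]
    rcases hgb with ⟨e1, e2⟩ | ⟨e1, e2⟩ <;> simp [Layout.bS, ebm, e1, e2, Lab.shift]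
  have fb₂ : (if b₂ ∈ L then f b₂ else (g b₂).shift 1) = .hub 1 (w.b2S 0) := by
    simp only [hR b₂ hb₂, if_false]
    rcases hgb with ⟨e1, e2⟩ | ⟨e1, e2⟩ <;> simp [Layout.b2S, ebm, e1, e2, Lab.shift]
  have hAB : ∀ x ∈ L ∪ R, ∀ n, (if x ∈ L then f x else (g x).shift 1) ≠ .A 0 n ∧ (if x ∈ L then f x else (g x).shift 1) ≠ .B 0 n := by
    rintro x (hx | hx) n
    · simp only [hx, if_true]
      have := hf x hx
      constructor <;> intro e <;> rw [e] at this <;> simp [Lab.Within] at this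
    · simp only [hR x hx, if_false]
      have := hg x hx
      constructor <;> intro e <;> cases hgx : g x <;> rw [hgx] at this e <;> simp [Lab.Within, Lab.shift] at this e <;> omega
  obtain ⟨k, h2, h3, h4⟩ := h1.add_inner hX h (by simp [hw, Layout.merge]) (by rintro x (hx | hx); exacts [hLI x hx, hRI x hx])
    (.inl ha) (.inl ha₁) (.inr hb) (.inr hb₂) fa fa₁ fb fb₂ hAB
  refine ⟨w, k, Layout.merge_normal hwl hwr (.inl rfl), fus, h2, fun x hx => ?_, fun x hx => ?_, h4⟩
  · rw [h3 x (.inl hx)]; simp [hx]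
  · rw [h3 x (.inr hx)]; simp [hR x hx]

end

/-! ### Extending labels across a cell -/

section
variable {V : Type u} {G : SimpleGraph V} {a a₁ b₁ b b₂ a₂ : V}

/-- `S` can be put to the right of cut 0, with `v` in the middle of it. The cut is unfused, and
the spot `lo` remains free for what is to the left of it. -/
def VertexLabels (G : SimpleGraph V) (S : Set V) (v : V) : Prop :=
  ∃ (w : Layout) (f : V → Lab V), w.Normal ∧ w.fused 0 = false ∧ Labels G w S f ∧ f v = .hub 0 .mid ∧
    (∀ x ∈ S, (f x).Within (Set.Ici 0)) ∧ ∀ x ∈ S, ¬ IsAtSpot .lo (f x)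

/-- `S` can be put to the right of cut 0, with `p q` as the right edge of the cell before it. The
cut may be fused or not. -/
def EdgeLabels (G : SimpleGraph V) (S : Set V) (p q : V) : Prop :=
  ∃ (w : Layout) (f : V → Lab V), w.Normal ∧ Labels G w S f ∧
    ((f p = .hub 0 .mid ∧ f q = .hub 0 .lo) ∨ (f q = .hub 0 .mid ∧ f p = .hub 0 .lo)) ∧ ∀ x ∈ S, (f x).Within (Set.Ici 0)

theorem _root_.Lab.Within.shift {N : Type v} {x : Lab N} (h : x.Within (Set.Ici 0)) :
    (x.shift 1).Within (Set.Ici 1) := by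
  cases x <;> simp [Lab.Within, Lab.shift] at * <;> omega

theorem _root_.Lab.Within.mono {N : Type v} {x : Lab N} {K K' : Set ℤ} (h : x.Within K)
    (hK : K ⊆ K') : x.Within K' := by
  cases x <;> simp only [Lab.Within] at * <;> first | exact hK h | exact ⟨hK h.1, hK h.2⟩

theorem IsAtSpot.not_within {N : Type v} {x : Lab N} {s : Spot} (h : IsAtSpot s x) : ¬ x.Within
    (Set.Ici 1) := by
  rcases h with rfl | ⟨n, rfl⟩ <;> simp [Lab.Within]

theorem IsAtSpot.within {N : Type v} {x : Lab N} {s : Spot} (h : IsAtSpot s x) {K : Set ℤ}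
    (hK : 0 ∈ K) : x.Within K := by
  rcases h with rfl | ⟨n, rfl⟩ <;> exact hK

/-- Labels for the part to the right of a cell extend to the cell together with a star of depth 2
(or 1 at a fused cut) at one left corner `v`, and a star of depth 1 at the other one `q`. -/
theorem IsCell.extend_left (hX : InClassX G) (h : IsCell G a a₁ b₁ b b₂ a₂) {S T Q : Set V}
    {v q : V} (φ : Bool)
    (hvq : (v = a ∧ q = a₁) ∨ (v = a₁ ∧ q = a)) (hv : v ∈ T)
    (hT : ∀ x ∈ T, x = v ∨ G.Adj v x ∨ (φ = false ∧ ∃ y ∈ T, G.Adj v y ∧ G.Adj y x))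
    (hTQ : ∀ x ∈ T, x ∉ Q) (hq : q ∈ Q)
    (hQ : ∀ x ∈ Q, ∀ y ∈ Q, G.Adj x y ↔ (x = q ∧ y ≠ q) ∨ (y = q ∧ x ≠ q))
    (hcross : ∀ x ∈ T, ∀ y ∈ Q, G.Adj x y ↔ x = v ∧ y = q)
    (hS : ∀ x, x ∈ S ↔ (x ∈ T ∨ x ∈ Q) ∨ x ∈ CellRight G a a₁ b₁ b b₂ a₂ ∨ x ∈ CellInner G a a₁ b₁
    b b₂ a₂)
    (hTI : ∀ x, x ∈ T ∨ x ∈ Q → x ∉ CellRight G a a₁ b₁ b b₂ a₂ ∧ x ∉ CellInner G a a₁ b₁ b b₂ a₂)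
    (hE : EdgeLabels G (CellRight G a a₁ b₁ b b₂ a₂) b b₂) :
    ∃ (w : Layout) (f : V → Lab V), w.Normal ∧ w.fused 0 = φ ∧ Labels G w S f ∧ f v = .hub 0 .mid ∧
      f q = .hub 0 (if φ then .lo else .hi) ∧ (∀ x ∈ S, (f x).Within (Set.Ici 0)) ∧
    (φ = false → ∀ x ∈ S, ¬ IsAtSpot .lo (f x)) := by
  obtain ⟨f, h1, h2, h3, h4⟩ := hX.exists_star_with_partner φ hv hT hTQ hq hQ hcross
  obtain ⟨wr, g, k1, k2, k3, k4⟩ := hE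
  have hh := h.hangs_right hX
  have fφ : (Layout.cut φ).fused 0 = φ := by simp [Layout.cut]
  have ha : a ∈ T ∪ Q ∧ a₁ ∈ T ∪ Q := by
    rcases hvq with ⟨rfl, rfl⟩ | ⟨rfl, rfl⟩
    exacts [⟨.inl hv, .inr hq⟩, ⟨.inr hq, .inl hv⟩]
  have hLw : ∀ x ∈ T ∪ Q, ∀ K : Set ℤ, 0 ∈ K → (f x).Within K := fun x hx K hK => (h4 x hx).elim (fun e => e.within hK) (fun e => e.within hK)
  obtain ⟨w, k, w1, w2, w3, w4, w5, w6⟩ := h.assemble hX (Layout.cut_normal φ) k1 h1 k2 (fun x hx => hLw x hx _ (by simp)) k4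
    (fun x hx => (hTI x hx).1) (fun x hx y hy hxy => by
      obtain ⟨e1, e2⟩ := h.right_nbr hX hy hxy.symm
      exact (h.far_of_left hX e1 e2 (hTI x hx).2 (hTI x hx).1 (.inr hy)).2 hxy) (fun x hx => (hTI x hx).2)
    (fun x hx => (h.right_notMem hX hx).1) ha.1 ha.2 hh.mem hh.mem' (by
      rw [fφ]
      rcases hvq with ⟨rfl, rfl⟩ | ⟨rfl, rfl⟩
      exacts [.inl ⟨h2, h3⟩, .inr ⟨h2, h3⟩]) k3
  have hS' : S = T ∪ Q ∪ CellRight G a a₁ b₁ b b₂ a₂ ∪ CellInner G a a₁ b₁ b b₂ a₂ := by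
    ext x; rw [hS]; simp only [Set.mem_union, or_assoc]
  rw [hS']
  refine ⟨w, k, w1, w2.trans fφ, w3, (w4 v (.inl hv)).trans h2, (w4 q (.inr hq)).trans h3, ?_, ?_⟩
  · rintro x ((hx | hx) | hx)
    · rw [w4 x hx]; exact hLw x hx _ (by simp)
    · rw [w5 x hx]; exact (k4 x hx).shift.mono (Set.Ici_subset_Ici.2 (by norm_num))
    · obtain ⟨n, e | e⟩ := w6 x hx <;> rw [e] <;> simp [Lab.Within]
  · rintro rfl x ((hx | hx) | hx) e
    · rw [w4 x hx] at e
      rcases h4 x hx with h' | h'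
      · exact h'.not_isAtSpot (by simp) e
      · rcases h' with h' | ⟨n, h'⟩ <;> rw [h'] at e <;> rcases e with e | ⟨m, e⟩ <;> simp at e
    · rw [w5 x hx] at e; exact e.not_within (k4 x hx).shift
    · obtain ⟨n, e' | e'⟩ := w6 x hx <;> rw [e'] at e <;> rcases e with e | ⟨m, e⟩ <;> cases e

/-- A hexagon through `p` within `S`, where `p` has a further neighbour, gives a cell with left
corner `p`; if `q` has a further neighbour as well, then `p q` is the left edge. -/
theorem InClassX.exists_cell_at (hX : InClassX G) {c d e f p q x : V} (h : IsHex G p q c d e f)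
    (hx : G.Adj p x) (hxq : x ≠ q) (hxf : x ≠ f)
   {S : Set V} (hp : p ∈ S) (hq : q ∈ S) (hc : c ∈ S) (hd : d ∈ S) (he : e ∈ S) (hf : f ∈ S) :
   ∃ a a₁ b₁ b b₂ a₂, IsCell G a a₁ b₁ b b₂ a₂ ∧ a ∈ S ∧ b ∈ S ∧ (p = a ∨ p = a₁) ∧
    (∀ y, G.Adj q y → y ≠ p → y ≠ c → (p = a ∧ q = a₁) ∨ (p = a₁ ∧ q = a)) := by
  obtain ⟨a, a₁, b₁, b, b₂, a₂, hc', ha, hb, hv⟩ := hX.exists_cell h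
  have hS : ∀ z ∈ [p, q, c, d, e, f], z ∈ S := by simp [*]
  have small : ∀ {v x y z : V}, G.Adj v x → G.Adj v y → G.Adj v z → x ≠ y → x ≠ z → y ≠ z → ¬ SmallDeg G v := by
    rintro v x y z h1 h2 h3 n1 n2 n3 ⟨s, t, hst⟩
    have := hst _ h1
    have := hst _ h2
    have := hst _ h3
    grind
  have hp' := hv p (by simp)
  have hq' := hv q (by simp)
  have sp := small h.ab h.fa.symm hx h.fb.symm hxq.symm hxf.symm
  have key : ∀ {a a₁ b₁ b b₂ a₂}, IsCell G a a₁ b₁ b b₂ a₂ → (p = a ∨ p = a₁) → (q = a ∨ q = a₁ ∨ q = b ∨ q = b₂ ∨ SmallDeg G q) →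
      (∀ y, G.Adj q y → y ≠ p → y ≠ c → (p = a ∧ q = a₁) ∨ (p = a₁ ∧ q = a)) := by
    intro a a₁ b₁ b b₂ a₂ h' hp hq y hy h1 h2
    have sq := small h.ab.symm h.bc hy h.ac h1.symm h2.symm
    have hne := h.ab.ne
    obtain ⟨n1, n2, n3⟩ := h'.hex.far hX
    obtain ⟨m1, m2, m3⟩ := h'.hex.rot.far hX
    have hab := h.ab
    rcases hp with rfl | rfl <;> rcases hq with rfl | rfl | rfl | rfl | hq
    · exact absurd rfl hne
    · exact .inl ⟨rfl, rfl⟩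
    · exact absurd hab n2.2
    · exact absurd hab n3.2
    · exact absurd hq sq
    · exact .inr ⟨rfl, rfl⟩
    · exact absurd rfl hne
    · exact absurd hab m1.2
    · exact absurd hab m2.2
    · exact absurd hq sq
  rcases hp' with hp' | hp' | hp' | hp' | hp'
  · exact ⟨a, a₁, b₁, b, b₂, a₂, hc', hS a ha, hS b hb, .inl hp', key hc' (.inl hp') hq'⟩
  · exact ⟨a, a₁, b₁, b, b₂, a₂, hc', hS a ha, hS b hb, .inr hp', key hc' (.inr hp') hq'⟩
  · exact ⟨_, _, _, _, _, _, hc'.flip hX, hS b hb, hS a ha, .inl hp', key (hc'.flip hX) (.inl hp') (by grind)⟩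
  · exact ⟨_, _, _, _, _, _, hc'.flip hX, hS b hb, hS a ha, .inr hp', key (hc'.flip hX) (.inr hp') (by grind)⟩
  · exact absurd hp' sp

end

/-! ### Parts hanging at a vertex -/

section
variable {V : Type u} {G : SimpleGraph V} {a a₁ b₁ b b₂ a₂ : V}

/-- Together with the path outside `S`, two legs in `S` would form an `S_{3,3,3}`. -/
theorem HangsAtVertex.not_two_legs (hX : InClassX G) {S : Set V} {v x y z x' y' z' : V}
    (hS : HangsAtVertex G S v)
    (h : IsLeg G v x y z) (h' : IsLeg G v x' y' z') (hx : x ∈ S) (hy : y ∈ S) (hz : z ∈ S)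
    (hx' : x' ∈ S) (hy' : y' ∈ S) (hz' : z' ∈ S)
    (hap : Apart G [x, y, z] [x', y', z']) : False := by
  obtain ⟨l₁, l₂, l₃, hl, n1, n2, n3⟩ := hS.leg
  have key : ∀ {x y z}, IsLeg G v x y z → x ∈ S → y ∈ S → z ∈ S → Apart G [l₁, l₂, l₃] [x, y, z] := by
    rintro x y z ⟨h1, h2, h3, h4, h5⟩ hx hy hz p hp q hq
    have hqS : q ∈ S ∧ q ∉ ({v} : Set V) := by
      simp only [List.mem_cons, List.not_mem_nil, or_false] at hq
      rcases hq with rfl | rfl | rfl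
      · exact ⟨hx, h1.ne'⟩
      · exact ⟨hy, h4.symm⟩
      · refine ⟨hz, ?_⟩
        rintro rfl
        exact hX.no3 h1 h2 h3.symm
    have hpS : p ∉ S := by
      simp only [List.mem_cons, List.not_mem_nil, or_false] at hp
      rcases hp with rfl | rfl | rfl <;> assumption
    exact (hS.closed.far hqS.1 hqS.2 hpS).symm
  exact hX.not_three_legs hl h h' (key h hx hy hz) (key h' hx' hy' hz') hap

/-- A connected part is within distance 2 of `v`, or contains a path of length 3 from `v`. -/
theorem ConnFrom.star_or_leg {T : Set V} {v : V} (h : ConnFrom G T v) (hv : v ∈ T) :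
    (∀ x ∈ T, x = v ∨ G.Adj v x ∨ ∃ y ∈ T, G.Adj v y ∧ G.Adj y x) ∨ ∃ x ∈ T, ∃ y ∈ T, ∃ z ∈ T,
    IsLeg G v x y z := by
  by_contra! hno
  obtain ⟨⟨x₀, h0, h1⟩, h2⟩ := hno
  have := h {x | x ∈ T ∧ (x = v ∨ G.Adj v x ∨ ∃ y ∈ T, G.Adj v y ∧ G.Adj y x)} ⟨hv, .inl rfl⟩ ?_ h0
  · rcases this.2 with e | e | ⟨y, hy, e1, e2⟩
    exacts [h1.1 e, h1.2.1 e, h1.2.2 y hy e1 e2]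
  · rintro x ⟨hx, hx'⟩ y hy hxy
    refine ⟨hy, ?_⟩
    by_contra! hc
    rcases hx' with rfl | e | ⟨t, ht, e1, e2⟩
    · exact hc.2.1 hxy
    · exact hc.2.2 x hx e hxy
    · refine h2 t ht x hx y hy ⟨e1, e2, hxy, ?_, ?_⟩
      · rintro rfl; exact hc.2.1 hxy
      · rintro rfl; exact hc.2.1 e1

/-- The case of a bridge `v x` which starts a leg in `S`. By induction there are labels for what
hangs at `x`. The remainder of `S` contains no further leg, hence is a star of depth 2, which is
put on the other side of an edge cell. -/
theorem HangsAtVertex.labels_of_bridge (hX : InClassX G) {S : Set V} {v x y z : V}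
    (hS : HangsAtVertex G S v)
    (h : IsLeg G v x y z) (hx : x ∈ S) (hy : y ∈ S) (hz : z ∈ S)
    (hbr : ∀ t ∈ G.reach {v} x, G.Adj v t → t = x)
    (ih : ∀ Z x, Z ⊂ S → HangsAtVertex G Z x → VertexLabels G Z x) : VertexLabels G S v := by
  set Z := G.reach {v} x
  have hvx := h.1
  have hvZ : ∀ t ∈ Z, t ≠ v := fun t ht => SimpleGraph.notMem_of_mem_reach (F := {v}) hvx.ne' ht
  have hZS : Z ⊆ S := by
    have : Z ⊆ {t | t ∈ S ∧ t ∈ Z} := SimpleGraph.reach_subset ⟨hx, SimpleGraph.mem_reach_self⟩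
      (fun s hs t ht hst => ⟨hS.closed s hs.1 (hvZ s hs.2) t hst, ht⟩)
    exact fun t ht => (this ht).1
  have hZn : ∀ t ∈ Z, ∀ s, G.Adj t s → s ∉ Z → t = x ∧ s = v := by
    intro t ht s hts hs
    have : s = v := by
      by_contra hsv
      exact hs (SimpleGraph.mem_reach_of_adj ht hts hsv)
    rw [this] at hts ⊢
    exact ⟨hbr t ht hts.symm, rfl⟩
  have hxZ : x ∈ Z := SimpleGraph.mem_reach_self
  have hyZ : y ∈ Z := SimpleGraph.mem_reach_of_adj hxZ h.2.1 h.2.2.2.1.symm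
  have hzZ : z ∈ Z := SimpleGraph.mem_reach_of_adj hyZ h.2.2.1 (by rintro rfl; exact hX.no3 h.1 h.2.1 h.2.2.1.symm)
  obtain ⟨l₁, l₂, l₃, hl, n1, n2, n3⟩ := hS.leg
  have hZ : HangsAtVertex G Z x := by
    refine ⟨hxZ, ?_, ?_, v, l₁, l₂, ⟨hvx.symm, hl.1, hl.2.1, ?_, hl.2.2.2.1⟩, fun e => hvZ v e rfl, fun e => n1 (hZS e), fun e => n2 (hZS e)⟩
    · intro t ht htx s hts
      by_contra hs
      exact htx (hZn t ht s hts hs).1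
    · exact fun T hT h' => SimpleGraph.reach_subset hT h'
    · rintro rfl; exact n1 hx
  obtain ⟨w, g, w1, w2, w3, w4, w5, w6⟩ := ih Z x ⟨hZS, fun e => hvZ v (e hS.mem) rfl⟩ hZ
  have hT : ConnFrom G (S \ Z) v := by
    intro T hvT hT t ht
    have := hS.conn (T ∪ Z) (.inl hvT) ?_ ht.1
    · exact this.resolve_right ht.2
    · rintro s (hs | hs) t ht hst
      · by_cases h' : t ∈ Z
        · exact .inr h'
        · exact .inl (hT s hs t ⟨ht, h'⟩ hst)
      · by_cases h' : t ∈ Z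
        · exact .inr h'
        · left; rw [(hZn s hs t hst h').2]; exact hvT
  have hvT : v ∈ S \ Z := ⟨hS.mem, fun e => hvZ v e rfl⟩
  have hstar : ∀ t ∈ S \ Z, t = v ∨ G.Adj v t ∨ ∃ y ∈ S \ Z, G.Adj v y ∧ G.Adj y t := by
    refine (hT.star_or_leg hvT).resolve_right ?_
    rintro ⟨x', hx', y', hy', z', hz', h'⟩
    refine hS.not_two_legs hX h h' hx hy hz hx'.1 hy'.1 hz'.1 ?_
    intro p hp q hq
    have hpZ : p ∈ Z := by
      simp only [List.mem_cons, List.not_mem_nil, or_false] at hp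
      rcases hp with rfl | rfl | rfl <;> assumption
    have hqZ : q ∉ Z ∧ q ≠ v := by
      simp only [List.mem_cons, List.not_mem_nil, or_false] at hq
      rcases hq with rfl | rfl | rfl
      · exact ⟨hx'.2, h'.1.ne'⟩
      · exact ⟨hy'.2, h'.2.2.2.1.symm⟩
      · refine ⟨hz'.2, ?_⟩
        rintro rfl
        exact hX.no3 h'.1 h'.2.1 h'.2.2.1.symm
    exact ⟨fun e => hqZ.1 (e ▸ hpZ), fun e => hqZ.2 (hZn p hpZ q e hqZ.1).2⟩
  obtain ⟨f, f1, f2, f3⟩ := hX.exists_star false hvT (fun t ht => by simpa using hstar t ht)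
  have hm := f1.merge (c := false) (am := true) (bm := true) w3 (fun t ht => (f3 t ht).within (by simp)) w5 (fun t ht => ht.2) ?_
  · have e : S = S \ Z ∪ Z := by rw [Set.sdiff_union_of_subset hZS]
    rw [e]
    refine ⟨_, _, Layout.merge_normal (Layout.cut_normal _) w1 (.inr ⟨by simp [Layout.cut], w2⟩), by simp [Layout.merge, Layout.cut], hm, by simp only [hvT, if_true, f2], ?_, ?_⟩
    · intro t ht
      by_cases h' : t ∈ S \ Z
      · simp only [h', if_true]; exact (f3 t h').within (by simp)
      · have := ht.resolve_left h'
        simp only [h', if_false]; exact (w5 t this).shift.mono (Set.Ici_subset_Ici.2 (by norm_num))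
    · intro t ht
      by_cases h' : t ∈ S \ Z
      · simp only [h', if_true]; exact (f3 t h').not_isAtSpot (by simp)
      · have := ht.resolve_left h'
        simp only [h', if_false]; exact fun e => e.not_within (w5 t this).shift
  · intro t ht s hs
    constructor
    · intro e
      obtain ⟨rfl, rfl⟩ := hZn s hs t e.symm ht.2
      exact ⟨rfl, f2, w4⟩
    · rintro ⟨-, e1, e2⟩
      rw [f1.inj t ht v hvT (e1.trans f2.symm), w3.inj s hs x hxZ (e2.trans w4.symm)]
      exact hvx

/-- The case of a cell with left corner `v`. By induction there are labels for what is to the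
right of it. Only pendant vertices are attached to the other left corner by `IsCell.pendant`, and
only a star of depth 2 to `v` itself, because a path through the cell is a leg at `v`. -/
theorem HangsAtVertex.labels_of_cell (hX : InClassX G) {S : Set V} {v : V}
    (hS : HangsAtVertex G S v)
    (h : IsCell G a a₁ b₁ b b₂ a₂) (hv : v = a ∨ v = a₁) (ha : a ∈ S) (hb : b ∈ S)
    (ih : ∀ Z p q, Z ⊂ S → HangsAtEdge G Z p q → EdgeLabels G Z p q) : VertexLabels G S v := by
  have hD : ({v} : Set V) ⊆ {a, a₁} := by rcases hv with rfl | rfl <;> simp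
  obtain ⟨ha₁, hb₂, hI, hR⟩ := h.subset_of_closedOff hX hS.closed hD ha hb
  set I := CellInner G a a₁ b₁ b b₂ a₂
  set R := CellRight G a a₁ b₁ b b₂ a₂
  obtain ⟨q, hvq⟩ : ∃ q, (v = a ∧ q = a₁) ∨ (v = a₁ ∧ q = a) := by
    rcases hv with rfl | rfl
    exacts [⟨_, .inl ⟨rfl, rfl⟩⟩, ⟨_, .inr ⟨rfl, rfl⟩⟩]
  have hne : ∀ z, z ≠ v → z ≠ q → z ≠ a ∧ z ≠ a₁ := fun z h1 h2 => by
    rcases hvq with ⟨rfl, rfl⟩ | ⟨rfl, rfl⟩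
    exacts [⟨h1, h2⟩, ⟨h2, h1⟩]
  have hvq' : G.Adj v q := by
    rcases hvq with ⟨rfl, rfl⟩ | ⟨rfl, rfl⟩
    exacts [h.hex.ab, h.hex.ab.symm]
  have hqS : q ∈ S := by rcases hvq with ⟨-, rfl⟩ | ⟨-, rfl⟩ <;> assumption
  have hRn : ∀ x ∈ R, x ∉ I ∧ x ≠ v ∧ x ≠ q ∧ ¬ G.Adj x v ∧ ¬ G.Adj x q := by
    intro x hx
    have h1 := h.right_notMem hX hx
    have h2 : ∀ y, G.Adj x y → _ := fun y => h.right_nbr hX hx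
    rcases hvq with ⟨rfl, rfl⟩ | ⟨rfl, rfl⟩
    · exact ⟨h1.1, h1.2.1, h1.2.2, fun e => (h2 _ e).1 rfl, fun e => (h2 _ e).2 rfl⟩
    · exact ⟨h1.1, h1.2.2, h1.2.1, fun e => (h2 _ e).2 rfl, fun e => (h2 _ e).1 rfl⟩
  have hIn : ∀ x ∈ I, x ≠ v ∧ x ≠ q := by
    intro x hx
    obtain ⟨h1, h2, -, -⟩ := h.corner_notMem hX
    rcases hvq with ⟨rfl, rfl⟩ | ⟨rfl, rfl⟩
    · exact ⟨fun e => h1 (e.subst (motive := (· ∈ I)) hx), fun e => h2 (e.subst (motive := (· ∈ I)) hx)⟩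
    · exact ⟨fun e => h2 (e.subst (motive := (· ∈ I)) hx), fun e => h1 (e.subst (motive := (· ∈ I)) hx)⟩
  have hfar : ∀ x, x ≠ v → x ≠ q → x ∉ I → x ∉ R → ∀ y, y ∈ I ∨ y ∈ R → Far G x y := fun x h1 h2 h3 h4 y hy =>
    h.far_of_left hX (hne x h1 h2).1 (hne x h1 h2).2 h3 h4 hy
  obtain ⟨l₁, l₂, l₃, hl, n1, n2, n3⟩ := hS.leg
  -- `Q` is the star at the left corner `q`, and `T` is what hangs at `v` without meeting the
  -- cell
  let Q : Set V := {x | x = q ∨ (x ∈ S ∧ G.Adj q x ∧ x ≠ v ∧ x ∉ I)}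
  have hQS : Q ⊆ S := by rintro x (rfl | hx); exacts [hqS, hx.1]
  have hQR : ∀ x ∈ Q, x ∉ R := by
    rintro x (rfl | hx) hxR
    · exact (hRn x hxR).2.2.1 rfl
    · exact (hRn x hxR).2.2.2.2 hx.2.1.symm
  have hQI : ∀ x ∈ Q, x ∉ I := by
    rintro x (rfl | hx) hxI
    · exact (hIn x hxI).2 rfl
    · exact hx.2.2.2 hxI
  have hpend : ∀ x ∈ Q, x ≠ q → ∀ y, G.Adj x y → y = q := by
    rintro x (rfl | hx) hxq y hxy
    · exact absurd rfl hxq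
    · exact h.pendant hX hS.closed hD ha hb hvq hl.1 hl.2.1 hl.2.2.2.1.symm n1 n2 hx.1 hx.2.1 hx.2.2.1 hx.2.2.2 hxy
  let T : Set V := {x | x ∈ S ∧ x ∉ Q ∧ x ∉ R ∧ x ∉ I}
  have hvT : v ∈ T := by
    refine ⟨hS.mem, ?_, fun e => (hRn v e).2.1 rfl, fun e => (hIn v e).1 rfl⟩
    rintro (e | e)
    · exact hvq'.ne e
    · exact e.2.2.1 rfl
  have hcase : ∀ x ∈ S, x ∈ T ∨ x ∈ Q ∨ x ∈ R ∨ x ∈ I := by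
    intro x hx
    by_contra! hc
    exact hc.1 ⟨hx, hc.2.1, hc.2.2.1, hc.2.2.2⟩
  have hTq : ∀ x ∈ T, G.Adj x q → x = v := by
    intro x hx e
    by_contra hxv
    exact hx.2.1 (.inr ⟨hx.1, e.symm, hxv, hx.2.2.2⟩)
  have hTfar : ∀ x ∈ T, x ≠ v → ∀ y, y ∈ I ∨ y ∈ R → Far G x y := fun x hx hxv => hfar x hxv (fun e => hx.2.1 (.inl e)) hx.2.2.2 hx.2.2.1
  have hconn : ConnFrom G T v := by
    intro T' hv' hT' x hx
    have := hS.conn {x | x ∈ T → x ∈ T'} (fun _ => hv') ?_ hx.1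
    · exact this hx
    · intro s hs t ht hst htT
      by_cases hsS : s ∈ S
      swap
      · by_cases htv : t = v
        · rw [htv]; exact hv'
        · exact absurd hst (fun e => (hS.closed.far ht htv hsS).2 e.symm)
      by_cases htv : t = v
      · rw [htv]; exact hv'
      rcases hcase s hsS with h' | h' | h' | h'
      · exact hT' s (hs h') t htT hst
      · by_cases hsq : s = q
        · exact absurd (hTq t htT (hsq ▸ hst.symm)) htv
        · exact absurd (.inl (hpend s h' hsq t hst)) htT.2.1
      · exact absurd hst.symm (hTfar t htT htv s (.inr h')).2
      · exact absurd hst.symm (hTfar t htT htv s (.inl h')).2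
  have hh := h.hangs_right hX
  obtain ⟨m₁, m₂, m₃, hm, k1, k2, k3⟩ : ∃ m₁ m₂ m₃, IsLeg G v m₁ m₂ m₃ ∧ (m₁ ∈ I ∨ m₁ ∈ R) ∧ (m₂ ∈ I ∨ m₂ ∈ R) ∧ (m₃ ∈ I ∨ m₃ ∈ R) := by
    rcases hv with rfl | rfl
    · exact ⟨a₂, b₂, b, ⟨h.hex.fa.symm, h.hex.ef.symm, h.hex.de.symm, h.hex.ea.symm, h.hex.df.symm⟩, .inl (.inr (.inl rfl)), .inr hh.mem', .inr hh.mem⟩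
    · exact ⟨b₁, b, b₂, ⟨h.hex.bc, h.hex.cd, h.hex.de, h.hex.bd, h.hex.ce⟩, .inl (.inl rfl), .inr hh.mem, .inr hh.mem'⟩
  have hIRS : ∀ x, x ∈ I ∨ x ∈ R → x ∈ S := fun x hx => hx.elim (fun e => hI e) (fun e => hR e)
  have hstar : ∀ t ∈ T, t = v ∨ G.Adj v t ∨ ∃ y ∈ T, G.Adj v y ∧ G.Adj y t := by
    refine (hconn.star_or_leg hvT).resolve_right ?_
    rintro ⟨x', hx', y', hy', z', hz', h'⟩
    refine hS.not_two_legs hX h' hm hx'.1 hy'.1 hz'.1 (hIRS _ k1) (hIRS _ k2) (hIRS _ k3) ?_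
    intro p hp r hr
    have hpT : p ∈ T ∧ p ≠ v := by
      simp only [List.mem_cons, List.not_mem_nil, or_false] at hp
      rcases hp with rfl | rfl | rfl
      · exact ⟨hx', h'.1.ne'⟩
      · exact ⟨hy', h'.2.2.2.1.symm⟩
      · refine ⟨hz', ?_⟩
        rintro rfl
        exact hX.no3 h'.1 h'.2.1 h'.2.2.1.symm
    have hrI : r ∈ I ∨ r ∈ R := by
      simp only [List.mem_cons, List.not_mem_nil, or_false] at hr
      rcases hr with rfl | rfl | rfl <;> assumption
    exact hTfar p hpT.1 hpT.2 r hrI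
  obtain ⟨w, f, w1, w2, w3, w4, w5, w6, w7⟩ := h.extend_left hX (S := S) (T := T) (Q := Q) false hvq hvT (fun t ht => by simpa using hstar t ht)
    (fun x hx => hx.2.1) (.inl rfl) (fun x hx y hy => by
      constructor
      · intro e
        by_cases hxq : x = q
        · exact .inl ⟨hxq, fun h => e.ne (hxq.trans h.symm)⟩
        · exact .inr ⟨hpend x hx hxq y e, hxq⟩
      · rintro (⟨rfl, e⟩ | ⟨rfl, e⟩)
        · exact (hy.resolve_left e).2.1
        · exact (hx.resolve_left e).2.1.symm) (fun x hx y hy => by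
      constructor
      · intro e
        by_cases hyq : y = q
        · exact ⟨hTq x hx (hyq ▸ e), hyq⟩
        · exact absurd (.inl (hpend y hy hyq x e.symm)) hx.2.1
      · rintro ⟨rfl, rfl⟩; exact hvq') (fun x => by
      constructor
      · intro hx
        rcases hcase x hx with e | e | e | e
        exacts [.inl (.inl e), .inl (.inr e), .inr (.inl e), .inr (.inr e)]
      · rintro ((e | e) | e | e)
        exacts [e.1, hQS e, hR e, hI e]) (fun x hx => by
      rcases hx with e | e
      exacts [e.2.2, ⟨hQR x e, hQI x e⟩]) (ih R b b₂ ⟨hR, fun e => (hRn v (e hS.mem)).2.1 rfl⟩ hh)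
  exact ⟨w, f, w1, w2, w3, w4, w6, w7 rfl⟩

end

/-! ### Parts hanging at an edge -/

section
variable {V : Type u} {G : SimpleGraph V} {a a₁ b₁ b b₂ a₂ : V}

theorem HangsAtEdge.symm (hX : InClassX G) {S : Set V} {p q : V} (h : HangsAtEdge G S p q) :
    HangsAtEdge G S q p := by
  obtain ⟨c, d, e, f, hh, hc, hd, he, hf⟩ := h.hex
  refine ⟨h.mem', h.mem, by rw [Set.pair_comm]; exact h.closed, ?_, f, e, d, c, hh.reflect, hf, he, hd, hc⟩
  intro T hT hT'
  exact h.conn T (hT' q hT p h.mem hh.ab.symm) hT'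

theorem EdgeLabels.symm {S : Set V} {p q : V} : EdgeLabels G S p q → EdgeLabels G S q p := by
  rintro ⟨w, f, h1, h2, h3, h4⟩
  exact ⟨w, f, h1, h2, h3.symm, h4⟩

/-- The case of a cell with left edge `p q`. As there are paths of length 2 outside `S` at both
ends, only pendant vertices of `S` are attached to `p` and `q` outside the cell, so that these fit
at a fused cut. -/
theorem HangsAtEdge.labels_of_cell (hX : InClassX G) {S : Set V} {p q : V}
    (hS : HangsAtEdge G S p q)
    (h : IsCell G a a₁ b₁ b b₂ a₂) (hpq : (p = a ∧ q = a₁) ∨ (p = a₁ ∧ q = a)) (ha : a ∈ S)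
    (hb : b ∈ S)
    (ih : ∀ Z p q, Z ⊂ S → HangsAtEdge G Z p q → EdgeLabels G Z p q) : EdgeLabels G S p q := by
  have hD : ({p, q} : Set V) ⊆ {a, a₁} := by rcases hpq with ⟨rfl, rfl⟩ | ⟨rfl, rfl⟩ <;> simp [Set.pair_comm]
  obtain ⟨ha₁, hb₂, hI, hR⟩ := h.subset_of_closedOff hX hS.closed hD ha hb
  set I := CellInner G a a₁ b₁ b b₂ a₂
  set R := CellRight G a a₁ b₁ b b₂ a₂
  have hh := h.hangs_right hX
  obtain ⟨c, d, e, f, hex, hc, hd, he, hf⟩ := hS.hex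
  have hRn : ∀ x ∈ R, x ≠ p ∧ x ≠ q ∧ ¬ G.Adj x p ∧ ¬ G.Adj x q := by
    intro x hx
    have h1 := h.right_notMem hX hx
    have h2 : ∀ y, G.Adj x y → _ := fun y => h.right_nbr hX hx
    rcases hpq with ⟨rfl, rfl⟩ | ⟨rfl, rfl⟩
    · exact ⟨h1.2.1, h1.2.2, fun e => (h2 _ e).1 rfl, fun e => (h2 _ e).2 rfl⟩
    · exact ⟨h1.2.2, h1.2.1, fun e => (h2 _ e).2 rfl, fun e => (h2 _ e).1 rfl⟩
  have hIn : ∀ x ∈ I, x ≠ p ∧ x ≠ q := by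
    intro x hx
    obtain ⟨h1, h2, -, -⟩ := h.corner_notMem hX
    rcases hpq with ⟨rfl, rfl⟩ | ⟨rfl, rfl⟩
    · exact ⟨fun e => h1 (e.subst (motive := (· ∈ I)) hx), fun e => h2 (e.subst (motive := (· ∈ I)) hx)⟩
    · exact ⟨fun e => h2 (e.subst (motive := (· ∈ I)) hx), fun e => h1 (e.subst (motive := (· ∈ I)) hx)⟩
  let B : V → V → Set V := fun p q => {x | x = p ∨ (x ∈ S ∧ G.Adj p x ∧ x ≠ q ∧ x ∉ I)}
  have hB : ∀ p q, p ∈ S → (∀ x ∈ R, x ≠ p ∧ ¬ G.Adj x p) → (∀ x ∈ I, x ≠ p) → ∀ x ∈ B p q, x ∈ S ∧ x ∉ R ∧ x ∉ I := by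
    rintro p q hp h1 h2 x (rfl | hx)
    · exact ⟨hp, fun e => (h1 x e).1 rfl, fun e => h2 x e rfl⟩
    · exact ⟨hx.1, fun e => (h1 x e).2 hx.2.1.symm, hx.2.2.2⟩
  have hBp := hB p q hS.mem (fun x hx => ⟨(hRn x hx).1, (hRn x hx).2.2.1⟩) fun x hx => (hIn x hx).1
  have hBq := hB q p hS.mem' (fun x hx => ⟨(hRn x hx).2.1, (hRn x hx).2.2.2⟩) fun x hx => (hIn x hx).2
  have hpendp : ∀ x ∈ B p q, x ≠ p → ∀ y, G.Adj x y → y = p := by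
    rintro x (rfl | hx) hxq y hxy
    · exact absurd rfl hxq
    · exact h.pendant hX hS.closed hD ha hb (v := q) (by grind) hex.bc hex.cd hex.bd.symm hc hd hx.1 hx.2.1 hx.2.2.1 hx.2.2.2 hxy
  have hpendq : ∀ x ∈ B q p, x ≠ q → ∀ y, G.Adj x y → y = q := by
    rintro x (rfl | hx) hxq y hxy
    · exact absurd rfl hxq
    · exact h.pendant hX hS.closed hD ha hb (v := p) hpq hex.fa.symm hex.ef.symm hex.ea hf he hx.1 hx.2.1 hx.2.2.1 hx.2.2.2 hxy
  have hdisj : ∀ x ∈ B p q, x ∉ B q p := by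
    rintro x (rfl | hx) (e | hx')
    · exact hex.ab.ne e
    · exact hx'.2.2.1 rfl
    · exact hx.2.2.1 e
    · exact hX.no3 hx.2.1 hx'.2.1.symm hex.ab
  have hcase : ∀ x ∈ S, x ∈ B p q ∨ x ∈ B q p ∨ x ∈ R ∨ x ∈ I := by
    refine hS.conn {x | x ∈ B p q ∨ x ∈ B q p ∨ x ∈ R ∨ x ∈ I} (.inl (.inl rfl)) ?_
    intro x hx y hy hxy
    by_cases hyI : y ∈ I
    · exact .inr (.inr (.inr hyI))
    by_cases hyp : y = p
    · exact .inl (.inl hyp)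
    by_cases hyq : y = q
    · exact .inr (.inl (.inl hyq))
    by_cases hxp : x = p
    · exact .inl (.inr ⟨hy, hxp ▸ hxy, hyq, hyI⟩)
    by_cases hxq : x = q
    · exact .inr (.inl (.inr ⟨hy, hxq ▸ hxy, hyp, hyI⟩))
    rcases hx with hx | hx | hx
    · exact .inl (.inl (hpendp x hx hxp y hxy))
    · exact .inr (.inl (.inl (hpendq x hx hxq y hxy)))
    · by_contra hc
      refine (h.far_of_left hX (x := y) ?_ ?_ hyI (fun e => hc (.inr (.inr (.inl e)))) hx.symm).2 hxy.symm <;> grind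
  obtain ⟨w, k, w1, w2, w3, w4, w5, w6, w7⟩ := h.extend_left hX (S := S) (T := B p q) (Q := B q p) true hpq (.inl rfl)
    (fun x hx => hx.elim .inl fun e => .inr (.inl e.2.1)) hdisj (.inl rfl) (fun x hx y hy => by
      constructor
      · intro e
        by_cases hxq : x = q
        · exact .inl ⟨hxq, fun h => e.ne (hxq.trans h.symm)⟩
        · exact .inr ⟨hpendq x hx hxq y e, hxq⟩
      · rintro (⟨rfl, e⟩ | ⟨rfl, e⟩)
        · exact (hy.resolve_left e).2.1
        · exact (hx.resolve_left e).2.1.symm) (fun x hx y hy => by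
      constructor
      · intro e
        by_cases hyq : y = q
        · refine ⟨?_, hyq⟩
          by_contra hxp
          exact hex.ab.ne ((hpendp x hx hxp y e).symm.trans hyq)
        · exact absurd (.inl (hpendq y hy hyq x e.symm)) (hdisj x hx)
      · rintro ⟨rfl, rfl⟩; exact hex.ab) (fun x => by
      constructor
      · intro hx
        rcases hcase x hx with e | e | e | e
        exacts [.inl (.inl e), .inl (.inr e), .inr (.inl e), .inr (.inr e)]
      · rintro ((e | e) | e | e)
        exacts [(hBp x e).1, (hBq x e).1, hR e, hI e]) (fun x hx => by
      rcases hx with e | e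
      exacts [(hBp x e).2, (hBq x e).2]) (ih R b b₂ ⟨hR, fun e => (hRn p (e hS.mem)).1 rfl⟩ hh)
  exact ⟨w, k, w1, w3, .inl ⟨w4, w5⟩, w6⟩

/-- The case that only pendant vertices of `S` hang at one end `q` of the edge. The remainder of
`S` hangs at `p` and has labels by induction; `q` and its pendant vertices are put at the free
spot `lo`. -/
theorem HangsAtEdge.labels_of_pendant (hX : InClassX G) {S : Set V} {p q : V}
    (hS : HangsAtEdge G S p q)
    (hq : ∀ y ∈ S, G.Adj q y → y ≠ p → ∀ t, G.Adj y t → t = q)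
    (ih : ∀ Z x, Z ⊂ S → HangsAtVertex G Z x → VertexLabels G Z x) : EdgeLabels G S p q := by
  classical
  obtain ⟨c, d, e, f, hex, hc, hd, he, hf⟩ := hS.hex
  let Q : Set V := {x | x = q ∨ (x ∈ S ∧ G.Adj q x ∧ x ≠ p)}
  have hQS : Q ⊆ S := by rintro x (rfl | hx); exacts [hS.mem', hx.1]
  have hpend : ∀ x ∈ Q, x ≠ q → ∀ y, G.Adj x y → y = q := by
    rintro x (rfl | hx) hxq y hxy
    · exact absurd rfl hxq
    · exact hq x hx.1 hx.2.1 hx.2.2 y hxy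
  have hpQ : p ∉ Q := by
    rintro (e | e)
    · exact hex.ab.ne e
    · exact e.2.2 rfl
  have hcr : ∀ x ∈ S \ Q, ∀ y ∈ Q, G.Adj x y → x = p ∧ y = q := by
    intro x hx y hy hxy
    have hyq : y = q := by
      by_contra hyq
      exact hx.2 (.inl (hpend y hy hyq x hxy.symm))
    refine ⟨?_, hyq⟩
    by_contra hxp
    exact hx.2 (.inr ⟨hx.1, hyq ▸ hxy.symm, hxp⟩)
  have hV : HangsAtVertex G (S \ Q) p := by
    refine ⟨⟨hS.mem, hpQ⟩, ?_, ?_, f, e, d, ⟨hex.fa.symm, hex.ef.symm, hex.de.symm, hex.ea.symm, hex.df.symm⟩, fun e => hf e.1, fun h => he h.1, fun e => hd e.1⟩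
    · intro x hx hxp y hxy
      have hxq : x ≠ q := fun e => hx.2 (.inl e)
      refine ⟨hS.closed x hx.1 (by rintro (e | e); exacts [hxp e, hxq e]) y hxy, fun e => hxp (hcr x hx y e hxy).1⟩
    · intro T hT hT' x hx
      have := hS.conn (T ∪ Q) (.inl hT) ?_ hx.1
      · exact this.resolve_right hx.2
      · rintro s hs t ht hst
        by_cases htQ : t ∈ Q
        · exact .inr htQ
        · rcases hs with hs | hs
          · exact .inl (hT' s hs t ⟨ht, htQ⟩ hst)
          · rw [(hcr t ⟨ht, htQ⟩ s hs hst.symm).1]; exact .inl hT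
  obtain ⟨w, g, w1, w2, w3, w4, w5, w6⟩ := ih _ p ⟨Set.sdiff_subset, fun e => (e hS.mem').2 (.inl rfl)⟩ hV
  have hm := w3.add_partner (s := .lo) (q := q) (Q := Q) (fun x hx => hx.2) hV.mem w4 (.inl rfl) (by simp) (by simp) w6 (fun x hx hadj => by
      have h1 := w5 x hx
      rw [SimpleGraph.adj_comm, Layout.adj_hub] at hadj
      rcases hadj with ⟨s', e, h, -⟩ | ⟨-, h, -⟩ | ⟨-, h, -⟩ | ⟨-, h, -⟩ | ⟨-, h, -⟩ | ⟨-, -, h⟩ | ⟨-, -, n, h⟩ | ⟨-, n, h⟩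
      · rw [e]; simp at h; rw [h]
      · cases h
      · cases h
      · have := w.aS_a1S 0; grind
      · have := w.aS_a1S 0; grind
      · rw [h] at h1; simp [Lab.Within] at h1
      · rw [h] at h1; simp [Lab.Within] at h1
      · exact absurd (.inr ⟨n, h⟩) (w6 x hx)) (fun x hx y hy => by
      constructor
      · intro e
        by_cases hxq : x = q
        · exact .inl ⟨hxq, fun h => e.ne (hxq.trans h.symm)⟩
        · exact .inr ⟨hpend x hx hxq y e, hxq⟩
      · rintro (⟨rfl, e⟩ | ⟨rfl, e⟩)
        · exact (hy.resolve_left e).2.1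
        · exact (hx.resolve_left e).2.1.symm) (fun x hx y hy => ⟨hcr x hx y hy, by rintro ⟨rfl, rfl⟩; exact hex.ab⟩)
  rw [Set.sdiff_union_of_subset hQS] at hm
  refine ⟨w, _, w1, hm, .inl ⟨?_, ?_⟩, ?_⟩
  · simp [hS.mem, hpQ, w4]
  · simp [show q ∈ Q from .inl rfl]
  · intro x hx
    by_cases h : x ∈ S \ Q
    · simp only [h, if_true]; exact w5 x h
    · simp only [h, if_false]
      split_ifs <;> simp [Lab.Within]

end

/-! ### The induction over hanging parts -/

section
variable {V : Type u} {G : SimpleGraph V} {a a₁ b₁ b b₂ a₂ : V}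

/-- If `S` is not a star of depth 2, it contains a leg that starts with an edge `v x`, which is a
bridge of `S` or lies in a hexagon within `S`. -/
theorem HangsAtVertex.labels_of_ih (hX : InClassX G) {S : Set V} {v : V} (hS : HangsAtVertex G S v)
    (ihV : ∀ Z x, Z ⊂ S → HangsAtVertex G Z x → VertexLabels G Z x)
    (ihE : ∀ Z p q, Z ⊂ S → HangsAtEdge G Z p q → EdgeLabels G Z p q) : VertexLabels G S v := by
  rcases hS.conn.star_or_leg hS.mem with h | ⟨x, hx, y, hy, z, hz, h⟩
  · obtain ⟨f, h1, h2, h3⟩ := hX.exists_star false hS.mem (fun x hx => by simpa using h x hx)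
    exact ⟨_, f, Layout.cut_normal _, by simp [Layout.cut], h1, h2, fun x hx => (h3 x hx).within (by simp), fun x hx => (h3 x hx).not_isAtSpot (by simp)⟩
  by_cases hbr : ∀ t ∈ G.reach {v} x, G.Adj v t → t = x
  · exact hS.labels_of_bridge hX h hx hy hz hbr ihV
  push Not at hbr
  obtain ⟨t, ht, hvt, htx⟩ := hbr
  let H : SimpleGraph V :=
    { Adj := fun s t => G.Adj s t ∧ s ∈ S ∧ t ∈ S ∧ ¬ (s = v ∧ t = x) ∧ ¬ (s = x ∧ t = v)
      symm := ⟨fun s t h => ⟨h.1.symm, h.2.2.1, h.2.1, fun e => h.2.2.2.2 ⟨e.2, e.1⟩, fun e => h.2.2.2.1 ⟨e.2, e.1⟩⟩⟩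
      loopless := ⟨fun s h => h.1.ne rfl⟩ }
  have hZ : G.reach {v} x ⊆ {s | s ∈ S ∧ s ≠ v ∧ H.Reachable x s} := by
    refine SimpleGraph.reach_subset ⟨hx, h.1.ne', .refl _⟩ ?_
    rintro s ⟨h1, h2, h3⟩ r hr hsr
    have hrv : r ≠ v := SimpleGraph.notMem_of_mem_reach (F := {v}) h.1.ne' hr
    have hrS := hS.closed s h1 h2 r hsr
    exact ⟨hrS, hrv, h3.trans (SimpleGraph.Adj.reachable ⟨hsr, h1, hrS, fun e => h2 e.1, fun e => hrv e.2⟩)⟩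
  obtain ⟨h1, h2, h3⟩ := hZ ht
  have hvt' : H.Adj v t := ⟨hvt, hS.mem, h1, fun e => htx e.2, fun e => h.1.ne e.1⟩
  obtain ⟨c, d, e, f, hc, hd, he, hf, hex⟩ := hX.exists_hex_of_edge (S := S) h.1 (H := H) (fun _ _ => Iff.rfl) (hvt'.reachable.trans h3.symm)
  obtain ⟨l₁, l₂, l₃, hl, n1, n2, n3⟩ := hS.leg
  obtain ⟨a, a₁, b₁, b, b₂, a₂, hcell, ha, hb, hv, -⟩ := hX.exists_cell_at hex hl.1 (fun h => n1 (h ▸ hx)) (fun h => n1 (h ▸ hf)) hS.mem hx hc hd he hf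
  exact hS.labels_of_cell hX hcell hv ha hb ihE

/-- If `p q` is not in a hexagon within `S`, then one end has only pendant vertices, since
otherwise paths of length 2 at both ends of the edge would form a `C₆^{+2l2}` with the hexagon
outside `S`. -/
theorem HangsAtEdge.labels_of_ih (hX : InClassX G) {S : Set V} {p q : V} (hS : HangsAtEdge G S p q)
    (ihV : ∀ Z x, Z ⊂ S → HangsAtVertex G Z x → VertexLabels G Z x)
    (ihE : ∀ Z p q, Z ⊂ S → HangsAtEdge G Z p q → EdgeLabels G Z p q) : EdgeLabels G S p q := by
  obtain ⟨c, d, e, f, hex, hc, hd, he, hf⟩ := hS.hex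
  let H : SimpleGraph V :=
    { Adj := fun s t => G.Adj s t ∧ s ∈ S ∧ t ∈ S ∧ ¬ (s = p ∧ t = q) ∧ ¬ (s = q ∧ t = p)
      symm := ⟨fun s t h => ⟨h.1.symm, h.2.2.1, h.2.1, fun e => h.2.2.2.2 ⟨e.2, e.1⟩, fun e => h.2.2.2.1 ⟨e.2, e.1⟩⟩⟩
      loopless := ⟨fun s h => h.1.ne rfl⟩ }
  by_cases hr : H.Reachable p q
  · obtain ⟨c', d', e', f', hc', hd', he', hf', hex'⟩ := hX.exists_hex_of_edge (S := S) hex.ab (H := H) (fun _ _ => Iff.rfl) hr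
    obtain ⟨a, a₁, b₁, b, b₂, a₂, hcell, ha, hb, hv, hpq⟩ := hX.exists_cell_at hex' hex.fa.symm hex.fb (fun h => hf (h ▸ hf')) hS.mem hS.mem' hc' hd' he' hf'
    exact hS.labels_of_cell hX hcell (hpq c hex.bc hex.ac.symm (fun h => hc (h ▸ hc'))) ha hb ihE
  by_cases hq : ∀ y ∈ S, G.Adj q y → y ≠ p → ∀ t, G.Adj y t → t = q
  · exact hS.labels_of_pendant hX hq ihV
  by_cases hp : ∀ y ∈ S, G.Adj p y → y ≠ q → ∀ t, G.Adj y t → t = p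
  · exact ((hS.symm hX).labels_of_pendant hX hp ihV).symm
  push Not at hp hq
  exfalso
  obtain ⟨x, hx, hpx, hxq, x', hxx, hxp⟩ := hp
  obtain ⟨y, hy, hqy, hyp, y', hyy, hyq⟩ := hq
  have hpq := hex.ab
  have hxn : ¬ G.Adj x q := fun e => hX.no3 hpx e hpq
  have hyn : ¬ G.Adj y p := fun e => hX.no3 hpq hqy e.symm
  have hxq' : x' ≠ q := by rintro rfl; exact hxn hxx
  have hyp' : y' ≠ p := by rintro rfl; exact hyn hyy
  have hxn' : ¬ G.Adj x' q := fun e => by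
    rcases hX.no4 hpx hxx e hpq with e | e
    exacts [hxp e.symm, hxq e]
  have hyn' : ¬ G.Adj y' p := fun e => by
    rcases hX.no4 hpq hqy hyy e.symm with e | e
    exacts [hyp e.symm, hyq e.symm]
  have hcl : ∀ z ∈ S, z ≠ p → z ≠ q → ∀ t, G.Adj z t → t ∈ S := fun z hz h1 h2 => hS.closed z hz (by rintro (e | e); exacts [h1 e, h2 e])
  have hx'S : x' ∈ S := hcl x hx hpx.ne' hxq x' hxx
  have hy'S : y' ∈ S := hcl y hy hyp hqy.ne' y' hyy
  have e1 : H.Adj p x := ⟨hpx, hS.mem, hx, fun e => hxq e.2, fun e => hpq.ne e.1⟩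
  have e2 : H.Adj x x' := ⟨hxx, hx, hx'S, fun e => hpx.ne' e.1, fun e => hxq e.1⟩
  have e3 : H.Adj q y := ⟨hqy, hS.mem', hy, fun e => hpq.ne e.1.symm, fun e => hyp e.2⟩
  have e4 : H.Adj y y' := ⟨hyy, hy, hy'S, fun e => hyp e.1, fun e => hqy.ne' e.1⟩
  have hout : ∀ z ∈ S, z ≠ p → z ≠ q → ∀ t ∈ [c, d, e, f], Far G z t := by
    intro z hz h1 h2 t ht
    refine hS.closed.far hz (by rintro (e | e); exacts [h1 e, h2 e]) ?_
    simp only [List.mem_cons, List.not_mem_nil, or_false] at ht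
    rcases ht with rfl | rfl | rfl | rfl <;> assumption
  refine hX.not_2l2 hex hpx hxx hxp hqy hyy hyq ?_ ?_ ?_
  · intro z hz t ht
    rcases List.mem_cons.1 hz with rfl | hz
    · rcases List.mem_cons.1 ht with rfl | ht
      exacts [⟨hxq, hxn⟩, hout z hx hpx.ne' hxq t ht]
    · obtain rfl : z = x' := by simpa using hz
      rcases List.mem_cons.1 ht with rfl | ht
      exacts [⟨hxq', hxn'⟩, hout z hx'S hxp hxq' t ht]
  · intro z hz t ht
    rcases List.mem_cons.1 hz with rfl | hz
    · rcases List.mem_cons.1 ht with rfl | ht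
      exacts [⟨hyp, hyn⟩, hout z hy hyp hqy.ne' t ht]
    · obtain rfl : z = y' := by simpa using hz
      rcases List.mem_cons.1 ht with rfl | ht
      exacts [⟨hyp', hyn'⟩, hout z hy'S hyp' hyq t ht]
  · have hpz : ∀ z ∈ [x, x'], H.Reachable p z ∧ z ∈ S ∧ z ≠ p ∧ z ≠ q := by
      intro z hz
      simp only [List.mem_cons, List.not_mem_nil, or_false] at hz
      rcases hz with rfl | rfl
      exacts [⟨e1.reachable, hx, hpx.ne', hxq⟩, ⟨e1.reachable.trans e2.reachable, hx'S, hxp, hxq'⟩]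
    have hqz : ∀ z ∈ [y, y'], H.Reachable q z ∧ z ∈ S := by
      intro z hz
      simp only [List.mem_cons, List.not_mem_nil, or_false] at hz
      rcases hz with rfl | rfl
      exacts [⟨e3.reachable, hy⟩, ⟨e3.reachable.trans e4.reachable, hy'S⟩]
    intro z hz t ht
    obtain ⟨h1, h2, h3, h4⟩ := hpz z hz
    obtain ⟨h5, h6⟩ := hqz t ht
    refine ⟨?_, fun hzt => ?_⟩
    · rintro rfl; exact hr (h1.trans h5.symm)
    · exact hr (h1.trans ((SimpleGraph.Adj.reachable (G := H) ⟨hzt, h2, h6, fun e => h3 e.1, fun e => h4 e.1⟩).trans h5.symm))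

/-- Parts hanging at a vertex or an edge can be labelled, by simultaneous induction over their
size. -/
theorem InClassX.labels (hX : InClassX G) (S : Set V) :
    (∀ v, HangsAtVertex G S v → VertexLabels G S v) ∧ ∀ p q, HangsAtEdge G S p q → EdgeLabels G S p
    q := by
  have := hX.finite
  induction S using WellFoundedLT.induction with
  | ind S ih =>
    have ihV : ∀ Z x, Z ⊂ S → HangsAtVertex G Z x → VertexLabels G Z x := fun Z x hZ => (ih Z hZ).1 x
    have ihE : ∀ Z p q, Z ⊂ S → HangsAtEdge G Z p q → EdgeLabels G Z p q := fun Z p q hZ => (ih Z hZ).2 p q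
    exact ⟨fun v hv => hv.labels_of_ih hX ihV ihE, fun p q h => h.labels_of_ih hX ihV ihE⟩

end

/-! ### Connected graphs of the class -/

namespace Layout
variable {N : Type u}

theorem Normal.rev {w : Layout} (h : w.Normal) : w.rev.Normal := by
  intro i hi
  have := h (-i) hi
  refine ⟨?_, ?_⟩
  · show w.hex (-1 - i) = true
    rw [show -1 - i = -i - 1 by ring]; exact this.2
  · show w.hex (-1 - (i - 1)) = true
    rw [show -1 - (i - 1) = -i by ring]; exact this.1

theorem _root_.Lab.Within.revLab {w : Layout} {x : Lab N} (h : x.Within (Set.Ici 0)) :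
    (w.revLab x).Within (Set.Iic 0) := by
  cases x <;> simp [Lab.Within, Layout.revLab] at * <;> omega

end Layout

section
variable {V : Type u} {G : SimpleGraph V} {a a₁ b₁ b b₂ a₂ : V}

theorem Labels.rev {N : Type v} {w : Layout} {S : Set V} {f : V → Lab N} (h : Labels G w S f) :
    Labels G w.rev S (fun x => w.revLab (f x)) :=
  ⟨fun x hx y hy e => h.inj x hx y hy (w.revLab_injective e), fun x hx y hy => Layout.rev_adj_iff.trans (h.adj x hx y hy)⟩

/-- The inner vertices of a cell do not depend on the side from which it is seen. -/
theorem IsCell.inner_flip (h : IsCell G a a₁ b₁ b b₂ a₂) (h' : IsCell G b b₂ a₂ a a₁ b₁) :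
    CellInner G b b₂ a₂ a a₁ b₁ = CellInner G a a₁ b₁ b b₂ a₂ := by
  have key : ∀ {a a₁ b₁ b b₂ a₂ : V}, IsCell G a a₁ b₁ b b₂ a₂ → IsCell G b b₂ a₂ a a₁ b₁ → CellInner G b b₂ a₂ a a₁ b₁ ⊆ CellInner G a a₁ b₁ b b₂ a₂ := by
    intro a a₁ b₁ b b₂ a₂ h h'
    rintro z (e | e | ⟨x, y, h1, h2, h3, h4, h5, e⟩)
    · exact .inr (.inl e)
    · exact .inl e
    · by_cases hy1 : y = a₁
      · subst hy1
        have := (h'.other x y h1 h2 h3 h4 h5).2 b₁ h.hex.bc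
        rcases this with e' | e'
        · exact absurd e'.symm h5
        · exact absurd e' h.hex.ac.symm
      by_cases hy2 : y = a₂
      · subst hy2
        have := (h'.other x y h1 h2 h3 h4 h5).2 b₂ h.hex.ef.symm
        rcases this with e' | e'
        · exact absurd e'.symm h4
        · exact absurd e' h.hex.ea
      exact .inr (.inr ⟨y, x, h3.symm, h2.symm, h1.symm, hy1, hy2, e.symm⟩)
  exact (key h h').antisymm (key h' h)

/-- A part of `G` without edges to the rest can be put into a universal graph. Isolated vertices
are required to be middle hubs, as other labels might have no place in the layout. -/
def ClosedLabels (G : SimpleGraph V) (S : Set V) : Prop :=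
  ∃ (w : Layout) (f : V → Lab V), w.Normal ∧ Labels G w S f ∧ ∀ x ∈ S, (∀ y, ¬ G.Adj x y) → ∃ i, f x = .hub i .mid

/-- A connected part with a cell consists of the cell and the parts hanging at its left and right
edges. -/
theorem IsCell.closedLabels (hX : InClassX G) (h : IsCell G a a₁ b₁ b b₂ a₂) {S : Set V}
    (hS : ClosedOff G S ∅)
    (hconn : ConnFrom G S a) (ha : a ∈ S) (hno : ∀ x ∈ S, ∃ y, G.Adj x y) : ClosedLabels G S := by
  have hS' : ∀ x ∈ S, ∀ y, G.Adj x y → y ∈ S := fun x hx => hS x hx (by simp)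
  have hb : b ∈ S := hS' _ (hS' _ (hS' _ ha _ h.hex.ab) _ h.hex.bc) _ h.hex.cd
  have h' := h.flip hX
  have hI := h.inner_flip h'
  obtain ⟨ha₁, hb₂, hIS, hRS⟩ := h.subset_of_closedOff hX hS (by simp) ha hb
  obtain ⟨-, -, -, hLS⟩ := h'.subset_of_closedOff hX hS (by simp) hb ha
  set R := CellRight G a a₁ b₁ b b₂ a₂
  set L := CellRight G b b₂ a₂ a a₁ b₁
  have hr := h.hangs_right hX
  have hl := h'.hangs_right hX
  have hLI : ∀ x ∈ L, x ∉ CellInner G a a₁ b₁ b b₂ a₂ := fun x hx e => (h'.right_notMem hX hx).1 (hI ▸ e)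
  have hRL : R ⊆ {x | x ∈ R ∧ x ∉ L} := by
    refine SimpleGraph.reach_subset ⟨hr.mem, fun e => (h'.right_notMem hX e).2.1 rfl⟩ ?_
    rintro x ⟨hx, hxL⟩ y hy hxy
    refine ⟨hy, fun hyL => hxL (hl.closed y hyL ?_ x hxy.symm)⟩
    rintro (e | e)
    exacts [(h.right_notMem hX hy).2.1 e, (h.right_notMem hX hy).2.2 e]
  have hLR : ∀ x ∈ L, x ∉ R := fun x hx e => (hRL e).2 hx
  have hadj : ∀ x ∈ L, ∀ y ∈ R, ¬ G.Adj x y := by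
    intro x hx y hy e
    refine (hRL hy).2 (hl.closed x hx ?_ y e)
    have := h.right_nbr hX hy e.symm
    rintro (e | e)
    exacts [this.1 e, this.2 e]
  obtain ⟨wr, g, r1, r2, r3, r4⟩ := (hX.labels R).2 _ _ hr
  obtain ⟨wl, f, l1, l2, l3, l4⟩ := (hX.labels L).2 _ _ hl
  obtain ⟨w, k, w1, -, w3, -⟩ := h.assemble hX l1.rev r1 l2.rev r2 (fun x hx => (l4 x hx).revLab) r4 hLR hadj hLI
    (fun x hx => (h.right_notMem hX hx).1) hl.mem hl.mem' hr.mem hr.mem' (by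
      have e : wl.rev.fused 0 = wl.fused 0 := by simp [Layout.rev]
      rw [e]
      rcases l3 with ⟨e1, e2⟩ | ⟨e1, e2⟩
      · left; rw [e1, e2]; simp [Layout.revLab, Layout.flip]
      · right; rw [e1, e2]; simp [Layout.revLab, Layout.flip]) r3
  have hSe : S ⊆ L ∪ R ∪ CellInner G a a₁ b₁ b b₂ a₂ := by
    refine hconn _ (.inl (.inl hl.mem)) ?_
    intro x hx y hy hxy
    by_cases hyI : y ∈ CellInner G a a₁ b₁ b b₂ a₂
    · exact .inr hyI
    by_cases hya : y = a
    · rw [hya]; exact .inl (.inl hl.mem)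
    by_cases hya₁ : y = a₁
    · rw [hya₁]; exact .inl (.inl hl.mem')
    by_cases hyb : y = b
    · rw [hyb]; exact .inl (.inr hr.mem)
    by_cases hyb₂ : y = b₂
    · rw [hyb₂]; exact .inl (.inr hr.mem')
    rcases hx with (hx | hx) | hx
    · exact .inl (.inl (SimpleGraph.mem_reach_of_adj hx hxy (by simp [hI, hyI, hyb, hyb₂])))
    · exact .inl (.inr (SimpleGraph.mem_reach_of_adj hx hxy (by simp [hyI, hya, hya₁])))
    · exfalso
      rcases h.nbr_inner hx hxy with e | e | e | e | e <;> contradiction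
  refine ⟨w, k, w1, ⟨fun x hx y hy => w3.inj x (hSe hx) y (hSe hy), fun x hx y hy => w3.adj x (hSe hx) y (hSe hy)⟩, fun x hx hx' => ?_⟩
  obtain ⟨y, hy⟩ := hno x hx
  exact absurd hy (hx' y)

/-- A connected part without hexagons but with a path `x₂ x₁ v w y₁ y₂` on six vertices. Its
middle edge `v w` is a bridge, and each half of the path provides the leg that is required for the
part of the graph on the other side. -/
theorem InClassX.closedLabels_of_path (hX : InClassX G) {S : Set V}
    (hhex : ∀ p ∈ S, ∀ b c d e f, ¬ IsHex G p b c d e f) (hS : ClosedOff G S ∅)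
    {x₂ x₁ v w y₁ y₂ : V} (hconn : ConnFrom G S v) (hv : v ∈ S) (hno : ∀ x ∈ S, ∃ y, G.Adj x y)
    (h₁ : G.Adj v x₁) (h₂ : G.Adj x₁ x₂) (h₃ : G.Adj v w)
    (h₄ : G.Adj w y₁) (h₅ : G.Adj y₁ y₂) (n₁ : x₂ ≠ v) (n₂ : x₁ ≠ w) (n₃ : v ≠ y₁) (n₄ : w ≠ y₂) :
    ClosedLabels G S := by
  have hS' : ∀ x ∈ S, ∀ y, G.Adj x y → y ∈ S := fun x hx => hS x hx (by simp)
  let H : SimpleGraph V :=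
    { Adj := fun s t => G.Adj s t ∧ s ∈ S ∧ t ∈ S ∧ ¬ (s = v ∧ t = w) ∧ ¬ (s = w ∧ t = v)
      symm := ⟨fun s t h => ⟨h.1.symm, h.2.2.1, h.2.1, fun e => h.2.2.2.2 ⟨e.2, e.1⟩, fun e => h.2.2.2.1 ⟨e.2, e.1⟩⟩⟩
      loopless := ⟨fun s h => h.1.ne rfl⟩ }
  have hnr : ¬ H.Reachable v w := by
    intro hr
    obtain ⟨c, d, e, f, -, -, -, -, h⟩ := hX.exists_hex_of_edge (S := S) h₃ (H := H) (fun _ _ => Iff.rfl) hr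
    exact hhex _ hv _ _ _ _ _ h
  have hw : w ∈ S := hS' v hv w h₃
  -- the two sides of the bridge
  have key : ∀ {p q x : V}, p ≠ q → p ∈ S → (p = v ∧ q = w ∨ p = w ∧ q = v) → x ∈ G.reach {q} p → x ∈ S ∧ x ≠ q ∧ H.Reachable p x := by
    intro p q x hpq hp he hx
    have : G.reach {q} p ⊆ {x | x ∈ S ∧ x ≠ q ∧ H.Reachable p x} := by
      refine SimpleGraph.reach_subset ⟨hp, hpq, .refl _⟩ ?_
      rintro s ⟨h1, h2, h3⟩ r hr hsr
      have hrq : r ≠ q := SimpleGraph.notMem_of_mem_reach (F := {q}) hpq hr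
      have hrS := hS' s h1 r hsr
      refine ⟨hrS, hrq, h3.trans (SimpleGraph.Adj.reachable ⟨hsr, h1, hrS, ?_, ?_⟩)⟩ <;> grind
    exact this hx
  set L := G.reach {w} v
  set R := G.reach {v} w
  have hL : ∀ x ∈ L, x ∈ S ∧ x ≠ w ∧ H.Reachable v x := fun x => key h₃.ne hv (.inl ⟨rfl, rfl⟩)
  have hR : ∀ x ∈ R, x ∈ S ∧ x ≠ v ∧ H.Reachable w x := fun x => key h₃.ne' hw (.inr ⟨rfl, rfl⟩)
  have hLR : ∀ x ∈ L, x ∉ R := fun x hx hx' => hnr ((hL x hx).2.2.trans (hR x hx').2.2.symm)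
  have hvL : v ∈ L := SimpleGraph.mem_reach_self
  have hwR : w ∈ R := SimpleGraph.mem_reach_self
  have hadj : ∀ x ∈ L, ∀ y ∈ R, G.Adj x y → x = v ∧ y = w := by
    intro x hx y hy hxy
    obtain ⟨h1, h2, h3⟩ := hL x hx
    obtain ⟨h4, h5, h6⟩ := hR y hy
    by_contra hc
    exact hnr (h3.trans ((SimpleGraph.Adj.reachable (G := H) ⟨hxy, h1, h4, hc, fun e => h2 e.1⟩).trans h6.symm))
  have hx₁ : x₁ ∈ L := SimpleGraph.mem_reach_of_adj hvL h₁ n₂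
  have hx₂ : x₂ ∈ L := SimpleGraph.mem_reach_of_adj hx₁ h₂ (by rintro rfl; exact hX.no3 h₁ h₂ h₃)
  have hy₁ : y₁ ∈ R := SimpleGraph.mem_reach_of_adj hwR h₄ n₃.symm
  have hy₂ : y₂ ∈ R := SimpleGraph.mem_reach_of_adj hy₁ h₅ (by rintro rfl; exact hX.no3 h₄ h₅ h₃.symm)
  have hangL : HangsAtVertex G L v := by
    refine ⟨hvL, ?_, fun T hT h' => SimpleGraph.reach_subset hT h', w, y₁, y₂, ⟨h₃, h₄, h₅, n₃, n₄⟩, fun e => hLR _ e hwR, fun e => hLR _ e hy₁, fun e => hLR _ e hy₂⟩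
    intro x hx hxv y hxy
    refine SimpleGraph.mem_reach_of_adj hx hxy ?_
    rintro rfl
    exact hxv (hadj x hx y hwR hxy).1
  have hangR : HangsAtVertex G R w := by
    refine ⟨hwR, ?_, fun T hT h' => SimpleGraph.reach_subset hT h', v, x₁, x₂, ⟨h₃.symm, h₁, h₂, n₂.symm, n₁.symm⟩, hLR _ hvL, hLR _ hx₁, hLR _ hx₂⟩
    intro x hx hxw y hxy
    refine SimpleGraph.mem_reach_of_adj hx hxy ?_
    rintro rfl
    exact hxw (hadj y hvL x hx hxy.symm).2
  obtain ⟨wl, f, l1, l2, l3, l4, l5, l6⟩ := (hX.labels L).1 _ hangL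
  obtain ⟨wr, g, r1, r2, r3, r4, r5, r6⟩ := (hX.labels R).1 _ hangR
  have l4' : wl.revLab (f v) = .hub 0 .mid := by rw [l4]; simp [Layout.revLab, Layout.flip]
  have hm := l3.rev.merge (c := false) (am := true) (bm := true) r3 (fun x hx => (l5 x hx).revLab) r5 hLR (fun x hx y hy => by
    constructor
    · intro e
      obtain ⟨rfl, rfl⟩ := hadj x hx y hy e
      exact ⟨rfl, l4', r4⟩
    · rintro ⟨-, e1, e2⟩
      rw [l3.rev.inj x hx v hvL (e1.trans l4'.symm), r3.inj y hy w hwR (e2.trans r4.symm)]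
      exact h₃)
  have hSe : S ⊆ L ∪ R := by
    refine hconn _ (.inl hvL) ?_
    intro x hx y hy hxy
    by_cases h1 : y = v
    · rw [h1]; exact .inl hvL
    by_cases h2 : y = w
    · rw [h2]; exact .inr hwR
    rcases hx with hx | hx
    · exact .inl (SimpleGraph.mem_reach_of_adj hx hxy h2)
    · exact .inr (SimpleGraph.mem_reach_of_adj hx hxy h1)
  refine ⟨_, _, Layout.merge_normal l1.rev r1 (.inr ⟨by simp [Layout.rev, l2], r2⟩), ⟨fun x hx y hy => hm.inj x (hSe hx) y (hSe hy), fun x hx y hy => hm.adj x (hSe hx) y (hSe hy)⟩, fun x hx hx' => ?_⟩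
  obtain ⟨y, hy⟩ := hno x hx
  exact absurd hy (hx' y)

/-- Three cases: there is a hexagon, and hence a cell; there is a path on six vertices; or there
is neither, and the part is a star of depth 2. In the last case, legs at all vertices could be
continued to a path on six vertices. -/
theorem InClassX.closedLabels_of_conn (hX : InClassX G) {S : Set V} (hS : ClosedOff G S ∅)
    (hconn : ∀ x ∈ S, ConnFrom G S x) : ClosedLabels G S := by
  have hS' : ∀ x ∈ S, ∀ y, G.Adj x y → y ∈ S := fun x hx => hS x hx (by simp)
  have star : ∀ x ∈ S, (∀ y ∈ S, y = x ∨ G.Adj x y ∨ ∃ z ∈ S, G.Adj x z ∧ G.Adj z y) → (∀ y ∈ S, (∀ z, ¬ G.Adj y z) → y = x) → ClosedLabels G S := by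
    intro x hx h h'
    obtain ⟨f, h1, h2, h3⟩ := hX.exists_star false hx (fun y hy => by simpa using h y hy)
    exact ⟨_, f, Layout.cut_normal _, h1, fun y hy e => ⟨0, by rw [h' y hy e]; exact h2⟩⟩
  by_cases hiso : ∃ x ∈ S, ∀ y, ¬ G.Adj x y
  · obtain ⟨x, hx, hx'⟩ := hiso
    have : S ⊆ {x} := hconn x hx {x} rfl (by rintro s rfl t - e; exact absurd e (hx' t))
    exact star x hx (fun y hy => .inl (this hy)) (fun y hy _ => this hy)
  push Not at hiso
  by_cases hex : ∃ p ∈ S, ∃ b c d e f, IsHex G p b c d e f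
  · obtain ⟨p, hp, q, c, d, e, f, h⟩ := hex
    obtain ⟨a, a₁, b₁, b, b₂, a₂, hc, ha, -⟩ := hX.exists_cell h
    have hq := hS' _ hp _ h.ab
    have hc' := hS' _ hq _ h.bc
    have hd := hS' _ hc' _ h.cd
    have he := hS' _ hd _ h.de
    have hf := hS' _ he _ h.ef
    have haS : a ∈ S := by
      simp only [List.mem_cons, List.not_mem_nil, or_false] at ha
      rcases ha with rfl | rfl | rfl | rfl | rfl | rfl <;> assumption
    exact hc.closedLabels hX hS (hconn a haS) haS hiso
  push Not at hex
  by_contra hno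
  have hpath : ∀ {x₂ x₁ v w y₁ y₂ : V}, v ∈ S → G.Adj v x₁ → G.Adj x₁ x₂ → G.Adj v w → G.Adj w y₁ → G.Adj y₁ y₂ → x₂ ≠ v → x₁ ≠ w → v ≠ y₁ → w ≠ y₂ → False :=
    fun hv h₁ h₂ h₃ h₄ h₅ n₁ n₂ n₃ n₄ => hno (hX.closedLabels_of_path hex hS (hconn _ hv) hv hiso h₁ h₂ h₃ h₄ h₅ n₁ n₂ n₃ n₄)
  have hleg : ∀ x ∈ S, ∃ y ∈ S, ∃ z ∈ S, ∃ t ∈ S, IsLeg G x y z t := by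
    intro x hx
    refine ((hconn x hx).star_or_leg hx).resolve_left fun h => hno (star x hx h fun y hy e => ?_)
    obtain ⟨t, ht⟩ := hiso y hy
    exact absurd ht (e t)
  obtain ⟨v, hv⟩ : S.Nonempty := by
    by_contra hc
    rw [Set.not_nonempty_iff_eq_empty] at hc
    exact hno ⟨_, fun _ => .hub 0 .mid, Layout.cut_normal false, ⟨by simp [hc], by simp [hc]⟩, by simp [hc]⟩
  obtain ⟨x, hx, y, hy, z, hz, k1, k2, k3, k4, k5⟩ := hleg v hv
  obtain ⟨a, ha, b, hb, c, hc, m1, m2, m3, m4, m5⟩ := hleg x hx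
  by_cases hav : a = v
  · subst hav
    exact hpath ha m2 m3 k1 k2 k3 m5.symm m4.symm k4 k5
  obtain ⟨d, hd, e, he, g, hg, r1, r2, r3, r4, r5⟩ := hleg a ha
  by_cases hdx : d = x
  · subst hdx
    exact hpath ha m2 m3 r1 r2 r3 m5.symm m4.symm r4 r5
  · exact hpath ha m1.symm k1.symm r1 r2 r3 (Ne.symm hav) (Ne.symm hdx) r4 r5

end

/-! ### Labeling a whole graph -/

namespace Layout
variable {N : Type u}

/-- The layout moved by `k` cuts. -/
def shift (w : Layout) (k : ℤ) : Layout := ⟨fun i => w.hex (i - k), fun i => w.aMid (i - k), fun i => w.bMid (i - k), fun i => w.fused (i - k)⟩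

theorem Normal.shift {w : Layout} (h : w.Normal) (k : ℤ) : (w.shift k).Normal := by
  intro i hi
  have := h (i - k) hi
  exact ⟨this.1, by rw [← this.2]; simp only [Layout.shift]; congr 1; ring⟩

theorem shift_adj {w : Layout} {k : ℤ} {x y : Lab N} : ((w.shift k).graph N).Adj (x.shift k)
    (y.shift k) ↔ (w.graph N).Adj x y := by
  have h : ∀ z : Lab N, z.Within Set.univ := fun z => by cases z <;> simp [Lab.Within]
  exact adj_shift (K := Set.univ) (fun i _ => by simp [Layout.shift]) (fun i _ _ => by simp [Layout.shift]) (h x) (h y)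

theorem _root_.Lab.exists_within (x : Lab N) : ∃ M : ℕ, ∀ n : ℕ, M ≤ n → x.Within
    (Set.Icc (-n : ℤ) n) := by
  have key : ∀ i : ℤ, ∃ M : ℕ, ∀ n : ℕ, M ≤ n → i ∈ Set.Icc (-n : ℤ) n ∧ i + 1 ∈ Set.Icc (-n : ℤ) n := fun i =>
    ⟨i.natAbs + 1, fun n hn => by simp only [Set.mem_Icc]; omega⟩
  cases x with
  | hub i s => obtain ⟨M, h⟩ := key i; exact ⟨M, fun n hn => (h n hn).1⟩
  | A i m => obtain ⟨M, h⟩ := key i; exact ⟨M, fun n hn => h n hn⟩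
  | B i m => obtain ⟨M, h⟩ := key i; exact ⟨M, fun n hn => h n hn⟩
  | pend i s m => obtain ⟨M, h⟩ := key i; exact ⟨M, fun n hn => (h n hn).1⟩
  | deep i m m' => obtain ⟨M, h⟩ := key i; exact ⟨M, fun n hn => (h n hn).1⟩

theorem exists_within {V : Type v} [Finite V] (f : V → Lab N) : ∃ M : ℕ, ∀ x, (f x).Within
    (Set.Icc (-M : ℤ) M) := by
  choose M hM using fun x => (f x).exists_within
  obtain ⟨m, hm⟩ := (Set.finite_range M).bddAbove
  exact ⟨m, fun x => hM x m (hm ⟨x, rfl⟩)⟩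

theorem _root_.Lab.Within.shift_Icc {x : Lab N} {M : ℤ} (h : x.Within (Set.Icc (-M) M)) (k : ℤ) :
    (x.shift k).Within (Set.Icc (k - M) (k + M)) := by
  cases x <;> simp [Lab.Within, Lab.shift] at * <;> omega

end Layout

section
variable {V : Type u} {G : SimpleGraph V}

theorem Labels.shift {N : Type v} {w : Layout} {S : Set V} {f : V → Lab N} (h : Labels G w S f)
    (k : ℤ) :
    Labels G (w.shift k) S (fun x => (f x).shift k) :=
  ⟨fun x hx y hy e => h.inj x hx y hy (Lab.shift_injective k e), fun x hx y hy => Layout.shift_adj.trans (h.adj x hx y hy)⟩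

/-- The components are labelled one by one. Their labels are moved apart, with a hexagonal cell
between them in which no vertices are used. -/
theorem InClassX.closedLabels (hX : InClassX G) {S : Set V} (hS : ClosedOff G S ∅) : ClosedLabels G
    S := by
  classical
  have := hX.finite
  induction S using WellFoundedLT.induction with
  | ind S ih =>
    rcases S.eq_empty_or_nonempty with rfl | ⟨v, hv⟩
    · exact ⟨_, fun _ => .hub 0 .mid, Layout.cut_normal false, ⟨by simp, by simp⟩, by simp⟩
    have hS' : ∀ x ∈ S, ∀ y, G.Adj x y → y ∈ S := fun x hx => hS x hx (by simp)
    set C := G.reach ∅ v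
    have hvC : v ∈ C := SimpleGraph.mem_reach_self
    have hC : ∀ x ∈ C, ∀ y, G.Adj x y → y ∈ C := fun x hx y hxy => SimpleGraph.mem_reach_of_adj hx hxy (by simp)
    have hCS : C ⊆ S := by
      exact SimpleGraph.reach_subset hv fun x hx y _ hxy => hS' x hx y hxy
    have hconn : ∀ x ∈ C, ConnFrom G C x := by
      intro x hx T hT hT'
      -- the complement of `T` in `C` is closed as well
      have hTv : v ∈ T := by
        by_contra hvT
        have : C ⊆ C \ T := SimpleGraph.reach_subset ⟨hvC, hvT⟩ fun s hs t ht hst => ⟨ht, fun e => hs.2 (hT' t e s hs.1 hst.symm)⟩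
        exact (this hx).2 hT
      exact SimpleGraph.reach_subset hTv hT'
    obtain ⟨wl, f, l1, l2, l3⟩ := hX.closedLabels_of_conn (S := C) (fun x hx _ => hC x hx) hconn
    obtain ⟨wr, g, r1, r2, r3⟩ := ih (S \ C) ⟨Set.sdiff_subset, fun e => (e hv).2 hvC⟩ (fun x hx _ y hxy => ⟨hS' x hx.1 y hxy, fun e => hx.2 (hC y e x hxy.symm)⟩)
    obtain ⟨M, hM⟩ := Layout.exists_within f
    obtain ⟨M', hM'⟩ := Layout.exists_within g
    have hm := (l2.shift (-M)).merge (c := true) (am := true) (bm := true) (r2.shift M')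
      (fun x hx => ((hM x).shift_Icc _).mono fun i hi => by have := hi.2; simp at this ⊢; omega)
      (fun x hx => ((hM' x).shift_Icc _).mono fun i hi => by have := hi.1; simp at this ⊢; omega) (fun x hx hx' => hx'.2 hx)
      (fun x hx y hy => by simpa using fun e => hy.2 (hC x hx y e))
    rw [Set.union_sdiff_cancel hCS] at hm
    refine ⟨_, _, Layout.merge_normal (l1.shift _) (r1.shift _) (.inl rfl), hm, fun x hx hx' => ?_⟩
    by_cases hxC : x ∈ C
    · obtain ⟨i, hi⟩ := l3 x hxC hx'
      simp only [hxC, if_true, hi]; exact ⟨_, rfl⟩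
    · obtain ⟨i, hi⟩ := r3 x ⟨hx, hxC⟩ hx'
      simp only [hxC, if_false, hi]; exact ⟨_, rfl⟩

/-- The label has a place in the layout. -/
def Lab.Present {N : Type v} (w : Layout) : Lab N → Prop
  | .hub i s => s = .hi → w.fused i = false
  | .A i _ => w.hex i = true
  | .B i _ => w.hex i = true
  | .pend i s _ => s = .hi → w.fused i = false
  | .deep i _ _ => w.fused i = false

theorem Layout.present_of_adj {N : Type v} {w : Layout} {x y : Lab N} (h : (w.graph N).Adj x y) :
    x.Present w := by
  have h1 := w.aS_a1S
  have h2 := w.bS_b2S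
  cases x with
  | hub i s =>
    have := h1 i
    have := h2 (i - 1)
    rw [Layout.adj_hub] at h; simp only [Lab.Present]; grind
  | A i n => cases n <;> simp only [Layout.adj_A_none, Layout.adj_A_some] at h <;> exact h.1
  | B i n => cases n <;> simp only [Layout.adj_B_none, Layout.adj_B_some] at h <;> exact h.1
  | pend i s n => rw [Layout.adj_pend] at h; simp only [Lab.Present]; grind
  | deep i n m => rw [Layout.adj_deep] at h; exact h.1

/-- Every graph of the class is an induced subgraph of a bounded part of the universal graph of a
layout with only finitely many fused cuts. -/
theorem InClassX.exists_labels (hX : InClassX G) : ∃ (w : Layout) (n : ℕ) (f : V → Lab V), w.Normal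
    ∧ (∀ i, w.fused i = true → 0 < i ∧ i < n) ∧
    Labels G w Set.univ f ∧ (∀ x, (f x).Within (Set.Ioo 0 (n : ℤ))) ∧ ∀ x, (f x).Present w := by
  have := hX.finite
  obtain ⟨w, f, h1, h2, h3⟩ := hX.closedLabels (S := Set.univ) (by simp [ClosedOff])
  obtain ⟨M, hM⟩ := Layout.exists_within f
  have h4 := h2.shift (M + 1)
  have h5 : ∀ x, ((f x).shift (M + 1)).Within (Set.Ioo 0 ((2 * M + 2 : ℕ) : ℤ)) := fun x => ((hM x).shift_Icc _).mono fun i hi => by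
    have := hi.1
    have := hi.2
    simp only [Set.mem_Ioo]; push_cast; omega
  -- cuts outside the window can be made unfused, since no labels are near to them
  let w' : Layout := { w.shift (M + 1) with fused := fun i => (w.shift (M + 1)).fused i && decide (0 < i ∧ i < (2 * M + 2 : ℕ)) }
  have h6 : Labels G w' Set.univ (fun x => (f x).shift (M + 1)) := by
    refine ⟨h4.inj, fun x hx y hy => ?_⟩
    rw [← h4.adj x hx y hy]
    have := Layout.adj_shift (N := V) (w := w.shift (M + 1)) (w' := w') (K := Set.Ioo 0 ((2 * M + 2 : ℕ) : ℤ)) (k := 0) (fun i hi => by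
      simp only [Set.mem_Ioo] at hi; simp only [w', add_zero, hi.1, hi.2]; simp) (fun i _ _ => by simp [w']) (h5 x) (h5 y)
    rwa [Lab.shift_zero, Lab.shift_zero] at this
  refine ⟨w', 2 * M + 2, _, ?_, ?_, h6, h5, fun x => ?_⟩
  · intro i hi
    simp only [w', Bool.and_eq_true] at hi
    exact h1.shift _ i hi.1
  · intro i hi
    simp only [w', Bool.and_eq_true, decide_eq_true_eq] at hi
    exact hi.2
  · by_cases hx : ∃ y, G.Adj x y
    · obtain ⟨y, hy⟩ := hx
      exact Layout.present_of_adj ((h6.adj x trivial y trivial).2 hy)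
    · push Not at hx
      obtain ⟨i, hi⟩ := h3 x trivial hx
      simp only [hi, Lab.shift, Lab.Present]
      intro h; cases h

end

/-! ### Trees given by parents -/

section
variable {X : Type u} {G : SimpleGraph X} {r : X} {par : X → X}

/-- A graph whose edges join the vertices other than `r` to their parents is a tree. -/
theorem SimpleGraph.isTree_of_parent [Finite X] (h₁ : ∀ x, x ≠ r → G.Adj x (par x))
    (h₂ : ∀ x y, G.Adj x y → (x ≠ r ∧ par x = y) ∨ (y ≠ r ∧ par y = x))
    (h₃ : ∀ x, ∃ n, par^[n] x = r) : G.IsTree := by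
  classical
  have hr : ∀ n x, par^[n] x = r → G.Reachable x r := by
    intro n
    induction n with
    | zero => rintro x rfl; exact .refl _
    | succ n ih =>
      intro x hx
      by_cases h : x = r
      · rw [h]
      · exact (h₁ x h).reachable.trans (ih _ (by rwa [Function.iterate_succ_apply] at hx))
  have hc : G.Connected := by
    have : Nonempty X := ⟨r⟩
    refine ⟨fun x y => ?_⟩
    obtain ⟨n, hn⟩ := h₃ x
    obtain ⟨m, hm⟩ := h₃ y
    exact (hr n x hn).trans (hr m y hm).symm
  rw [SimpleGraph.isTree_iff_connected_and_card]
  refine ⟨hc, le_antisymm ?_ hc.card_vert_le_card_edgeSet_add_one⟩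
  let e : {x // x ≠ r} → G.edgeSet := fun x => ⟨s(x.1, par x.1), h₁ x.1 x.2⟩
  have he : Function.Surjective e := by
    rintro ⟨z, hz⟩
    induction z with
    | h x y =>
      rcases h₂ x y hz with ⟨h, rfl⟩ | ⟨h, rfl⟩
      · exact ⟨⟨x, h⟩, rfl⟩
      · exact ⟨⟨y, h⟩, Subtype.ext Sym2.eq_swap⟩
  have h4 := Nat.card_le_card_of_surjective e he
  have := Fintype.ofFinite X
  have h5 : Nat.card {x // x ≠ r} + 1 = Nat.card X := by
    simp only [Nat.card_eq_fintype_card, Fintype.card_subtype_compl, Fintype.card_subtype_eq]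
    have : 0 < Fintype.card X := Fintype.card_pos_iff.2 ⟨r⟩
    omega
  omega

/-- A graph is obtained from a subgraph by attaching graphs to its vertices if every edge which is not in the subgraph
joins vertices with the same anchor. -/
theorem exists_iso_attachAt {S : Type v} {H : SimpleGraph S} (Φ : H ↪g G) (ρ : X → S)
    (hρ : ∀ s, ρ (Φ s) = s)
    (h : ∀ x y, G.Adj x y → ρ x = ρ y ∨ (x = Φ (ρ x) ∧ y = Φ (ρ y))) :
    ∃ e : G ≃g attachAt H (fun s => G.induce {x | ρ x = s}) (fun s => ⟨Φ s, hρ s⟩), ∀ s, e (Φ s) =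
    ⟨s, Φ s, hρ s⟩ := by
  let e : X ≃ Σ s, {x | ρ x = s} := ⟨fun x => ⟨ρ x, x, rfl⟩, fun p => p.2.1, fun x => rfl, by rintro ⟨s, x, rfl⟩; rfl⟩
  refine ⟨⟨e, fun {x y} => ?_⟩, fun s => e.symm.injective rfl⟩
  rw [attachAt_adj]
  constructor
  · rintro (⟨h1, h2, h3⟩ | ⟨s, y', z', h1, h2, h3⟩)
    · have e1 : x = Φ (ρ x) := congrArg Subtype.val h2
      have e2 : y = Φ (ρ y) := congrArg Subtype.val h3
      rw [e1, e2]
      exact Φ.map_rel_iff.2 h1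
    · obtain rfl : x = y'.1 := by rw [← e.symm_apply_apply x, h2]; rfl
      obtain rfl : y = z'.1 := by rw [← e.symm_apply_apply y, h3]; rfl
      exact h1
  · intro hxy
    by_cases h' : ρ x = ρ y
    · right
      refine ⟨ρ y, ⟨x, h'⟩, ⟨y, rfl⟩, hxy, e.symm.injective rfl, rfl⟩
    · obtain ⟨h1, h2⟩ := (h x y hxy).resolve_left h'
      refine .inl ⟨?_, Subtype.ext h1, Subtype.ext h2⟩
      rw [h1, h2] at hxy
      exact Φ.map_rel_iff.1 hxy

theorem SimpleGraph.dist_le_one_of_eq_or_adj {x y : X} (h : y = x ∨ G.Adj x y) : G.dist x y ≤ 1 :=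
    by
  rcases h with rfl | h
  · simp
  · exact SimpleGraph.dist_le h.toWalk

theorem SimpleGraph.dist_le_two_of_adj {x y z : X} (h : z = x ∨ G.Adj x z) (h' : y = z ∨ G.Adj z y)
    : G.dist x y ≤ 2 := by
  rcases h with rfl | h <;> rcases h' with rfl | h'
  · simp
  · exact (SimpleGraph.dist_le h'.toWalk).trans (by simp)
  · exact (SimpleGraph.dist_le h.toWalk).trans (by simp)
  · exact SimpleGraph.dist_le (.cons h h'.toWalk)

/-- A strip with trees attached to it, which are given by parents: `ρ x` is the vertex of the
strip to whose tree `x` belongs, and `par x` is the next vertex on the way there. -/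
theorem isHexCaterpillar_of_parent {X : Type} [Finite X] {G : SimpleGraph X} {n : ℕ}
    {t : Fin (n + 1) → ℕ} {d : Fin n → ℤˣ} (Φ : hexStrip t d ↪g G)
    {α β : StripVertex t d} (hα : α = stripMk t d 0 .a ∨ α = stripMk t d 0 (.aj 0))
    (hβ : β = stripMk t d (Fin.last n) .b ∨ β = stripMk t d (Fin.last n) (.bj 1)) (par : X → X)
    (ρ : X → StripVertex t d)
    (hρ : ∀ s, ρ (Φ s) = s) (hpar : ∀ x, ρ (par x) = ρ x)
    (hadj : ∀ x, x ≠ Φ (ρ x) → G.Adj x (par x))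
    (h : ∀ x y, G.Adj x y → (x = Φ (ρ x) ∧ y = Φ (ρ y)) ∨ (x ≠ Φ (ρ x) ∧ par x = y) ∨ (y ≠ Φ (ρ y)
    ∧ par y = x))
    (h2 : ∀ x, par (par x) = Φ (ρ x)) (h1 : ∀ x, ρ x ≠ α → ρ x ≠ β → par x = Φ (ρ x))
    (h0 : ∀ x, ¬ IsPort t d (ρ x) → x = Φ (ρ x)) :
    IsHexCaterpillar G (Φ α) (Φ β) := by
  have hsame : ∀ x y, G.Adj x y → ρ x = ρ y ∨ (x = Φ (ρ x) ∧ y = Φ (ρ y)) := by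
    intro x y hxy
    rcases h x y hxy with e | ⟨-, e⟩ | ⟨-, e⟩
    · exact .inr e
    · exact .inl (by rw [← e, hpar])
    · exact .inl (by rw [← e, hpar])
  obtain ⟨e, he⟩ := exists_iso_attachAt Φ ρ hρ hsame
  have hroot : ∀ {s} (x : {x | ρ x = s}), x.1 ≠ Φ s → x.1 ≠ Φ (ρ x.1) := by
    rintro _ ⟨x, rfl⟩ h; exact h
  have hd : ∀ {s} (x : {x | ρ x = s}), par (par x.1) = Φ s := by
    rintro _ ⟨x, rfl⟩; exact h2 x
  have step : ∀ {s} (x : {x | ρ x = s}), par x.1 = x.1 ∨ G.Adj (par x.1) x.1 := by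
    rintro _ ⟨x, rfl⟩
    by_cases hx : x = Φ (ρ x)
    · left
      by_contra hc
      have h3 : par x ≠ Φ (ρ (par x)) := by rw [hpar, ← hx]; exact hc
      have h4 := hadj _ h3
      rw [h2 x, ← hx] at h4
      rcases h _ _ h4 with e1 | ⟨-, e1⟩ | ⟨e1, -⟩
      · exact h3 e1.1
      · have := h2 (par x)
        rw [hpar, e1, ← hx] at this
        exact hc this
      · exact e1 hx
    · exact .inr (hadj x hx).symm
  refine ⟨n, t, d, α, β, _, _, _, hα, hβ, fun s => inferInstance, fun s => ?_, fun s x => ?_, fun s hs hs' x => ?_, fun s hs x => ?_, e, he α, he β⟩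
  · refine SimpleGraph.isTree_of_parent (r := ⟨Φ s, hρ s⟩) (par := fun x => ⟨par x.1, (hpar x.1).trans x.2⟩) ?_ ?_ ?_
    · rintro x hx
      exact hadj _ (hroot x fun e => hx (Subtype.ext e))
    · rintro ⟨x, rfl⟩ ⟨y, hy⟩ hxy
      have hy' : ρ y = ρ x := hy
      rcases h x y hxy with e | ⟨e1, e2⟩ | ⟨e1, e2⟩
      · exact absurd (e.1.trans ((congrArg Φ hy'.symm).trans e.2.symm)) (SimpleGraph.Adj.ne hxy)
      · exact .inl ⟨fun e => e1 (congrArg Subtype.val e), Subtype.ext e2⟩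
      · refine .inr ⟨fun e => e1 ?_, Subtype.ext e2⟩
        rw [hy']; exact congrArg Subtype.val e
    · intro x
      exact ⟨2, Subtype.ext (hd x)⟩
  · refine SimpleGraph.dist_le_two_of_adj (z := ⟨par x.1, (hpar x.1).trans x.2⟩) ?_ ?_
    · rcases step ⟨par x.1, (hpar x.1).trans x.2⟩ with e | e <;> simp only [hd x] at e
      · exact .inl (Subtype.ext e.symm)
      · exact .inr e
    · rcases step x with e | e
      · exact .inl (Subtype.ext e.symm)
      · exact .inr e
  · refine SimpleGraph.dist_le_one_of_eq_or_adj ?_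
    obtain ⟨x, rfl⟩ := x
    have e1 := h1 x hs hs'
    rcases step (s := ρ x) ⟨x, rfl⟩ with e | e <;> simp only [e1] at e
    · exact .inl (Subtype.ext e.symm)
    · exact .inr e
  · obtain ⟨x, rfl⟩ := x
    exact Subtype.ext (h0 x hs)

end

/-! ### Pieces of a layout -/

namespace Lab

/-- All names that occur are the numbers `2, …, t + 1`. The numbers `0` and `1` are not used,
because they are the indices of `a₁` and `a₂` in `cellLab`. -/
def Named (t : ℕ) : Lab ℕ → Prop
  | .hub _ _ => True
  | .A _ n => ∀ m ∈ n, 2 ≤ m ∧ m < t + 2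
  | .B _ n => ∀ m ∈ n, 2 ≤ m ∧ m < t + 2
  | .pend _ _ m => 2 ≤ m ∧ m < t + 2
  | .deep _ m m' => (2 ≤ m ∧ m < t + 2) ∧ 2 ≤ m' ∧ m' < t + 2

/-- The labels between the consecutive unfused cuts `p` and `q`. The hub `lo` of cut `p` belongs
to the previous piece. The vertices attached to a common middle hub of two pieces are attributed
to the piece on the right. -/
def Between (w : Layout) (p q : ℤ) : Lab ℕ → Prop
  | .hub i s => p ≤ i ∧ i ≤ q ∧ (i = p → s ≠ .lo) ∧ (p < i → s ≠ .hi)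
  | .A i _ => p ≤ i ∧ i < q ∧ w.hex i = true
  | .B i _ => p ≤ i ∧ i < q ∧ w.hex i = true
  | .pend i s _ => p ≤ i ∧ i ≤ q ∧ (i = p → s ≠ .lo) ∧ (p < i → s ≠ .hi) ∧ (i = q → s ≠ .mid)
  | .deep i _ _ => i = p

/-- The label of the hub, or of the inner vertex of a cell, to which a label is attached. -/
def base {N : Type u} : Lab N → Lab N
  | .pend i s _ => .hub i s
  | .deep i _ _ => .hub i .mid
  | x => x

/-- One step on the way from a label to its base. -/
def par {N : Type u} : Lab N → Lab N
  | .pend i s _ => .hub i s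
  | .deep i n _ => .pend i .mid n
  | x => x

variable {N : Type u} {w : Layout} {p q : ℤ} {t : ℕ}

theorem par_par (x : Lab N) : x.par.par = x.base := by cases x <;> rfl
theorem base_par (x : Lab N) : x.par.base = x.base := by cases x <;> rfl
theorem base_base (x : Lab N) : x.base.base = x.base := by cases x <;> rfl

theorem adj_cases {x y : Lab N} (h : (w.graph N).Adj x y) :
    (x = x.base ∧ y = y.base) ∨ (x ≠ x.base ∧ x.par = y) ∨ (y ≠ y.base ∧ y.par = x) := by
  cases x <;> cases y <;> simp [Layout.adj_iff, Layout.Edge, base, par] at h ⊢ <;> grind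

theorem adj_par {x : Lab ℕ} (hx : x.Between w p q) (hp : w.fused p = false) (h : x ≠ x.base) :
    (w.graph ℕ).Adj x x.par := by
  cases x <;> simp [Layout.adj_iff, Layout.Edge, base, par, Between] at hx h ⊢
  · rename_i i s n
    rintro rfl
    have : i = p := by grind
    rw [this]; exact hp
  · rw [hx]; exact hp

/-- The vertices of the piece between the consecutive unfused cuts `p` and `q`, with `t` names. -/
def region (w : Layout) (t : ℕ) (p q : ℤ) : Set (Lab ℕ) := {x | x.Between w p q ∧ x.Named t}

theorem par_mem_region {x : Lab ℕ} (hx : x ∈ region w t p q) (hpq : p < q) : x.par ∈ region w t p q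
    := by
  obtain ⟨h1, h2⟩ := hx
  cases x <;> simp [region, par, Between, Named] at h1 h2 ⊢ <;> grind

theorem base_mem_region {x : Lab ℕ} (hx : x ∈ region w t p q) (hpq : p < q) : x.base ∈ region w t p
    q := by
  rw [← par_par]; exact par_mem_region (par_mem_region hx hpq) hpq

theorem region_finite (hpq : p < q) : (region w t p q).Finite := by
  have hK := Set.finite_Icc p q
  have hN := Set.finite_Iio (t + 2)
  have hS : ({.mid, .lo, .hi} : Set Spot).Finite := by simp
  have hO : ({none} ∪ some '' Set.Iio (t + 2) : Set (Option ℕ)).Finite := (Set.finite_singleton _).union (hN.image _)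
  have h1 := Set.Finite.image2 (Lab.hub (N := ℕ)) hK hS
  have h2 := Set.Finite.image2 Lab.A hK hO
  have h3 := Set.Finite.image2 Lab.B hK hO
  have h4 := (hK.prod (hS.prod hN)).image (fun x => Lab.pend x.1 x.2.1 x.2.2)
  have h5 := (hK.prod (hN.prod hN)).image (fun x => Lab.deep x.1 x.2.1 x.2.2)
  refine ((((h1.union h2).union h3).union h4).union h5).subset ?_
  have hO' : ∀ n : Option ℕ, (∀ m ∈ n, 2 ≤ m ∧ m < t + 2) → n ∈ ({none} ∪ some '' Set.Iio (t + 2) : Set (Option ℕ)) := by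
    rintro (_ | n) h
    · exact .inl rfl
    · exact .inr ⟨n, (h n rfl).2, rfl⟩
  rintro x ⟨hx, hx'⟩
  cases x with
  | hub i s => exact .inl (.inl (.inl (.inl ⟨i, ⟨hx.1, hx.2.1⟩, s, by cases s <;> simp, rfl⟩)))
  | A i n => exact .inl (.inl (.inl (.inr ⟨i, ⟨hx.1, hx.2.1.le⟩, n, hO' n hx', rfl⟩)))
  | B i n => exact .inl (.inl (.inr ⟨i, ⟨hx.1, hx.2.1.le⟩, n, hO' n hx', rfl⟩))
  | pend i s n => exact .inl (.inr ⟨(i, s, n), ⟨⟨hx.1, hx.2.1⟩, by cases s <;> simp, hx'.2⟩, rfl⟩)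
  | deep i n m =>
    obtain rfl : i = p := hx
    exact .inr ⟨(i, n, m), ⟨⟨le_rfl, hpq.le⟩, hx'.1.2, hx'.2.2⟩, rfl⟩

theorem between_inPiece {x : Lab ℕ} (hx : x.Between w p q) (hpq : p < q) : x.InPiece p q := by
  cases x <;> simp [Between, InPiece] at hx ⊢ <;> grind

end Lab

/-! ### Pieces made of hexagonal cells -/

namespace Layout
variable {w : Layout} {p q : ℤ} {t : ℕ}

/-- A piece that consists of hexagonal cells is a hexagonal caterpillar, as only the cuts inside
it are fused. Its strip is formed by the labels that are their own base; each cell has `t + 2`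
paths. -/
theorem isHexCaterpillar_region {n : ℕ} (hq : q = p + n + 1) (hp : w.fused p = false)
    (hhex : ∀ i, p ≤ i → i < q → w.hex i = true)
    (hfus : ∀ i, p < i → i < q → w.fused i = true) (ha : .hub p .mid ∈ Lab.region w t p q)
    (hb : .hub q .mid ∈ Lab.region w t p q) :
    IsHexCaterpillar ((w.graph ℕ).induce (Lab.region w t p q)) ⟨_, ha⟩ ⟨_, hb⟩ := by
  have hpq : p < q := by omega
  have : Finite (Lab.region w t p q) := (Lab.region_finite hpq).to_subtype
  let d : Fin n → ℤˣ := fun i => if w.bMid (p + i) ≠ w.aMid (p + i + 1) then 1 else -1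
  have hd : ∀ i : Fin n, d i = 1 ↔ w.bMid (p + i) ≠ w.aMid (p + i + 1) := by
    intro i
    have hm : (-1 : ℤˣ) ≠ 1 := by decide
    simp only [d]; split_ifs with h <;> simp [h, hm]
  obtain ⟨Φ, hΦ⟩ := exists_strip_embedding w (fun _ : Fin (n + 1) => t) d p (fun i => hhex _ (by omega) (by have := i.2; omega))
    (fun i => hfus _ (by omega) (by have := i.2; omega)) hd
  have cS := w.aS_a1S
  have cS' := w.bS_b2S
  have hmem : ∀ s, Φ s ∈ Lab.region w t p q ∧ (Φ s).base = Φ s := by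
    intro s
    induction s using Quot.ind with
    | mk s =>
      obtain ⟨i, x⟩ := s
      rw [show Quot.mk _ ⟨i, x⟩ = stripMk (fun _ => t) d i x from rfl, hΦ]
      have hi := i.2
      have h1 := hhex (p + i) (by omega) (by omega)
      have h2 := cS (p + i)
      have h3 := cS' (p + i)
      have h4 : p < p + i → w.fused (p + i) = true := fun h => hfus _ h (by omega)
      have h5 : (i : ℤ) ≠ 0 → 0 < (i : ℤ) := by omega
      rcases x with _ | _ | j | j
      · simp only [cellLab, Lab.region, Lab.Between, Lab.Named, Lab.base, Set.mem_ofPred_eq, and_true]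
        refine ⟨by omega, by omega, fun e => ?_, fun e => ?_⟩ <;> grind
      · simp only [cellLab, Lab.region, Lab.Between, Lab.Named, Lab.base, Set.mem_ofPred_eq, and_true]
        refine ⟨by omega, by omega, fun e => ?_, fun e => ?_⟩ <;> grind
      · simp only [cellLab]
        split_ifs with e1 e2
        · simp only [Lab.region, Lab.Between, Lab.Named, Lab.base, Set.mem_ofPred_eq, and_true]
          refine ⟨by omega, by omega, fun e => ?_, fun e => ?_⟩ <;> grind
        · simp [Lab.region, Lab.Between, Lab.Named, Lab.base, h1]; omega
        · have e1' : (j : ℕ) ≠ 0 := fun h => e1 (Fin.ext h)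
          have e2' : (j : ℕ) ≠ 1 := fun h => e2 (Fin.ext h)
          have : (j : ℕ) < t + 2 := j.2
          simp only [Lab.region, Lab.Between, Lab.Named, Lab.base, Set.mem_ofPred_eq, and_true]
          refine ⟨⟨by omega, by omega, h1⟩, ?_⟩
          rintro m ⟨⟩
          omega
      · simp only [cellLab]
        split_ifs with e1 e2
        · simp [Lab.region, Lab.Between, Lab.Named, Lab.base, h1]; omega
        · simp only [Lab.region, Lab.Between, Lab.Named, Lab.base, Set.mem_ofPred_eq, and_true]
          refine ⟨by omega, by omega, fun e => ?_, fun e => ?_⟩ <;> grind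
        · have e1' : (j : ℕ) ≠ 0 := fun h => e1 (Fin.ext h)
          have e2' : (j : ℕ) ≠ 1 := fun h => e2 (Fin.ext h)
          have : (j : ℕ) < t + 2 := j.2
          simp only [Lab.region, Lab.Between, Lab.Named, Lab.base, Set.mem_ofPred_eq, and_true]
          refine ⟨⟨by omega, by omega, h1⟩, ?_⟩
          rintro m ⟨⟩
          omega
  have cell : ∀ j, p ≤ j → j < q → ∃ i : Fin (n + 1), j = p + i := fun j h1 h2 => ⟨⟨(j - p).toNat, by omega⟩, by simp; omega⟩
  have hsurj : ∀ x ∈ Lab.region w t p q, x.base = x → ∃ s, Φ s = x := by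
    rintro x ⟨h1, h2⟩ h3
    cases x with
    | pend i s n => cases h3
    | deep i n m => cases h3
    | hub i s =>
      obtain ⟨h4, h5, h6, h7⟩ := h1
      rcases h4.eq_or_lt with rfl | h4
      · have h8 := cS p
        have h9 := h6 rfl
        by_cases h : w.aS p = s
        · exact ⟨_, (hΦ 0 .a).trans (by simp [cellLab, h])⟩
        · refine ⟨_, (hΦ 0 (.aj 0)).trans ?_⟩
          have : w.a1S p = s := by cases s <;> grind
          simp [cellLab, this]
      · obtain ⟨j, hj⟩ := cell (i - 1) (by omega) (by omega)
        have h8 := cS' (p + j)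
        have h9 := h7 h4
        obtain rfl : i = p + j + 1 := by omega
        by_cases h : w.bS (p + j) = s
        · exact ⟨_, (hΦ j .b).trans (by simp [cellLab, h])⟩
        · refine ⟨_, (hΦ j (.bj 1)).trans ?_⟩
          have : w.b2S (p + j) = s := by cases s <;> grind
          simp [cellLab, this]
    | A i m =>
      obtain ⟨j, rfl⟩ := cell i h1.1 h1.2.1
      cases m with
      | none => exact ⟨_, (hΦ j (.aj 1)).trans (by simp [cellLab])⟩
      | some m =>
        have := h2 m rfl
        refine ⟨_, (hΦ j (.aj ⟨m, this.2⟩)).trans ?_⟩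
        simp [cellLab, Fin.ext_iff]
        split_ifs <;> first | omega | rfl
    | B i m =>
      obtain ⟨j, rfl⟩ := cell i h1.1 h1.2.1
      cases m with
      | none => exact ⟨_, (hΦ j (.bj 0)).trans (by simp [cellLab])⟩
      | some m =>
        have := h2 m rfl
        refine ⟨_, (hΦ j (.bj ⟨m, this.2⟩)).trans ?_⟩
        simp [cellLab, Fin.ext_iff]
        split_ifs <;> first | omega | rfl
  have : Nonempty (StripVertex (fun _ : Fin (n + 1) => t) d) := ⟨stripMk _ d 0 .a⟩
  choose! σ hσ using fun x (hx : x ∈ Lab.region w t p q) => hsurj x.base (Lab.base_mem_region hx hpq) (Lab.base_base x)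
  let Φ' : hexStrip (fun _ : Fin (n + 1) => t) d ↪g (w.graph ℕ).induce (Lab.region w t p q) :=
    ⟨⟨fun s => ⟨Φ s, (hmem s).1⟩, fun s s' e => Φ.injective (congrArg Subtype.val e)⟩, Φ.map_rel_iff⟩
  have hΦ' : ∀ s, (Φ' s).1 = Φ s := fun s => rfl
  have hroot : ∀ x : Lab.region w t p q, x = Φ' (σ x.1) ↔ x.1 = x.1.base := fun x => by
    rw [Subtype.ext_iff, hΦ', hσ x.1 x.2]
  obtain ⟨α, hα, eα⟩ : ∃ α, (α = stripMk (fun _ => t) d 0 .a ∨ α = stripMk (fun _ => t) d 0 (.aj 0)) ∧ Φ α = .hub p .mid := by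
    rcases cS p with h | h
    · exact ⟨_, .inl rfl, (hΦ 0 .a).trans (by simp [cellLab, h.1])⟩
    · exact ⟨_, .inr rfl, (hΦ 0 (.aj 0)).trans (by simp [cellLab, h.1])⟩
  obtain ⟨β, hβ, eβ⟩ : ∃ β, (β = stripMk (fun _ => t) d (Fin.last n) .b ∨ β = stripMk (fun _ => t) d (Fin.last n) (.bj 1)) ∧ Φ β = .hub q .mid := by
    rcases cS' (p + n) with h | h
    · exact ⟨_, .inl rfl, (hΦ (Fin.last n) .b).trans (by simp [cellLab, h.1, hq])⟩
    · exact ⟨_, .inr rfl, (hΦ (Fin.last n) (.bj 1)).trans (by simp [cellLab, h.1, hq])⟩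
  have main := isHexCaterpillar_of_parent Φ' hα hβ (fun x => ⟨x.1.par, Lab.par_mem_region x.2 hpq⟩) (fun x => σ x.1) (fun s => ?_) (fun x => ?_)
    (fun x hx => ?_) (fun x y hxy => ?_) (fun x => ?_) (fun x h1 h2 => ?_) (fun x hx => ?_)
  · convert main using 1
    · exact Subtype.ext eα.symm
    · exact Subtype.ext eβ.symm
  · exact Φ.injective ((hσ _ (hmem s).1).trans (hmem s).2)
  · exact Φ.injective (by rw [hσ _ (Lab.par_mem_region x.2 hpq), hσ _ x.2, Lab.base_par])
  · exact Lab.adj_par x.2.1 hp (fun e => hx ((hroot x).2 e))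
  · exact (Lab.adj_cases (x := x.1) (y := y.1) hxy).imp (fun h => ⟨(hroot x).2 h.1, (hroot y).2 h.2⟩)
      (Or.imp (fun h => ⟨fun e => h.1 ((hroot x).1 e), Subtype.ext h.2⟩) fun h => ⟨fun e => h.1 ((hroot y).1 e), Subtype.ext h.2⟩)
  · refine Subtype.ext ?_
    rw [hΦ', hσ x.1 x.2, ← Lab.par_par]
  · refine Subtype.ext ?_
    rw [hΦ', hσ x.1 x.2]
    obtain ⟨x, hx, hx'⟩ := x
    cases x with
    | deep i n m =>
      have e : i = p := hx
      exact absurd (Φ.injective ((hσ _ ⟨hx, hx'⟩).trans (by rw [eα, ← e]; rfl))) h1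
    | _ => rfl
  · rw [hroot]
    by_contra hne
    refine hx ?_
    have e := hσ x.1 x.2
    obtain ⟨i, s, his⟩ : ∃ i s, x.1.base = .hub i s := by
      obtain ⟨x, hx, hx'⟩ := x
      cases x <;> first | exact ⟨_, _, rfl⟩ | exact absurd rfl hne
    rw [his] at e
    generalize σ x.1 = z at e
    induction z using Quot.ind with
    | mk z =>
      obtain ⟨j, y⟩ := z
      rw [show Quot.mk _ ⟨j, y⟩ = stripMk (fun _ => t) d j y from rfl, hΦ] at e
      show IsPort _ d (stripMk (fun _ => t) d j y)
      refine ⟨j, ?_⟩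
      rcases y with _ | _ | y | y
      · exact .inl rfl
      · exact .inr (.inl rfl)
      · simp only [cellLab] at e
        split_ifs at e with h1
        rw [h1]; exact .inr (.inr (.inl rfl))
      · simp only [cellLab] at e
        split_ifs at e with h1 h1
        rw [h1]; exact .inr (.inr (.inr rfl))

end Layout

/-! ### Pieces made of one edge -/

/-- A function that grows by at most 1 along each edge grows by at most the length along a walk.
-/
theorem SimpleGraph.Walk.le_add_length {V : Type u} {G : SimpleGraph V} {g : V → ℕ}
    (h : ∀ x y, G.Adj x y → g y ≤ g x + 1) {x y : V}
    (p : G.Walk x y) : g y ≤ g x + p.length := by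
  induction p with
  | nil => simp
  | cons hxy _ ih => have := h _ _ hxy; simp only [SimpleGraph.Walk.length_cons]; omega

namespace Layout
variable {w : Layout} {p : ℤ} {t : ℕ}

/-- The labels of the region of a single edge. -/
theorem region_edge_cases (hp : w.hex p = false) {x : Lab ℕ} (hx : x ∈ Lab.region w t p (p + 1)) :
    x = .hub p .mid ∨ x = .hub p .hi ∨ x = .hub (p + 1) .mid ∨ x = .hub (p + 1) .lo ∨
    (∃ n, x = .pend p .mid n) ∨ (∃ n, x = .pend p .hi n) ∨
    (∃ n, x = .pend (p + 1) .lo n) ∨ ∃ n m, x = .deep p n m := by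
  obtain ⟨hx, -⟩ := hx
  cases x with
  | hub i s =>
    obtain ⟨h1, h2, h3, h4⟩ := hx
    obtain rfl | rfl : i = p ∨ i = p + 1 := by omega
    · cases s <;> simp at h3 ⊢
    · cases s <;> simp at h4 ⊢
  | A i n =>
    obtain rfl : i = p := by have := hx.1; have := hx.2.1; omega
    exact absurd hx.2.2 (by simp [hp])
  | B i n =>
    obtain rfl : i = p := by have := hx.1; have := hx.2.1; omega
    exact absurd hx.2.2 (by simp [hp])
  | pend i s n =>
    obtain ⟨h1, h2, h3, h4, h5⟩ := hx
    obtain rfl | rfl : i = p ∨ i = p + 1 := by omega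
    · cases s <;> simp at h3 ⊢
    · cases s <;> simp at h4 h5 ⊢
  | deep i n m =>
    obtain rfl : i = p := hx
    simp

/-- The parent in the tree of an edge cell, whose root is the hub in the middle of cut `q`. -/
def edgePar (q : ℤ) : Lab ℕ → Lab ℕ
  | .hub i s => if s = .mid then .hub q .mid else .hub i .mid
  | x => x.par

/-- A height function which changes by at most 1 along the edges of an edge cell. -/
def edgeHeight (p : ℤ) : Lab ℕ → ℕ
  | .hub i s => (if i = p then 2 else 3) + if s = .mid then 0 else 1
  | .pend i s _ => if s = .mid then 1 else if i = p then 4 else 5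
  | _ => 0

/-- A piece that consists of an edge cell is a lobster whose path is this edge. No single vertex
is within distance 2 of all vertices: for `t ≥ 1` there are vertices `deep` on the left and
pendant at `lo` on the right, and these have distance 5. -/
theorem isLobster_region (hp : w.hex p = false) (hf : w.fused p = false)
    (hf' : w.fused (p + 1) = false) (ht : 1 ≤ t)
    (ha : .hub p .mid ∈ Lab.region w t p (p + 1)) (hb : .hub (p + 1) .mid ∈ Lab.region w t p (p +
    1)) :
    IsLobster ((w.graph ℕ).induce (Lab.region w t p (p + 1))) ⟨_, ha⟩ ⟨_, hb⟩ := by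
  have hpq : p < p + 1 := by omega
  have hfin : Finite (Lab.region w t p (p + 1)) := (Lab.region_finite hpq).to_subtype
  set H := (w.graph ℕ).induce (Lab.region w t p (p + 1)) with hH
  have hHadj : ∀ x y, H.Adj x y ↔ (w.graph ℕ).Adj x.1 y.1 := fun x y => Iff.rfl
  have hcase : ∀ x : Lab.region w t p (p + 1), _ := fun x => region_edge_cases hp x.2
  have hpar : ∀ x ∈ Lab.region w t p (p + 1), edgePar (p + 1) x ∈ Lab.region w t p (p + 1) := by
    intro x hx
    cases x with
    | hub i s =>
      simp only [edgePar]
      split_ifs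
      · exact hb
      · have := hx.1; simp [Lab.Between, Lab.region, Lab.Named] at this ⊢; omega
    | _ => exact Lab.par_mem_region hx hpq
  have hadjpar : ∀ x ∈ Lab.region w t p (p + 1), x ≠ .hub (p + 1) .mid → (w.graph ℕ).Adj x (edgePar (p + 1) x) := by
    intro x hx hne
    rcases region_edge_cases hp hx with rfl | rfl | rfl | rfl | ⟨n, rfl⟩ | ⟨n, rfl⟩ | ⟨n, rfl⟩ | ⟨n, m, rfl⟩
    · simp [edgePar, adj_iff, Edge, hp]
    · simp [edgePar, adj_iff, Edge, hf]
    · exact absurd rfl hne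
    · simp [edgePar, adj_iff, Edge]
    · simp [edgePar, Lab.par, adj_iff, Edge]
    · simp [edgePar, Lab.par, adj_iff, Edge, hf]
    · simp [edgePar, Lab.par, adj_iff, Edge]
    · simp [edgePar, Lab.par, adj_iff, Edge, hf]
  have hadj : ∀ x ∈ Lab.region w t p (p + 1), ∀ y ∈ Lab.region w t p (p + 1), (w.graph ℕ).Adj x y →
      (x ≠ .hub (p + 1) .mid ∧ edgePar (p + 1) x = y) ∨ (y ≠ .hub (p + 1) .mid ∧ edgePar (p + 1) y = x) := by
    intro x hx y hy hxy
    rcases region_edge_cases hp hx with rfl | rfl | rfl | rfl | ⟨n, rfl⟩ | ⟨n, rfl⟩ | ⟨n, rfl⟩ | ⟨n, m, rfl⟩ <;>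
    rcases region_edge_cases hp hy with rfl | rfl | rfl | rfl | ⟨n', rfl⟩ | ⟨n', rfl⟩ | ⟨n', rfl⟩ | ⟨n', m', rfl⟩ <;>
      simp [edgePar, Lab.par, adj_iff, Edge] at hxy ⊢ <;> simp [hxy]
  have htree : H.IsTree := by
    refine SimpleGraph.isTree_of_parent (r := ⟨_, hb⟩) (par := fun x => ⟨edgePar (p + 1) x.1, hpar _ x.2⟩) ?_ ?_ ?_
    · intro x hx
      exact hadjpar x.1 x.2 fun e => hx (Subtype.ext e)
    · intro x y hxy
      simpa only [ne_eq, Subtype.ext_iff] using hadj x.1 x.2 y.1 y.2 hxy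
    · intro x
      refine ⟨3, Subtype.ext ?_⟩
      show edgePar (p + 1) (edgePar (p + 1) (edgePar (p + 1) x.1)) = _
      rcases hcase x with e | e | e | e | ⟨n, e⟩ | ⟨n, e⟩ | ⟨n, e⟩ | ⟨n, m, e⟩ <;> rw [e] <;> simp [edgePar, Lab.par]
  have hab : H.Adj ⟨_, ha⟩ ⟨_, hb⟩ := by rw [hHadj]; simp [adj_iff, Edge, hp]
  let P : Lab.region w t p (p + 1) → Lab.region w t p (p + 1) := fun x => ⟨edgePar (p + 1) x.1, hpar _ x.2⟩
  have hstep : ∀ x, x = P x ∨ H.Adj (P x) x := fun x => by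
    by_cases h : x.1 = .hub (p + 1) .mid
    · left; refine Subtype.ext ?_; simp only [P, h]; simp [edgePar]
    · exact .inr (hadjpar x.1 x.2 h).symm
  refine ⟨hfin, htree, hab.toWalk, SimpleGraph.Walk.IsPath.of_adj hab, ?_, ?_⟩
  · intro x
    refine ⟨P (P x), ?_, SimpleGraph.dist_le_two_of_adj (hstep (P x)) (hstep x)⟩
    have : (P (P x)).1 = .hub p .mid ∨ (P (P x)).1 = .hub (p + 1) .mid := by
      simp only [P]
      rcases hcase x with e | e | e | e | ⟨n, e⟩ | ⟨n, e⟩ | ⟨n, e⟩ | ⟨n, m, e⟩ <;> rw [e] <;> simp [edgePar, Lab.par]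
    rw [hab.support_toWalk, List.mem_pair, Subtype.ext_iff, Subtype.ext_iff]
    exact this
  · intro c d q hq hd
    rw [hab.length_toWalk]
    by_contra hlen
    -- a single vertex cannot be near to both ends of a path of length 5
    have hq0 : q.length = 0 := by omega
    obtain rfl := SimpleGraph.Walk.eq_of_length_eq_zero hq0
    obtain rfl : q = .nil := SimpleGraph.Walk.eq_nil_iff_nil.2 (SimpleGraph.Walk.length_eq_zero_iff.1 hq0)
    have hlip : ∀ x y, H.Adj x y → edgeHeight p y.1 ≤ edgeHeight p x.1 + 1 := by
      intro x y hxy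
      have h' : (w.graph ℕ).Adj x.1 y.1 := hxy
      rcases hcase x with e | e | e | e | ⟨n, e⟩ | ⟨n, e⟩ | ⟨n, e⟩ | ⟨n, m, e⟩ <;>
      rcases hcase y with e' | e' | e' | e' | ⟨n', e'⟩ | ⟨n', e'⟩ | ⟨n', e'⟩ | ⟨n', m', e'⟩ <;> rw [e, e'] at h' ⊢ <;>
        simp [adj_iff, Edge, edgeHeight] at h' ⊢
    have hdist : ∀ x y, edgeHeight p y.1 ≤ edgeHeight p x.1 + H.dist x y := by
      intro x y
      obtain ⟨r, hr⟩ := htree.connected.exists_walk_length_eq_dist x y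
      rw [← hr]
      exact r.le_add_length (g := fun x => edgeHeight p x.1) hlip
    have m1 : .deep p 2 2 ∈ Lab.region w t p (p + 1) := by simp [Lab.region, Lab.Between, Lab.Named]; omega
    have m2 : .pend (p + 1) .lo 2 ∈ Lab.region w t p (p + 1) := by simp [Lab.region, Lab.Between, Lab.Named]; omega
    obtain ⟨y, hy, h1⟩ := hd ⟨_, m1⟩
    obtain ⟨y', hy', h2⟩ := hd ⟨_, m2⟩
    rw [SimpleGraph.Walk.support_nil, List.mem_singleton] at hy hy'
    subst hy hy'
    have h3 := hdist ⟨_, m1⟩ y'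
    have h4 := hdist y' ⟨_, m2⟩
    rw [SimpleGraph.dist_comm] at h3
    simp [edgeHeight] at h3 h4
    omega

end Layout

/-! ### Universality -/

namespace Layout
variable {w : Layout} {t : ℕ}

/-- The unfused cuts from cut 0 on can be enumerated, when only finitely many cuts are fused. -/
theorem exists_unfused_cuts {n : ℕ} (h : ∀ i, w.fused i = true → 0 < i ∧ i < n) : ∃ u : ℕ → ℤ, u 0
    = 0 ∧ StrictMono u ∧
    (∀ l, w.fused (u l) = false) ∧ ∀ l i, u l < i → i < u (l + 1) → w.fused i = true := by
  have key : ∀ c : ℤ, ∃ c', c < c' ∧ w.fused c' = false ∧ ∀ i, c < i → i < c' → w.fused i = true := by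
    intro c
    have hex : ∃ k : ℕ, w.fused (c + 1 + k) = false := by
      by_contra! hc
      have := (h _ (by simpa using hc (n + (-c).toNat))).2
      omega
    refine ⟨c + 1 + Nat.find hex, by omega, Nat.find_spec hex, fun i h1 h2 => ?_⟩
    have := Nat.find_min hex (m := (i - (c + 1)).toNat) (by omega)
    rw [show c + 1 + ((i - (c + 1)).toNat : ℤ) = i by omega] at this
    simpa using this
  choose nx h1 h2 h3 using key
  refine ⟨fun l => nx^[l] 0, rfl, strictMono_nat_of_lt_succ fun l => ?_, fun l => ?_, fun l i => ?_⟩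
  · rw [Function.iterate_succ_apply']; exact h1 _
  · cases l with
    | zero =>
      by_contra hc
      exact absurd (h 0 (by simpa using hc)).1 (by simp)
    | succ l => simp only [Function.iterate_succ_apply']; exact h2 _
  · show nx^[l] 0 < i → i < nx^[l + 1] 0 → _
    rw [Function.iterate_succ_apply']; exact h3 _ i

theorem exists_cut_between {u : ℕ → ℤ} (hu : StrictMono u) (h0 : u 0 = 0) {i : ℤ} (hi : 0 ≤ i) : ∃
    l : ℕ, u l ≤ i ∧ i < u (l + 1) ∧ (l : ℤ) ≤ i := by
  have hle : ∀ l : ℕ, (l : ℤ) ≤ u l := by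
    intro l
    induction l with
    | zero => simp [h0]
    | succ l ih => have := hu (Nat.lt_succ_self l); push_cast; simp only [Nat.succ_eq_add_one] at this; omega
  have hex : ∃ l : ℕ, i < u (l + 1) := ⟨i.toNat, by have := hle (i.toNat + 1); push_cast at this; omega⟩
  have h1 := Nat.find_spec hex
  have h2 : u (Nat.find hex) ≤ i := by
    rcases Nat.eq_zero_or_pos (Nat.find hex) with h | h
    · rw [h, h0]; exact hi
    · have := Nat.find_min hex (m := Nat.find hex - 1) (by omega)
      rw [Nat.sub_add_cancel h] at this
      omega
  exact ⟨_, h2, h1, (hle _).trans h2⟩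

/-- Every label that is attached to the universal graph is in the region of some piece. -/
theorem exists_mem_region {n : ℕ} {u : ℕ → ℤ} (hu : StrictMono u) (h0 : u 0 = 0)
    (hfu : ∀ l i, u l < i → i < u (l + 1) → w.fused i = true) {x : Lab ℕ}
    (hx : x.Within (Set.Ioo 0 (n : ℤ))) (hp : x.Present w)
    (ht : x.Named t) : ∃ l : Fin (n + 1), x ∈ Lab.region w t (u l) (u (l + 1)) := by
  have step : ∀ i : ℤ, i ∈ Set.Ioo 0 (n : ℤ) → ∃ l : ℕ, u l ≤ i ∧ i < u (l + 1) ∧ l < n + 1 := by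
    intro i hi
    obtain ⟨l, h1, h2, h3⟩ := exists_cut_between hu h0 hi.1.le
    exact ⟨l, h1, h2, by have := hi.2; omega⟩
  suffices ∃ l : ℕ, l < n + 1 ∧ x.Between w (u l) (u (l + 1)) by
    obtain ⟨l, hl, hb⟩ := this
    exact ⟨⟨l, hl⟩, hb, ht⟩
  have hub : ∀ (i : ℤ) (s : Spot), i ∈ Set.Ioo 0 (n : ℤ) → (s = .hi → w.fused i = false) → ∃ l : ℕ, l < n + 1 ∧ u l ≤ i ∧ i ≤ u (l + 1) ∧ (i = u l → s ≠ .lo) ∧ (u l < i → s ≠ .hi) ∧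
      (i = u (l + 1) → s ≠ .mid) := by
    intro i s hi hs
    obtain ⟨l, h1, h2, h3⟩ := step i hi
    by_cases hlo : i = u l ∧ s = .lo
    · obtain ⟨rfl, rfl⟩ := hlo
      obtain ⟨l, rfl⟩ : ∃ k, l = k + 1 := Nat.exists_eq_succ_of_ne_zero (by rintro rfl; rw [h0] at hi; exact absurd hi.1 (by simp))
      have h4 := hu (Nat.lt_succ_self l)
      exact ⟨l, by omega, h4.le, le_rfl, fun e => absurd e h4.ne', by simp, by simp⟩
    · refine ⟨l, h3, h1, h2.le, fun e e' => hlo ⟨e, e'⟩, fun h e => ?_, fun e => absurd e h2.ne⟩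
      rw [hfu l i h h2] at hs
      cases hs e
  cases x with
  | hub i s =>
    obtain ⟨l, h1, h2, h3, h4, h5, -⟩ := hub i s hx hp
    exact ⟨l, h1, h2, h3, h4, h5⟩
  | pend i s m =>
    obtain ⟨l, h1, h2⟩ := hub i s hx hp
    exact ⟨l, h1, h2⟩
  | A i m =>
    obtain ⟨l, h1, h2, h3⟩ := step i hx.1
    exact ⟨l, h3, h1, h2, hp⟩
  | B i m =>
    obtain ⟨l, h1, h2, h3⟩ := step i hx.1
    exact ⟨l, h3, h1, h2, hp⟩
  | deep i m m' =>
    obtain ⟨l, h1, h2, h3⟩ := step i hx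
    refine ⟨l, h3, ?_⟩
    by_contra hne
    have : w.fused i = true := hfu l i (lt_of_le_of_ne h1 fun e => hne e.symm) h2
    rw [show w.fused i = false from hp] at this
    cases this

/-- A bounded part of the universal graph is contained in a generalized hexagonal caterpillar. The
layout is cut at its unfused cuts. Since a fused cut is between hexagonal cells, every piece is a
single edge cell or consists of hexagonal cells. -/
theorem exists_isGenHexCaterpillar {n T : ℕ} (hw : w.Normal)
    (h : ∀ i, w.fused i = true → 0 < i ∧ i < n) (ht : 1 ≤ T) :
    ∃ (W : Type) (H : SimpleGraph W) (Φ : H ↪g w.graph ℕ), IsGenHexCaterpillar H ∧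
      ∀ x : Lab ℕ, x.Within (Set.Ioo 0 (n : ℤ)) → x.Present w → x.Named T → x ∈ Set.range Φ := by
  obtain ⟨u, h0, hu, hu', hfu⟩ := exists_unfused_cuts h
  have hlt : ∀ l, u l < u (l + 1) := fun l => hu (Nat.lt_succ_self l)
  have ma : ∀ l, .hub (u l) .mid ∈ Lab.region w T (u l) (u (l + 1)) := fun l => by
    have := (hlt l).le; simp [Lab.region, Lab.Between, Lab.Named, this]
  have mb : ∀ l, .hub (u (l + 1)) .mid ∈ Lab.region w T (u l) (u (l + 1)) := fun l => by
    have := (hlt l).le; simp [Lab.region, Lab.Between, Lab.Named, this]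
  let W : Fin (n + 1) → Type := fun l => Lab.region w T (u l) (u (l + 1))
  let H : ∀ l, SimpleGraph (W l) := fun l => (w.graph ℕ).induce (Lab.region w T (u l) (u (l + 1)))
  let a : ∀ l, W l := fun l => ⟨_, ma l⟩
  let b : ∀ l, W l := fun l => ⟨_, mb l⟩
  have hpiece : ∀ l : ℕ, IsHexCaterpillar ((w.graph ℕ).induce (Lab.region w T (u l) (u (l + 1)))) ⟨_, ma l⟩ ⟨_, mb l⟩ ∨
      IsLobster ((w.graph ℕ).induce (Lab.region w T (u l) (u (l + 1)))) ⟨_, ma l⟩ ⟨_, mb l⟩ := by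
    intro l
    have hl := hlt l
    by_cases hhex : ∀ i, u l ≤ i → i < u (l + 1) → w.hex i = true
    · left
      refine isHexCaterpillar_region (n := (u (l + 1) - u l - 1).toNat) (by omega) (hu' l) hhex (hfu l) _ _
    · right
      push Not at hhex
      obtain ⟨i, h1, h2, h3⟩ := hhex
      -- both ends of an edge cell are unfused
      have e1 : u l = i := by
        by_contra hne
        exact h3 (hw i (hfu l i (lt_of_le_of_ne h1 hne) h2)).1
      have e2 : u (l + 1) = i + 1 := by
        by_contra hne
        have := (hw (i + 1) (hfu l (i + 1) (by omega) (by omega))).2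
        rw [add_sub_cancel_right] at this
        exact h3 this
      have key : ∀ p q : ℤ, q = p + 1 → w.hex p = false → w.fused p = false → w.fused q = false → ∀ m₁ m₂,
          IsLobster ((w.graph ℕ).induce (Lab.region w T p q)) ⟨.hub p .mid, m₁⟩ ⟨.hub q .mid, m₂⟩ := by
        rintro p _ rfl k1 k2 k3 m₁ m₂
        exact isLobster_region k1 k2 k3 ht m₁ m₂
      exact key _ _ (by rw [e1, e2]) (by rw [e1]; simpa using h3) (hu' l) (hu' (l + 1)) _ _
  -- different pieces contain different pendant vertices
  have htag : ∀ (i j : Fin (n + 1)) (x : W i) (y : W j) t, i ≠ j → x.1.tag = some t → y.1.tag ≠ some t := by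
    intro i j x y t hij hx hy
    have key : ∀ (l : ℕ) (x : Lab ℕ) c s m, x ∈ Lab.region w T (u l) (u (l + 1)) → x.tag = some (c, s, m) →
        u l ≤ c ∧ c ≤ u (l + 1) ∧ (c = u l → s ≠ .lo) ∧ (c = u (l + 1) → s = .lo) := by
      intro l x c s m hx hxt
      have hl := hlt l
      have hx := hx.1
      cases x with
      | pend i s' m' =>
        obtain ⟨rfl, rfl, rfl⟩ : i = c ∧ s' = s ∧ m' = m := by simpa [Lab.tag] using hxt
        obtain ⟨k1, k2, k3, k4, k5⟩ := hx
        exact ⟨k1, k2, k3, by cases s' <;> grind⟩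
      | deep i m' m'' =>
        obtain ⟨rfl, rfl, rfl⟩ : i = c ∧ .mid = s ∧ m' = m := by simpa [Lab.tag] using hxt
        obtain rfl : i = u l := hx
        exact ⟨le_rfl, hl.le, by simp, fun e => absurd e hl.ne⟩
      | _ => cases hxt
    obtain ⟨c, s, m⟩ := t
    have kx := key i _ c s m x.2 hx
    have ky := key j _ c s m y.2 hy
    have hij' : (i : ℕ) ≠ j := fun e => hij (Fin.ext e)
    rcases lt_or_gt_of_ne hij' with h' | h'
    · have := hu.monotone (show (i : ℕ) + 1 ≤ j by omega)
      have e1 : c = u (i + 1) := by omega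
      exact ky.2.2.1 (by omega) (kx.2.2.2 e1)
    · have := hu.monotone (show (j : ℕ) + 1 ≤ i by omega)
      have e1 : c = u (j + 1) := by omega
      exact kx.2.2.1 (by omega) (ky.2.2.2 e1)
  obtain ⟨Φ, hΦ⟩ := exists_chain_embedding (H := H) (a := a) (b := b) u hu.monotone hu' (fun l => SimpleGraph.Embedding.induce _)
    (fun l x => Lab.between_inPiece x.2.1 (hlt l)) (fun _ => rfl) (fun _ => rfl) htag
  refine ⟨_, _, Φ, ⟨n, W, H, a, b, fun l => hpiece l, ⟨SimpleGraph.Iso.refl⟩⟩, fun x h1 h2 h3 => ?_⟩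
  obtain ⟨l, hl⟩ := exists_mem_region hu h0 hfu h1 h2 h3
  exact ⟨Quot.mk _ ⟨l, x, hl⟩, hΦ l ⟨x, hl⟩⟩

end Layout

/-- Every graph of the class is an induced subgraph of a generalized hexagonal caterpillar. -/
theorem InClassX.exists_isIndContained {V : Type u} {G : SimpleGraph V} (hX : InClassX G) : ∃
    (W : Type) (H : SimpleGraph W), IsGenHexCaterpillar H ∧ G ⊴ H := by
  have := hX.finite
  obtain ⟨w, n, f, h1, h2, h3, h4, h5⟩ := hX.exists_labels
  -- names become natural numbers from 2 on
  let e := Finite.equivFin V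
  let ν : V → ℕ := fun x => e x + 2
  have hν : Function.Injective ν := fun x y hxy => e.injective (Fin.ext (by simpa [ν] using hxy))
  have hν' : ∀ x, 2 ≤ ν x ∧ ν x < Nat.card V + 1 + 2 := fun x => ⟨by simp [ν], by have := (e x).2; simp only [ν]; omega⟩
  obtain ⟨W, H, Φ, hH, hΦ⟩ := Layout.exists_isGenHexCaterpillar (T := Nat.card V + 1) h1 h2 (by omega)
  have hr : ∀ x, (f x).map ν ∈ Set.range Φ := by
    intro x
    have hw := h4 x
    have hp := h5 x
    refine hΦ _ ?_ ?_ ?_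
    · generalize f x = y at *; cases y <;> exact hw
    · generalize f x = y at *; cases y <;> exact hp
    · generalize f x = y at *; cases y <;> simp [Lab.map, Lab.Named, hν']
  choose g hg using hr
  refine ⟨W, H, hH, ⟨⟨⟨g, fun x y hxy => ?_⟩, fun {x y} => ?_⟩⟩⟩
  · refine h3.inj x trivial y trivial (Lab.map_injective hν ?_)
    rw [← hg, ← hg, hxy]
  · show H.Adj (g x) (g y) ↔ G.Adj x y
    rw [← Φ.map_adj_iff, hg, hg, Layout.adj_map hν, h3.adj x trivial y trivial]

theorem mainTheorem6 :
    (∀ (V : Type u) (G : SimpleGraph V), IsGenHexCaterpillar G → InClassX G) ∧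
    (∀ (V : Type u) (G : SimpleGraph V), InClassX G →
      ∃ (W : Type) (H : SimpleGraph W), IsGenHexCaterpillar H ∧ G ⊴ H) := by
  refine ⟨fun V G h => h.inClassX, ?_⟩
  exact fun V G h => h.exists_isIndContained
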